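/- **Conventions.** A *system of constraints* $F$ is a finite conjunction of Boolean functions ("constraints") $c$, each over a finite set $\mathrm{var}(c)$ of Boolean variables; a model is an assignment to the variables of $F$ that satisfies all constraints. The incidence graph $G_F$ has the constraints and the variables of $F$ as vertices, with $c$ adjacent to $x$ iff $x\in\mathrm{var}(c)$; $|G_F|$ is its number of vertices. The width of a tree decomposition $(T,b)$ is $\max_t |b(t)|$ (without the usual $-1$). A *state transition system* (STS) consists of a finite state set $S$, functions $f_0,f_1:S\to S$, a starting state and a set of accepting states; it reads a word over $\{0,1\}$ letter by letter. It is *one-sided* if $f_0=\mathrm{id}$ or $f_1=\mathrm{id}$. It *describes* a constraint $c$ modulo literal-flipping if, for some fixed choice of variables of $c$ to be negated, the word of the (possibly negated) values of the variables of $c$ is accepted iff $c$ is satisfied. The constraint is *one-sided* if a one-sided STS describes it, and its state size is then the least number of states of such an STS. *Elementary operations* are those of a unit-cost machine with arrays of natural-number indices and arrays of complex numbers. On indices, used for addressing and control, it has addition, truncated subtraction and comparison; on complex numbers it has $+,-,\cdot,/$ (exact, with $x/0=0$), the conversion of an index to a number, and the formation of $e^{2\pi i/n}$ for an index $n$. Control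 does not depend on complex numbers. Each operation, constant, memory access, assignment and test costs one. **Theorem.** There are a fixed program and a fixed constant $K$ such that the following holds for all integers $w\ge 2$ and $k\ge 0$. Let $F$ be a system of one-sided constraints of state size at most $w$, each constraint $c$ being given with its set of variables and a one-sided STS with at most $w$ states (for instance a minimal one) that describes $c$ modulo literal-flipping, together with the flipping; and let a tree decomposition $(T,b)$ of $G_F$ of width $k$ be given (adjacency lists of $T$ and lists of the elements of the bags). On this input the program halts and outputs the exact number of models of $F$ after at most $$K\cdot\Bigl((2w)^k\,k\,\log(w)\cdot|G_F| + (k+1)\,|V(T)|\Bigr)$$ elementary operations. The second summand pays for reading the given decomposition; in particular, the number of operations is $O\bigl((2w)^k\,k\,\log(w)\cdot|G_F|\bigr)$ whenever $k\ge1$ and $T$ has $O(|G_F|)$ nodes. -/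

import Mathlib

/-! ## Systems of Boolean constraints and their incidence graphs -/

namespace OneSidedCounting

/-- A Boolean constraint whose variables form the finite set `scope` of the variables
`0, …, n - 1`: a Boolean function of the assignments to `scope`. -/
structure Constraint (n : ℕ) where
  scope : Finset (Fin n)
  holds : (scope → Bool) → Bool

/-- A finite system (conjunction) of constraints. -/
structure ConstraintSystem where
  numVars : ℕ
  numCons : ℕ
  con : Fin numCons → Constraint numVars

namespace ConstraintSystem

/-- A model is an assignment to the variables that satisfies every constraint. -/
def IsModel (F : ConstraintSystem) (τ : Fin F.numVars → Bool) : Prop :=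
  ∀ c, (F.con c).holds (fun v => τ v) = true

/-- The number of models. -/
noncomputable def modelCount (F : ConstraintSystem) : ℕ :=
  Nat.card {τ : Fin F.numVars → Bool // F.IsModel τ}

/-- The incidence graph `G_F`: constraints (left) and variables (right), a constraint being joined
to its variables. -/
def incidenceGraph (F : ConstraintSystem) : SimpleGraph (Fin F.numCons ⊕ Fin F.numVars) :=
  SimpleGraph.fromRel fun a b => ∃ c v, a = Sum.inl c ∧ b = Sum.inr v ∧ v ∈ (F.con c).scope

/-- `|G_F|`, the number of vertices of the incidence graph. -/
def graphSize (F : ConstraintSystem) : ℕ :=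
  Fintype.card (Fin F.numCons ⊕ Fin F.numVars)

end ConstraintSystem

/-! ## State transition systems -/

/-- A state transition system with state set `S`. -/
structure STS (S : Type) where
  f0 : S → S
  f1 : S → S
  start : S
  accept : S → Bool

namespace STS

variable {S : Type}

/-- The extended transition function on words over `{0, 1}`; letters are read from the left. -/
def run (A : STS S) (l : List Bool) : S :=
  l.foldl (fun s b => if b then A.f1 s else A.f0 s) A.start

/-- One of the two letters never changes the state. -/
def OneSided (A : STS S) : Prop :=
  (∀ s, A.f0 s = s) ∨ (∀ s, A.f1 s = s)

end STS

/-- A one-sided STS with finitely many states describing the constraint `c` modulo literal-flipping;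
`flip v` tells whether the literal of the variable `v` is flipped. The word that is read lists
the (flipped) values of the variables of `c` in increasing order of the variables. -/
structure OneSidedDescription {n : ℕ} (c : Constraint n) where
  numStates : ℕ
  sts : STS (Fin numStates)
  flip : c.scope → Bool
  oneSided : sts.OneSided
  describes : ∀ τ : c.scope → Bool,
    sts.accept (sts.run (((Finset.univ : Finset c.scope).sort (· ≤ ·)).map
      fun v => xor (flip v) (τ v))) = c.holds τ

/-! ## Tree decompositions -/

/-- A tree decomposition of the graph `G`; the nodes of the tree are numbered. -/
structure TreeDecomposition {V : Type} (G : SimpleGraph V) where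
  numNodes : ℕ
  tree : SimpleGraph (Fin numNodes)
  isTree : tree.IsTree
  bag : Fin numNodes → Finset V
  cover : ∀ v, ∃ t, v ∈ bag t
  edge : ∀ u v, G.Adj u v → ∃ t, u ∈ bag t ∧ v ∈ bag t
  conn : ∀ v, (tree.induce {t | v ∈ bag t}).Connected

/-- The width is the maximal size of a bag (the convention without `- 1`). -/
def TreeDecomposition.width {V : Type} {G : SimpleGraph V} (D : TreeDecomposition G) : ℕ :=
  Finset.univ.sup fun t => (D.bag t).card

/-! ## The unit-cost machine model

A program works on two-dimensional arrays, named by natural numbers. An index array has entries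
in `ℕ`, a number array has entries in `ℂ`. Indices are used for addressing and for control, and
only addition, truncated subtraction and comparison are available for them. On numbers there are
the field operations (with `x / 0 = 0`), the embedding of indices, and the roots of unity
`exp (2πi / n)`. Control never depends on numbers. Every operation, constant, memory access, and
test costs one. -/

/-- A memory content: array name, row, column. -/
structure Store where
  idx : ℕ → ℕ → ℕ → ℕ
  num : ℕ → ℕ → ℕ → ℂ

/-- Index expressions. -/
inductive IExp where
  | lit (n : ℕ)
  | get (a : ℕ) (i j : IExp)
  | add (x y : IExp)
  | sub (x y : IExp)

namespace IExp

def eval (s : Store) : IExp → ℕ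
  | lit n => n
  | get a i j => s.idx a (i.eval s) (j.eval s)
  | add x y => x.eval s + y.eval s
  | sub x y => x.eval s - y.eval s

def cost : IExp → ℕ
  | lit _ => 1
  | get _ i j => i.cost + j.cost + 1
  | add x y => x.cost + y.cost + 1
  | sub x y => x.cost + y.cost + 1

end IExp

/-- Number expressions. -/
inductive NExp where
  | cast (e : IExp)
  | root (e : IExp)
  | get (a : ℕ) (i j : IExp)
  | add (x y : NExp)
  | sub (x y : NExp)
  | mul (x y : NExp)
  | div (x y : NExp)

namespace NExp

noncomputable def eval (s : Store) : NExp → ℂ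
  | cast e => (e.eval s : ℂ)
  | root e => Complex.exp (2 * Real.pi * Complex.I / (e.eval s : ℂ))
  | get a i j => s.num a (i.eval s) (j.eval s)
  | add x y => x.eval s + y.eval s
  | sub x y => x.eval s - y.eval s
  | mul x y => x.eval s * y.eval s
  | div x y => x.eval s / y.eval s

def cost : NExp → ℕ
  | cast e => e.cost + 1
  | root e => e.cost + 1
  | get _ i j => i.cost + j.cost + 1
  | add x y => x.cost + y.cost + 1
  | sub x y => x.cost + y.cost + 1
  | mul x y => x.cost + y.cost + 1
  | div x y => x.cost + y.cost + 1

end NExp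

/-- Overwriting one array entry. -/
def setEntry {α : Type} (m : ℕ → ℕ → ℕ → α) (a i j : ℕ) (x : α) : ℕ → ℕ → ℕ → α :=
  fun a' i' j' => if a' = a ∧ i' = i ∧ j' = j then x else m a' i' j'

/-- Programs. Conditions are comparisons `x < y` of index expressions. -/
inductive Program where
  | nop
  | setIdx (a : ℕ) (i j e : IExp)
  | setNum (a : ℕ) (i j : IExp) (e : NExp)
  | seq (p q : Program)
  | ifLt (x y : IExp) (p q : Program)
  | whileLt (x y : IExp) (p : Program)

/-- `Exec p s s' t`: started with memory content `s`, the program `p` halts with memory content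
`s'` after `t` elementary operations. -/
inductive Exec : Program → Store → Store → ℕ → Prop where
  | nop (s : Store) : Exec .nop s s 1
  | setIdx (s : Store) (a : ℕ) (i j e : IExp) :
      Exec (.setIdx a i j e) s
        { s with idx := setEntry s.idx a (i.eval s) (j.eval s) (e.eval s) }
        (i.cost + j.cost + e.cost + 1)
  | setNum (s : Store) (a : ℕ) (i j : IExp) (e : NExp) :
      Exec (.setNum a i j e) s
        { s with num := setEntry s.num a (i.eval s) (j.eval s) (e.eval s) }
        (i.cost + j.cost + e.cost + 1)
  | seq {p q : Program} {s s' s'' : Store} {t t' : ℕ} :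
      Exec p s s' t → Exec q s' s'' t' → Exec (.seq p q) s s'' (t + t')
  | ifTrue {x y : IExp} {p q : Program} {s s' : Store} {t : ℕ} :
      x.eval s < y.eval s → Exec p s s' t →
        Exec (.ifLt x y p q) s s' (x.cost + y.cost + 1 + t)
  | ifFalse {x y : IExp} {p q : Program} {s s' : Store} {t : ℕ} :
      ¬ x.eval s < y.eval s → Exec q s s' t →
        Exec (.ifLt x y p q) s s' (x.cost + y.cost + 1 + t)
  | whileTrue {x y : IExp} {p : Program} {s s' s'' : Store} {t t' : ℕ} :
      x.eval s < y.eval s → Exec p s s' t → Exec (.whileLt x y p) s' s'' t' →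
        Exec (.whileLt x y p) s s'' (x.cost + y.cost + 1 + t + t')
  | whileFalse {x y : IExp} {p : Program} {s : Store} :
      ¬ x.eval s < y.eval s → Exec (.whileLt x y p) s s (x.cost + y.cost + 1)

/-! ## The input -/

/-- The values of a function on `Fin n`, padded with zeros. -/
def pad {n : ℕ} (f : Fin n → ℕ) (i : ℕ) : ℕ :=
  if h : i < n then f ⟨i, h⟩ else 0

/-- The elements of a finite set of numbers in increasing order, padded with zeros. -/
def listing {n : ℕ} (s : Finset (Fin n)) (i : ℕ) : ℕ :=
  ((s.sort (· ≤ ·)).map Fin.val).getD i 0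

section Input

variable (F : ConstraintSystem) (R : ∀ c, OneSidedDescription (F.con c))
  (D : TreeDecomposition F.incidenceGraph)

open scoped Classical in
/-- The neighbours of a node of the decomposition tree. -/
noncomputable def nodeNeighbors (t : Fin D.numNodes) : Finset (Fin D.numNodes) :=
  Finset.univ.filter fun u => D.tree.Adj t u

/-- The constraints in the bag of a node. -/
def bagCons (t : Fin D.numNodes) : Finset (Fin F.numCons) :=
  Finset.univ.filter fun c => Sum.inl c ∈ D.bag t

/-- The variables in the bag of a node. -/
def bagVars (t : Fin D.numNodes) : Finset (Fin F.numVars) :=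
  Finset.univ.filter fun v => Sum.inr v ∈ D.bag t

/-- Occurrence of the variable `v` in the constraint `c`: `0` if it does not occur, `1` if it
occurs unflipped, `2` if it occurs flipped. -/
def occurrence (c : Fin F.numCons) (v : Fin F.numVars) : ℕ :=
  if h : v ∈ (F.con c).scope then (if (R c).flip ⟨v, h⟩ then 2 else 1) else 0

/-- The index arrays at the start.
Array 0 holds, in row 0, the numbers of constraints, variables and tree nodes.
Array 1 holds the occurrences of the variables (columns) in the constraints (rows).
Arrays 2, 3, 4, 5 hold the STS of each constraint (row): the number of states and the starting
state in array 2, the two transition functions in arrays 3 and 4, the accepting states in array 5.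
Arrays 6, 7, 8, 9 hold the tree decomposition, with one row for each node: its degree and the
numbers of constraints and variables in its bag in array 6, the lists of its neighbours, of the
constraints in its bag and of the variables in its bag in arrays 7, 8 and 9.
All other entries are zero. -/
noncomputable def inputIdx : ℕ → ℕ → ℕ → ℕ
  | 0 => fun i j =>
      match i, j with
      | 0, 0 => F.numCons
      | 0, 1 => F.numVars
      | 0, 2 => D.numNodes
      | _, _ => 0
  | 1 => fun i j => pad (fun c => pad (occurrence F R c) j) i
  | 2 => fun i j => pad (fun c =>
      match j with
      | 0 => (R c).numStates
      | 1 => ((R c).sts.start : ℕ)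
      | _ => 0) i
  | 3 => fun i j => pad (fun c => pad (fun s => ((R c).sts.f0 s : ℕ)) j) i
  | 4 => fun i j => pad (fun c => pad (fun s => ((R c).sts.f1 s : ℕ)) j) i
  | 5 => fun i j => pad (fun c => pad (fun s => if (R c).sts.accept s then 1 else 0) j) i
  | 6 => fun i j => pad (fun t =>
      match j with
      | 0 => (nodeNeighbors F D t).card
      | 1 => (bagCons F D t).card
      | 2 => (bagVars F D t).card
      | _ => 0) i
  | 7 => fun i j => pad (fun t => listing (nodeNeighbors F D t) j) i
  | 8 => fun i j => pad (fun t => listing (bagCons F D t) j) i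
  | 9 => fun i j => pad (fun t => listing (bagVars F D t) j) i
  | _ => fun _ _ => 0

/-- The memory content at the start; all numbers are zero. -/
noncomputable def inputStore : Store where
  idx := inputIdx F R D
  num := fun _ _ _ => 0

end Input

end OneSidedCounting

namespace OneSidedCounting

/-! ## A program logic with time -/

/-! A one-sided automaton moves on one letter only, so the state it reaches is `f^[d] q`, where `d`
is the number of variables whose literal reads as the active letter. With `w` states, the `w`-th
iterate equals an earlier one, so every count can be replaced by a count below `w` that leads to the
same state (`exists_iterate_eq`, `iterate_wrap`). Counting models thus means summing over all
assignments a product of weights, one for each constraint, that depend on the counts only; every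
occurrence of a variable in a constraint adds 1 or 0 to a count.

This sum is evaluated by eliminating the vertices of the incidence graph one by one. The calculation
takes place in an algebra: functions of the assignment with values in formal sums of families of
counts, where families leading to the same states are identified. Each pair of a variable and a
constraint gives a factor, and the product of all factors is the monomial of all counts
(`prod_edge`). Eliminating a vertex is a linear map: it sums over the two values of a variable, or
it replaces the count of a constraint by the weight of its state. Factors that do not involve the
vertex are scalars for this map (`free_gen`); this is the distributive law. Eliminating all vertices
produces the desired sum (`elimAll_prod_edge`).

The order comes from the tree decomposition. The nodes are put into a search order, the vertices are
numbered by the first node in which they occur, and the elimination runs backwards. If two subtrees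
of a tree meet, the first node of the later one belongs to the other (`first_mem`). Therefore the
first bag of a vertex `r` contains all smaller neighbours of `r`, and the smaller vertices of this
bag all lie in the first bag of the largest one among them, `p` (`inBag_of_meet`). So the outcome of
eliminating `r` can be multiplied into the table of `p`, and no table outgrows a bag: it has at most
`k` coordinates.

It remains to multiply tables quickly. In a variable coordinate the product is pointwise. In a
constraint coordinate counts are added, as exponents are in a product of polynomials. Two counts
below `w` have a sum below `2 * w`, so a cyclic convolution of length `2 * w` computes this product
without overflow; afterwards the counts are reduced again (`sum_bwd_fwd_gen`, `elem_mul`). A table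
has at most `(2 * w) ^ k` entries, and transforming it in one coordinate costs a factor of order
`log w`, by fast Fourier transforms. As `2 * w` need not be a power of two, the chirp transform
reduces the general length to that case (`chirp_transform`). There are boundedly many table
transforms for each vertex, each with at most `k` coordinates; this gives the main term. The
preparation costs a multiple of `k + 1` for each node and polynomially little in `k` and `w` for
each vertex, which is absorbed (`timeBound_le`).

Correctness and running time are proved together: in the calculus `WP`, the postcondition of a
program speaks of the final memory and of the number of operations, and termination is part of the
assertion. -/

instance (n : ℕ) : OfNat IExp n := ⟨.lit n⟩
instance : Add IExp := ⟨.add⟩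
instance : Sub IExp := ⟨.sub⟩
instance : Add NExp := ⟨.add⟩
instance : Sub NExp := ⟨.sub⟩
instance : Mul NExp := ⟨.mul⟩
instance : Div NExp := ⟨.div⟩

/-- The scalar register `a`. -/
abbrev V (a : ℕ) : IExp := .get a 0 0

/-- The scalar number register `a`. -/
abbrev VN (a : ℕ) : NExp := .get a 0 0

/-! ### Evaluation and cost of expressions -/

namespace IExp
variable (s : Store) (x y i j : IExp) (n a : ℕ)
@[simp] theorem eval_ofNat : (ofNat(n) : IExp).eval s = OfNat.ofNat n := rfl
@[simp] theorem eval_zero : (0 : IExp).eval s = 0 := rfl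
@[simp] theorem eval_one : (1 : IExp).eval s = 1 := rfl
@[simp] theorem eval_lit : (IExp.lit n).eval s = n := rfl
@[simp] theorem eval_add : (x + y).eval s = x.eval s + y.eval s := rfl
@[simp] theorem eval_sub : (x - y).eval s = x.eval s - y.eval s := rfl
@[simp] theorem eval_get : (IExp.get a i j).eval s = s.idx a (i.eval s) (j.eval s) := rfl
@[simp] theorem cost_ofNat : (ofNat(n) : IExp).cost = 1 := rfl
@[simp] theorem cost_zero : (0 : IExp).cost = 1 := rfl
@[simp] theorem cost_one : (1 : IExp).cost = 1 := rfl
@[simp] theorem cost_lit : (IExp.lit n).cost = 1 := rfl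
@[simp] theorem cost_add : (x + y).cost = x.cost + y.cost + 1 := rfl
@[simp] theorem cost_sub : (x - y).cost = x.cost + y.cost + 1 := rfl
@[simp] theorem cost_get : (IExp.get a i j).cost = i.cost + j.cost + 1 := rfl
end IExp

namespace NExp
variable (s : Store) (x y : NExp) (i j e : IExp) (a : ℕ)
@[simp] theorem eval_add : (x + y).eval s = x.eval s + y.eval s := rfl
@[simp] theorem eval_sub : (x - y).eval s = x.eval s - y.eval s := rfl
@[simp] theorem eval_mul : (x * y).eval s = x.eval s * y.eval s := rfl
@[simp] theorem eval_div : (x / y).eval s = x.eval s / y.eval s := rfl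
@[simp] theorem eval_get : (NExp.get a i j).eval s = s.num a (i.eval s) (j.eval s) := rfl
@[simp] theorem eval_cast : (NExp.cast e).eval s = (e.eval s : ℂ) := rfl
@[simp] theorem eval_root :
    (NExp.root e).eval s = Complex.exp (2 * Real.pi * Complex.I / (e.eval s : ℂ)) := rfl
@[simp] theorem cost_add : (x + y).cost = x.cost + y.cost + 1 := rfl
@[simp] theorem cost_sub : (x - y).cost = x.cost + y.cost + 1 := rfl
@[simp] theorem cost_mul : (x * y).cost = x.cost + y.cost + 1 := rfl
@[simp] theorem cost_div : (x / y).cost = x.cost + y.cost + 1 := rfl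
@[simp] theorem cost_get : (NExp.get a i j).cost = i.cost + j.cost + 1 := rfl
@[simp] theorem cost_cast : (NExp.cast e).cost = e.cost + 1 := rfl
@[simp] theorem cost_root : (NExp.root e).cost = e.cost + 1 := rfl
end NExp

/-- Overwriting one entry of a two-dimensional array. -/
def upd {α : Type} (m : ℕ → ℕ → α) (i j : ℕ) (x : α) : ℕ → ℕ → α :=
  fun i' j' => if i' = i ∧ j' = j then x else m i' j'

@[simp] theorem upd_same {α : Type} (m : ℕ → ℕ → α) (i j : ℕ) (x : α) : upd m i j x i j = x := by
  simp [upd]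

theorem upd_row_ne {α : Type} (m : ℕ → ℕ → α) {i i' : ℕ} (j : ℕ) (x : α) (h : i' ≠ i) :
    upd m i j x i' = m i' := by
  funext j'; simp [upd, h]

theorem upd_ne {α : Type} (m : ℕ → ℕ → α) {i i' j j' : ℕ} (x : α) (h : i' ≠ i ∨ j' ≠ j) :
    upd m i j x i' j' = m i' j' := by
  have : ¬ (i' = i ∧ j' = j) := by tauto
  simp [upd, this]

/-- Overwriting the first `n` entries of the row `i` of a two-dimensional array. -/
def fillRow {α : Type} (m : ℕ → ℕ → α) (i n : ℕ) (f : ℕ → α) : ℕ → ℕ → α :=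
  fun i' j' => if i' = i ∧ j' < n then f j' else m i' j'

theorem fillRow_lt {α : Type} (m : ℕ → ℕ → α) (i : ℕ) {n j : ℕ} (f : ℕ → α) (h : j < n) :
    fillRow m i n f i j = f j := by
  simp [fillRow, h]

theorem fillRow_ne {α : Type} (m : ℕ → ℕ → α) {i i' : ℕ} (n : ℕ) (f : ℕ → α) (h : i' ≠ i) :
    fillRow m i n f i' = m i' := by
  funext j; simp [fillRow, h]

theorem fillRow_ge {α : Type} (m : ℕ → ℕ → α) (i i' : ℕ) {n j : ℕ} (f : ℕ → α) (h : n ≤ j) :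
    fillRow m i n f i' j = m i' j := by
  simp [fillRow, Nat.not_lt.2 h]

theorem fillRow_zero {α : Type} (m : ℕ → ℕ → α) (i : ℕ) (f : ℕ → α) : fillRow m i 0 f = m := by
  funext i' j'; simp [fillRow]

theorem upd_fillRow {α : Type} (m : ℕ → ℕ → α) (i n : ℕ) (f : ℕ → α) :
    upd (fillRow m i n f) i n (f n) = fillRow m i (n + 1) f := by
  funext i' j'
  simp only [upd, fillRow]
  by_cases hi : i' = i <;> by_cases hj : j' = n <;> simp [hi, hj]
  split_ifs <;> first | rfl | omega

namespace Store

/-- Assignment to an index entry. -/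
def setI (s : Store) (a i j v : ℕ) : Store :=
  { s with idx := fun a' => if a' = a then upd (s.idx a) i j v else s.idx a' }

/-- Assignment to a number entry. -/
def setN (s : Store) (a i j : ℕ) (v : ℂ) : Store :=
  { s with num := fun a' => if a' = a then upd (s.num a) i j v else s.num a' }

/-- Assignment to an initial segment of a row of an index array. -/
def fillI (s : Store) (a i n : ℕ) (f : ℕ → ℕ) : Store :=
  { s with idx := fun a' => if a' = a then fillRow (s.idx a) i n f else s.idx a' }

/-- Assignment to an initial segment of a row of a number array. -/
def fillN (s : Store) (a i n : ℕ) (f : ℕ → ℂ) : Store :=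
  { s with num := fun a' => if a' = a then fillRow (s.num a) i n f else s.num a' }

variable (s : Store) (a i j v n : ℕ) (z : ℂ) (f : ℕ → ℕ) (g : ℕ → ℂ)

@[simp] theorem setI_idx : (s.setI a i j v).idx a = upd (s.idx a) i j v := by simp [setI]
@[simp] theorem setI_idx_ne {a b : ℕ} (h : b ≠ a) : (s.setI a i j v).idx b = s.idx b := by
  simp [setI, h]
@[simp] theorem setI_num : (s.setI a i j v).num = s.num := rfl
@[simp] theorem setN_num : (s.setN a i j z).num a = upd (s.num a) i j z := by simp [setN]
@[simp] theorem setN_num_ne {a b : ℕ} (h : b ≠ a) : (s.setN a i j z).num b = s.num b := by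
  simp [setN, h]
@[simp] theorem setN_idx : (s.setN a i j z).idx = s.idx := rfl
@[simp] theorem fillI_idx : (s.fillI a i n f).idx a = fillRow (s.idx a) i n f := by simp [fillI]
@[simp] theorem fillI_idx_ne {a b : ℕ} (h : b ≠ a) : (s.fillI a i n f).idx b = s.idx b := by
  simp [fillI, h]
@[simp] theorem fillI_num : (s.fillI a i n f).num = s.num := rfl
@[simp] theorem fillN_num : (s.fillN a i n g).num a = fillRow (s.num a) i n g := by simp [fillN]
@[simp] theorem fillN_num_ne {a b : ℕ} (h : b ≠ a) : (s.fillN a i n g).num b = s.num b := by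
  simp [fillN, h]
@[simp] theorem fillN_idx : (s.fillN a i n g).idx = s.idx := rfl

end Store

/-- Started in `s`, the program halts, in a memory content and after a time that satisfy `Q`. -/
def WP (P : Program) (s : Store) (Q : Store → ℕ → Prop) : Prop :=
  ∃ s' t, Exec P s s' t ∧ Q s' t

namespace Program

/-- Whether the program can write to the index array `a`. -/
def writesI : Program → ℕ → Bool
  | nop, _ => false
  | setIdx a _ _ _, b => Nat.beq a b
  | setNum _ _ _ _, _ => false
  | seq p q, b => p.writesI b || q.writesI b
  | ifLt _ _ p q, b => p.writesI b || q.writesI b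
  | whileLt _ _ p, b => p.writesI b

/-- Whether the program can write to the number array `a`. -/
def writesN : Program → ℕ → Bool
  | nop, _ => false
  | setIdx _ _ _ _, _ => false
  | setNum a _ _ _, b => Nat.beq a b
  | seq p q, b => p.writesN b || q.writesN b
  | ifLt _ _ p q, b => p.writesN b || q.writesN b
  | whileLt _ _ p, b => p.writesN b

/-- `for v = 0, …, b - 1 do p` with the register `v`. -/
def loop (v : ℕ) (b : IExp) (p : Program) : Program :=
  seq (setIdx v 0 0 0) (whileLt (V v) b (seq p (setIdx v 0 0 (V v + 1))))

/-- Assignment to an index register. -/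
def set (v : ℕ) (e : IExp) : Program := setIdx v 0 0 e

/-- Assignment to a number register. -/
def setn (v : ℕ) (e : NExp) : Program := setNum v 0 0 e

end Program

infixr:60 " ;; " => Program.seq

/-- The arrays that the program cannot write to are unchanged. -/
structure Frame (P : Program) (s s' : Store) : Prop where
  idx : ∀ a, P.writesI a = false → s'.idx a = s.idx a
  num : ∀ a, P.writesN a = false → s'.num a = s.num a

theorem Frame.refl (P : Program) (s : Store) : Frame P s s := ⟨fun _ _ => rfl, fun _ _ => rfl⟩

theorem Frame.trans {P : Program} {s s' s'' : Store} (h : Frame P s s') (h' : Frame P s' s'') :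
    Frame P s s'' :=
  ⟨fun a ha => (h'.idx a ha).trans (h.idx a ha), fun a ha => (h'.num a ha).trans (h.num a ha)⟩

theorem Frame.of_le {P P' : Program} {s s' : Store} (h : Frame P s s')
    (hI : ∀ a, P'.writesI a = false → P.writesI a = false)
    (hN : ∀ a, P'.writesN a = false → P.writesN a = false) : Frame P' s s' :=
  ⟨fun a ha => h.idx a (hI a ha), fun a ha => h.num a (hN a ha)⟩

theorem setEntry_idx (s : Store) (a i j v : ℕ) :
    ({ s with idx := setEntry s.idx a i j v } : Store) = s.setI a i j v := by
  simp only [Store.setI, Store.mk.injEq, and_true]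
  funext a' i' j'
  by_cases h : a' = a
  · subst h; simp [setEntry, upd]
  · simp [setEntry, h]

theorem setEntry_num (s : Store) (a i j : ℕ) (v : ℂ) :
    ({ s with num := setEntry s.num a i j v } : Store) = s.setN a i j v := by
  simp only [Store.setN, Store.mk.injEq, true_and]
  funext a' i' j'
  by_cases h : a' = a
  · subst h; simp [setEntry, upd]
  · simp [setEntry, h]

/-- Array names are literals, so the arrays that may change can be read off from the text of the
program. `writesI` and `writesN` evaluate to Booleans; hence the facts `hF.idx a rfl` used
throughout are pure computations, and loop invariants mention only what a loop changes. -/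
theorem Exec.frame {P : Program} {s s' : Store} {t : ℕ} (h : Exec P s s' t) : Frame P s s' := by
  induction h with
  | nop s => exact Frame.refl _ _
  | setIdx s a i j e =>
    rw [setEntry_idx]
    refine ⟨fun b hb => ?_, fun b _ => rfl⟩
    exact Store.setI_idx_ne _ _ _ _ (fun h => by simp [Program.writesI, h] at hb)
  | setNum s a i j e =>
    rw [setEntry_num]
    refine ⟨fun b _ => rfl, fun b hb => ?_⟩
    exact Store.setN_num_ne _ _ _ _ (fun h => by simp [Program.writesN, h] at hb)
  | seq _ _ h1 h2 =>
    constructor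
    · intro a ha
      simp only [Program.writesI, Bool.or_eq_false_iff] at ha
      exact (h2.idx a ha.2).trans (h1.idx a ha.1)
    · intro a ha
      simp only [Program.writesN, Bool.or_eq_false_iff] at ha
      exact (h2.num a ha.2).trans (h1.num a ha.1)
  | ifTrue _ _ h =>
    constructor
    · intro a ha
      simp only [Program.writesI, Bool.or_eq_false_iff] at ha
      exact h.idx a ha.1
    · intro a ha
      simp only [Program.writesN, Bool.or_eq_false_iff] at ha
      exact h.num a ha.1
  | ifFalse _ _ h =>
    constructor
    · intro a ha
      simp only [Program.writesI, Bool.or_eq_false_iff] at ha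
      exact h.idx a ha.2
    · intro a ha
      simp only [Program.writesN, Bool.or_eq_false_iff] at ha
      exact h.num a ha.2
  | whileTrue _ _ _ h1 h2 => exact ⟨fun a ha => (h2.idx a ha).trans (h1.idx a ha),
      fun a ha => (h2.num a ha).trans (h1.num a ha)⟩
  | whileFalse _ => exact Frame.refl _ _

/-- The frame is handed over to the new postcondition. Because of this, the specifications below
first reduce to a version without the frame and get it back for free. -/
theorem WP.mono {P : Program} {s : Store} {Q Q' : Store → ℕ → Prop} (h : WP P s Q)
    (hQ : ∀ s' t, Q s' t → Frame P s s' → Q' s' t) : WP P s Q' := by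
  obtain ⟨s', t, he, hq⟩ := h
  exact ⟨s', t, he, hQ s' t hq he.frame⟩

@[simp] theorem WP_nop (s : Store) (Q : Store → ℕ → Prop) : WP .nop s Q ↔ Q s 1 :=
  ⟨fun ⟨_, _, he, hq⟩ => by cases he; exact hq, fun h => ⟨_, _, .nop s, h⟩⟩

@[simp] theorem WP_setIdx (s : Store) (a : ℕ) (i j e : IExp) (Q : Store → ℕ → Prop) :
    WP (.setIdx a i j e) s Q ↔
      Q (s.setI a (i.eval s) (j.eval s) (e.eval s)) (i.cost + j.cost + e.cost + 1) := by
  rw [← setEntry_idx]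
  exact ⟨fun ⟨_, _, he, hq⟩ => by cases he; exact hq, fun h => ⟨_, _, .setIdx s a i j e, h⟩⟩

@[simp] theorem WP_setNum (s : Store) (a : ℕ) (i j : IExp) (e : NExp) (Q : Store → ℕ → Prop) :
    WP (.setNum a i j e) s Q ↔
      Q (s.setN a (i.eval s) (j.eval s) (e.eval s)) (i.cost + j.cost + e.cost + 1) := by
  rw [← setEntry_num]
  exact ⟨fun ⟨_, _, he, hq⟩ => by cases he; exact hq, fun h => ⟨_, _, .setNum s a i j e, h⟩⟩

@[simp] theorem WP_set (s : Store) (v : ℕ) (e : IExp) (Q : Store → ℕ → Prop) :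
    WP (.set v e) s Q ↔ Q (s.setI v 0 0 (e.eval s)) (e.cost + 3) := by
  have : 1 + 1 + e.cost + 1 = e.cost + 3 := by omega
  simp [Program.set, this]

@[simp] theorem WP_setn (s : Store) (v : ℕ) (e : NExp) (Q : Store → ℕ → Prop) :
    WP (.setn v e) s Q ↔ Q (s.setN v 0 0 (e.eval s)) (e.cost + 3) := by
  have : 1 + 1 + e.cost + 1 = e.cost + 3 := by omega
  simp [Program.setn, this]

@[simp] theorem WP_seq (s : Store) (p q : Program) (Q : Store → ℕ → Prop) :
    WP (p ;; q) s Q ↔ WP p s (fun s' t => WP q s' (fun s'' t' => Q s'' (t + t'))) := by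
  constructor
  · rintro ⟨_, _, he, hq⟩
    cases he with
    | seq h1 h2 => exact ⟨_, _, h1, _, _, h2, hq⟩
  · rintro ⟨_, _, h1, _, _, h2, hq⟩
    exact ⟨_, _, .seq h1 h2, hq⟩

@[simp] theorem WP_ifLt (s : Store) (x y : IExp) (p q : Program) (Q : Store → ℕ → Prop) :
    WP (.ifLt x y p q) s Q ↔ if x.eval s < y.eval s
      then WP p s (fun s' t => Q s' (x.cost + y.cost + 1 + t))
      else WP q s (fun s' t => Q s' (x.cost + y.cost + 1 + t)) := by
  constructor
  · rintro ⟨_, _, he, hq⟩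
    cases he with
    | ifTrue h h' => rw [if_pos h]; exact ⟨_, _, h', hq⟩
    | ifFalse h h' => rw [if_neg h]; exact ⟨_, _, h', hq⟩
  · intro h
    split_ifs at h with hc
    · obtain ⟨_, _, h', hq⟩ := h
      exact ⟨_, _, .ifTrue hc h', hq⟩
    · obtain ⟨_, _, h', hq⟩ := h
      exact ⟨_, _, .ifFalse hc h', hq⟩

/-- The rule for loops: `I i` holds after `i` rounds, of which there are `n`. -/
theorem WP_while {x y : IExp} {p : Program} {s : Store} {Q : Store → ℕ → Prop} (n : ℕ) (C : ℕ → ℕ)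
    (I : ℕ → Store → Prop) (h0 : I 0 s)
    (hs : ∀ i s', i < n → I i s' → Frame p s s' →
      x.eval s' < y.eval s' ∧ WP p s' (fun s'' t => I (i + 1) s'' ∧ t ≤ C i))
    (hn : ∀ s', I n s' → Frame p s s' → ¬ x.eval s' < y.eval s')
    (hQ : ∀ s' t, I n s' → Frame p s s' →
      t ≤ (∑ i ∈ Finset.range n, (C i + (x.cost + y.cost + 1))) + (x.cost + y.cost + 1) →
      Q s' t) : WP (.whileLt x y p) s Q := by
  -- Generalized to the situation after `i` rounds with `m` rounds to go, so that induction on `m`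
  -- applies.
  suffices H : ∀ m i s', i + m = n → I i s' → Frame p s s' → ∃ s'' t,
      Exec (.whileLt x y p) s' s'' t ∧ I n s'' ∧ Frame p s s'' ∧
      t ≤ (∑ i ∈ Finset.Ico i n, (C i + (x.cost + y.cost + 1))) + (x.cost + y.cost + 1) by
    obtain ⟨s'', t, he, hI, hF, ht⟩ := H n 0 s (by omega) h0 (Frame.refl _ _)
    exact ⟨s'', t, he, hQ _ _ hI hF (by simpa using ht)⟩
  intro m
  induction m with
  | zero =>
    intro i s' hi hI hF
    obtain rfl : i = n := by omega
    exact ⟨s', _, .whileFalse (hn s' hI hF), hI, hF, by simp⟩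
  | succ m ih =>
    intro i s' hi hI hF
    obtain ⟨hlt, s1, t1, he1, hI1, ht1⟩ := hs i s' (by omega) hI hF
    obtain ⟨s2, t2, he2, hI2, hF2, ht2⟩ := ih (i + 1) s1 (by omega) hI1 (hF.trans he1.frame)
    refine ⟨s2, _, .whileTrue hlt he1 he2, hI2, hF2, ?_⟩
    rw [Finset.sum_eq_sum_Ico_succ_bot (by omega)]
    omega

/-- The test costs `b.cost + 4`, the increment of the counter 8 and its initialization 4. This
accounts for the extra `b.cost + 12` in each round and for `b.cost + 8` once. The bound `b` has to
keep its value for the reason alone that the loop does not write to what it reads. -/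
theorem WP_loop' {v : ℕ} {b : IExp} {p : Program} {s : Store} {Q : Store → ℕ → Prop} (n : ℕ)
    (C : ℕ → ℕ) (I : ℕ → Store → Prop) (hv : p.writesI v = false)
    (hb : ∀ s', Frame (.loop v b p) s s' → b.eval s' = n)
    (h0 : I 0 (s.setI v 0 0 0))
    (hs : ∀ i s', i < n → I i s' → s'.idx v 0 0 = i → Frame (.loop v b p) s s' →
      WP p s' (fun s'' t => I (i + 1) (s''.setI v 0 0 (i + 1)) ∧ t ≤ C i))
    (hQ : ∀ s' t, I n s' → s'.idx v 0 0 = n → Frame (.loop v b p) s s' →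
      t ≤ (∑ i ∈ Finset.range n, (C i + (b.cost + 12))) + (b.cost + 8) → Q s' t) :
    WP (.loop v b p) s Q := by
  have hF0 : Frame (.loop v b p) s (s.setI v 0 0 0) := by
    refine ⟨fun a ha => Store.setI_idx_ne _ _ _ _ fun h => ?_, fun a _ => rfl⟩
    simp [Program.loop, Program.writesI, h] at ha
  have hle : ∀ s', Frame (p ;; .setIdx v 0 0 (V v + 1)) (s.setI v 0 0 0) s' →
      Frame (.loop v b p) s s' := fun s' h => hF0.trans (h.of_le
        (by intro a; simp +contextual [Program.loop, Program.writesI])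
        (by intro a; simp +contextual [Program.loop, Program.writesN]))
  rw [Program.loop, WP_seq, WP_setIdx]
  refine WP_while n (fun i => C i + 8) (fun i s' => I i s' ∧ s'.idx v 0 0 = i)
    ⟨h0, by simp⟩ ?_ ?_ ?_
  · rintro i s' hi ⟨hI, hvi⟩ hF
    refine ⟨by simp [hvi, hb s' (hle s' hF), hi], ?_⟩
    rw [WP_seq]
    refine (hs i s' hi hI hvi (hle s' hF)).mono ?_
    rintro s'' t ⟨hI', ht⟩ hF'
    have : s''.idx v 0 0 = i := by rw [hF'.idx v hv, hvi]
    simp only [WP_setIdx, IExp.eval_zero, IExp.eval_add, IExp.eval_get, IExp.eval_one, this,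
      IExp.cost_zero, IExp.cost_one, IExp.cost_add, IExp.cost_get]
    exact ⟨⟨hI', by simp⟩, by omega⟩
  · rintro s' ⟨hI, hvi⟩ hF
    simp [hvi, hb s' (hle s' hF)]
  · rintro s' t ⟨hI, hvi⟩ hF ht
    refine hQ s' _ hI hvi (hle s' hF) ?_
    simp only [IExp.cost_zero, IExp.cost_get] at ht ⊢
    have : ∑ i ∈ Finset.range n, (C i + 8 + (1 + 1 + 1 + b.cost + 1)) =
      ∑ i ∈ Finset.range n, (C i + (b.cost + 12)) := Finset.sum_congr rfl fun _ _ => by ring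
    omega

/-- The rule for counting loops with rounds of bounded cost. -/
theorem WP_loop {v : ℕ} {b : IExp} {p : Program} {s : Store} {Q : Store → ℕ → Prop} (n C : ℕ)
    (I : ℕ → Store → Prop) (hv : p.writesI v = false)
    (hb : ∀ s', Frame (.loop v b p) s s' → b.eval s' = n)
    (h0 : I 0 (s.setI v 0 0 0))
    (hs : ∀ i s', i < n → I i s' → s'.idx v 0 0 = i → Frame (.loop v b p) s s' →
      WP p s' (fun s'' t => I (i + 1) (s''.setI v 0 0 (i + 1)) ∧ t ≤ C))
    (hQ : ∀ s' t, I n s' → s'.idx v 0 0 = n → Frame (.loop v b p) s s' →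
      t ≤ n * (C + (b.cost + 12)) + (b.cost + 8) → Q s' t) :
    WP (.loop v b p) s Q :=
  WP_loop' n (fun _ => C) I hv hb h0 hs (by simpa using hQ)

/-- Filling a row of a number array. -/
theorem WP_loop_setNum {v a : ℕ} {b i : IExp} {e : NExp} {s : Store} {Q : Store → ℕ → Prop}
    (n iv : ℕ) (f : ℕ → ℂ)
    (hi : ∀ x, x < n → i.eval ((s.setI v 0 0 x).fillN a iv x f) = iv)
    (he : ∀ x, x < n → e.eval ((s.setI v 0 0 x).fillN a iv x f) = f x)
    (hb : ∀ x, x ≤ n → b.eval ((s.setI v 0 0 x).fillN a iv x f) = n)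
    (hQ : ∀ t, t ≤ n * (i.cost + e.cost + b.cost + 16) + (b.cost + 8) →
      Q ((s.setI v 0 0 n).fillN a iv n f) t) :
    WP (.loop v b (.setNum a i (V v) e)) s Q := by
  rw [Program.loop, WP_seq, WP_setIdx]
  -- The invariant is the exact memory. The expressions are evaluated when only the entries below
  -- `x` have been overwritten, so `e` may refer to the old value of the entry `x` itself; updates
  -- in place are covered. The 12 consists of 4 for addressing and assignment and 8 for the
  -- increment.
  refine WP_while n (fun _ => i.cost + e.cost + 12)
    (fun x s' => s' = (s.setI v 0 0 x).fillN a iv x f) ?_ ?_ ?_ ?_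
  · simp only [Store.fillN, fillRow_zero, IExp.eval_zero, Store.setI, Store.mk.injEq, true_and]
    funext a'
    split_ifs with h <;> simp_all
  · rintro x s' hx rfl -
    constructor
    · rw [hb x hx.le]; simpa using hx
    · simp only [WP_seq, WP_setNum, WP_setIdx, IExp.cost_zero, IExp.cost_one, IExp.cost_add, IExp.cost_get, hi x hx,
        he x hx]
      refine ⟨?_, by omega⟩
      simp only [Store.setI, Store.setN, Store.fillN, Store.mk.injEq]
      constructor
      · funext a' i' j'
        by_cases h : a' = v <;> simp [h, upd]
        split_ifs <;> rfl
      · funext a'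
        by_cases h : a' = a <;> simp [h]
        exact upd_fillRow _ _ _ _
  · rintro s' rfl -
    rw [hb n le_rfl]; simp
  · rintro s' t rfl - ht
    refine hQ _ ?_
    simp only [IExp.cost_zero, IExp.cost_get, Finset.sum_const, Finset.card_range,
      smul_eq_mul] at ht ⊢
    have : n * (i.cost + e.cost + 12 + (1 + 1 + 1 + b.cost + 1)) =
      n * (i.cost + e.cost + b.cost + 16) := by ring
    omega

/-- Filling a row of an index array. -/
theorem WP_loop_setIdx {v a : ℕ} {b i e : IExp} {s : Store} {Q : Store → ℕ → Prop}
    (n iv : ℕ) (f : ℕ → ℕ) (hva : v ≠ a)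
    (hi : ∀ x, x < n → i.eval ((s.setI v 0 0 x).fillI a iv x f) = iv)
    (he : ∀ x, x < n → e.eval ((s.setI v 0 0 x).fillI a iv x f) = f x)
    (hb : ∀ x, x ≤ n → b.eval ((s.setI v 0 0 x).fillI a iv x f) = n)
    (hQ : ∀ t, t ≤ n * (i.cost + e.cost + b.cost + 16) + (b.cost + 8) →
      Q ((s.setI v 0 0 n).fillI a iv n f) t) :
    WP (.loop v b (.setIdx a i (V v) e)) s Q := by
  rw [Program.loop, WP_seq, WP_setIdx]
  refine WP_while n (fun _ => i.cost + e.cost + 12)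
    (fun x s' => s' = (s.setI v 0 0 x).fillI a iv x f) ?_ ?_ ?_ ?_
  · simp only [Store.fillI, Store.setI, fillRow_zero, IExp.eval_zero, Store.mk.injEq, and_true]
    funext a'
    split_ifs with h <;> simp_all
  · rintro x s' hx rfl -
    constructor
    · rw [hb x hx.le]; simpa [hva] using hx
    · simp only [WP_seq, WP_setIdx, IExp.cost_zero, IExp.cost_one, IExp.cost_add, IExp.cost_get, hi x hx,
        he x hx]
      refine ⟨?_, by omega⟩
      have h1 : (V v).eval ((s.setI v 0 0 x).fillI a iv x f) = x := by simp [hva]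
      rw [h1]
      have h2 : (V v + 1).eval (((s.setI v 0 0 x).fillI a iv x f).setI a iv x (f x)) = x + 1 := by
        simp [hva]
      rw [h2]
      simp only [Store.setI, Store.fillI, Store.mk.injEq, IExp.eval_zero, and_true]
      funext a'
      by_cases h : a' = v
      · subst h
        simp only [if_true, hva, if_false]
        funext i' j'; simp only [upd]; split_ifs <;> rfl
      · by_cases h' : a' = a
        · subst h'
          simp [h, upd_fillRow]
        · simp [h, h']
  · rintro s' rfl -
    rw [hb n le_rfl]; simp [hva]
  · rintro s' t rfl - ht
    refine hQ _ ?_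
    simp only [IExp.cost_zero, IExp.cost_get, Finset.sum_const, Finset.card_range,
      smul_eq_mul] at ht ⊢
    have : n * (i.cost + e.cost + 12 + (1 + 1 + 1 + b.cost + 1)) =
      n * (i.cost + e.cost + b.cost + 16) := by ring
    omega

/-! ## The fast Fourier transform of length a power of two -/

open Finset

/-- The principal root of unity of order `n`. -/
noncomputable def zetaRoot (n : ℕ) : ℂ := Complex.exp (2 * Real.pi * Complex.I / (n : ℂ))

theorem zetaRoot_pow_self {n : ℕ} (hn : n ≠ 0) : zetaRoot n ^ n = 1 := by
  have h : (n : ℂ) ≠ 0 := Nat.cast_ne_zero.2 hn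
  rw [zetaRoot, ← Complex.exp_nat_mul, mul_div_cancel₀ _ h, Complex.exp_two_pi_mul_I]

theorem zetaRoot_ne_zero (n : ℕ) : zetaRoot n ≠ 0 := Complex.exp_ne_zero _

theorem isPrimitiveRoot_zetaRoot {n : ℕ} (hn : n ≠ 0) : IsPrimitiveRoot (zetaRoot n) n :=
  Complex.isPrimitiveRoot_exp n hn

theorem zetaRoot_two_mul_sq (l : ℕ) : zetaRoot (2 * l) ^ 2 = zetaRoot l := by
  rcases Nat.eq_zero_or_pos l with rfl | h
  · simp [zetaRoot]
  · have : (l : ℂ) ≠ 0 := Nat.cast_ne_zero.2 h.ne'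
    rw [zetaRoot, zetaRoot, ← Complex.exp_nat_mul]
    congr 1
    push_cast
    field_simp

theorem zetaRoot_two_mul_pow {l : ℕ} (h : 0 < l) : zetaRoot (2 * l) ^ l = -1 := by
  have : (l : ℂ) ≠ 0 := Nat.cast_ne_zero.2 h.ne'
  rw [zetaRoot, ← Complex.exp_nat_mul, ← Complex.exp_pi_mul_I]
  congr 1
  push_cast
  field_simp

theorem sum_range_two_mul (f : ℕ → ℂ) (l : ℕ) :
    ∑ t ∈ range (2 * l), f t = ∑ t ∈ range l, f (2 * t) + ∑ t ∈ range l, f (2 * t + 1) := by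
  induction l with
  | zero => simp
  | succ l ih =>
    rw [Nat.mul_succ, sum_range_succ, sum_range_succ, sum_range_succ, sum_range_succ, ih]
    ring

/-- The Fourier transform of length `l` of the subsequence of `x` of the places
`r, r + R, r + 2 R, …`. -/
noncomputable def dftStep (x : ℕ → ℂ) (l R r q : ℕ) : ℂ :=
  ∑ t ∈ range l, x (r + R * t) * zetaRoot l ^ (t * q)

/-- The summands are split according to the parity of `t`. Even ones belong to the residue `r`
modulo `2 * R`, odd ones to `r + R` and carry an additional twiddle factor; the square of the root
of order `2 * l` is the root of order `l`. -/
theorem dftStep_two_mul (x : ℕ → ℂ) (l R r q : ℕ) :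
    dftStep x (2 * l) R r q =
      dftStep x l (2 * R) r q + zetaRoot (2 * l) ^ q * dftStep x l (2 * R) (r + R) q := by
  rw [dftStep, sum_range_two_mul, dftStep, dftStep, mul_sum]
  congr 1
  · refine sum_congr rfl fun t _ => ?_
    rw [← zetaRoot_two_mul_sq l, ← pow_mul]
    congr 2 <;> ring
  · refine sum_congr rfl fun t _ => ?_
    rw [← zetaRoot_two_mul_sq l, ← pow_mul, mul_left_comm, ← pow_add]
    congr 2 <;> ring

/-- The upper half of the frequencies reuses the two transforms of the lower half: they have period
`l` in `q`, and only the twiddle factor changes sign. -/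
theorem dftStep_two_mul_add (x : ℕ → ℂ) {l : ℕ} (hl : 0 < l) (R r q : ℕ) :
    dftStep x (2 * l) R r (q + l) =
      dftStep x l (2 * R) r q - zetaRoot (2 * l) ^ q * dftStep x l (2 * R) (r + R) q := by
  have h : ∀ r, dftStep x l (2 * R) r (q + l) = dftStep x l (2 * R) r q := by
    intro r
    refine sum_congr rfl fun t _ => ?_
    rw [mul_add, pow_add, mul_comm t l, pow_mul _ l t, zetaRoot_pow_self hl.ne', one_pow, mul_one]
  rw [dftStep_two_mul, h, h, pow_add, zetaRoot_two_mul_pow hl]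
  ring

theorem block_lt {q q' r R : ℕ} (hq : q' < q) (hr : r < R) : q' * R + r < q * R :=
  calc q' * R + r < q' * R + R := by omega
    _ = (q' + 1) * R := by ring
    _ ≤ q * R := Nat.mul_le_mul_right _ hq

open Program IExp in
/-- One stage of the transform: the row `j + 1` of the array 8 is computed from the row `j`. -/
def fftStage : Program :=
  set 44 (.get 28 0 (V 41)) ;;
  set 45 (.get 28 0 (V 40 - 1 - V 41)) ;;
  set 46 0 ;; set 47 0 ;; set 48 (.get 28 0 (V 40 - 1)) ;;
  setn 10 (.cast 1) ;; setn 11 (.root (V 44 + V 44)) ;;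
  loop 42 (V 44) (
    loop 43 (V 45) (
      .setNum 8 (V 41 + 1) (V 47 + V 43)
        (.get 8 (V 41) (V 46 + V 43) + VN 10 * .get 8 (V 41) (V 46 + V 45 + V 43)) ;;
      .setNum 8 (V 41 + 1) (V 48 + V 43)
        (.get 8 (V 41) (V 46 + V 43) - VN 10 * .get 8 (V 41) (V 46 + V 45 + V 43))) ;;
    set 46 (V 46 + V 45 + V 45) ;; set 47 (V 47 + V 45) ;; set 48 (V 48 + V 45) ;;
    setn 10 (VN 10 * VN 11))

/-- A butterfly stage between two rows. Block `q` of the old row, of length `2 * R`, yields block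
`q` of the lower half and block `q` of the upper half of the new row, each of length `R`. Indices
cannot be multiplied, so the places `2 * q * R`, `q * R` and `l * R + q * R` are kept in registers
and advanced by additions; the twiddle factor is advanced by one multiplication for each block. -/
theorem fftStage_spec {s : Store} {Q : Store → ℕ → Prop} (j l R : ℕ)
    (hj : s.idx 41 0 0 = j) (hl : s.idx 28 0 j = l)
    (hR : s.idx 28 0 (s.idx 40 0 0 - 1 - j) = R) (hM : s.idx 28 0 (s.idx 40 0 0 - 1) = l * R)
    (hQ : ∀ s' t, Frame fftStage s s' → t ≤ 110 * (l * R) + 150 * l + 150 →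
      (∀ i, i ≠ j + 1 → s'.num 8 i = s.num 8 i) →
      (∀ q < l, ∀ r < R,
        s'.num 8 (j + 1) (q * R + r) = s.num 8 j (2 * q * R + r) +
          zetaRoot (2 * l) ^ q * s.num 8 j (2 * q * R + R + r) ∧
        s'.num 8 (j + 1) (l * R + (q * R + r)) = s.num 8 j (2 * q * R + r) -
          zetaRoot (2 * l) ^ q * s.num 8 j (2 * q * R + R + r)) → Q s' t) :
    WP fftStage s Q := by
  suffices H : WP fftStage s (fun s' t => t ≤ 110 * (l * R) + 150 * l + 150 ∧
      (∀ i, i ≠ j + 1 → s'.num 8 i = s.num 8 i) ∧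
      (∀ q < l, ∀ r < R,
        s'.num 8 (j + 1) (q * R + r) = s.num 8 j (2 * q * R + r) +
          zetaRoot (2 * l) ^ q * s.num 8 j (2 * q * R + R + r) ∧
        s'.num 8 (j + 1) (l * R + (q * R + r)) = s.num 8 j (2 * q * R + r) -
          zetaRoot (2 * l) ^ q * s.num 8 j (2 * q * R + R + r))) from
    H.mono fun s' t h hF => hQ s' t hF h.1 h.2.1 h.2.2
  simp [fftStage, hj, hl, hR, hM]
  refine WP_loop l (110 * R + 100) (fun q s' =>
    (∀ i, i ≠ j + 1 → s'.num 8 i = s.num 8 i) ∧ s'.idx 46 0 0 = 2 * q * R ∧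
    s'.idx 47 0 0 = q * R ∧ s'.idx 48 0 0 = l * R + q * R ∧
    s'.num 10 0 0 = zetaRoot (2 * l) ^ q ∧
    (∀ q' < q, ∀ r < R,
        s'.num 8 (j + 1) (q' * R + r) = s.num 8 j (2 * q' * R + r) +
          zetaRoot (2 * l) ^ q' * s.num 8 j (2 * q' * R + R + r) ∧
        s'.num 8 (j + 1) (l * R + (q' * R + r)) = s.num 8 j (2 * q' * R + r) -
          zetaRoot (2 * l) ^ q' * s.num 8 j (2 * q' * R + R + r))) rfl ?_ ?_ ?_ ?_
  · intro s' hF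
    have := hF.idx 44 rfl
    simp [this]
  · simp
  · rintro q s1 hq ⟨h8, h46, h47, h48, h10, hd⟩ h42 hF
    have e41 := hF.idx 41 rfl
    have e44 := hF.idx 44 rfl
    have e45 := hF.idx 45 rfl
    have e11 := hF.num 11 rfl
    simp at e41 e44 e45 e11
    have e41' : s1.idx 41 0 0 = j := by rw [e41, hj]
    have e11' : s1.num 11 0 0 = zetaRoot (2 * l) := by rw [e11, upd_same, zetaRoot]; push_cast; ring_nf
    rw [WP_seq]
    -- Besides the entries already computed, the invariant says that nothing was written outside the
    -- two windows of the current block; this preserves the earlier blocks.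
    refine WP_loop R 90 (fun r s' =>
      (∀ i, i ≠ j + 1 → s'.num 8 i = s.num 8 i) ∧
      (∀ x, (x < q * R ∨ q * R + r ≤ x) → (x < l * R + q * R ∨ l * R + q * R + r ≤ x) →
        s'.num 8 (j + 1) x = s1.num 8 (j + 1) x) ∧
      (∀ r' < r,
        s'.num 8 (j + 1) (q * R + r') = s.num 8 j (2 * q * R + r') +
          zetaRoot (2 * l) ^ q * s.num 8 j (2 * q * R + R + r') ∧
        s'.num 8 (j + 1) (l * R + (q * R + r')) = s.num 8 j (2 * q * R + r') -
          zetaRoot (2 * l) ^ q * s.num 8 j (2 * q * R + R + r'))) rfl ?_ ?_ ?_ ?_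
    · intro s' hF'
      simp [hF'.idx 45 rfl, e45]
    · simp; exact h8
    · rintro r s2 hr ⟨g8, gu, gd⟩ h43 hF'
      have hqR : q * R + R ≤ l * R := by
        calc q * R + R = (q + 1) * R := by ring
          _ ≤ l * R := Nat.mul_le_mul_right _ hq
      simp [hF'.idx 41 rfl, hF'.idx 45 rfl, hF'.idx 46 rfl, hF'.idx 47 rfl, hF'.idx 48 rfl,
        hF'.num 10 rfl, e41', e45, h46, h47, h48, h10, h43]
      rw [upd_row_ne _ _ _ (by omega : j ≠ j + 1), g8 j (by omega)]
      refine ⟨fun i hi => ?_, fun x hx hx' => ?_, fun r' hr' => ?_⟩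
      · rw [upd_row_ne _ _ _ hi, upd_row_ne _ _ _ hi, g8 i hi]
      · rw [upd_ne _ _ (by omega), upd_ne _ _ (by omega)]
        exact gu x (by omega) (by omega)
      · rcases Nat.lt_or_eq_of_le hr' with h | rfl
        · rw [upd_ne _ _ (by omega), upd_ne _ _ (by omega), upd_ne _ _ (by omega),
            upd_ne _ _ (by omega)]
          exact gd r' h
        · rw [upd_ne _ _ (by omega), upd_same, ← add_assoc, upd_same]
          simp
    · rintro s2 t ⟨g8, gu, gd⟩ h43 hF' ht
      simp [hF'.idx 45 rfl, hF'.idx 46 rfl, hF'.idx 47 rfl, hF'.idx 48 rfl,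
        hF'.num 10 rfl, hF'.num 11 rfl, e45, h46, h47, h48, h10, e11'] at ht ⊢
      refine ⟨⟨fun i hi => g8 i hi, by ring, by ring, by ring, by ring, fun q' hq' r hr => ?_⟩, ?_⟩
      · have hqR : q * R + R ≤ l * R := by
          calc q * R + R = (q + 1) * R := by ring
            _ ≤ l * R := Nat.mul_le_mul_right _ hq
        rcases Nat.lt_or_eq_of_le hq' with h | rfl
        · have := block_lt h hr
          rw [gu _ (by omega) (by omega), gu _ (by omega) (by omega)]
          exact hd q' h r hr
        · exact gd r hr
      · linarith
  · rintro s1 t ⟨h8, h46, h47, h48, h10, hd⟩ h42 hF ht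
    refine ⟨?_, h8, hd⟩
    simp at ht
    linarith

open Program IExp in
/-- The Fourier transform of length `2 ^ m` of the row `0` of the array 8 to the row `m`. -/
def fft : Program := loop 41 (V 40) fftStage

theorem fft_spec {s : Store} {Q : Store → ℕ → Prop} (m : ℕ) (hm : s.idx 40 0 0 = m)
    (hp : ∀ j ≤ m, s.idx 28 0 j = 2 ^ j)
    (hQ : ∀ s' t, Frame fft s s' → t ≤ 500 * 2 ^ m * (m + 1) →
      (∀ q < 2 ^ m, s'.num 8 m q =
        ∑ t ∈ range (2 ^ m), s.num 8 0 t * zetaRoot (2 ^ m) ^ (t * q)) → Q s' t) :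
    WP fft s Q := by
  -- Row `j` holds, at `q * 2 ^ (m - j) + r`, the frequency `q` of the transform of length `2 ^ j`
  -- of the entries whose places are `r` modulo `2 ^ (m - j)`. For `j = 0` these are the data, for
  -- `j = m` the whole transform. Writing each stage to a new row makes a bit reversal unnecessary.
  refine WP_loop m (260 * 2 ^ m + 150) (fun j s' => ∀ q < 2 ^ j, ∀ r < 2 ^ (m - j),
    s'.num 8 j (q * 2 ^ (m - j) + r) = dftStep (s.num 8 0) (2 ^ j) (2 ^ (m - j)) r q) rfl
    ?_ ?_ ?_ ?_
  · intro s' hF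
    simp [hF.idx 40 rfl, hm]
  · intro q hq r hr
    obtain rfl : q = 0 := by simpa using hq
    simp [dftStep]
  · intro j s1 hj hI h41 hF
    have hR : 2 ^ (m - j) = 2 * 2 ^ (m - 1 - j) := by
      rw [← pow_succ']; congr 1; omega
    have hM : 2 ^ (m - 1) = 2 ^ j * 2 ^ (m - 1 - j) := by
      rw [← pow_add]; congr 1; omega
    have e28 := hF.idx 28 rfl
    have e40 := hF.idx 40 rfl
    refine fftStage_spec j (2 ^ j) (2 ^ (m - 1 - j)) h41 ?_ ?_ ?_ ?_
    · rw [e28, hp j hj.le]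
    · rw [e28, e40, hm, hp _ (by omega)]
    · rw [e28, e40, hm, hp _ (by omega), hM]
    · intro s2 t hF2 ht h8 hd
      constructor
      · have hR' : m - (j + 1) = m - 1 - j := by omega
        rw [hR']
        intro q hq r hr
        set R := 2 ^ (m - 1 - j) with hRdef
        have key : ∀ q' < 2 ^ j, s1.num 8 j (2 * q' * R + r) =
            dftStep (s.num 8 0) (2 ^ j) (2 * R) r q' ∧ s1.num 8 j (2 * q' * R + R + r) =
            dftStep (s.num 8 0) (2 ^ j) (2 * R) (r + R) q' := by
          intro q' hq'
          have h1 := hI q' hq' r (by omega)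
          have h2 := hI q' hq' (r + R) (by omega)
          rw [hR] at h1 h2
          rw [← h1, ← h2]
          constructor <;> congr 1 <;> ring
        have hl : 0 < 2 ^ j := by positivity
        simp only [Store.setI_num]
        rw [pow_succ'] at hq ⊢
        by_cases hq' : q < 2 ^ j
        · rw [dftStep_two_mul, (hd q hq' r hr).1, (key q hq').1, (key q hq').2]
        · obtain ⟨q', rfl⟩ := Nat.exists_eq_add_of_le' (Nat.not_lt.1 hq')
          have hq'' : q' < 2 ^ j := by omega
          have := (hd q' hq'' r hr).2
          rw [dftStep_two_mul_add _ hl, ← (key q' hq'').1, ← (key q' hq'').2, ← this]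
          congr 1; ring
      · have h1 : 2 ^ j * 2 ^ (m - 1 - j) ≤ 2 ^ m := by
          rw [← hM]; exact Nat.pow_le_pow_right (by norm_num) (by omega)
        have h2 : 2 * 2 ^ j ≤ 2 ^ m := by
          rw [← pow_succ']; exact Nat.pow_le_pow_right (by norm_num) (by omega)
        rw [← hM] at ht h1
        generalize 2 ^ m = a at *
        generalize 2 ^ (m - 1) = b at *
        omega
  · intro s1 t hI h41 hF ht
    refine hQ s1 t hF ?_ fun q hq => ?_
    · simp at ht
      have : 1 ≤ 2 ^ m := Nat.one_le_two_pow
      nlinarith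
    · have := hI q hq 0 (by simp)
      simpa [dftStep] using this

/-! ## Fourier transforms of arbitrary length -/

theorem sum_zetaRoot_pow {M : ℕ} (hM : M ≠ 0) (n : ℕ) :
    ∑ q ∈ range M, zetaRoot M ^ (n * q) = if M ∣ n then (M : ℂ) else 0 := by
  have hz := isPrimitiveRoot_zetaRoot hM
  simp only [pow_mul]
  split_ifs with h
  · rw [(hz.pow_eq_one_iff_dvd n).2 h]; simp
  · have h1 : zetaRoot M ^ n ≠ 1 := fun h' => h ((hz.pow_eq_one_iff_dvd n).1 h')
    have h2 := mul_neg_geom_sum (zetaRoot M ^ n) M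
    rw [← pow_mul, mul_comm n M, pow_mul, zetaRoot_pow_self hM, one_pow, sub_self] at h2
    exact (mul_eq_zero.1 h2).resolve_left (sub_ne_zero.2 h1.symm)

/-- This identity writes `j * k` as a function of `j + k` minus functions of `j` and of `k`.
Binomial coefficients instead of half squares avoid a square root of `ζ`. -/
theorem choose_two_add (j k : ℕ) : (j + k).choose 2 = j.choose 2 + k.choose 2 + j * k := by
  induction k with
  | zero => simp
  | succ k ih =>
    rw [← add_assoc, Nat.choose_succ_succ' (j + k) 1, Nat.choose_succ_succ' k 1, ih]
    simp only [Nat.choose_one_right]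
    ring

/-- By `choose_two_add`, the factor `ζ ^ (j * k)` equals `ζ ^ (j + k).choose 2` divided by a factor
of `j` and a factor of `k`. So the transform is, up to these factors, a correlation with the chirp.
Reversing the chirp turns it into a cyclic convolution of length `M`. The third transform is again a
forward one, which reads off the coefficients at negative places; hence the frequency `k + 1` and
the division by `M`. -/
theorem chirp_transform {N M : ℕ} (hM : 2 * N ≤ M) {ζ : ℂ} (hζ : ζ ≠ 0) (x : ℕ → ℂ)
    {k : ℕ} (hk : k < N) :
    (∑ q ∈ range M,
        ((∑ t ∈ range M, (if t < N then x t / ζ ^ t.choose 2 else 0) * zetaRoot M ^ (t * q)) *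
        (∑ t ∈ range M, ζ ^ (M - 1 - t).choose 2 * zetaRoot M ^ (t * q))) *
        zetaRoot M ^ (q * (k + 1))) / (ζ ^ k.choose 2 * M) =
      ∑ j ∈ range N, x j * ζ ^ (j * k) := by
  have hM0 : M ≠ 0 := by omega
  have hMc : (M : ℂ) ≠ 0 := Nat.cast_ne_zero.2 hM0
  have hz : ∀ n, ζ ^ n ≠ 0 := fun n => pow_ne_zero n hζ
  set a : ℕ → ℂ := fun t => if t < N then x t / ζ ^ t.choose 2 else 0 with ha
  set b : ℕ → ℂ := fun t => ζ ^ (M - 1 - t).choose 2 with hb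
  have h1 : ∑ q ∈ range M, ((∑ t ∈ range M, a t * zetaRoot M ^ (t * q)) *
        (∑ t ∈ range M, b t * zetaRoot M ^ (t * q))) * zetaRoot M ^ (q * (k + 1)) =
      ∑ t ∈ range M, ∑ u ∈ range M, a t * b u * (if M ∣ t + u + k + 1 then (M : ℂ) else 0) := by
    simp only [sum_mul_sum]
    simp only [sum_mul]
    rw [sum_comm]
    refine sum_congr rfl fun t _ => ?_
    rw [sum_comm]
    refine sum_congr rfl fun u _ => ?_
    rw [← sum_zetaRoot_pow hM0, mul_sum]
    refine sum_congr rfl fun q _ => ?_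
    rw [show (t + u + k + 1) * q = t * q + u * q + q * (k + 1) by ring, pow_add, pow_add]
    ring
  have h2 : ∀ t < N, ∑ u ∈ range M, a t * b u * (if M ∣ t + u + k + 1 then (M : ℂ) else 0) =
      a t * ζ ^ (t + k).choose 2 * M := by
    intro t ht
    -- Since `t, k < N` and `2 * N ≤ M`, the number `t + u + k + 1` lies strictly between 0 and `2 *
    -- M`. If `M` divides it, it is equal to `M`, so exactly one `u` survives and the chirp at this
    -- `u` has the argument `t + k`.
    rw [sum_eq_single (M - 1 - t - k)]
    · rw [if_pos ⟨1, by omega⟩]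
      simp only [hb]
      rw [show M - 1 - (M - 1 - t - k) = t + k by omega]
    · intro u hu hne
      rw [if_neg, mul_zero]
      rintro ⟨c, hc⟩
      rw [mem_range] at hu
      have : c < 2 := by
        by_contra h
        have : M * 2 ≤ M * c := Nat.mul_le_mul_left _ (by omega)
        omega
      interval_cases c <;> omega
    · intro h; rw [mem_range] at h; omega
  rw [h1, ← sum_subset (range_subset_range.2 (by omega : N ≤ M)), sum_div]
  · refine sum_congr rfl fun t ht => ?_
    rw [mem_range] at ht
    have h3 := hz (t.choose 2)
    have h4 := hz (k.choose 2)
    simp only [ha]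
    rw [h2 t ht, ha]
    simp only [ht, if_true]
    rw [choose_two_add, pow_add, pow_add]
    field_simp
  · intro t _ ht
    rw [mem_range] at ht
    simp [ha, ht]

open Program IExp in
/-- The powers of two up to the first one that is at least twice the register 50. -/
def powers : Program :=
  .setIdx 28 0 0 1 ;; set 40 0 ;;
  .whileLt (.get 28 0 (V 40)) (V 50 + V 50) (
    .setIdx 28 0 (V 40 + 1) (.get 28 0 (V 40) + .get 28 0 (V 40)) ;; set 40 (V 40 + 1))

theorem powers_spec {s : Store} {Q : Store → ℕ → Prop} (N : ℕ) (hN : s.idx 50 0 0 = N)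
    (hQ : ∀ s' t, Frame powers s s' → t ≤ 50 * (Nat.clog 2 (2 * N) + 1) →
      s'.idx 40 0 0 = Nat.clog 2 (2 * N) → (∀ j ≤ Nat.clog 2 (2 * N), s'.idx 28 0 j = 2 ^ j) →
      Q s' t) : WP powers s Q := by
  suffices H : WP powers s (fun s' t => t ≤ 50 * (Nat.clog 2 (2 * N) + 1) ∧
      s'.idx 40 0 0 = Nat.clog 2 (2 * N) ∧ (∀ j ≤ Nat.clog 2 (2 * N), s'.idx 28 0 j = 2 ^ j)) from
    H.mono fun s' t h hF => hQ s' t hF h.1 h.2.1 h.2.2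
  simp only [powers, WP_seq, WP_setIdx, WP_set]
  refine WP_while (Nat.clog 2 (2 * N)) (fun _ => 30)
    (fun i s' => s'.idx 40 0 0 = i ∧ ∀ j ≤ i, s'.idx 28 0 j = 2 ^ j) ?_ ?_ ?_ ?_
  · simp
  · rintro i s1 hi ⟨h40, h28⟩ hF
    have e50 := hF.idx 50 rfl
    simp at e50
    have : 2 ^ i < 2 * N := (Nat.lt_clog_iff_pow_lt (by norm_num)).1 hi
    constructor
    · simp [h40, h28 i le_rfl, e50, hN]; omega
    · simp [h40]
      intro j hj
      rcases Nat.lt_or_eq_of_le hj with h | rfl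
      · rw [upd_ne _ _ (by omega), h28 j (by omega)]
      · rw [upd_same, h28 i le_rfl]; ring
  · rintro s1 ⟨h40, h28⟩ hF
    have e50 := hF.idx 50 rfl
    simp at e50
    have : 2 * N ≤ 2 ^ Nat.clog 2 (2 * N) := Nat.le_pow_clog (by norm_num) _
    simp [h40, h28 _ le_rfl, e50, hN]; omega
  · rintro s1 t ⟨h40, h28⟩ hF ht
    simp at ht
    exact ⟨by simp; omega, h40, h28⟩

open Program IExp in
/-- The powers of `ζ` (number register 12) with the exponents `n.choose 2`. -/
def chirps : Program :=
  setn 13 (.cast 1) ;; setn 14 (.cast 1) ;;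
  loop 52 (V 51) (.setNum 15 0 (V 52) (VN 13) ;; setn 13 (VN 13 * VN 14) ;;
    setn 14 (VN 14 * VN 12))

/-- Consecutive exponents `i.choose 2` differ by `i`. Maintaining `ζ ^ i` as well therefore gives
every chirp value by two multiplications. -/
theorem chirps_spec {s : Store} {Q : Store → ℕ → Prop} (M : ℕ) (ζ : ℂ) (hM : s.idx 51 0 0 = M)
    (hζ : s.num 12 0 0 = ζ)
    (hQ : ∀ s' t, Frame chirps s s' → t ≤ 100 * (M + 1) →
      (∀ j < M, s'.num 15 0 j = ζ ^ j.choose 2) → Q s' t) : WP chirps s Q := by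
  suffices H : WP chirps s (fun s' t => t ≤ 100 * (M + 1) ∧
      (∀ j < M, s'.num 15 0 j = ζ ^ j.choose 2)) from
    H.mono fun s' t h hF => hQ s' t hF h.1 h.2
  simp only [chirps, WP_seq, WP_setn]
  refine WP_loop M 80
    (fun i s' => s'.num 13 0 0 = ζ ^ i.choose 2 ∧ s'.num 14 0 0 = ζ ^ i ∧
      ∀ j < i, s'.num 15 0 j = ζ ^ j.choose 2) rfl ?_ ?_ ?_ ?_
  · intro s' hF
    have := hF.idx 51 rfl
    simp at this
    simp [this, hM]
  · simp
  · rintro i s1 hi ⟨h13, h14, h15⟩ h52 hF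
    have e12 := hF.num 12 rfl
    simp at e12
    simp [h13, h14, h52, e12, hζ]
    refine ⟨?_, ?_, fun j hj => ?_⟩
    · rw [← pow_add, Nat.choose_succ_succ' i 1, Nat.choose_one_right, add_comm]
    · rw [pow_succ]
    · rcases Nat.lt_or_eq_of_le hj with h | rfl
      · rw [upd_ne _ _ (by omega), h15 j (by omega)]
      · rw [upd_same]
  · rintro s1 t ⟨-, -, h15⟩ h52 hF ht
    simp at ht ⊢
    exact ⟨by omega, h15⟩

open Program IExp in
/-- The transform `y k = ∑ j, x j * ζ ^ (j * k)` of length `N` (register 50), from the array 5 to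
the array 6. -/
def bluestein : Program :=
  powers ;; set 51 (.get 28 0 (V 40)) ;; chirps ;;
  loop 52 (V 51) (.setNum 8 0 (V 52) (.get 15 0 (V 51 - 1 - V 52))) ;;
  fft ;;
  loop 52 (V 51) (.setNum 9 0 (V 52) (.get 8 (V 40) (V 52))) ;;
  loop 52 (V 51) (.setNum 8 0 (V 52) (.cast 0)) ;;
  loop 52 (V 50) (.setNum 8 0 (V 52) (.get 5 0 (V 52) / .get 15 0 (V 52))) ;;
  fft ;;
  loop 52 (V 51) (.setNum 8 0 (V 52) (.get 8 (V 40) (V 52) * .get 9 0 (V 52))) ;;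
  fft ;;
  loop 52 (V 50) (.setNum 6 0 (V 52) (.get 8 (V 40) (V 52 + 1) / (.get 15 0 (V 52) * .cast (V 51))))

/-- Three transforms of length `M = 2 ^ m`, where `2 * N ≤ M ≤ 4 * N`, realize `chirp_transform`:
one of the reversed chirp, one of the padded data, one of the product. Their cost is of the order `M
* m`, hence `N * log N`. -/
theorem bluestein_spec {s : Store} {Q : Store → ℕ → Prop} (N : ℕ) (ζ : ℂ) (hN0 : 0 < N)
    (hN : s.idx 50 0 0 = N) (hζ : s.num 12 0 0 = ζ) (hζ0 : ζ ≠ 0)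
    (hQ : ∀ s' t, Frame bluestein s s' → t ≤ 20000 * N * (Nat.log 2 N + 3) →
      (∀ k < N, s'.num 6 0 k = ∑ j ∈ range N, s.num 5 0 j * ζ ^ (j * k)) → Q s' t) :
    WP bluestein s Q := by
  suffices H : WP bluestein s (fun s' t => t ≤ 20000 * N * (Nat.log 2 N + 3) ∧
      (∀ k < N, s'.num 6 0 k = ∑ j ∈ range N, s.num 5 0 j * ζ ^ (j * k))) from
    H.mono fun s' t h hF => hQ s' t hF h.1 h.2
  set m := Nat.clog 2 (2 * N) with hm
  have hM2 : 2 * N ≤ 2 ^ m := Nat.le_pow_clog (by norm_num) _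
  -- The input of the last transform is written to row 0 while row `m` is still being read, so these
  -- rows must be different.
  have hm0 : m ≠ 0 := by rintro h; rw [h] at hM2; omega
  have hml : m ≤ Nat.log 2 N + 2 := by
    refine (Nat.clog_le_iff_le_pow (by norm_num)).2 ?_
    have := Nat.lt_pow_succ_log_self (by norm_num : 1 < 2) N
    rw [pow_succ]
    rw [Nat.succ_eq_add_one] at this
    omega
  -- By the minimality of `m`, the power `2 ^ (m - 1)` is still below `2 * N`.
  have hM4 : 2 ^ m ≤ 4 * N := by
    have := Nat.pow_pred_clog_lt_self (b := 2) (by norm_num) (by omega : 1 < 2 * N)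
    rw [← hm, Nat.pred_eq_sub_one] at this
    have h2 : 2 ^ m = 2 * 2 ^ (m - 1) := by rw [← pow_succ']; congr 1; omega
    omega
  rw [bluestein, WP_seq]
  refine powers_spec N hN fun s1 t1 F1 ht1 h40 h28 => ?_
  rw [← hm] at h40 h28 ht1
  simp only [WP_seq, WP_set]
  set M := 2 ^ m with hMdef
  have hev : (IExp.get 28 0 (V 40)).eval s1 = M := by simp [h40, h28, hMdef]
  rw [hev]
  refine chirps_spec M ζ (by simp) (by simp [F1.num 12 rfl, hζ]) fun s2 t2 F2 ht2 h15 => ?_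
  have e51 : s2.idx 51 0 0 = M := by simp [F2.idx 51 rfl]
  have e50 : s2.idx 50 0 0 = N := by simp [F2.idx 50 rfl, F1.idx 50 rfl, hN]
  have e40 : s2.idx 40 0 0 = m := by simp [F2.idx 40 rfl, h40]
  have e28 : ∀ j ≤ m, s2.idx 28 0 j = 2 ^ j := by simpa [F2.idx 28 rfl] using h28
  have e5 : s2.num 5 = s.num 5 := by simp [F2.num 5 rfl, F1.num 5 rfl]
  refine WP_loop_setNum M 0 (fun x => ζ ^ (M - 1 - x).choose 2) (by simp) ?_ (by simp [e51]) ?_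
  · intro x hx
    simp [e51, h15 (M - 1 - x) (by omega)]
  intro t3 ht3
  refine fft_spec m (by simp [e40]) (by simpa using e28) fun s4 t4 F4 ht4 h4 => ?_
  rw [← hMdef] at h4
  have g51 : s4.idx 51 0 0 = M := by simp [F4.idx 51 rfl, e51]
  have g50 : s4.idx 50 0 0 = N := by simp [F4.idx 50 rfl, e50]
  have g40 : s4.idx 40 0 0 = m := by simp [F4.idx 40 rfl, e40]
  have g28 : ∀ j ≤ m, s4.idx 28 0 j = 2 ^ j := by simpa [F4.idx 28 rfl] using e28
  have g5 : s4.num 5 = s.num 5 := by simp [F4.num 5 rfl, e5]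
  have g15 : ∀ j < M, s4.num 15 0 j = ζ ^ j.choose 2 := by simpa [F4.num 15 rfl] using h15
  have k4 : ∀ q < M, s4.num 8 m q = ∑ t ∈ range M, ζ ^ (M - 1 - t).choose 2 *
      zetaRoot M ^ (t * q) := by
    intro q hq
    rw [h4 q hq]
    refine sum_congr rfl fun t ht => ?_
    simp [fillRow_lt _ _ _ (mem_range.1 ht)]
  refine WP_loop_setNum M 0 (fun x => s4.num 8 m x) (by simp) (by simp [g40]) (by simp [g51]) ?_
  intro t5 ht5
  refine WP_loop_setNum M 0 (fun x => 0) (by simp) (by simp) (by simp [g51]) ?_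
  intro t6 ht6
  refine WP_loop_setNum N 0 (fun x => s.num 5 0 x / ζ ^ x.choose 2) (by simp) ?_
    (by simp [g50]) ?_
  · intro x hx
    simp [g5, g15 x (by omega)]
  intro t7 ht7
  refine fft_spec m (by simp [g40]) (by simpa using g28) fun s8 t8 F8 ht8 h8 => ?_
  rw [← hMdef] at h8
  have i51 : s8.idx 51 0 0 = M := by simp [F8.idx 51 rfl, g51]
  have i50 : s8.idx 50 0 0 = N := by simp [F8.idx 50 rfl, g50]
  have i40 : s8.idx 40 0 0 = m := by simp [F8.idx 40 rfl, g40]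
  have i28 : ∀ j ≤ m, s8.idx 28 0 j = 2 ^ j := by simpa [F8.idx 28 rfl] using g28
  have i15 : ∀ j < M, s8.num 15 0 j = ζ ^ j.choose 2 := by simpa [F8.num 15 rfl] using g15
  have i9 : ∀ q < M, s8.num 9 0 q = ∑ t ∈ range M, ζ ^ (M - 1 - t).choose 2 *
      zetaRoot M ^ (t * q) := by
    intro q hq
    rw [F8.num 9 rfl]
    simp [fillRow_lt _ _ _ hq, k4 q hq]
  have k8 : ∀ q < M, s8.num 8 m q = ∑ t ∈ range M,
      (if t < N then s.num 5 0 t / ζ ^ t.choose 2 else 0) * zetaRoot M ^ (t * q) := by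
    intro q hq
    rw [h8 q hq]
    refine sum_congr rfl fun t ht => ?_
    congr 1
    by_cases h : t < N
    · simp [fillRow_lt _ _ _ h, h]
    · simp [fillRow_ge _ _ _ _ (Nat.not_lt.1 h), fillRow_lt _ _ _ (mem_range.1 ht), h]
  refine WP_loop_setNum M 0 (fun x => s8.num 8 m x * s8.num 9 0 x) (by simp) ?_
    (by simp [i51]) ?_
  · intro x hx
    simp [i40, fillRow_ne _ _ _ hm0]
  intro t9 ht9
  refine fft_spec m (by simp [i40]) (by simpa using i28) fun s10 t10 F10 ht10 h10 => ?_
  rw [← hMdef] at h10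
  have j51 : s10.idx 51 0 0 = M := by simp [F10.idx 51 rfl, i51]
  have j50 : s10.idx 50 0 0 = N := by simp [F10.idx 50 rfl, i50]
  have j40 : s10.idx 40 0 0 = m := by simp [F10.idx 40 rfl, i40]
  have j15 : ∀ j < M, s10.num 15 0 j = ζ ^ j.choose 2 := by simpa [F10.num 15 rfl] using i15
  refine WP_loop_setNum N 0 (fun x => ∑ j ∈ range N, s.num 5 0 j * ζ ^ (j * x)) (by simp) ?_
    (by simp [j50]) ?_
  · intro x hx
    simp [j40, j51, j15 x (by omega)]
    rw [h10 _ (by omega), ← chirp_transform hM2 hζ0 _ hx]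
    congr 1
    refine sum_congr rfl fun q hq => ?_
    rw [mem_range] at hq
    simp [fillRow_lt _ _ _ hq, k8 q hq, i9 q hq]
  intro t11 ht11
  refine ⟨?_, fun k hk => by simp [fillRow_lt _ _ _ hk]⟩
  simp at ht3 ht5 ht6 ht7 ht9 ht11 ⊢
  clear_value M
  have hlog : 500 * M * (m + 1) ≤ 500 * (4 * N) * (Nat.log 2 N + 3) :=
    Nat.mul_le_mul (Nat.mul_le_mul_left _ hM4) (by omega)
  have h1 : N * 3 ≤ N * (Nat.log 2 N + 3) := by gcongr; omega
  have h2 : m + 1 ≤ M := hMdef ▸ Nat.lt_two_pow_self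
  rw [mul_assoc 20000]
  rw [mul_assoc 500 (4 * N), mul_assoc 4 N] at hlog
  rw [← hMdef] at ht4 ht8 ht10
  generalize 500 * M * (m + 1) = z at *
  generalize N * (Nat.log 2 N + 3) = y at *
  omega

/-! ## Tables -/

/-- The data of the elimination of the vertices `0, 1, …` of an incidence graph. A vertex is a
variable (`kind` is `0`) or a constraint (`kind` is `1`). The coordinate of a vertex takes `dim`
values, of which only the first `low` are significant. `rd b d` is the significant value that
represents the count `d`, `wt b d` is the weight of the value `d`, and `act c x` is the value of the
variable `x` that is counted by the constraint `c`, or `2` if `x` does not occur in `c`. Finally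
`bag b` is the decreasing list of the vertices of the table of `b`. -/
structure Layout where
  kind : ℕ → ℕ
  low : ℕ → ℕ
  dim : ℕ → ℕ
  rd : ℕ → ℕ → ℕ
  wt : ℕ → ℕ → ℕ
  act : ℕ → ℕ → ℕ
  bag : ℕ → List ℕ

namespace Layout

variable (L : Layout)

/-- The number of entries of a table. -/
def size (B : List ℕ) : ℕ := (B.map L.dim).prod

@[simp] theorem size_nil : L.size [] = 1 := rfl
@[simp] theorem size_cons (b : ℕ) (B : List ℕ) : L.size (b :: B) = L.dim b * L.size B := by
  simp [size]

/-- The consistency conditions on a vertex. -/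
structure Good (b : ℕ) : Prop where
  var : L.kind b = 0 → L.low b = 2 ∧ L.dim b = 2
  con : L.kind b ≠ 0 → L.kind b = 1 ∧ 0 < L.low b ∧ L.dim b = L.low b + L.low b ∧
    (∀ d, L.rd b d < L.low b) ∧ ∀ d < L.low b, L.rd b d = d

variable {L}

theorem Good.low_pos {b : ℕ} (h : L.Good b) : 0 < L.low b := by
  by_cases h0 : L.kind b = 0
  · have := h.var h0; omega
  · exact (h.con h0).2.1

theorem Good.low_le_dim {b : ℕ} (h : L.Good b) : L.low b ≤ L.dim b := by
  by_cases h0 : L.kind b = 0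
  · have := h.var h0; omega
  · have := h.con h0; omega

theorem Good.dim_pos {b : ℕ} (h : L.Good b) : 0 < L.dim b := h.low_pos.trans_le h.low_le_dim

variable (L)

theorem size_pos {B : List ℕ} (h : ∀ b ∈ B, L.Good b) : 0 < L.size B := by
  induction B with
  | nil => simp
  | cons b B ih =>
    rw [size_cons]
    exact Nat.mul_pos (h b (by simp)).dim_pos (ih fun b' hb' => h b' (by simp [hb']))

/-- The matrix of the evaluation of a coordinate. -/
noncomputable def fwd (b d e : ℕ) : ℂ :=
  if L.kind b = 0 then (if e = d then 1 else 0)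
  else if e < L.low b then zetaRoot (L.dim b) ^ (e * d) else 0

/-- The matrix of the interpolation of a coordinate, followed by the reduction of the counts. -/
noncomputable def bwd (b d e : ℕ) : ℂ :=
  if L.kind b = 0 then (if e = d then 1 else 0)
  else ∑ n ∈ range (L.dim b),
    if L.rd b n = d then (zetaRoot (L.dim b))⁻¹ ^ (e * n) / (L.dim b : ℂ) else 0

/-- The transform of a table by a matrix in each coordinate. -/
noncomputable def trans (W : ℕ → ℕ → ℕ → ℂ) : List ℕ → (ℕ → ℂ) → ℕ → ℂ
  | [], T => T
  | b :: B, T => fun x => ∑ e ∈ range (L.dim b),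
      W b (x / L.size B) e * trans W B (fun y => T (e * L.size B + y)) (x % L.size B)

theorem trans_cons (W : ℕ → ℕ → ℕ → ℂ) (b : ℕ) (B : List ℕ) (T : ℕ → ℂ) (d : ℕ) {x : ℕ}
    (hx : x < L.size B) : L.trans W (b :: B) T (d * L.size B + x) =
      ∑ e ∈ range (L.dim b), W b d e * L.trans W B (fun y => T (e * L.size B + y)) x := by
  have h1 : (d * L.size B + x) / L.size B = d := by
    rw [mul_comm, Nat.mul_add_div (by omega), Nat.div_eq_of_lt hx, add_zero]
  have h2 : (d * L.size B + x) % L.size B = x := by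
    rw [mul_comm, Nat.mul_add_mod, Nat.mod_eq_of_lt hx]
  simp only [trans, h1, h2]

/-- The contents of the memory that represent the layout with `n` vertices. -/
structure Holds (n : ℕ) (s : Store) : Prop where
  kind : ∀ r < n, s.idx 13 0 r = L.kind r
  low : ∀ r < n, s.idx 16 0 r = L.low r
  dim : ∀ r < n, s.idx 17 0 r = L.dim r
  rd : ∀ r < n, L.kind r ≠ 0 → ∀ d < L.dim r, s.idx 20 r d = L.rd r d
  wt : ∀ r < n, ∀ d < L.low r, s.idx 21 r d = L.wt r d
  len : ∀ r < n, s.idx 23 0 r = (L.bag r).length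
  bag : ∀ r < n, ∀ j (h : j < (L.bag r).length), s.idx 22 r j = (L.bag r)[j]
  sz : ∀ r < n, ∀ j ≤ (L.bag r).length, s.idx 24 r j = L.size ((L.bag r).drop j)
  mark : ∀ r < n, ∀ b, s.idx 25 r b = if b ∈ L.bag r then 1 else 0
  act : ∀ c < n, ∀ x < n, L.kind c ≠ 0 → L.kind x = 0 →
    L.act c x = if s.idx 1 (s.idx 14 0 c) (s.idx 14 0 x) < 1 then 2 else
      if s.idx 1 (s.idx 14 0 c) (s.idx 14 0 x) < 2 then s.idx 18 0 c else 1 - s.idx 18 0 c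

/-- The index arrays that hold the layout. -/
def arrays : List ℕ := [1, 13, 14, 16, 17, 18, 20, 21, 22, 23, 24, 25]

variable {L}

theorem Holds.congr {n : ℕ} {s s' : Store} (h : L.Holds n s)
    (hs : ∀ a ∈ arrays, s'.idx a = s.idx a) : L.Holds n s' := by
  have h1 := hs 1 (by simp [arrays])
  have h13 := hs 13 (by simp [arrays])
  have h14 := hs 14 (by simp [arrays])
  have h16 := hs 16 (by simp [arrays])
  have h17 := hs 17 (by simp [arrays])
  have h18 := hs 18 (by simp [arrays])
  have h20 := hs 20 (by simp [arrays])
  have h21 := hs 21 (by simp [arrays])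
  have h22 := hs 22 (by simp [arrays])
  have h23 := hs 23 (by simp [arrays])
  have h24 := hs 24 (by simp [arrays])
  have h25 := hs 25 (by simp [arrays])
  constructor
  · rw [h13]; exact h.kind
  · rw [h16]; exact h.low
  · rw [h17]; exact h.dim
  · rw [h20]; exact h.rd
  · rw [h21]; exact h.wt
  · rw [h23]; exact h.len
  · rw [h22]; exact h.bag
  · rw [h24]; exact h.sz
  · rw [h25]; exact h.mark
  · rw [h1, h14, h18]; exact h.act

theorem Holds.frame {n : ℕ} {s s' : Store} {P : Program} (h : L.Holds n s) (hF : Frame P s s')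
    (hP : arrays.all (fun a => !P.writesI a) = true) : L.Holds n s' :=
  h.congr fun a ha => hF.idx a (by simpa using (List.all_eq_true.1 hP) a ha)

end Layout

/-! ## Transforming a line of a table -/

open Program IExp in
/-- Reading a line of a table into the array 5. -/
def lineIn : Program :=
  set 66 (V 62) ;;
  loop 65 (V 50) (
    .ifLt (V 65) (V 67) (.setNum 5 0 (V 65) (.get 2 (V 61) (V 66)))
      (.setNum 5 0 (V 65) (.cast 0)) ;;
    set 66 (V 66 + V 63))

theorem lineIn_spec {s : Store} {Q : Store → ℕ → Prop} (N : ℕ) (hN : s.idx 50 0 0 = N)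
    (hQ : ∀ s' t, Frame lineIn s s' → t ≤ 100 * (N + 1) →
      (∀ d < N, s'.num 5 0 d = if d < s.idx 67 0 0 then
        s.num 2 (s.idx 61 0 0) (s.idx 62 0 0 + d * s.idx 63 0 0) else 0) → Q s' t) :
    WP lineIn s Q := by
  suffices H : WP lineIn s (fun s' t => t ≤ 100 * (N + 1) ∧
      (∀ d < N, s'.num 5 0 d = if d < s.idx 67 0 0 then
        s.num 2 (s.idx 61 0 0) (s.idx 62 0 0 + d * s.idx 63 0 0) else 0)) from
    H.mono fun s' t h hF => hQ s' t hF h.1 h.2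
  simp only [lineIn, WP_seq, WP_set]
  refine WP_loop N 60 (fun i s' => s'.idx 66 0 0 = s.idx 62 0 0 + i * s.idx 63 0 0 ∧
    ∀ d < i, s'.num 5 0 d = if d < s.idx 67 0 0 then
        s.num 2 (s.idx 61 0 0) (s.idx 62 0 0 + d * s.idx 63 0 0) else 0) rfl ?_ ?_ ?_ ?_
  · intro s' hF
    have := hF.idx 50 rfl
    simp at this
    simp [this, hN]
  · simp
  · rintro i s1 hi ⟨h66, h5⟩ h65 hF
    have e61 := hF.idx 61 rfl
    have e63 := hF.idx 63 rfl
    have e67 := hF.idx 67 rfl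
    have e2 := hF.num 2 rfl
    simp at e61 e63 e67 e2
    simp [h65, h66, e61, e63, e67, e2]
    split_ifs with hc
    · refine ⟨by ring, fun d hd => ?_⟩
      rcases Nat.lt_or_eq_of_le hd with h | rfl
      · rw [upd_ne _ _ (by omega), h5 d h]
      · rw [upd_same, if_pos hc]
    · refine ⟨by ring, fun d hd => ?_⟩
      rcases Nat.lt_or_eq_of_le hd with h | rfl
      · rw [upd_ne _ _ (by omega), h5 d h]
      · rw [upd_same, if_neg hc]
  · rintro s1 t ⟨-, h5⟩ h65 hF ht
    simp at ht ⊢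
    exact ⟨by omega, h5⟩

open Program IExp in
/-- The reduction of the transformed line, from the array 6 to the array 7. -/
def lineMid : Program :=
  loop 65 (V 50) (.setNum 7 0 (V 65) (.cast 0)) ;;
  .ifLt (V 60) 1 (loop 65 (V 50) (.setNum 7 0 (V 65) (.get 6 0 (V 65))))
    (loop 65 (V 50) (.setNum 7 0 (.get 20 (V 64) (V 65))
      (.get 7 0 (.get 20 (V 64) (V 65)) + .get 6 0 (V 65) / .cast (V 50))))

/-- In the backward direction several counts can have the same representative. Therefore the line is
cleared first, and every entry, divided by the length, is added at the place of its representative.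
-/
theorem lineMid_spec {s : Store} {Q : Store → ℕ → Prop} (N : ℕ) (rd : ℕ → ℕ)
    (hN : s.idx 50 0 0 = N) (hrd : ∀ d < N, s.idx 20 (s.idx 64 0 0) d = rd d)
    (hQ : ∀ s' t, Frame lineMid s s' → t ≤ 200 * (N + 1) →
      (∀ d < N, s'.num 7 0 d = if s.idx 60 0 0 = 0 then s.num 6 0 d else
        ∑ n ∈ range N, if rd n = d then s.num 6 0 n / (N : ℂ) else 0) → Q s' t) :
    WP lineMid s Q := by
  suffices H : WP lineMid s (fun s' t => t ≤ 200 * (N + 1) ∧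
      (∀ d < N, s'.num 7 0 d = if s.idx 60 0 0 = 0 then s.num 6 0 d else
        ∑ n ∈ range N, if rd n = d then s.num 6 0 n / (N : ℂ) else 0)) from
    H.mono fun s' t h hF => hQ s' t hF h.1 h.2
  rw [lineMid, WP_seq]
  refine WP_loop_setNum N 0 (fun _ => 0) (by simp) (by simp) (by simp [hN]) ?_
  intro t ht
  rw [WP_ifLt]
  simp at ht
  by_cases h0' : s.idx 60 0 0 = 0
  · rw [if_pos (by simp [h0'])]
    refine WP_loop_setNum N 0 (fun x => s.num 6 0 x) (by simp) (by simp) (by simp [hN]) ?_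
    intro t' ht'
    simp at ht'
    refine ⟨by simp; omega, fun d hd => ?_⟩
    simp [fillRow_lt _ _ _ hd, h0']
  · rw [if_neg (by simp [h0'])]
    refine WP_loop N 60 (fun i s' => ∀ d < N, s'.num 7 0 d =
      ∑ n ∈ range i, if rd n = d then s.num 6 0 n / (N : ℂ) else 0) rfl ?_ ?_ ?_ ?_
    · intro s' hF
      have := hF.idx 50 rfl
      simp at this
      simp [this, hN]
    · intro d hd; simp [fillRow_lt _ _ _ hd]
    · rintro i s1 hi h7 h65 hF
      have e20 := hF.idx 20 rfl
      have e64 := hF.idx 64 rfl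
      have e6 := hF.num 6 rfl
      have e50 := hF.idx 50 rfl
      simp at e20 e64 e6 e50
      simp [h65, e20, e64, e6, hrd i hi, e50, hN]
      intro d hd
      rw [sum_range_succ]
      by_cases h : rd i = d
      · subst h
        rw [upd_same, h7 _ hd, if_pos rfl]
      · rw [upd_ne _ _ (by omega), h7 _ hd, if_neg h, add_zero]
    · rintro s1 t' h7 h65 hF ht'
      simp at ht'
      refine ⟨by simp; omega, fun d hd => ?_⟩
      rw [if_neg h0', h7 d hd]

open Program IExp in
/-- Writing the array 7 to a line of a table. -/
def lineOut : Program :=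
  set 66 (V 62) ;;
  loop 65 (V 50) (.setNum 2 (V 61 + 1) (V 66) (.get 7 0 (V 65)) ;; set 66 (V 66 + V 63))

theorem lineOut_spec {s : Store} {Q : Store → ℕ → Prop} (N j base st : ℕ) (hN : s.idx 50 0 0 = N)
    (hj : s.idx 61 0 0 = j) (hb : s.idx 62 0 0 = base) (hst : s.idx 63 0 0 = st) (hst0 : 0 < st)
    (hQ : ∀ s' t, Frame lineOut s s' → t ≤ 100 * (N + 1) →
      (∀ i, i ≠ j + 1 → s'.num 2 i = s.num 2 i) →
      (∀ x, (∀ d < N, x ≠ base + d * st) → s'.num 2 (j + 1) x = s.num 2 (j + 1) x) →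
      (∀ d < N, s'.num 2 (j + 1) (base + d * st) = s.num 7 0 d) → Q s' t) :
    WP lineOut s Q := by
  suffices H : WP lineOut s (fun s' t => t ≤ 100 * (N + 1) ∧
      (∀ i, i ≠ j + 1 → s'.num 2 i = s.num 2 i) ∧
      (∀ x, (∀ d < N, x ≠ base + d * st) → s'.num 2 (j + 1) x = s.num 2 (j + 1) x) ∧
      (∀ d < N, s'.num 2 (j + 1) (base + d * st) = s.num 7 0 d)) from
    H.mono fun s' t h hF => hQ s' t hF h.1 h.2.1 h.2.2.1 h.2.2.2
  simp only [lineOut, WP_seq, WP_set]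
  refine WP_loop N 60 (fun i s' => s'.idx 66 0 0 = base + i * st ∧
      (∀ i, i ≠ j + 1 → s'.num 2 i = s.num 2 i) ∧
      (∀ x, (∀ d < i, x ≠ base + d * st) → s'.num 2 (j + 1) x = s.num 2 (j + 1) x) ∧
      (∀ d < i, s'.num 2 (j + 1) (base + d * st) = s.num 7 0 d)) rfl ?_ ?_ ?_ ?_
  · intro s' hF
    have := hF.idx 50 rfl
    simp at this
    simp [this, hN]
  · simp [hb]
  · rintro i s1 hi ⟨h66, hr, hu, hd⟩ h65 hF
    have e61 := hF.idx 61 rfl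
    have e63 := hF.idx 63 rfl
    have e7 := hF.num 7 rfl
    simp at e61 e63 e7
    simp [h65, h66, e61, e63, e7, hj, hst]
    refine ⟨by ring, fun k hk => ?_, fun x hx => ?_, fun d hdi => ?_⟩
    · rw [upd_row_ne _ _ _ hk, hr k hk]
    · rw [upd_ne _ _ (Or.inr (hx i le_rfl)), hu x fun d hdi => hx d hdi.le]
    · rcases Nat.lt_or_eq_of_le hdi with h | rfl
      · rw [upd_ne _ _ (Or.inr _), hd d h]
        have : d * st < i * st := Nat.mul_lt_mul_of_pos_right h hst0
        omega
      · rw [upd_same]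
  · rintro s1 t ⟨-, hr, hu, hd⟩ h65 hF ht
    simp at ht ⊢
    exact ⟨by omega, hr, hu, hd⟩

open Program IExp in
/-- The transform of a line of a table, from the row `j` (register 61) of the array 2 to the next
row. The line starts at the place in the register 62 and has the stride in the register 63. The
coordinate is in the register 64, the direction of the transform in the register 60. -/
def line : Program :=
  .ifLt 0 (.get 13 0 (V 64)) (
    set 50 (.get 17 0 (V 64)) ;;
    .ifLt (V 60) 1 (set 67 (.get 16 0 (V 64)) ;; setn 12 (.root (V 50)))
      (set 67 (V 50) ;; setn 12 (.cast 1 / .root (V 50))) ;;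
    lineIn ;; bluestein ;; lineMid ;; lineOut)
  (.setNum 2 (V 61 + 1) (V 62) (.get 2 (V 61) (V 62)) ;;
    .setNum 2 (V 61 + 1) (V 62 + V 63) (.get 2 (V 61) (V 62 + V 63)))

/-- The matrices of the transform with the given direction. -/
noncomputable def Layout.dir (L : Layout) (mode : ℕ) : ℕ → ℕ → ℕ → ℂ :=
  if mode = 0 then L.fwd else L.bwd

/-- Both directions run the same code on a constraint coordinate. Forwards, the significant entries
are padded by zeros and transformed with the root of unity. Backwards, the full line is transformed
with the inverse root, divided by the length and reduced. -/
theorem line_spec {L : Layout} {n : ℕ} {s : Store} {Q : Store → ℕ → Prop} (hL : L.Holds n s)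
    (b j base st lam : ℕ) (hb : s.idx 64 0 0 = b) (hbn : b < n) (hg : L.Good b)
    (hj : s.idx 61 0 0 = j) (hbase : s.idx 62 0 0 = base) (hst : s.idx 63 0 0 = st) (hst0 : 0 < st)
    (hlam : Nat.log 2 (L.dim b) + 3 ≤ lam)
    (hQ : ∀ s' t, Frame line s s' → t ≤ 21000 * (L.dim b * lam) →
      (∀ i, i ≠ j + 1 → s'.num 2 i = s.num 2 i) →
      (∀ x, (∀ d < L.dim b, x ≠ base + d * st) → s'.num 2 (j + 1) x = s.num 2 (j + 1) x) →
      (∀ d < L.dim b, s'.num 2 (j + 1) (base + d * st) =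
        ∑ e ∈ range (L.dim b), L.dir (s.idx 60 0 0) b d e * s.num 2 j (base + e * st)) → Q s' t) :
    WP line s Q := by
  suffices H : WP line s (fun s' t => t ≤ 21000 * (L.dim b * lam) ∧
      (∀ i, i ≠ j + 1 → s'.num 2 i = s.num 2 i) ∧
      (∀ x, (∀ d < L.dim b, x ≠ base + d * st) → s'.num 2 (j + 1) x = s.num 2 (j + 1) x) ∧
      (∀ d < L.dim b, s'.num 2 (j + 1) (base + d * st) =
        ∑ e ∈ range (L.dim b), L.dir (s.idx 60 0 0) b d e * s.num 2 j (base + e * st))) from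
    H.mono fun s' t h hF => hQ s' t hF h.1 h.2.1 h.2.2.1 h.2.2.2
  have hk := hL.kind b hbn
  have hdim := hL.dim b hbn
  have hlow := hL.low b hbn
  rw [line, WP_ifLt]
  -- For a variable both matrices are the identity of size two: its coordinate multiplies pointwise
  -- already, and the two entries are merely copied to the next row.
  by_cases h0 : L.kind b = 0
  · have hd2 := (hg.var h0).2
    rw [if_neg (by simp [hb, hk, h0])]
    simp [hj, hbase, hst, hd2]
    refine ⟨by omega, fun i hi => ?_, fun x hx => ?_, fun d hd => ?_⟩
    · rw [upd_row_ne _ _ _ hi, upd_row_ne _ _ _ hi]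
    · have h1 := hx 0 (by omega)
      have h2 := hx 1 (by omega)
      rw [upd_ne _ _ (by omega), upd_ne _ _ (by omega)]
    · rw [upd_ne _ _ (by omega : j ≠ j + 1 ∨ _), sum_range_succ, sum_range_one]
      interval_cases d
      · rw [upd_ne _ _ (by omega)]
        by_cases hm : s.idx 60 0 0 = 0 <;> simp [Layout.dir, Layout.fwd, Layout.bwd, h0, hm]
      · by_cases hm : s.idx 60 0 0 = 0 <;> simp [Layout.dir, Layout.fwd, Layout.bwd, h0, hm]
  · obtain ⟨h1, hlow0, hdl, hrd, hrd'⟩ := hg.con h0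
    have hN0 : 0 < L.dim b := by omega
    rw [if_pos (by simp [hb, hk, h1])]
    simp only [WP_seq, WP_set, WP_ifLt, WP_setn]
    -- The common part of both directions, with the root `ζ` and the number `lim` of entries to be
    -- read as parameters.
    have key : ∀ (s1 : Store) (t0 : ℕ) (ζ : ℂ) (lim : ℕ), t0 ≤ 50 → ζ ≠ 0 →
        (∀ a, a ≠ 50 → a ≠ 67 → s1.idx a = s.idx a) → s1.num 2 = s.num 2 →
        s1.idx 50 0 0 = L.dim b → s1.idx 67 0 0 = lim → s1.num 12 0 0 = ζ →
        (∀ d e, e < L.dim b → L.dir (s.idx 60 0 0) b d e = if e < lim then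
          (if s.idx 60 0 0 = 0 then ζ ^ (e * d) else ∑ n ∈ range (L.dim b),
            if L.rd b n = d then ζ ^ (e * n) / (L.dim b : ℂ) else 0) else 0) →
        WP lineIn s1 (fun s' t => WP bluestein s' (fun s'' t' => WP lineMid s'' (fun s''' t'' =>
          WP lineOut s''' (fun s4 t3 => t0 + (t + (t' + (t'' + t3))) ≤ 21000 * (L.dim b * lam) ∧
      (∀ i, i ≠ j + 1 → s4.num 2 i = s.num 2 i) ∧
      (∀ x, (∀ d < L.dim b, x ≠ base + d * st) → s4.num 2 (j + 1) x = s.num 2 (j + 1) x) ∧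
      (∀ d < L.dim b, s4.num 2 (j + 1) (base + d * st) =
        ∑ e ∈ range (L.dim b), L.dir (s.idx 60 0 0) b d e * s.num 2 j (base + e * st)))))) := by
      intro s1 t0 ζ lim ht0 hζ0 hs1 hn2 e50 e67 e12 hW
      refine lineIn_spec (L.dim b) e50 fun s2 t2 F2 ht2 h2 => ?_
      refine bluestein_spec (L.dim b) ζ hN0 (by rw [F2.idx 50 rfl, e50])
        (by rw [F2.num 12 rfl, e12]) hζ0 fun s3 t3 F3 ht3 h3 => ?_
      have e64 : s3.idx 64 0 0 = b := by
        rw [F3.idx 64 rfl, F2.idx 64 rfl, hs1 64 (by norm_num) (by norm_num), hb]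
      refine lineMid_spec (L.dim b) (L.rd b) (by rw [F3.idx 50 rfl, F2.idx 50 rfl, e50]) ?_
        fun s4 t4 F4 ht4 h4 => ?_
      · intro d hd
        rw [e64, F3.idx 20 rfl, F2.idx 20 rfl, hs1 20 (by norm_num) (by norm_num),
          hL.rd b hbn h0 d hd]
      have u2 : s4.num 2 = s.num 2 := by rw [F4.num 2 rfl, F3.num 2 rfl, F2.num 2 rfl, hn2]
      refine lineOut_spec (L.dim b) j base st
        (by rw [F4.idx 50 rfl, F3.idx 50 rfl, F2.idx 50 rfl, e50])
        (by rw [F4.idx 61 rfl, F3.idx 61 rfl, F2.idx 61 rfl, hs1 61 (by norm_num) (by norm_num), hj])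
        (by rw [F4.idx 62 rfl, F3.idx 62 rfl, F2.idx 62 rfl, hs1 62 (by norm_num) (by norm_num),
          hbase])
        (by rw [F4.idx 63 rfl, F3.idx 63 rfl, F2.idx 63 rfl, hs1 63 (by norm_num) (by norm_num),
          hst]) hst0 fun s5 t5 F5 ht5 h5 h5' h5'' => ?_
      refine ⟨?_, fun i hi => by rw [h5 i hi, u2], fun x hx => by rw [h5' x hx, u2],
        fun d hd => ?_⟩
      · have h1 : L.dim b * 3 ≤ L.dim b * lam := Nat.mul_le_mul_left _ (by omega)
        have h2 : 20000 * L.dim b * (Nat.log 2 (L.dim b) + 3) ≤ 20000 * (L.dim b * lam) := by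
          rw [mul_assoc]
          exact Nat.mul_le_mul_left _ (Nat.mul_le_mul_left _ hlam)
        omega
      · rw [h5'' d hd, h4 d hd]
        have e60 : s3.idx 60 0 0 = s.idx 60 0 0 := by
          rw [F3.idx 60 rfl, F2.idx 60 rfl, hs1 60 (by norm_num) (by norm_num)]
        have hx : ∀ e < L.dim b, s2.num 5 0 e = if e < lim then s.num 2 j (base + e * st) else 0 := by
          intro e he
          rw [h2 e he, e67, hn2, hs1 61 (by norm_num) (by norm_num),
            hs1 62 (by norm_num) (by norm_num), hs1 63 (by norm_num) (by norm_num), hj, hbase, hst]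
        rw [e60, h3 d hd]
        split_ifs with hm
        · refine sum_congr rfl fun e he => ?_
          rw [mem_range] at he
          rw [hx e he, hW d e he, if_pos hm]
          split_ifs <;> ring
        · have : ∀ e ∈ range (L.dim b), L.dir (s.idx 60 0 0) b d e * s.num 2 j (base + e * st) =
              ∑ n ∈ range (L.dim b), if L.rd b n = d then
                s2.num 5 0 e * ζ ^ (e * n) / (L.dim b : ℂ) else 0 := by
            intro e he
            rw [mem_range] at he
            rw [hx e he, hW d e he, if_neg hm]
            split_ifs with hl
            · rw [sum_mul]
              refine sum_congr rfl fun n _ => ?_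
              split_ifs <;> ring
            · simp
          rw [sum_congr rfl this, sum_comm]
          refine sum_congr rfl fun n hn => ?_
          rw [mem_range] at hn
          split_ifs
          · rw [h3 n hn, sum_div]
          · simp
    have hz := zetaRoot_ne_zero (L.dim b)
    split_ifs with hm
    · have hm' : s.idx 60 0 0 = 0 := by simpa using hm
      refine (key _ 40 (zetaRoot (L.dim b)) (L.low b) (by norm_num) hz ?_ ?_ ?_ ?_ ?_ ?_).mono ?_
      · intro a ha ha'; simp [ha, ha']
      · simp
      · simp [hb, hdim]
      · simp [hb, hlow]
      · simp [hb, hdim, zetaRoot]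
      · intro d e he
        simp [Layout.dir, Layout.fwd, hm', h0]
      · intro s2 t2 h _
        refine h.mono fun s3 t3 h _ => h.mono fun s4 t4 h _ => h.mono fun s5 t5 h _ => ?_
        refine ⟨?_, h.2⟩
        have := h.1
        simp; omega
    · have hm' : s.idx 60 0 0 ≠ 0 := by simpa using hm
      refine (key _ 40 (zetaRoot (L.dim b))⁻¹ (L.dim b) (by norm_num) (inv_ne_zero hz)
        ?_ ?_ ?_ ?_ ?_ ?_).mono ?_
      · intro a ha ha'; simp [ha, ha']
      · simp
      · simp [hb, hdim]
      · simp [hb, hdim]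
      · simp [hb, hdim, zetaRoot]
      · intro d e he
        simp [Layout.dir, Layout.bwd, hm', h0, he]
      · intro s2 t2 h _
        refine h.mono fun s3 t3 h _ => h.mono fun s4 t4 h _ => h.mono fun s5 t5 h _ => ?_
        refine ⟨?_, h.2⟩
        have := h.1
        simp; omega

/-! ## Transforming a table -/

open Program IExp in
/-- The transform of the coordinate in the register 64. -/
def axis : Program :=
  set 75 0 ;;
  .whileLt (V 75) (.get 24 (V 70) 0) (
    loop 76 (V 63) (set 62 (V 75 + V 76) ;; line) ;; set 75 (V 75 + V 73))

theorem add_mul_inj {x x' d d' st : ℕ} (hx : x < st) (hx' : x' < st)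
    (h : x + d * st = x' + d' * st) : x = x' ∧ d = d' := by
  have h1 : x = x' := by
    have := congrArg (· % st) h
    simpa [Nat.add_mul_mod_self_right, Nat.mod_eq_of_lt hx, Nat.mod_eq_of_lt hx'] using this
  subst h1
  exact ⟨rfl, Nat.eq_of_mul_eq_mul_right (by omega : 0 < st) (by omega)⟩

/-- With row-major storage, the lines in this coordinate have the stride `st`, and `st` interleaved
lines fill a block of length `L.dim b * st`. The number `O` of blocks is not in the memory and
indices cannot be divided; so the outer loop advances the start of the block until it reaches the
size of the table. -/
theorem axis_spec {L : Layout} {n : ℕ} {s : Store} {Q : Store → ℕ → Prop} (hL : L.Holds n s)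
    (b j st O lam : ℕ) (hb : s.idx 64 0 0 = b) (hbn : b < n) (hg : L.Good b)
    (hj : s.idx 61 0 0 = j) (hst : s.idx 63 0 0 = st) (hst0 : 0 < st)
    (hbl : s.idx 73 0 0 = L.dim b * st)
    (htot : s.idx 24 (s.idx 70 0 0) 0 = O * (L.dim b * st))
    (hlam : Nat.log 2 (L.dim b) + 3 ≤ lam)
    (hQ : ∀ s' t, Frame axis s s' → t ≤ 22000 * (O * (L.dim b * st) * lam) + 50 →
      (∀ i, i ≠ j + 1 → s'.num 2 i = s.num 2 i) →
      (∀ o < O, ∀ d < L.dim b, ∀ x < st, s'.num 2 (j + 1) (o * (L.dim b * st) + (x + d * st)) =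
        ∑ e ∈ range (L.dim b), L.dir (s.idx 60 0 0) b d e *
          s.num 2 j (o * (L.dim b * st) + (x + e * st))) → Q s' t) :
    WP axis s Q := by
  suffices H : WP axis s (fun s' t => t ≤ 22000 * (O * (L.dim b * st) * lam) + 50 ∧
      (∀ i, i ≠ j + 1 → s'.num 2 i = s.num 2 i) ∧
      (∀ o < O, ∀ d < L.dim b, ∀ x < st, s'.num 2 (j + 1) (o * (L.dim b * st) + (x + d * st)) =
        ∑ e ∈ range (L.dim b), L.dir (s.idx 60 0 0) b d e *
          s.num 2 j (o * (L.dim b * st) + (x + e * st)))) from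
    H.mono fun s' t h hF => hQ s' t hF h.1 h.2.1 h.2.2
  have hN0 := hg.dim_pos
  set N := L.dim b with hN
  have hNst : 0 < N * st := Nat.mul_pos hN0 hst0
  have hin : ∀ {d x}, d < N → x < st → x + d * st < N * st := by
    intro d x hd hx
    have := block_lt hd hx
    omega
  simp only [axis, WP_seq, WP_set]
  refine WP_while O (fun _ => st * (21000 * (N * lam) + 30) + 30) (fun o s' =>
    s'.idx 75 0 0 = o * (N * st) ∧ (∀ i, i ≠ j + 1 → s'.num 2 i = s.num 2 i) ∧
      (∀ o' < o, ∀ d < N, ∀ x < st, s'.num 2 (j + 1) (o' * (N * st) + (x + d * st)) =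
        ∑ e ∈ range N, L.dir (s.idx 60 0 0) b d e *
          s.num 2 j (o' * (N * st) + (x + e * st)))) ?_ ?_ ?_ ?_
  · simp
  · rintro o s1 ho ⟨h75, hr, hd⟩ hF
    have e24 := hF.idx 24 rfl
    have e70 := hF.idx 70 rfl
    have e63 := hF.idx 63 rfl
    have e64 := hF.idx 64 rfl
    have e61 := hF.idx 61 rfl
    have e60 := hF.idx 60 rfl
    have e73 := hF.idx 73 rfl
    simp at e24 e70 e63 e64 e61 e60 e73
    constructor
    · simp [h75, e24, e70, htot]
      exact Nat.mul_lt_mul_of_pos_right ho hNst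
    have hL1 : L.Holds n s1 :=
      (hL.congr (fun a ha => by
        simp only [Layout.arrays, List.mem_cons, List.not_mem_nil, or_false] at ha
        rcases ha with h | h | h | h | h | h | h | h | h | h | h | h <;> subst h <;> simp :
          ∀ a ∈ Layout.arrays, (s.setI 75 0 0 0).idx a = s.idx a)).frame hF rfl
    rw [WP_seq]
    refine WP_loop st (21000 * (N * lam) + 10) (fun i s' =>
      (∀ i, i ≠ j + 1 → s'.num 2 i = s.num 2 i) ∧
      (∀ y < o * (N * st), s'.num 2 (j + 1) y = s1.num 2 (j + 1) y) ∧
      (∀ d < N, ∀ x < i, s'.num 2 (j + 1) (o * (N * st) + (x + d * st)) =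
        ∑ e ∈ range N, L.dir (s.idx 60 0 0) b d e *
          s.num 2 j (o * (N * st) + (x + e * st)))) rfl ?_ ?_ ?_ ?_
    · intro s' hF'
      simp [hF'.idx 63 rfl, e63, hst]
    · simp; exact hr
    · rintro i s2 hi ⟨gr, gu, gd⟩ h76 hF'
      have hL2 : L.Holds n (s2.setI 62 0 0 (o * (N * st) + i)) :=
        (hL1.frame hF' rfl).congr (fun a ha => by
          simp only [Layout.arrays, List.mem_cons, List.not_mem_nil, or_false] at ha
          rcases ha with h | h | h | h | h | h | h | h | h | h | h | h <;> subst h <;> simp)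
      simp only [WP_seq, WP_set, IExp.eval_add, IExp.eval_get, IExp.eval_zero, hF'.idx 75 rfl, h75,
        h76]
      refine line_spec hL2 b j (o * (N * st) + i) st lam (by simp [hF'.idx 64 rfl, e64, hb]) hbn hg
        (by simp [hF'.idx 61 rfl, e61, hj]) (by simp) (by simp [hF'.idx 63 rfl, e63, hst]) hst0
        hlam ?_
      intro s3 t3 F3 ht3 h3 h3' h3''
      simp only [Store.setI_num] at h3 h3' h3'' ⊢
      have e60' : s2.idx 60 0 0 = s.idx 60 0 0 := by rw [hF'.idx 60 rfl, e60]
      rw [← hN] at h3' h3'' ht3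
      refine ⟨⟨fun k hk => by rw [h3 k hk, gr k hk], fun y hy => ?_, fun d hdN x hx => ?_⟩, ?_⟩
      · rw [h3' y (fun d _ => by omega), gu y hy]
      · rcases Nat.lt_succ_iff_lt_or_eq.1 hx with h | rfl
        · rw [h3' _ (fun d' hd' => ?_), gd d hdN x h]
          intro heq
          have := add_mul_inj (by omega) hi (show x + d * st = i + d' * st by omega)
          omega
        · rw [← add_assoc, h3'' d hdN]
          simp only [Store.setI_idx_ne _ _ _ _ (by norm_num : (60 : ℕ) ≠ 62), e60']
          refine sum_congr rfl fun e _ => ?_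
          rw [gr j (by omega), add_assoc]
      · simp
        omega
    · rintro s2 t ⟨gr, gu, gd⟩ h76 hF' ht
      simp [hF'.idx 75 rfl, hF'.idx 73 rfl, h75, e73, hbl] at ht ⊢
      refine ⟨⟨by ring, gr, fun o' ho' d hdN x hx => ?_⟩, ?_⟩
      · rcases Nat.lt_or_eq_of_le ho' with h | rfl
        · rw [gu _ (block_lt h (hin hdN hx)), hd o' h d hdN x hx]
        · exact gd d hdN x hx
      · have : st * (21000 * (N * lam) + 10 + 15) + 5 * st = st * (21000 * (N * lam) + 30) := by
          ring
        omega
  · rintro s1 ⟨h75, -, -⟩ hF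
    have e24 := hF.idx 24 rfl
    have e70 := hF.idx 70 rfl
    simp at e24 e70
    simp [h75, e24, e70, htot]
  · rintro s1 t ⟨-, hr, hd⟩ hF ht
    refine ⟨?_, hr, hd⟩
    simp at ht ⊢
    have h1 : O * st ≤ O * (N * st) * lam := by
      calc O * st = O * (1 * st) * 1 := by ring
        _ ≤ O * (N * st) * lam := by gcongr <;> omega
    have h2 : O * 1 ≤ O * st := Nat.mul_le_mul_left _ hst0
    have h3 : O * (st * (21000 * (N * lam) + 30) + 30 + 9) =
      21000 * (O * (N * st) * lam) + 30 * (O * st) + 39 * O := by ring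
    omega

open Program IExp in
/-- The transform of all coordinates of a table of the vertex in the register 70, from the row `0`
of the array 2 to the row whose number is the number of coordinates. -/
def axes : Program :=
  loop 71 (.get 23 0 (V 70)) (
    set 61 (V 71) ;; set 72 (.get 23 0 (V 70) - 1 - V 71) ;;
    set 64 (.get 22 (V 70) (V 72)) ;; set 63 (.get 24 (V 70) (V 72 + 1)) ;;
    set 73 (.get 24 (V 70) (V 72)) ;; axis)

theorem Layout.size_append (L : Layout) (A B : List ℕ) :
    L.size (A ++ B) = L.size A * L.size B := by
  simp [Layout.size]

/-- Coordinates are treated from the last to the first, each into a new row. After `jj` rounds the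
transform has been applied to the last `jj` coordinates, separately for each choice `o` of the
others; this matches the recursion of `Layout.trans`. -/
theorem axes_spec {L : Layout} {n : ℕ} {s : Store} {Q : Store → ℕ → Prop} (hL : L.Holds n s)
    (p lam : ℕ) (hp : s.idx 70 0 0 = p) (hpn : p < n)
    (hB : ∀ b ∈ L.bag p, b < n ∧ L.Good b ∧ Nat.log 2 (L.dim b) + 3 ≤ lam) (hlam : 0 < lam)
    (hQ : ∀ s' t, Frame axes s s' →
      t ≤ 23000 * (((L.bag p).length + 1) * (L.size (L.bag p) * lam)) →
      (∀ x < L.size (L.bag p), s'.num 2 (L.bag p).length x =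
        L.trans (L.dir (s.idx 60 0 0)) (L.bag p) (s.num 2 0) x) → Q s' t) :
    WP axes s Q := by
  suffices H : WP axes s (fun s' t =>
      t ≤ 23000 * (((L.bag p).length + 1) * (L.size (L.bag p) * lam)) ∧
      (∀ x < L.size (L.bag p), s'.num 2 (L.bag p).length x =
        L.trans (L.dir (s.idx 60 0 0)) (L.bag p) (s.num 2 0) x)) from
    H.mono fun s' t h hF => hQ s' t hF h.1 h.2
  set B := L.bag p with hBdef
  set W := L.dir (s.idx 60 0 0) with hW
  have hpos : ∀ k, 0 < L.size (B.drop k) := fun k =>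
    L.size_pos fun b hb => (hB b (List.mem_of_mem_drop hb)).2.1
  have hlen := hL.len p hpn
  refine WP_loop B.length (22000 * (L.size B * lam) + 150) (fun jj s' =>
    s'.num 2 0 = s.num 2 0 ∧
    ∀ o < L.size (B.take (B.length - jj)), ∀ x < L.size (B.drop (B.length - jj)),
      s'.num 2 jj (o * L.size (B.drop (B.length - jj)) + x) =
        L.trans W (B.drop (B.length - jj))
          (fun y => s.num 2 0 (o * L.size (B.drop (B.length - jj)) + y)) x) rfl ?_ ?_ ?_ ?_
  · intro s' hF
    simp [hF.idx 23 rfl, hF.idx 70 rfl, hp, hlen, ← hBdef]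
  · simp [Layout.trans]
  · rintro jj s1 hjj ⟨hr0, hI⟩ h71 hF
    have e23 := hF.idx 23 rfl
    have e70 := hF.idx 70 rfl
    have e22 := hF.idx 22 rfl
    have e24 := hF.idx 24 rfl
    have e60 := hF.idx 60 rfl
    obtain ⟨k, hk⟩ : ∃ k, k = B.length - (jj + 1) := ⟨_, rfl⟩
    have hk1 : B.length - jj = k + 1 := by omega
    have hkl : k < B.length := by omega
    rw [hk1] at hI
    rw [← hk]
    have hdrop : B.drop k = B[k] :: B.drop (k + 1) := List.drop_eq_getElem_cons hkl
    have htake : B.take (k + 1) = B.take k ++ [B[k]] := (List.take_concat_get' B k hkl).symm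
    obtain ⟨hbn, hbg, hbl⟩ := hB B[k] (List.getElem_mem hkl)
    have ev1 : B.length - 1 - jj = k := by omega
    simp only [WP_seq, WP_set]
    simp [h71, e23, e70, e22, e24, hp, hlen, ← hBdef, ev1, hL.bag p hpn k hkl,
      hL.sz p hpn (k + 1) hkl, hL.sz p hpn k hkl.le]
    set st := L.size (B.drop (k + 1)) with hst
    have hszk : L.size (B.drop k) = L.dim B[k] * st := by rw [hdrop, L.size_cons]
    have htot : L.size B = L.size (B.take k) * (L.dim B[k] * st) := by
      rw [← hszk, ← L.size_append, List.take_append_drop]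
    refine axis_spec (L := L) (n := n) ?_ B[k] jj st (L.size (B.take k)) lam (by simp) hbn hbg
      (by simp) (by simp) (hpos (k + 1)) (by simp [hszk]) ?_ hbl ?_
    · refine (hL.frame hF rfl).congr fun a ha => ?_
      simp only [Layout.arrays, List.mem_cons, List.not_mem_nil, or_false] at ha
      rcases ha with h | h | h | h | h | h | h | h | h | h | h | h <;> subst h <;> simp
    · have := hL.sz p hpn 0 (Nat.zero_le _)
      rw [List.drop_zero, ← hBdef] at this
      simp [e24, e70, hp, this, htot]
    · intro s2 t F2 ht h2 h2'
      simp [e60] at h2 h2' ⊢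
      rw [← htot] at ht
      refine ⟨⟨by rw [h2 0 (by omega), hr0], fun o ho x hx => ?_⟩, by omega⟩
      rw [hszk] at hx ⊢
      -- The place within the block is split into the value `d` of the new coordinate and the place
      -- `y` in the coordinates after it.
      obtain ⟨d, y, hd, hy, rfl⟩ : ∃ d y, d < L.dim B[k] ∧ y < st ∧ x = d * st + y :=
        ⟨x / st, x % st, Nat.div_lt_of_lt_mul (by rwa [mul_comm]), Nat.mod_lt _ (hpos _),
          by rw [mul_comm]; exact (Nat.div_add_mod x st).symm⟩
      rw [hdrop, L.trans_cons _ _ _ _ _ hy, add_comm (d * st), h2' o ho d hd y hy]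
      refine sum_congr rfl fun e he => ?_
      rw [mem_range] at he
      have hoe : o * L.dim B[k] + e < L.size (B.take (k + 1)) := by
        rw [htake, L.size_append, L.size_cons, L.size_nil, mul_one]
        exact block_lt ho he
      have := hI _ hoe y hy
      rw [show o * (L.dim B[k] * st) + (y + e * st) = (o * L.dim B[k] + e) * st + y by ring, this]
      congr 2
      funext z
      congr 1
      ring
  · rintro s1 t ⟨-, hI⟩ h71 hF ht
    simp at ht hI
    refine ⟨?_, hI⟩
    have h1 : 1 ≤ L.size B * lam := Nat.mul_pos (by simpa using hpos 0) hlam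
    nlinarith

/-! ## The algebra of the elimination -/

/-- Counters modulo state equivalence: `cls c d` is the state of the constraint `c` after the count
`d`, and `val c` is the weight of its states. -/
structure Counter where
  cls : ℕ → ℕ → ℕ
  cls_add : ∀ c d d' e, cls c d = cls c d' → cls c (d + e) = cls c (d' + e)
  val : ℕ → ℕ → ℂ

namespace Counter

variable (K : Counter)

/-- Families of counts, up to the states that they lead to. -/
def con : AddCon (ℕ → ℕ) where
  r p q := ∀ c, K.cls c (p c) = K.cls c (q c)
  iseqv := ⟨fun _ _ => rfl, fun h c => (h c).symm, fun h h' c => (h c).trans (h' c)⟩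
  add' := by
    intro w x y z h h' c
    simp only [Pi.add_apply]
    rw [K.cls_add c _ _ (y c) (h c), add_comm, K.cls_add c _ _ (x c) (h' c), add_comm]

/-- Formal sums of families of counts. -/
abbrev Ring := AddMonoidAlgebra ℂ K.con.Quotient

/-- The formal sum of one family of counts. -/
noncomputable def mon (p : ℕ → ℕ) : K.Ring := AddMonoidAlgebra.single (p : K.con.Quotient) 1

theorem mon_add (p q : ℕ → ℕ) : K.mon (p + q) = K.mon p * K.mon q := by
  simp [mon, AddMonoidAlgebra.single_mul_single]

theorem mon_zero : K.mon 0 = 1 := rfl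

theorem mon_congr {p q : ℕ → ℕ} (h : ∀ c, K.cls c (p c) = K.cls c (q c)) : K.mon p = K.mon q := by
  rw [mon, mon]
  congr 1
  exact (AddCon.eq K.con).2 h

/-- The weight of a family at the constraint `c`. -/
def weight (c : ℕ) : K.con.Quotient → ℂ :=
  Quotient.lift (fun p : ℕ → ℕ => K.val c (K.cls c (p c))) fun _ _ h => congrArg _ (h c)

/-- Forgetting the count of the constraint `c`. -/
def forget (c : ℕ) : K.con.Quotient → K.con.Quotient :=
  Quotient.lift (fun p : ℕ → ℕ => (Function.update p c 0 : K.con.Quotient)) fun p q h => by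
    refine (AddCon.eq K.con).2 fun b => ?_
    by_cases hb : b = c
    · subst hb; simp
    · simpa [hb] using h b

/-- The elimination of the constraint `c` from a formal sum. -/
noncomputable def elimCon (c : ℕ) : K.Ring →ₗ[ℂ] K.Ring :=
  (Finsupp.lsum ℂ fun m => LinearMap.toSpanSingleton ℂ K.Ring
    (AddMonoidAlgebra.single (K.forget c m) (K.weight c m))).comp
    ({ toFun := AddMonoidAlgebra.coeff, map_add' := fun _ _ => rfl, map_smul' := fun _ _ => rfl } :
      K.Ring →ₗ[ℂ] (K.con.Quotient →₀ ℂ))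

theorem elimCon_single (c : ℕ) (m : K.con.Quotient) (z : ℂ) :
    K.elimCon c (AddMonoidAlgebra.single m z) =
      AddMonoidAlgebra.single (K.forget c m) (z * K.weight c m) := by
  simp only [elimCon, LinearMap.comp_apply, Finsupp.lsum_apply]
  refine (Finsupp.sum_single_index ?_).trans ?_
  · simp
  · simp

theorem elimCon_mon (c : ℕ) (p : ℕ → ℕ) :
    K.elimCon c (K.mon p) = K.val c (K.cls c (p c)) • K.mon (Function.update p c 0) := by
  rw [mon, elimCon_single, mon, AddMonoidAlgebra.smul_single]
  congr 1
  simp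
  rfl

/-- The weight at `c` depends only on the count of `c`, to which `p` contributes nothing, and
forgetting that count leaves `p` intact. So the monomial acts as a scalar; by linearity it suffices
to check single terms. -/
theorem elimCon_mon_mul (c : ℕ) (p : ℕ → ℕ) (hp : p c = 0) (y : K.Ring) :
    K.elimCon c (K.mon p * y) = K.mon p * K.elimCon c y := by
  induction y using AddMonoidAlgebra.induction_linear with
  | zero => simp
  | add f g hf hg => rw [mul_add, map_add, hf, hg, map_add, mul_add]
  | single m z =>
    rw [elimCon_single, mon, AddMonoidAlgebra.single_mul_single, AddMonoidAlgebra.single_mul_single,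
      elimCon_single]
    induction m using AddCon.induction_on with
    | H q =>
      rw [← AddCon.coe_add]
      have h1 : K.forget c ((p + q : ℕ → ℕ) : K.con.Quotient) =
          (p : K.con.Quotient) + K.forget c (q : K.con.Quotient) := by
        show ((Function.update (p + q) c 0 : ℕ → ℕ) : K.con.Quotient) =
          ((p + Function.update q c 0 : ℕ → ℕ) : K.con.Quotient)
        congr 1
        funext b
        by_cases hb : b = c
        · subst hb; simp [hp]
        · simp [hb]
      have h2 : K.weight c ((p + q : ℕ → ℕ) : K.con.Quotient) = K.weight c (q : K.con.Quotient) := by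
        show K.val c (K.cls c ((p + q) c)) = K.val c (K.cls c (q c))
        simp [hp]
      rw [h1, h2, one_mul, one_mul]

end Counter

/-- A layout fits to a counter. -/
structure Layout.Fits (L : Layout) (K : Counter) (b : ℕ) : Prop where
  var : L.kind b = 0 → ∀ d < 2, L.wt b d = 1
  cls : L.kind b ≠ 0 → ∀ d, K.cls b (L.rd b d) = K.cls b d
  val : L.kind b ≠ 0 → ∀ d < L.low b, (L.wt b d : ℂ) = K.val b (K.cls b d)

/-! ### Coordinates, elimination maps and the elements represented by tables -/

namespace Layout

variable (L : Layout) (K : Counter)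

/-- Formal sums that depend on the values of the variables. -/
abbrev Alg := (ℕ → Bool) → K.Ring

theorem alg_smul_def (z : ℂ) (f : Alg K) : z • f = algebraMap ℂ (Alg K) z * f :=
  Algebra.smul_def z f

/-- The value `d` of the coordinate `b`. -/
noncomputable def gen (b d : ℕ) : Alg K := fun τ =>
  if L.kind b = 0 then (if (τ b).toNat = d then 1 else 0) else K.mon (Pi.single b d)

/-- The elimination of the vertex `r`. -/
noncomputable def eps (r : ℕ) : Alg K →ₗ[ℂ] Alg K where
  toFun f τ := if L.kind r = 0 then f (Function.update τ r false) + f (Function.update τ r true)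
    else K.elimCon r (f τ)
  map_add' f g := by
    funext τ
    simp only [Pi.add_apply]
    split_ifs
    · ring
    · simp
  map_smul' z f := by
    funext τ
    simp only [Pi.smul_apply, RingHom.id_apply]
    split_ifs
    · rw [smul_add]
    · simp

/-- The element is a scalar for the elimination of the vertex `r`. -/
def Free (r : ℕ) (f : Alg K) : Prop := ∀ g, L.eps K r (f * g) = f * L.eps K r g

variable {L K}

theorem Free.mul {r : ℕ} {f g : Alg K} (hf : L.Free K r f) (hg : L.Free K r g) :
    L.Free K r (f * g) := fun h => by rw [mul_assoc, hf, hg, mul_assoc]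

theorem Free.sum {ι : Type*} {r : ℕ} {s : Finset ι} {f : ι → Alg K}
    (hf : ∀ i ∈ s, L.Free K r (f i)) : L.Free K r (∑ i ∈ s, f i) := fun h => by
  rw [sum_mul, map_sum, sum_mul]
  exact sum_congr rfl fun i hi => hf i hi h

theorem Free.prod {ι : Type*} {r : ℕ} {s : Finset ι} {f : ι → Alg K}
    (hf : ∀ i ∈ s, L.Free K r (f i)) : L.Free K r (∏ i ∈ s, f i) := by
  classical
  induction s using Finset.induction_on with
  | empty => intro h; simp
  | insert i s hi ih =>
    rw [prod_insert hi]
    exact (hf i (by simp)).mul (ih fun j hj => hf j (by simp [hj]))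

theorem free_algebraMap (r : ℕ) (z : ℂ) : L.Free K r (algebraMap ℂ (Alg K) z) := fun h => by
  rw [← alg_smul_def, map_smul, alg_smul_def]

/-- Substituting a value for the variable `r` does not affect another coordinate, and a monomial
supported at another constraint has count 0 at `r`. This is what allows factors to be pulled out of
an elimination. -/
theorem free_gen {r b : ℕ} (hb : b ≠ r) (d : ℕ) : L.Free K r (L.gen K b d) := by
  intro g
  funext τ
  by_cases hr : L.kind r = 0
  · have : ∀ v, L.gen K b d (Function.update τ r v) = L.gen K b d τ := by
      intro v; simp [gen, hb]
    simp only [eps, LinearMap.coe_mk, AddHom.coe_mk, hr, if_true, Pi.mul_apply, this, mul_add]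
  · simp only [eps, LinearMap.coe_mk, AddHom.coe_mk, hr, if_false, Pi.mul_apply]
    by_cases hk : L.kind b = 0
    · simp only [gen, hk, if_true]
      split_ifs
      · rw [one_mul, one_mul]
      · rw [zero_mul, zero_mul, map_zero]
    · simp only [gen, hk, if_false]
      exact K.elimCon_mon_mul r _ (by simp [hb.symm]) _

/-- For a variable, exactly one of the two substituted values equals `d`. For a constraint, the
single count is replaced by its weight and the empty monomial is left. -/
theorem eps_gen {r d : ℕ} (hg : L.Good r) (hf : L.Fits K r) (hd : d < L.low r) :
    L.eps K r (L.gen K r d) = algebraMap ℂ (Alg K) (L.wt r d) := by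
  funext τ
  by_cases hr : L.kind r = 0
  · rw [(hg.var hr).1] at hd
    rw [hf.var hr d hd]
    simp only [eps, LinearMap.coe_mk, AddHom.coe_mk, hr, if_true, gen, Function.update_self]
    interval_cases d <;> simp [AddMonoidAlgebra.one_def]
  · simp only [eps, LinearMap.coe_mk, AddHom.coe_mk, hr, if_false, gen]
    rw [K.elimCon_mon, hf.val hr d hd, Pi.algebraMap_apply, Algebra.algebraMap_eq_smul_one]
    have : Function.update (Pi.single r d : ℕ → ℕ) r 0 = 0 := by
      funext b
      by_cases hb : b = r
      · subst hb; simp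
      · simp [hb]
    rw [this, K.mon_zero]
    simp

theorem gen_zero {b : ℕ} (hb : L.kind b ≠ 0) : L.gen K b 0 = 1 := by
  funext τ
  simp [gen, hb, K.mon_zero]

theorem sum_gen {b : ℕ} (hb : L.kind b = 0) : ∑ d ∈ range 2, L.gen K b d = 1 := by
  funext τ
  simp only [gen, hb, if_true, Finset.sum_apply, sum_range_succ, sum_range_zero, zero_add]
  cases τ b <;> simp

theorem gen_mul_gen_con {b : ℕ} (hb : L.kind b ≠ 0) (d e : ℕ) :
    L.gen K b d * L.gen K b e = L.gen K b (d + e) := by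
  funext τ
  simp only [gen, hb, if_false, Pi.mul_apply, Pi.single_add, K.mon_add]

theorem gen_mul_gen_var {b : ℕ} (hb : L.kind b = 0) (d e : ℕ) :
    L.gen K b d * L.gen K b e = if d = e then L.gen K b d else 0 := by
  funext τ
  by_cases h : d = e
  · subst h
    simp [gen, hb]
  · simp only [gen, hb, if_true, Pi.mul_apply, h, if_false, Pi.zero_apply]
    split_ifs with h1 h2
    · exact absurd (h1.symm.trans h2) h
    all_goals simp

/-- The monomials live in a quotient in which counts leading to the same state coincide, so reducing
a count is an identity in the algebra and not an approximation. -/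
theorem gen_rd {b : ℕ} (hf : L.Fits K b) (hb : L.kind b ≠ 0) (d : ℕ) :
    L.gen K b (L.rd b d) = L.gen K b d := by
  funext τ
  simp only [gen, hb, if_false]
  refine K.mon_congr fun c => ?_
  by_cases hc : c = b
  · subst hc; simpa using hf.cls hb d
  · simp [hc]

/-- The structure constants of one coordinate: evaluating two unit vectors, multiplying the values
and interpolating gives the product of the corresponding generators. For a constraint, orthogonality
of characters selects the count `n` that is congruent to `d + e` modulo `L.dim b`. As `d` and `e`
are below half of the length, `n = d + e` holds exactly, and `gen_rd` undoes the reduction. Entries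
that are not significant are annihilated by `fwd`. -/
theorem sum_bwd_fwd_gen {b : ℕ} (hg : L.Good b) (hf : L.Fits K b) {d e : ℕ} (hd : d < L.dim b)
    (he : e < L.dim b) :
    ∑ q ∈ range (L.low b), (∑ i ∈ range (L.dim b), L.bwd b q i * L.fwd b i d * L.fwd b i e) •
      L.gen K b q = if d < L.low b ∧ e < L.low b then L.gen K b d * L.gen K b e else 0 := by
  by_cases hb : L.kind b = 0
  · obtain ⟨h1, h2⟩ := hg.var hb
    rw [h2] at hd he
    rw [gen_mul_gen_var hb, h1, h2]
    simp only [bwd, fwd, hb, if_true, sum_range_succ, sum_range_zero]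
    interval_cases d <;> interval_cases e <;> simp
  · obtain ⟨-, h1, h2, h3, h4⟩ := hg.con hb
    set N := L.dim b with hN
    have hN0 : N ≠ 0 := by omega
    have hNc : (N : ℂ) ≠ 0 := Nat.cast_ne_zero.2 hN0
    by_cases hlow : d < L.low b ∧ e < L.low b
    · rw [if_pos hlow, gen_mul_gen_con hb, ← gen_rd hf hb (d + e)]
      have key : ∀ q, ∑ i ∈ range N, L.bwd b q i * L.fwd b i d * L.fwd b i e =
          if L.rd b (d + e) = q then 1 else 0 := by
        intro q
        have h5 : ∀ i, L.bwd b q i * L.fwd b i d * L.fwd b i e = ∑ n ∈ range N,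
            if L.rd b n = q then (zetaRoot N ^ ((d + e) * i) * (zetaRoot N)⁻¹ ^ (n * i)) / N
              else 0 := by
          intro i
          simp only [bwd, fwd, hb, if_false, hlow.1, hlow.2, if_true, ← hN, sum_mul]
          refine sum_congr rfl fun n _ => ?_
          split_ifs
          · rw [add_mul, pow_add, mul_comm n i]; ring
          · simp
        simp only [h5]
        rw [sum_comm]
        have h6 : ∀ n ∈ range N, ∑ i ∈ range N, (if L.rd b n = q then
            (zetaRoot N ^ ((d + e) * i) * (zetaRoot N)⁻¹ ^ (n * i)) / N else 0 : ℂ) =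
            if n = d + e then (if L.rd b (d + e) = q then 1 else 0) else 0 := by
          intro n hn
          rw [mem_range] at hn
          -- The negative exponent is replaced by `N - n`, so that the orthogonality relation
          -- applies with natural exponents.
          have h7 : ∀ i, zetaRoot N ^ ((d + e) * i) * (zetaRoot N)⁻¹ ^ (n * i) =
              zetaRoot N ^ ((d + e + (N - n)) * i) := by
            intro i
            have h8 : zetaRoot N ^ ((N - n) * i) * zetaRoot N ^ (n * i) = 1 := by
              rw [← pow_add, ← add_mul, Nat.sub_add_cancel hn.le, pow_mul, zetaRoot_pow_self hN0,
                one_pow]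
            rw [inv_pow, add_mul (d + e) (N - n) i, pow_add, eq_inv_of_mul_eq_one_left h8]
          simp only [h7]
          by_cases c2 : n = d + e
          · subst c2
            by_cases c1 : L.rd b (d + e) = q
            · simp only [c1, if_true]
              rw [← sum_div, sum_zetaRoot_pow hN0, if_pos, div_self hNc]
              rw [show d + e + (N - (d + e)) = N by omega]
            · simp [c1]
          · rw [if_neg c2]
            by_cases c1 : L.rd b n = q
            · simp only [c1, if_true]
              rw [← sum_div, sum_zetaRoot_pow hN0, if_neg, zero_div]
              rintro ⟨c, hc⟩
              have hc2 : c < 2 := by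
                by_contra h
                have : N * 2 ≤ N * c := Nat.mul_le_mul_left _ (by omega)
                omega
              interval_cases c <;> omega
            · simp [c1]
        -- The place `d + e` exists because `d` and `e` are below `L.low b` and `N` is twice that
        -- number: the convolution does not wrap around.
        rw [sum_congr rfl h6, sum_ite_eq', if_pos (mem_range.2 (by omega))]
      simp only [key, ite_smul, one_smul, zero_smul]
      rw [sum_ite_eq, if_pos (mem_range.2 (h3 _))]
    · rw [if_neg hlow]
      refine sum_eq_zero fun q _ => ?_
      rw [sum_eq_zero, zero_smul]
      intro i _
      simp only [fwd, hb, if_false]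
      rcases not_and_or.1 hlow with h | h <;> simp [h]

variable (L K)

/-- The element that is represented by a table. -/
noncomputable def elem : List ℕ → (ℕ → ℂ) → Alg K
  | [], T => algebraMap ℂ (Alg K) (T 0)
  | b :: B, T => ∑ d ∈ range (L.low b), L.gen K b d * elem B (fun x => T (d * L.size B + x))

variable {L K}

theorem elem_cons (b : ℕ) (B : List ℕ) (T : ℕ → ℂ) : L.elem K (b :: B) T =
    ∑ d ∈ range (L.low b), L.gen K b d * L.elem K B (fun x => T (d * L.size B + x)) := rfl

theorem elem_congr {B : List ℕ} (hB : ∀ b ∈ B, L.Good b) {T T' : ℕ → ℂ}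
    (h : ∀ x < L.size B, T x = T' x) : L.elem K B T = L.elem K B T' := by
  induction B generalizing T T' with
  | nil => rw [elem, elem, h 0 (by simp)]
  | cons b B ih =>
    rw [elem_cons, elem_cons]
    refine sum_congr rfl fun d hd => ?_
    rw [mem_range] at hd
    rw [ih (fun b' hb' => hB b' (by simp [hb'])) fun x hx => h _ ?_]
    rw [size_cons]
    exact block_lt (hd.trans_le (hB b (by simp)).low_le_dim) hx

theorem elem_sum {ι : Type*} (B : List ℕ) (s : Finset ι) (c : ι → ℂ) (T : ι → ℕ → ℂ) :
    L.elem K B (fun x => ∑ i ∈ s, c i * T i x) = ∑ i ∈ s, c i • L.elem K B (T i) := by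
  induction B generalizing T with
  | nil => simp [elem, alg_smul_def]
  | cons b B ih =>
    simp only [elem_cons, ih, mul_sum, smul_sum]
    rw [sum_comm]
    refine sum_congr rfl fun i _ => sum_congr rfl fun d _ => ?_
    rw [mul_smul_comm]

theorem free_elem {r : ℕ} {B : List ℕ} (hr : r ∉ B) (T : ℕ → ℂ) : L.Free K r (L.elem K B T) := by
  induction B generalizing T with
  | nil => exact free_algebraMap _ _
  | cons b B ih =>
    simp only [List.mem_cons, not_or] at hr
    exact Free.sum fun d _ => (free_gen (Ne.symm hr.1) d).mul (ih hr.2 _)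

/-- The remaining coordinates are free for `r`, so the elimination only meets the generators of `r`.
This justifies the sum of weighted slices computed by `message`. -/
theorem eps_elem {r : ℕ} {B : List ℕ} (hg : L.Good r) (hf : L.Fits K r) (hr : r ∉ B) (T : ℕ → ℂ) :
    L.eps K r (L.elem K (r :: B) T) =
      L.elem K B (fun x => ∑ d ∈ range (L.low r), (L.wt r d : ℂ) * T (d * L.size B + x)) := by
  rw [elem_sum, elem_cons, map_sum]
  refine sum_congr rfl fun d hd => ?_
  rw [mul_comm, free_elem hr, eps_gen hg hf (mem_range.1 hd), mul_comm, alg_smul_def]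

theorem trans_congr (W : ℕ → ℕ → ℕ → ℂ) {B : List ℕ} {T T' : ℕ → ℂ}
    (h : ∀ x < L.size B, T x = T' x) (x : ℕ) (hx : x < L.size B) :
    L.trans W B T x = L.trans W B T' x := by
  induction B generalizing T T' x with
  | nil => exact h x hx
  | cons b B ih =>
    simp only [trans]
    have h0 : 0 < L.size B := by
      rcases Nat.eq_zero_or_pos (L.size B) with h0 | h0
      · rw [size_cons, h0] at hx; omega
      · exact h0
    refine sum_congr rfl fun e he => ?_
    rw [ih (fun y hy => h _ (by rw [size_cons]; exact block_lt (mem_range.1 he) hy)) _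
      (Nat.mod_lt _ h0)]

theorem trans_sum {ι : Type*} (W : ℕ → ℕ → ℕ → ℂ) (B : List ℕ) (s : Finset ι) (c : ι → ℂ)
    (T : ι → ℕ → ℂ) :
    L.trans W B (fun x => ∑ i ∈ s, c i * T i x) = fun x => ∑ i ∈ s, c i * L.trans W B (T i) x := by
  induction B generalizing T with
  | nil => rfl
  | cons b B ih =>
    funext x
    simp only [trans, ih, mul_sum]
    rw [sum_comm]
    exact sum_congr rfl fun i _ => sum_congr rfl fun e _ => by ring

/-- Multiplication by transforming, multiplying the entries and transforming back. -/
theorem elem_mul {B : List ℕ} (hB : ∀ b ∈ B, L.Good b ∧ L.Fits K b) (T T' : ℕ → ℂ) :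
    L.elem K B (L.trans L.bwd B (fun x => L.trans L.fwd B T x * L.trans L.fwd B T' x)) =
      L.elem K B T * L.elem K B T' := by
  induction B generalizing T T' with
  | nil => simp [trans, elem]
  | cons b B ih =>
    obtain ⟨hg, hf⟩ := hB b (by simp)
    have hB' : ∀ b ∈ B, L.Good b ∧ L.Fits K b := fun b' hb' => hB b' (by simp [hb'])
    have ih' := ih hB'
    set S := L.size B with hS
    -- The products, in the remaining coordinates, of the transforms of slice `d` of the first table
    -- and slice `e` of the second; the induction hypothesis applies to each of them.
    set P : ℕ → ℕ → ℕ → ℂ := fun d e x => L.trans L.fwd B (fun y => T (d * S + y)) x *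
      L.trans L.fwd B (fun y => T' (e * S + y)) x with hP
    -- By bilinearity, slice `q` of the result combines the `P d e` with the structure constants of
    -- the first coordinate, which `sum_bwd_fwd_gen` evaluates.
    have h1 : ∀ q, L.elem K B (fun x => L.trans L.bwd (b :: B) (fun x =>
        L.trans L.fwd (b :: B) T x * L.trans L.fwd (b :: B) T' x) (q * S + x)) =
        ∑ p ∈ range (L.dim b) ×ˢ range (L.dim b),
          (∑ i ∈ range (L.dim b), L.bwd b q i * L.fwd b i p.1 * L.fwd b i p.2) •
            L.elem K B (L.trans L.bwd B (P p.1 p.2)) := by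
      intro q
      rw [← elem_sum]
      refine elem_congr (fun b' hb' => (hB' b' hb').1) fun x hx => ?_
      rw [trans_cons _ _ _ _ _ _ hx]
      have h2 : ∀ i, L.trans L.bwd B (fun y => L.trans L.fwd (b :: B) T (i * S + y) *
          L.trans L.fwd (b :: B) T' (i * S + y)) x =
          ∑ p ∈ range (L.dim b) ×ˢ range (L.dim b), (L.fwd b i p.1 * L.fwd b i p.2) *
            L.trans L.bwd B (P p.1 p.2) x := by
        intro i
        have := trans_sum (L := L) L.bwd B (range (L.dim b) ×ˢ range (L.dim b))
          (fun p => L.fwd b i p.1 * L.fwd b i p.2) (fun p => P p.1 p.2)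
        rw [← congrFun this x]
        refine trans_congr _ (fun y hy => ?_) x hx
        rw [trans_cons _ _ _ _ _ _ hy, trans_cons _ _ _ _ _ _ hy, sum_mul_sum, sum_product]
        refine sum_congr rfl fun d _ => sum_congr rfl fun e _ => ?_
        simp only [hP]
        ring
      simp only [← hS, h2, mul_sum, sum_mul]
      rw [sum_comm]
      refine sum_congr rfl fun p _ => sum_congr rfl fun i _ => by ring
    rw [elem_cons]
    simp only [← hS, h1, mul_sum, mul_smul_comm]
    rw [sum_comm]
    have h3 : ∀ p ∈ range (L.dim b) ×ˢ range (L.dim b), (∑ q ∈ range (L.low b),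
        (∑ i ∈ range (L.dim b), L.bwd b q i * L.fwd b i p.1 * L.fwd b i p.2) •
          (L.gen K b q * L.elem K B (L.trans L.bwd B (P p.1 p.2)))) =
        if p.1 < L.low b ∧ p.2 < L.low b then (L.gen K b p.1 *
          L.elem K B (fun y => T (p.1 * S + y))) * (L.gen K b p.2 *
            L.elem K B (fun y => T' (p.2 * S + y))) else 0 := by
      intro p hp
      rw [mem_product, mem_range, mem_range] at hp
      simp only [← smul_mul_assoc]
      rw [← sum_mul, sum_bwd_fwd_gen hg hf hp.1 hp.2, hP, ih']
      split_ifs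
      · ring
      · simp
    rw [sum_congr rfl h3, elem_cons, elem_cons, sum_mul_sum, ← sum_product', ← sum_filter]
    refine sum_congr ?_ fun p _ => rfl
    ext p
    have := hg.low_le_dim
    simp only [mem_filter, mem_product, mem_range]
    omega

end Layout

namespace Layout

variable (L : Layout) (K : Counter)

/-! ## The total sum -/

/-- The contribution of the variable `x` to the count of the constraint `c`. -/
noncomputable def cross (c x : ℕ) : Alg K := fun τ =>
  if L.act c x = (τ x).toNat then L.gen K c 1 τ else 1

/-- The contribution of a pair of vertices. -/
noncomputable def edge (r b : ℕ) : Alg K :=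
  if L.kind r = 0 then (if L.kind b = 0 then 1 else L.cross K b r)
  else (if L.kind b = 0 then L.cross K r b else 1)

/-- The count of the constraint `c` over the variables below `n`. -/
def count (n : ℕ) (τ : ℕ → Bool) (c : ℕ) : ℕ :=
  if c < n ∧ L.kind c ≠ 0 then #{x ∈ range n | L.kind x = 0 ∧ L.act c x = (τ x).toNat} else 0

/-- The elimination of the vertices `n - 1, …, 0`. -/
noncomputable def elimAll : ℕ → Alg K → Alg K
  | 0, f => f
  | n + 1, f => elimAll n (L.eps K n f)

/-- The elimination of the constraints `n - 1, …, 0`. -/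
noncomputable def elimCons : ℕ → K.Ring → K.Ring
  | 0, y => y
  | n + 1, y => elimCons n (if L.kind n = 0 then y else K.elimCon n y)

open Classical in
/-- The assignments to the variables below `n`, extended by `false`. -/
noncomputable def assignments : ℕ → Finset (ℕ → Bool)
  | 0 => {fun _ => false}
  | n + 1 => if L.kind n = 0 then
      assignments n ∪ (assignments n).image (fun τ => Function.update τ n true)
      else assignments n

variable {L K}

theorem gen_con_apply {c : ℕ} (hc : L.kind c ≠ 0) (d : ℕ) (τ : ℕ → Bool) :
    L.gen K c d τ = K.mon (Pi.single c d) := by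
  simp [gen, hc]

theorem gen_mul_cross {c x β : ℕ} (hx : L.kind x = 0) :
    L.gen K x β * L.cross K c x = L.gen K x β * (if L.act c x = β then L.gen K c 1 else 1) := by
  funext τ
  simp only [Pi.mul_apply, gen, hx, if_true, cross]
  by_cases h : (τ x).toNat = β
  · subst h
    by_cases h' : L.act c x = (τ x).toNat <;> simp [h', gen]
  · simp [h]

theorem sum_gen_cross {c x : ℕ} (hx : L.kind x = 0) :
    ∑ β ∈ range 2, L.gen K x β * (if L.act c x = β then L.gen K c 1 else 1) = L.cross K c x := by
  simp only [← gen_mul_cross hx]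
  rw [← sum_mul, sum_gen hx, one_mul]

/-- A pair of a variable and a constraint occurs once, under whichever of its vertices is larger.
When the vertex `n` is added, a variable raises the counts of smaller constraints, and a constraint
collects the contributions of the smaller variables. No reduction of counts takes place here. -/
theorem prod_edge (n : ℕ) (τ : ℕ → Bool) :
    (∏ r ∈ range n, ∏ b ∈ range r, L.edge K r b) τ = K.mon (L.count n τ) := by
  induction n with
  | zero =>
    have : L.count 0 τ = 0 := by funext c; simp [count]
    rw [this, K.mon_zero]
    simp
  | succ n ih =>
    rw [prod_range_succ, Pi.mul_apply, ih]
    have key : (∏ b ∈ range n, L.edge K n b) τ = K.mon (fun c =>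
        if L.kind n = 0 then
          (if c < n ∧ L.kind c ≠ 0 ∧ L.act c n = (τ n).toNat then 1 else 0)
        else if c = n then #{x ∈ range n | L.kind x = 0 ∧ L.act n x = (τ x).toNat} else 0) := by
      have aux : ∀ m ≤ n, (∏ b ∈ range m, L.edge K n b) τ = K.mon (fun c =>
        if L.kind n = 0 then
          (if c < m ∧ L.kind c ≠ 0 ∧ L.act c n = (τ n).toNat then 1 else 0)
        else if c = n then #{x ∈ range m | L.kind x = 0 ∧ L.act n x = (τ x).toNat} else 0) := by
        intro m
        induction m with
        | zero =>
          intro _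
          refine (Eq.trans ?_ K.mon_zero.symm).trans (congrArg K.mon ?_)
          · simp
          · funext c
            simp
        | succ m ihm =>
          intro hm
          rw [prod_range_succ, Pi.mul_apply, ihm (by omega)]
          have h1 : L.edge K n m τ = K.mon (fun c =>
              if L.kind n = 0 then
                (if c = m ∧ L.kind m ≠ 0 ∧ L.act m n = (τ n).toNat then 1 else 0)
              else if c = n ∧ L.kind m = 0 ∧ L.act n m = (τ m).toNat then 1 else 0) := by
            by_cases hn : L.kind n = 0 <;> by_cases hm0 : L.kind m = 0 <;>
              simp only [edge, hn, hm0, if_true, if_false, cross, ne_eq, not_true, not_false_iff,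
                false_and, and_false, true_and]
            · exact K.mon_zero.symm
            · split_ifs with ha
              · rw [gen_con_apply hm0]
                congr 1
                funext c
                simp [Pi.single_apply, ha]
              · simp only [ha, and_false, if_false]
                exact K.mon_zero.symm
            · split_ifs with ha
              · rw [gen_con_apply hn]
                congr 1
                funext c
                simp [Pi.single_apply, ha]
              · simp only [ha, and_false, if_false]
                exact K.mon_zero.symm
            · exact K.mon_zero.symm
          rw [h1, ← K.mon_add]
          congr 1
          funext c
          simp only [Pi.add_apply]
          by_cases hn : L.kind n = 0
          · simp only [hn, if_true]
            by_cases hcm : c = m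
            · subst hcm
              simp
            · have : c < m + 1 ↔ c < m := by omega
              simp [hcm, this]
          · simp only [hn, if_false]
            by_cases hcn : c = n
            · subst hcn
              simp only [if_true, range_add_one, filter_insert, true_and]
              split_ifs with ha
              · rw [card_insert_of_notMem (by simp)]
              · rfl
            · simp [hcn]
      exact aux n le_rfl
    rw [key, ← K.mon_add]
    congr 1
    funext c
    simp only [Pi.add_apply, count]
    by_cases hn : L.kind n = 0
    · simp only [hn, if_true]
      by_cases hc : c < n ∧ L.kind c ≠ 0
      · have hc' : c < n + 1 ∧ L.kind c ≠ 0 := ⟨by omega, hc.2⟩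
        rw [if_pos hc, if_pos hc', range_add_one, filter_insert]
        simp only [hc.1, hc.2, hn, true_and, ne_eq, not_false_iff]
        split_ifs with ha
        · rw [card_insert_of_notMem (by simp)]
        · rfl
      · have hc' : ¬ (c < n + 1 ∧ L.kind c ≠ 0) := by
          rintro ⟨h1, h2⟩
          have : c ≠ n := by rintro rfl; exact h2 hn
          exact hc ⟨by omega, h2⟩
        rw [if_neg hc, if_neg hc', if_neg (by tauto)]
    · simp only [hn, if_false]
      by_cases hcn : c = n
      · subst hcn
        rw [if_neg (by omega), if_pos rfl, if_pos ⟨by omega, hn⟩, range_add_one, filter_insert,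
          if_neg (by tauto), zero_add]
      · rw [if_neg hcn, add_zero]
        have : c < n + 1 ↔ c < n := by omega
        simp only [this, range_add_one, filter_insert, hn, false_and, if_false]

theorem elimCons_add (n : ℕ) (y z : K.Ring) :
    L.elimCons K n (y + z) = L.elimCons K n y + L.elimCons K n z := by
  induction n generalizing y z with
  | zero => rfl
  | succ n ih =>
    simp only [elimCons]
    split_ifs
    · exact ih y z
    · rw [map_add, ih]

theorem elimCons_smul (n : ℕ) (z : ℂ) (y : K.Ring) :
    L.elimCons K n (z • y) = z • L.elimCons K n y := by
  induction n generalizing y with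
  | zero => rfl
  | succ n ih =>
    simp only [elimCons]
    split_ifs
    · exact ih y
    · rw [map_smul, ih]

theorem elimCons_mon (n : ℕ) (p : ℕ → ℕ) : L.elimCons K n (K.mon p) =
    (∏ c ∈ range n, if L.kind c = 0 then 1 else K.val c (K.cls c (p c))) •
      K.mon (fun c => if c < n ∧ L.kind c ≠ 0 then 0 else p c) := by
  induction n generalizing p with
  | zero => simp [elimCons]
  | succ n ih =>
    rw [prod_range_succ, elimCons]
    by_cases hn : L.kind n = 0
    · simp only [hn, if_true, mul_one]
      rw [ih]
      congr 2
      funext c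
      by_cases hcn : c = n
      · subst hcn; simp [hn]
      · have : c < n + 1 ↔ c < n := by omega
        simp [this]
    · simp only [hn, if_false]
      have hprod : (∏ c ∈ range n, if L.kind c = 0 then 1 else
          K.val c (K.cls c (Function.update p n 0 c))) =
          ∏ c ∈ range n, if L.kind c = 0 then 1 else K.val c (K.cls c (p c)) := by
        refine prod_congr rfl fun c hc => ?_
        rw [mem_range] at hc
        rw [Function.update_of_ne (by omega)]
      rw [K.elimCon_mon, elimCons_smul, ih, smul_smul, mul_comm, hprod]
      congr 2
      · funext c
        by_cases hcn : c = n
        · subst hcn; simp [hn]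
        · have : c < n + 1 ↔ c < n := by omega
          simp [this, hcn]

open Classical in
theorem mem_assignments {n : ℕ} {τ : ℕ → Bool} :
    τ ∈ L.assignments n ↔ ∀ i, τ i = true → i < n ∧ L.kind i = 0 := by
  induction n generalizing τ with
  | zero =>
    simp only [assignments, mem_singleton]
    constructor
    · rintro rfl; simp
    · intro h
      funext i
      by_contra hi
      have := (h i (by simpa using hi)).1
      omega
  | succ n ih =>
    rw [assignments]
    by_cases hn : L.kind n = 0
    · rw [if_pos hn, mem_union, mem_image]
      constructor
      · rintro (h | ⟨σ, h, rfl⟩) i hi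
        · have := ih.1 h i hi
          exact ⟨by omega, this.2⟩
        · by_cases hin : i = n
          · subst hin; exact ⟨by omega, hn⟩
          · rw [Function.update_of_ne hin] at hi
            have := ih.1 h i hi
            exact ⟨by omega, this.2⟩
      · intro h
        by_cases hτ : τ n = true
        · right
          refine ⟨Function.update τ n false, ih.2 fun i hi => ?_, ?_⟩
          · by_cases hin : i = n
            · subst hin; simp at hi
            · rw [Function.update_of_ne hin] at hi
              have := h i hi
              exact ⟨by omega, this.2⟩
          · rw [Function.update_idem, ← hτ, Function.update_eq_self]
        · left
          refine ih.2 fun i hi => ?_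
          have := h i hi
          have hin : i ≠ n := by rintro rfl; exact hτ hi
          exact ⟨by omega, this.2⟩
    · rw [if_neg hn, ih]
      constructor
      · intro h i hi
        have := h i hi
        exact ⟨by omega, this.2⟩
      · intro h i hi
        have := h i hi
        have hin : i ≠ n := by rintro rfl; exact hn this.2
        exact ⟨by omega, this.2⟩

-- The element is evaluated at the assignment that is constantly false. Eliminating the variable `n`
-- doubles the assignments that remain to be summed, by setting `n` to false or to true; all places
-- that are not variables below `n` keep the value false, so the sum is finite.
open Classical in
theorem elimAll_apply (n : ℕ) (f : Alg K) :
    L.elimAll K n f (fun _ => false) = ∑ τ ∈ L.assignments n, L.elimCons K n (f τ) := by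
  induction n generalizing f with
  | zero => simp [elimAll, assignments, elimCons]
  | succ n ih =>
    rw [elimAll, ih]
    by_cases hn : L.kind n = 0
    · have hf : ∀ τ ∈ L.assignments n, τ n = false := by
        intro τ hτ
        by_contra h
        have := (mem_assignments.1 hτ n (by simpa using h)).1
        omega
      rw [assignments, if_pos hn, sum_union, sum_image]
      · rw [← sum_add_distrib]
        refine sum_congr rfl fun τ hτ => ?_
        simp only [eps, LinearMap.coe_mk, AddHom.coe_mk, hn, if_true, elimCons, elimCons_add]
        congr 3
        rw [← hf τ hτ, Function.update_eq_self]
      · intro τ hτ σ hσ h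
        have := congrArg (fun ρ => Function.update ρ n false) h
        simp only [Function.update_idem] at this
        rwa [← hf τ hτ, Function.update_eq_self, hf τ hτ, ← hf σ hσ, Function.update_eq_self] at this
      · rw [disjoint_left]
        intro τ hτ hτ'
        rw [mem_image] at hτ'
        obtain ⟨σ, -, rfl⟩ := hτ'
        have := hf _ hτ
        simp at this
    · rw [assignments, if_neg hn]
      refine sum_congr rfl fun τ _ => ?_
      simp only [eps, LinearMap.coe_mk, AddHom.coe_mk, hn, if_false, elimCons]

/-- The elimination of all vertices yields the sum over all assignments of the products of the
weights of the final states. -/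
theorem elimAll_prod_edge (n : ℕ) {z : ℂ}
    (h : algebraMap ℂ (Alg K) z = L.elimAll K n (∏ r ∈ range n, ∏ b ∈ range r, L.edge K r b)) :
    z = ∑ τ ∈ L.assignments n, ∏ c ∈ range n,
      if L.kind c = 0 then 1 else K.val c (K.cls c (L.count n τ c)) := by
  have h1 := congrFun h (fun _ => false)
  rw [elimAll_apply] at h1
  -- Eliminating a constraint resets its count to 0, and `count` vanishes outside the constraints
  -- below `n`. So the monomial that is left is 1, and only the scalar of the weights remains.
  have h2 : ∀ τ, L.elimCons K n ((∏ r ∈ range n, ∏ b ∈ range r, L.edge K r b) τ) =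
      algebraMap ℂ K.Ring (∏ c ∈ range n,
        if L.kind c = 0 then 1 else K.val c (K.cls c (L.count n τ c))) := by
    intro τ
    rw [prod_edge, elimCons_mon, Algebra.algebraMap_eq_smul_one]
    congr 1
    rw [← K.mon_zero]
    congr 1
    funext c
    simp only [count]
    split_ifs <;> rfl
  simp only [h2] at h1
  rw [← map_sum, Pi.algebraMap_apply] at h1
  exact (algebraMap ℂ K.Ring).injective h1

/-! ## Elimination steps -/

/-- Distributive law: all factors but the one of `r` move out of the elimination of `r`. -/
theorem elimAll_step {r : ℕ} {z : ℂ} {a : ℕ → Alg K} (ha : ∀ u < r, L.Free K r (a u)) :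
    L.elimAll K (r + 1) (algebraMap ℂ (Alg K) z * ∏ u ∈ range (r + 1), a u) =
      L.elimAll K r (algebraMap ℂ (Alg K) z * (∏ u ∈ range r, a u) * L.eps K r (a r)) := by
  rw [elimAll, prod_range_succ, ← mul_assoc]
  congr 1
  exact (free_algebraMap r z).mul (Free.prod fun u hu => ha u (mem_range.1 hu)) _

theorem elimAll_step_root {r : ℕ} {z y : ℂ} {a : ℕ → Alg K} (ha : ∀ u < r, L.Free K r (a u))
    (hy : L.eps K r (a r) = algebraMap ℂ (Alg K) y) :
    L.elimAll K (r + 1) (algebraMap ℂ (Alg K) z * ∏ u ∈ range (r + 1), a u) =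
      L.elimAll K r (algebraMap ℂ (Alg K) (z * y) * ∏ u ∈ range r, a u) := by
  rw [elimAll_step ha, hy, map_mul]
  congr 1
  ring

/-- The eliminated factor can be attached to any earlier factor. Choosing the largest other vertex
of the table of `r` will keep the tables within the bags. -/
theorem elimAll_step_parent {r p : ℕ} {z : ℂ} {a a' : ℕ → Alg K}
    (ha : ∀ u < r, L.Free K r (a u)) (hp : p < r) (hap : a' p = a p * L.eps K r (a r))
    (ha' : ∀ u < r, u ≠ p → a' u = a u) :
    L.elimAll K (r + 1) (algebraMap ℂ (Alg K) z * ∏ u ∈ range (r + 1), a u) =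
      L.elimAll K r (algebraMap ℂ (Alg K) z * ∏ u ∈ range r, a' u) := by
  rw [elimAll_step ha]
  congr 1
  have hpr : p ∈ range r := mem_range.2 hp
  rw [← mul_prod_erase _ _ hpr, ← mul_prod_erase _ _ hpr, hap]
  have : ∏ u ∈ (range r).erase p, a' u = ∏ u ∈ (range r).erase p, a u :=
    prod_congr rfl fun u hu => ha' u (mem_range.1 (mem_of_mem_erase hu)) (ne_of_mem_erase hu)
  rw [this]
  ring

/-! ## Tables with a single entry -/

variable (L K)

/-- The element that is represented by the table with the only entry `1` at `x`. -/
noncomputable def mono (B : List ℕ) (x : ℕ) : Alg K := L.elem K B (fun y => if x = y then 1 else 0)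

variable {L K}

theorem mono_nil : L.mono K [] 0 = 1 := by
  simp [mono, elem]

theorem mono_cons {b d x : ℕ} {B : List ℕ} (hd : d < L.low b) (hB : ∀ b ∈ B, L.Good b)
    (hx : x < L.size B) : L.mono K (b :: B) (d * L.size B + x) = L.gen K b d * L.mono K B x := by
  rw [mono, elem_cons, sum_eq_single d]
  · rw [mono]
    congr 1
    refine elem_congr hB fun y hy => ?_
    simp
  · intro e _ hne
    have : L.elem K B (fun y => if d * L.size B + x = e * L.size B + y then (1 : ℂ) else 0) =
        L.elem K B (fun y => ∑ i ∈ (∅ : Finset ℕ), (0 : ℂ) * (fun _ _ => 0 : ℕ → ℕ → ℂ) i y) := by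
      refine elem_congr hB fun y hy => ?_
      rw [if_neg, sum_empty]
      intro h
      exact hne (add_mul_inj hy hx (by omega)).2
    rw [this, elem_sum, sum_empty, mul_zero]
  · intro h; exact absurd (mem_range.2 hd) h

theorem elem_eq_sum_mono (B : List ℕ) {ι : Type*} (s : Finset ι) (c : ι → ℂ) (x : ι → ℕ) :
    L.elem K B (fun y => ∑ i ∈ s, c i * if x i = y then 1 else 0) =
      ∑ i ∈ s, c i • L.mono K B (x i) :=
  elem_sum B s c fun i y => if x i = y then 1 else 0

end Layout

/-! ## The table of the edges at a vertex -/

namespace Layout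

variable {L : Layout} {K : Counter}

theorem Holds.setI {n : ℕ} {s : Store} (h : L.Holds n s) {a : ℕ} (ha : a ∉ arrays) (i j v : ℕ) :
    L.Holds n (s.setI a i j v) :=
  h.congr fun b hb => Store.setI_idx_ne _ _ _ _ (by rintro rfl; exact ha hb)

theorem Holds.setN {n : ℕ} {s : Store} (h : L.Holds n s) (a i j : ℕ) (v : ℂ) :
    L.Holds n (s.setN a i j v) :=
  h.congr fun _ _ => rfl

theorem Holds.fillN {n : ℕ} {s : Store} (h : L.Holds n s) (a i m : ℕ) (f : ℕ → ℂ) :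
    L.Holds n (s.fillN a i m f) :=
  h.congr fun _ _ => rfl

/-- The factor 1 is inserted as the sum of the two generators of the variable `b`, and on each
summand the edge is a fixed power of the generator of `r`. The value 2, which no `d < 2` attains,
encodes that nothing is counted. The raised count is reduced at once, so that it remains
significant. -/
theorem gen_mul_edge_var {r b : ℕ} (hr : L.kind r ≠ 0 → L.Fits K r) (hb : L.kind b = 0) (q : ℕ) :
    L.gen K r q * L.edge K r b = ∑ d ∈ range 2,
      L.gen K r (if (if L.kind r = 0 then 2 else L.act r b) = d then L.rd r (q + 1) else q) *
        L.gen K b d := by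
  by_cases h0 : L.kind r = 0
  · have h1 : ∀ d ∈ range 2, L.gen K r (if (if L.kind r = 0 then 2 else L.act r b) = d then
        L.rd r (q + 1) else q) * L.gen K b d = L.gen K r q * L.gen K b d := by
      intro d hd
      rw [mem_range] at hd
      rw [if_pos h0, if_neg (by omega)]
    rw [sum_congr rfl h1, ← mul_sum, sum_gen hb]
    simp [edge, h0, hb]
  · simp only [edge, h0, hb, if_false, if_true]
    rw [← sum_gen_cross hb, mul_sum]
    refine sum_congr rfl fun d _ => ?_
    split_ifs with h
    · rw [gen_rd (hr h0) h0, ← gen_mul_gen_con h0]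
      ring
    · ring

/-- For a constraint `b` no summation is needed: the value of the variable `r` is already fixed by
`q`, so the edge contributes the count 0 or 1 to `b`. The count 0 is the unit. -/
theorem gen_mul_edge_con {r b : ℕ} (hbf : L.Fits K b) (hb : L.kind b ≠ 0) (q : ℕ) :
    L.gen K r q * L.edge K r b = L.gen K r q *
      L.gen K b (if L.kind r = 0 ∧ L.act b r = q then L.rd b 1 else 0) := by
  by_cases h0 : L.kind r = 0
  · simp only [edge, h0, hb, if_false, if_true, true_and]
    rw [gen_mul_cross h0]
    split_ifs
    · rw [gen_rd hbf hb]
    · rw [gen_zero hb]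
  · simp only [edge, h0, hb, if_false, false_and]
    rw [gen_zero hb]

end Layout

open Program IExp in
/-- The value of a variable that is counted by a constraint, to the register 84. -/
def actOf (c x : IExp) : Program :=
  .ifLt (.get 1 (.get 14 0 c) (.get 14 0 x)) 1 (set 84 2)
    (.ifLt (.get 1 (.get 14 0 c) (.get 14 0 x)) 2 (set 84 (.get 18 0 c))
      (set 84 (1 - .get 18 0 c)))

theorem actOf_spec {L : Layout} {n : ℕ} {s : Store} {Q : Store → ℕ → Prop} (hL : L.Holds n s)
    {c x : IExp} {cv xv : ℕ} (hc : c.eval s = cv) (hx : x.eval s = xv) (hcn : cv < n) (hxn : xv < n)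
    (hkc : L.kind cv ≠ 0) (hkx : L.kind xv = 0)
    (hQ : ∀ t, t ≤ 3 * c.cost + 2 * x.cost + 30 → Q (s.setI 84 0 0 (L.act cv xv)) t) :
    WP (actOf c x) s Q := by
  have := hL.act cv hcn xv hxn hkc hkx
  simp only [actOf, WP_ifLt, WP_set, IExp.eval_get, hc, hx, IExp.eval_ofNat,
    IExp.eval_sub, IExp.cost_get, IExp.cost_ofNat, IExp.cost_sub]
  split_ifs at this ⊢ with h1 h2
  all_goals rw [← this]; exact hQ _ (by omega)

open Program IExp in
/-- Extending the lists of places in the arrays 26 and 27, of length `V 83`, by `V 88 - 1` copies,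
each of which is shifted against the previous one. -/
def extend : Program :=
  set 90 0 ;; loop 91 (V 88 - 1) (set 90 (V 90 + V 83)) ;;
  loop 85 (V 90) (
    .setIdx 26 0 (V 83 + V 85) (.get 26 0 (V 85) + V 87) ;;
    .setIdx 27 0 (V 83 + V 85) (.get 27 0 (V 85) + V 89)) ;;
  set 83 (V 83 + V 90)

/-- The entry `cnt + m` is derived from the entry `m`, one block earlier, which is either original
or already shifted. So the `d`-th copy is shifted by `d` strides although only additions are
available. -/
theorem extend_spec {s : Store} {Q : Store → ℕ → Prop} (cnt S S' c : ℕ) (hcnt : s.idx 83 0 0 = cnt)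
    (hcnt0 : 0 < cnt) (hS : s.idx 87 0 0 = S) (hS' : s.idx 89 0 0 = S') (hc : s.idx 88 0 0 = c + 1)
    (hQ : ∀ s' t, Frame extend s s' → t ≤ 100 * ((c + 1) * cnt) →
      s'.idx 83 0 0 = (c + 1) * cnt → s'.idx 90 0 0 = c * cnt →
      (∀ d < c + 1, ∀ i < cnt, s'.idx 26 0 (d * cnt + i) = s.idx 26 0 i + d * S) →
      (∀ d < c + 1, ∀ i < cnt, s'.idx 27 0 (d * cnt + i) = s.idx 27 0 i + d * S') → Q s' t) :
    WP extend s Q := by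
  suffices H : WP extend s (fun s' t => t ≤ 100 * ((c + 1) * cnt) ∧
      s'.idx 83 0 0 = (c + 1) * cnt ∧ s'.idx 90 0 0 = c * cnt ∧
      (∀ d < c + 1, ∀ i < cnt, s'.idx 26 0 (d * cnt + i) = s.idx 26 0 i + d * S) ∧
      (∀ d < c + 1, ∀ i < cnt, s'.idx 27 0 (d * cnt + i) = s.idx 27 0 i + d * S')) from
    H.mono fun s' t h hF => hQ s' t hF h.1 h.2.1 h.2.2.1 h.2.2.2.1 h.2.2.2.2
  simp only [extend, WP_seq, WP_set]
  refine WP_loop c 20 (fun m s' => s'.idx 90 0 0 = m * cnt) rfl ?_ ?_ ?_ ?_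
  · intro s' hF
    have := hF.idx 88 rfl
    simp at this
    simp [this, hc]
  · simp
  · rintro m s1 hm h90 h91 hF
    have e83 := hF.idx 83 rfl
    simp at e83
    simp [h90, e83, hcnt]
    ring
  rintro s1 t1 h90 - F1 ht1
  simp at ht1
  have f83 := F1.idx 83 rfl
  have f87 := F1.idx 87 rfl
  have f89 := F1.idx 89 rfl
  have f26 := F1.idx 26 rfl
  have f27 := F1.idx 27 rfl
  simp at f83 f87 f89 f26 f27
  refine WP_loop (c * cnt) 40 (fun m s' => ∀ d i, i < cnt → d * cnt + i < cnt + m →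
    s'.idx 26 0 (d * cnt + i) = s.idx 26 0 i + d * S ∧
    s'.idx 27 0 (d * cnt + i) = s.idx 27 0 i + d * S') rfl ?_ ?_ ?_ ?_
  · intro s' hF
    have := hF.idx 90 rfl
    simp [this, h90]
  · intro d i hi hd
    have : d = 0 := by
      by_contra h
      have : 1 * cnt ≤ d * cnt := Nat.mul_le_mul_right _ (by omega)
      omega
    subst this
    simp [f26, f27]
  · rintro m s2 hm h1 h85 hF
    have e83 := hF.idx 83 rfl
    have e87 := hF.idx 87 rfl
    have e89 := hF.idx 89 rfl
    have hdm := Nat.div_add_mod' m cnt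
    have hmod := Nat.mod_lt m hcnt0
    obtain ⟨g1, g2⟩ := h1 (m / cnt) (m % cnt) hmod (by omega)
    rw [hdm] at g1 g2
    simp [h85, e83, e87, e89, f83, f87, f89, g1, g2, hcnt, hS, hS']
    intro d i hi hd
    by_cases h : d * cnt + i = cnt + m
    · have h2 : i + d * cnt = m % cnt + (m / cnt + 1) * cnt := by
        rw [add_mul]; omega
      obtain ⟨rfl, rfl⟩ := add_mul_inj hi hmod h2
      rw [h]
      simp only [upd_same]
      constructor <;> ring
    · rw [upd_ne _ _ (by omega), upd_ne _ _ (by omega)]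
      exact h1 d i hi (by omega)
  · rintro s2 t2 h1 - F2 ht2
    have e83 := F2.idx 83 rfl
    have e90 := F2.idx 90 rfl
    have hlt : ∀ d < c + 1, ∀ i < cnt, d * cnt + i < cnt + c * cnt := by
      intro d hd i hi
      have := block_lt hd hi
      rw [add_mul] at this
      omega
    simp at ht2
    have h3 : c * 1 ≤ c * cnt := Nat.mul_le_mul_left _ hcnt0
    simp [e83, f83, hcnt, e90, h90]
    refine ⟨?_, by ring, fun d hd i hi => (h1 d i hi (hlt d (by omega) i hi)).1,
      fun d hd i hi => (h1 d i hi (hlt d (by omega) i hi)).2⟩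
    rw [add_mul]
    omega

open Program IExp in
/-- Splitting the monomials in the arrays 26 and 27 at a variable. -/
def splitVar : Program :=
  set 88 2 ;; set 89 0 ;; extend ;;
  .ifLt (V 84) 2 (
    .ifLt (V 84) 1 (set 92 0) (set 92 (V 90)) ;;
    loop 85 (V 90) (.setIdx 27 0 (V 92 + V 85) (.get 20 (V 80) (.get 27 0 (V 92 + V 85) + 1)))) .nop

/-- After doubling the list, the block of the value `a` is the one in which the constraint counts
the variable; only its counts advance. For `a = 2` no block is concerned. -/
theorem splitVar_spec {s : Store} {Q : Store → ℕ → Prop} (cnt S a : ℕ) (rd : ℕ → ℕ)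
    (hcnt : s.idx 83 0 0 = cnt) (hcnt0 : 0 < cnt) (hS : s.idx 87 0 0 = S) (ha : s.idx 84 0 0 = a)
    (hrd : a < 2 → ∀ i < cnt, s.idx 20 (s.idx 80 0 0) (s.idx 27 0 i + 1) = rd (s.idx 27 0 i + 1))
    (hQ : ∀ s' t, Frame splitVar s s' → t ≤ 450 * cnt → s'.idx 83 0 0 = 2 * cnt →
      (∀ d < 2, ∀ i < cnt, s'.idx 26 0 (d * cnt + i) = s.idx 26 0 i + d * S) →
      (∀ d < 2, ∀ i < cnt, s'.idx 27 0 (d * cnt + i) =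
        if a = d then rd (s.idx 27 0 i + 1) else s.idx 27 0 i) → Q s' t) :
    WP splitVar s Q := by
  suffices H : WP splitVar s (fun s' t => t ≤ 450 * cnt ∧ s'.idx 83 0 0 = 2 * cnt ∧
      (∀ d < 2, ∀ i < cnt, s'.idx 26 0 (d * cnt + i) = s.idx 26 0 i + d * S) ∧
      (∀ d < 2, ∀ i < cnt, s'.idx 27 0 (d * cnt + i) =
        if a = d then rd (s.idx 27 0 i + 1) else s.idx 27 0 i)) from
    H.mono fun s' t h hF => hQ s' t hF h.1 h.2.1 h.2.2.1 h.2.2.2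
  simp only [splitVar, WP_seq, WP_set]
  refine extend_spec cnt S 0 1 (by simp [hcnt]) hcnt0 (by simp [hS]) (by simp) (by simp) ?_
  intro s1 t1 F1 ht1 h83 h90 h26 h27
  have e84 := F1.idx 84 rfl
  have e80 := F1.idx 80 rfl
  have e20 := F1.idx 20 rfl
  simp at e84 e80 e20 h83 h90 h26 h27
  rw [WP_ifLt]
  simp only [IExp.eval_get, IExp.eval_zero, IExp.eval_ofNat, e84, ha]
  by_cases h2 : a < 2
  · rw [if_pos h2, WP_seq]
    have key : ∀ (s2 : Store) (t2 : ℕ), t2 ≤ 20 → s2.idx 92 0 0 = a * cnt →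
        (∀ b, b ≠ 92 → s2.idx b = s1.idx b) → WP (Program.loop 85 (V 90) (.setIdx 27 0 (V 92 + V 85)
          (.get 20 (V 80) (.get 27 0 (V 92 + V 85) + 1)))) s2 (fun s' t => t2 + t ≤ 200 * cnt ∧
          s'.idx 83 0 0 = 2 * cnt ∧
          (∀ d < 2, ∀ i < cnt, s'.idx 26 0 (d * cnt + i) = s.idx 26 0 i + d * S) ∧
          (∀ d < 2, ∀ i < cnt, s'.idx 27 0 (d * cnt + i) =
            if a = d then rd (s.idx 27 0 i + 1) else s.idx 27 0 i)) := by
      intro s2 t2 ht2 h92 hs2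
      refine WP_loop cnt 40 (fun m s' => ∀ d < 2, ∀ i < cnt, s'.idx 27 0 (d * cnt + i) =
            if a = d ∧ i < m then rd (s.idx 27 0 i + 1) else s.idx 27 0 i) rfl ?_ ?_ ?_ ?_
      · intro s' hF
        simp [hF.idx 90 rfl, hs2, h90]
      · simp [hs2]
        exact h27
      · rintro m s3 hm h3 h85 hF
        have g := h3 a h2 m hm
        simp at g
        simp [h85, hF.idx 92 rfl, h92, g, hF.idx 20 rfl, hF.idx 80 rfl, hs2, e20, e80, hrd h2 m hm]
        intro d hd i hi
        by_cases h : i + d * cnt = m + a * cnt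
        · obtain ⟨rfl, rfl⟩ := add_mul_inj hi hm h
          simp
        · rw [upd_ne _ _ (by omega), h3 d (by omega) i hi]
          have : a = d → (i < m ↔ i < m + 1) := by
            rintro rfl
            omega
          by_cases had : a = d
          · simp [this had, Nat.lt_succ_iff]
          · simp [had]
      · rintro s3 t3 h3 - F3 ht3
        simp at ht3
        simp [F3.idx 83 rfl, F3.idx 26 rfl, hs2, h83]
        refine ⟨by omega, h26, fun d hd i hi => ?_⟩
        rw [h3 d (by omega) i hi]
        simp [hi]
    rw [WP_ifLt]
    simp only [IExp.eval_get, IExp.eval_zero, IExp.eval_one, e84, ha, WP_set]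
    split_ifs with h1
    · obtain rfl : a = 0 := by omega
      refine (key _ 10 (by omega) (by simp) (fun b hb => by simp [hb])).mono ?_
      rintro s3 t3 ⟨h3, h4⟩ -
      simp
      exact ⟨by omega, h4.1, fun d hd => h4.2.1 d (by omega), fun d hd => h4.2.2 d (by omega)⟩
    · obtain rfl : a = 1 := by omega
      refine (key _ 10 (by omega) (by simp [h90]) (fun b hb => by simp [hb])).mono ?_
      rintro s3 t3 ⟨h3, h4⟩ -
      simp
      exact ⟨by omega, h4.1, fun d hd => h4.2.1 d (by omega), fun d hd => h4.2.2 d (by omega)⟩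
  · rw [if_neg h2]
    simp [h83]
    refine ⟨by omega, h26, fun d hd i hi => ?_⟩
    rw [h27 d hd i hi, if_neg (by omega)]

open Program IExp in
/-- Moving the monomials in the arrays 26 and 27 at a constraint. -/
def moveCon : Program :=
  .ifLt 0 (.get 20 (V 86) 1) (
    loop 85 (V 83) (
      .ifLt (V 84) (.get 27 0 (V 85)) .nop (.ifLt (.get 27 0 (V 85)) (V 84) .nop
        (.setIdx 26 0 (V 85) (.get 26 0 (V 85) + V 87))))) .nop

/-- The shift `e * S` requires no multiplication since `e` is 0 or 1: it is the representative of
the count 1, which is 0 for an automaton with a single state. -/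
theorem moveCon_spec {s : Store} {Q : Store → ℕ → Prop} (cnt S a e : ℕ)
    (hcnt : s.idx 83 0 0 = cnt) (hS : s.idx 87 0 0 = S) (ha : s.idx 84 0 0 = a)
    (he : s.idx 20 (s.idx 86 0 0) 1 = e) (he1 : e ≤ 1)
    (hQ : ∀ s' t, Frame moveCon s s' → t ≤ 80 * (cnt + 1) →
      (∀ i < cnt, s'.idx 26 0 i = s.idx 26 0 i + (if a = s.idx 27 0 i then e else 0) * S) →
        Q s' t) :
    WP moveCon s Q := by
  suffices H : WP moveCon s (fun s' t => t ≤ 80 * (cnt + 1) ∧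
      (∀ i < cnt, s'.idx 26 0 i = s.idx 26 0 i + (if a = s.idx 27 0 i then e else 0) * S)) from
    H.mono fun s' t h hF => hQ s' t hF h.1 h.2
  rw [moveCon, WP_ifLt]
  by_cases h0 : e = 0
  · rw [if_neg (by simp [he, h0])]
    simp [h0]
    omega
  have he' : e = 1 := by omega
  subst he'
  rw [if_pos (by simp [he])]
  refine WP_loop cnt 50 (fun m s' => ∀ i < cnt, s'.idx 26 0 i = s.idx 26 0 i +
      (if i < m ∧ a = s.idx 27 0 i then 1 else 0) * S) rfl ?_ ?_ ?_ ?_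
  · intro s' hF
    have := hF.idx 83 rfl
    simp [this, hcnt]
  · simp
  · rintro m s1 hm h1 h85 hF
    have e84 := hF.idx 84 rfl
    have e87 := hF.idx 87 rfl
    have e27 := hF.idx 27 rfl
    have h26 := h1 m hm
    rw [if_neg (by omega)] at h26
    simp only [WP_ifLt]
    simp [h85, e84, e87, e27, h26, hS, ha]
    have key : ∀ i < cnt, a ≠ s.idx 27 0 m → s1.idx 26 0 i = s.idx 26 0 i +
        if i ≤ m ∧ a = s.idx 27 0 i then S else 0 := by
      intro i hi hne
      rw [h1 i hi]
      by_cases him : i = m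
      · subst him; simp [hne]
      · have : i ≤ m ↔ i < m := by omega
        simp [this]
    split_ifs with c1 c2
    · exact fun i hi => key i hi (by omega)
    · exact fun i hi => key i hi (by omega)
    · intro i hi
      by_cases him : i = m
      · subst him
        rw [upd_same, if_pos ⟨by omega, by omega⟩]
      · rw [upd_ne _ _ (by omega), h1 i hi]
        have : i ≤ m ↔ i < m := by omega
        simp [this]
  · rintro s1 t h1 h85 hF ht
    simp at ht ⊢
    refine ⟨by omega, fun i hi => ?_⟩
    rw [h1 i hi]
    simp [hi]

theorem sum_range_block {M : Type*} [AddCommMonoid M] (c n : ℕ) (f : ℕ → M) :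
    ∑ x ∈ range (c * n), f x = ∑ d ∈ range c, ∑ i ∈ range n, f (d * n + i) := by
  induction c with
  | zero => simp
  | succ c ih => rw [add_mul, one_mul, sum_range_add, ih, sum_range_succ]

/-! ### Products of edges as sums of monomials -/

namespace Layout

/-- The element `f` is the sum of the monomials with the counts `q` at `r` and the places `off` in
the tables over `B`. -/
structure Expands (L : Layout) (K : Counter) (r : ℕ) (B : List ℕ) (cnt : ℕ) (off q : ℕ → ℕ)
    (f : Alg K) : Prop where
  pos : 0 < cnt
  le : cnt ≤ L.low r * L.size B
  off_lt : ∀ i < cnt, off i < L.size B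
  q_lt : ∀ i < cnt, q i < L.low r
  sum : ∑ i ∈ range cnt, L.gen K r (q i) * L.mono K B (off i) = f

variable {L : Layout} {K : Counter}

theorem Expands.var {r b cnt : ℕ} {B : List ℕ} {off q off' q' : ℕ → ℕ} {f : Alg K}
    (h : L.Expands K r B cnt off q f) (hr : L.Good r) (hrf : L.Fits K r) (hb : L.Good b)
    (hk : L.kind b = 0) (hB : ∀ b ∈ B, L.Good b)
    (hoff : ∀ d < 2, ∀ i < cnt, off' (d * cnt + i) = off i + d * L.size B)
    (hq : ∀ d < 2, ∀ i < cnt, q' (d * cnt + i) =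
      if (if L.kind r = 0 then 2 else L.act r b) = d then L.rd r (q i + 1) else q i) :
    L.Expands K r (b :: B) (2 * cnt) off' q' (L.edge K r b * f) := by
  have hd2 := (hb.var hk).2
  have hl2 := (hb.var hk).1
  have hsplit : ∀ x < 2 * cnt, ∃ d < 2, ∃ i < cnt, x = d * cnt + i := by
    intro x hx
    by_cases hxc : x < cnt
    · exact ⟨0, by omega, x, hxc, by omega⟩
    · exact ⟨1, by omega, x - cnt, by omega, by omega⟩
  refine ⟨by have := h.pos; omega, ?_, ?_, ?_, ?_⟩
  · rw [size_cons, hd2]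
    have := h.le
    have e : L.low r * (2 * L.size B) = 2 * (L.low r * L.size B) := by ring
    omega
  · intro x hx
    obtain ⟨d, hd, i, hi, rfl⟩ := hsplit x hx
    rw [hoff d hd i hi, size_cons, hd2]
    have := block_lt hd (h.off_lt i hi)
    omega
  · intro x hx
    obtain ⟨d, hd, i, hi, rfl⟩ := hsplit x hx
    rw [hq d hd i hi]
    split_ifs with h1 h2 h2
    · omega
    · exact h.q_lt i hi
    · exact (hr.con h1).2.2.2.1 _
    · exact h.q_lt i hi
  · rw [sum_range_block, sum_comm, ← h.sum, mul_sum]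
    refine sum_congr rfl fun i hi => ?_
    rw [mem_range] at hi
    rw [mul_left_comm, ← mul_assoc, gen_mul_edge_var (fun _ => hrf) hk, sum_mul]
    refine sum_congr rfl fun d hd => ?_
    rw [mem_range] at hd
    rw [hoff d hd i hi, hq d hd i hi, add_comm (off i), mono_cons (by omega) hB (h.off_lt i hi),
      mul_assoc]

theorem Expands.con {r b cnt : ℕ} {B : List ℕ} {off q off' : ℕ → ℕ} {f : Alg K}
    (h : L.Expands K r B cnt off q f) (hb : L.Good b) (hbf : L.Fits K b)
    (hk : L.kind b ≠ 0) (hB : ∀ b ∈ B, L.Good b)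
    (hoff : ∀ i < cnt, off' i = off i +
      (if L.kind r = 0 ∧ L.act b r = q i then L.rd b 1 else 0) * L.size B) :
    L.Expands K r (b :: B) cnt off' q (L.edge K r b * f) := by
  have hlow : ∀ i < cnt,
      (if L.kind r = 0 ∧ L.act b r = q i then L.rd b 1 else 0) < L.low b := by
    intro i _
    split_ifs
    · exact (hb.con hk).2.2.2.1 _
    · exact hb.low_pos
  refine ⟨h.pos, ?_, ?_, h.q_lt, ?_⟩
  · rw [size_cons]
    refine h.le.trans (Nat.mul_le_mul_left _ ?_)
    exact Nat.le_mul_of_pos_left _ hb.dim_pos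
  · intro i hi
    rw [hoff i hi, size_cons, add_comm]
    exact block_lt ((hlow i hi).trans_le hb.low_le_dim) (h.off_lt i hi)
  · rw [← h.sum, mul_sum]
    refine sum_congr rfl fun i hi => ?_
    rw [mem_range] at hi
    rw [mul_left_comm, ← mul_assoc, gen_mul_edge_con hbf hk, hoff i hi, add_comm (off i),
      mono_cons (hlow i hi) hB (h.off_lt i hi), mul_assoc]

/-- The empty product is the sum of both generators if `r` is a variable, and the generator of the
count 0 if `r` is a constraint. Both starting lists fit into the same two memory entries; only their
length differs. -/
theorem Expands.nil {r : ℕ} (hr : L.Good r) {off q : ℕ → ℕ} (h0 : off 0 = 0) (h1 : off 1 = 0)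
    (hq0 : q 0 = 0) (hq1 : q 1 = 1) :
    L.Expands K r [] (if L.kind r = 0 then 2 else 1) off q 1 := by
  by_cases hk : L.kind r = 0
  · have := (hr.var hk).1
    rw [if_pos hk]
    refine ⟨by omega, by simp [this], ?_, ?_, ?_⟩
    · intro i hi
      interval_cases i <;> simp [*]
    · intro i hi
      interval_cases i <;> simp [*]
    · rw [← sum_gen hk]
      refine sum_congr rfl fun i hi => ?_
      rw [mem_range] at hi
      interval_cases i <;> simp [*, mono_nil]
  · have := hr.low_pos
    rw [if_neg hk]
    refine ⟨by omega, by simp; omega, ?_, ?_, ?_⟩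
    · intro i hi
      interval_cases i; simp [*]
    · intro i hi
      interval_cases i; simp [*]
    · simp [h0, hq0, mono_nil, gen_zero hk]

theorem Expands.elem_eq {r cnt : ℕ} {B : List ℕ} {off q : ℕ → ℕ} {f : Alg K} {T : ℕ → ℂ}
    (h : L.Expands K r B cnt off q f) (hr : L.Good r) (hB : ∀ b ∈ B, L.Good b)
    (hT : ∀ x < L.size (r :: B),
      T x = ∑ i ∈ range cnt, if q i * L.size B + off i = x then (1 : ℂ) else 0) :
    L.elem K (r :: B) T = f := by
  have hB' : ∀ b ∈ r :: B, L.Good b := by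
    intro b hb
    rcases List.mem_cons.1 hb with rfl | hb
    exacts [hr, hB b hb]
  rw [← h.sum, elem_congr hB' (T' := fun x => ∑ i ∈ range cnt, (1 : ℂ) *
    if q i * L.size B + off i = x then (1 : ℂ) else 0) (by simpa using hT), elem_eq_sum_mono]
  refine sum_congr rfl fun i hi => ?_
  rw [mem_range] at hi
  rw [one_smul, mono_cons (h.q_lt i hi) hB (h.off_lt i hi)]

end Layout

open Program IExp in
/-- Multiplication of a sum of monomials by the edge between the vertices in the registers 80
and 86. -/
def expandEdge : Program :=
  .ifLt 0 (.get 13 0 (V 86))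
    (.ifLt 0 (.get 13 0 (V 80)) .nop (actOf (V 86) (V 80) ;; moveCon))
    (.ifLt 0 (.get 13 0 (V 80)) (actOf (V 80) (V 86)) (set 84 2) ;; splitVar)

theorem expandEdge_spec {L : Layout} {K : Counter} {n : ℕ} {s : Store} {Q : Store → ℕ → Prop}
    (hL : L.Holds n s) (r b : ℕ) {B : List ℕ} {cnt : ℕ} {f : Layout.Alg K} (hr : s.idx 80 0 0 = r)
    (hb : s.idx 86 0 0 = b) (hrn : r < n) (hbn : b < n) (hgr : L.Good r) (hfr : L.Fits K r)
    (hgb : L.Good b) (hfb : L.Fits K b) (hB : ∀ b ∈ B, L.Good b) (hS : s.idx 87 0 0 = L.size B)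
    (hcnt : s.idx 83 0 0 = cnt) (hE : L.Expands K r B cnt (s.idx 26 0) (s.idx 27 0) f)
    (hQ : ∀ s' t, Frame expandEdge s s' → t ≤ 600 * cnt →
      L.Expands K r (b :: B) (s'.idx 83 0 0) (s'.idx 26 0) (s'.idx 27 0) (L.edge K r b * f) →
      Q s' t) :
    WP expandEdge s Q := by
  suffices H : WP expandEdge s (fun s' t => t ≤ 600 * cnt ∧
      L.Expands K r (b :: B) (s'.idx 83 0 0) (s'.idx 26 0) (s'.idx 27 0) (L.edge K r b * f)) from
    H.mono fun s' t h hF => hQ s' t hF h.1 h.2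
  have hkr := hL.kind r hrn
  have hkb := hL.kind b hbn
  have hpos := hE.pos
  rw [expandEdge, WP_ifLt]
  by_cases hb0 : L.kind b = 0
  · rw [if_neg (by simp [hb, hkb, hb0]), WP_seq]
    have key : ∀ t0, t0 ≤ 60 → WP splitVar (s.setI 84 0 0 (if L.kind r = 0 then 2 else L.act r b))
        (fun s' t => t0 + t ≤ 550 * cnt ∧ L.Expands K r (b :: B) (s'.idx 83 0 0) (s'.idx 26 0)
          (s'.idx 27 0) (L.edge K r b * f)) := by
      intro t0 ht0
      refine splitVar_spec cnt (L.size B) _ (L.rd r) (by simp [hcnt]) hpos (by simp [hS])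
        (by simp; rfl) ?_ ?_
      · intro ha i hi
        have hr0 : L.kind r ≠ 0 := by
          intro h
          simp [h] at ha
        have := hE.q_lt i hi
        have h2 := (hgr.con hr0).2.2.1
        simp [hr]
        exact hL.rd r hrn hr0 _ (by omega)
      · intro s' t _ ht h83 h26 h27
        refine ⟨by omega, ?_⟩
        rw [h83]
        simp at h26 h27
        exact hE.var hgr hfr hgb hb0 hB (fun d hd => h26 d (by omega)) fun d hd => h27 d (by omega)
    rw [WP_ifLt]
    by_cases hr0 : L.kind r = 0
    · rw [if_neg (by simp [hr, hkr, hr0])]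
      have := key 20 (by omega)
      rw [if_pos hr0] at this
      simp only [WP_set]
      refine this.mono fun s' t h _ => ⟨?_, h.2⟩
      simp
      omega
    · rw [if_pos (by simp [hr, hkr]; omega)]
      refine actOf_spec hL (by simpa using hr) (by simpa using hb) hrn hbn hr0 hb0 ?_
      intro t1 ht1
      simp at ht1
      have := key 60 (by omega)
      rw [if_neg hr0] at this
      refine this.mono fun s' t h _ => ⟨?_, h.2⟩
      simp
      omega
  · rw [if_pos (by simp [hb, hkb]; omega), WP_ifLt]
    by_cases hr0 : L.kind r = 0
    · rw [if_neg (by simp [hr, hkr, hr0]), WP_seq]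
      refine actOf_spec hL (by simpa using hb) (by simpa using hr) hbn hrn hb0 hr0 ?_
      intro t1 ht1
      have h1 := hgb.con hb0
      have hrd := hL.rd b hbn hb0 1 (by omega)
      have hle1 : L.rd b 1 ≤ 1 := by
        -- If only the count 0 is significant, the representative of 1 must be 0; otherwise 1
        -- represents itself.
        by_cases hl : 1 < L.low b
        · exact (h1.2.2.2.2 1 hl).le
        · have := h1.2.2.2.1 1
          omega
      refine moveCon_spec cnt (L.size B) (L.act b r) (L.rd b 1) (by simp [hcnt]) (by simp [hS])
        (by simp) (by simp [hb, hrd]) hle1 ?_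
      intro s' t F ht h26
      have e27 := F.idx 27 rfl
      have e83 := F.idx 83 rfl
      simp at e27 e83 h26 ht1 ⊢
      refine ⟨by omega, ?_⟩
      rw [e83, hcnt, e27]
      refine hE.con hgb hfb hb0 hB fun i hi => ?_
      rw [h26 i hi]
      simp [hr0]
    · rw [if_pos (by simp [hr, hkr]; omega)]
      simp [hcnt]
      refine ⟨by omega, hE.con hgb hfb hb0 hB fun i hi => by simp [hr0]⟩

open Program IExp in
/-- The expansion of the product of the edges at the vertex in the register 80 into monomials. -/
def expandEdges : Program :=
  .setIdx 26 0 0 0 ;; .setIdx 26 0 1 0 ;; .setIdx 27 0 0 0 ;; .setIdx 27 0 1 1 ;;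
  set 83 2 ;; .ifLt 0 (.get 13 0 (V 80)) (set 83 1) .nop ;;
  loop 81 (.get 23 0 (V 80) - 1) (
    set 82 (.get 23 0 (V 80) - 1 - V 81) ;;
    set 86 (.get 22 (V 80) (V 82)) ;; set 87 (.get 24 (V 80) (V 82 + 1)) ;; expandEdge)

/-- Each factor is multiplied in at a cost proportional to the current number of monomials, which
never exceeds the number of entries of the final table. Hence one table costs its size times the
length of its list, without any Fourier transform. -/
theorem expandEdges_spec {L : Layout} {K : Counter} {n : ℕ} {s : Store} {Q : Store → ℕ → Prop}
    (hL : L.Holds n s) (r : ℕ) (B : List ℕ) (hr : s.idx 80 0 0 = r) (hrn : r < n)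
    (hbag : L.bag r = r :: B) (hB : ∀ b ∈ L.bag r, b < n ∧ L.Good b ∧ L.Fits K b)
    (hQ : ∀ s' t, Frame expandEdges s s' →
      t ≤ 700 * ((B.length + 1) * L.size (L.bag r)) →
      L.Expands K r B (s'.idx 83 0 0) (s'.idx 26 0) (s'.idx 27 0) (B.map (L.edge K r)).prod →
      Q s' t) :
    WP expandEdges s Q := by
  suffices H : WP expandEdges s (fun s' t =>
      t ≤ 700 * ((B.length + 1) * L.size (L.bag r)) ∧
      L.Expands K r B (s'.idx 83 0 0) (s'.idx 26 0) (s'.idx 27 0) (B.map (L.edge K r)).prod) from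
    H.mono fun s' t h hF => hQ s' t hF h.1 h.2
  obtain ⟨-, hgr, hfr⟩ := hB r (by simp [hbag])
  have hBn : ∀ b ∈ B, b < n ∧ L.Good b ∧ L.Fits K b := fun b hb => hB b (by simp [hbag, hb])
  have hlen := hL.len r hrn
  have hkr := hL.kind r hrn
  rw [hbag, List.length_cons] at hlen
  have hpos : 0 < L.size (L.bag r) := L.size_pos fun b hb => (hB b hb).2.1
  have hdrop : ∀ k, ∀ b ∈ B.drop k, L.Good b := fun k b hb => (hBn b (List.mem_of_mem_drop hb)).2.1
  have hszle : ∀ k, L.low r * L.size (B.drop k) ≤ L.size (L.bag r) := by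
    intro k
    rw [hbag, L.size_cons]
    refine Nat.mul_le_mul hgr.low_le_dim ?_
    conv_rhs => rw [← List.take_append_drop k B, L.size_append]
    exact Nat.le_mul_of_pos_left _ (L.size_pos fun b hb => (hBn b (List.mem_of_mem_take hb)).2.1)
  simp only [expandEdges, WP_seq, WP_setIdx, WP_set]
  set s0 := ((((s.setI 26 0 0 0).setI 26 0 1 0).setI 27 0 0 0).setI 27 0 1 1).setI 83 0 0 2 with hs0
  have key : ∀ (s1 : Store) (t0 : ℕ), t0 ≤ 60 →
      (s1 = if L.kind r = 0 then s0 else s0.setI 83 0 0 1) →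
      WP (Program.loop 81 (.get 23 0 (V 80) - 1) (
      .set 82 (.get 23 0 (V 80) - 1 - V 81) ;;
      .set 86 (.get 22 (V 80) (V 82)) ;; .set 87 (.get 24 (V 80) (V 82 + 1)) ;; expandEdge))
      s1 (fun s' t => t0 + t ≤ 700 * ((B.length + 1) * L.size (L.bag r)) ∧
      L.Expands K r B (s'.idx 83 0 0) (s'.idx 26 0) (s'.idx 27 0)
        (B.map (L.edge K r)).prod) := by
    intro s1 t0 ht0 hs1
    have hb80 : s1.idx 80 0 0 = r := by rw [hs1]; split_ifs <;> simp [hs0, hr]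
    have hb23 : s1.idx 23 = s.idx 23 := by rw [hs1]; split_ifs <;> simp [hs0]
    have hL1 : L.Holds n s1 := by
      refine hL.congr fun a ha => ?_
      have : ∀ b : ℕ, b ∉ Layout.arrays → a ≠ b := fun b hb h => hb (h ▸ ha)
      have h26 := this 26 (by simp [Layout.arrays])
      have h27 := this 27 (by simp [Layout.arrays])
      have h83 := this 83 (by simp [Layout.arrays])
      rw [hs1]; split_ifs <;> simp [hs0, h26, h27, h83]
    refine WP_loop B.length (600 * L.size (L.bag r) + 60) (fun m s' =>
      L.Expands K r (B.drop (B.length - m)) (s'.idx 83 0 0) (s'.idx 26 0) (s'.idx 27 0)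
        ((B.drop (B.length - m)).map (L.edge K r)).prod) rfl ?_ ?_ ?_ ?_
    · intro s' hF
      simp [hF.idx 23 rfl, hF.idx 80 rfl, hb80, hb23, hlen]
    · have := Layout.Expands.nil (K := K) hgr (off := s0.idx 26 0) (q := s0.idx 27 0)
        (by simp [hs0, upd]) (by simp [hs0, upd]) (by simp [hs0, upd]) (by simp [hs0, upd])
      simp
      have e83 : s1.idx 83 0 0 = if L.kind r = 0 then 2 else 1 := by
        rw [hs1]; split_ifs <;> simp [hs0]
      have e26 : s1.idx 26 = s0.idx 26 := by rw [hs1]; split_ifs <;> simp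
      have e27 : s1.idx 27 = s0.idx 27 := by rw [hs1]; split_ifs <;> simp
      rw [e83, e26, e27]
      exact this
    · rintro m s2 hm hE h81 hF
      have hL2 := hL1.frame hF rfl
      obtain ⟨k, hk⟩ : ∃ k, k = B.length - (m + 1) := ⟨_, rfl⟩
      have hk1 : B.length - m = k + 1 := by omega
      have hkl : k < B.length := by omega
      rw [hk1] at hE
      rw [← hk]
      have hd : B.drop k = B[k] :: B.drop (k + 1) := List.drop_eq_getElem_cons hkl
      have e80 : s2.idx 80 0 0 = r := by rw [hF.idx 80 rfl, hb80]
      have e23 : s2.idx 23 0 r = B.length + 1 := by rw [hF.idx 23 rfl, hb23, hlen]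
      have ev : B.length - m = k + 1 := hk1
      have hbg := hL2.bag r hrn (k + 1) (by rw [hbag]; simp; omega)
      have hsz := hL2.sz r hrn (k + 2) (by rw [hbag]; simp; omega)
      have hbg' : (L.bag r)[k + 1]'(by rw [hbag]; simp; omega) = B[k] := by simp [hbag]
      have hdr : (L.bag r).drop (k + 2) = B.drop (k + 1) := by rw [hbag]; rfl
      rw [hbg'] at hbg
      rw [hdr] at hsz
      obtain ⟨hbn, hgb, hfb⟩ := hBn B[k] (List.getElem_mem hkl)
      simp only [WP_seq, WP_set]
      simp [e80, e23, h81, ev, hbg, hsz]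
      refine expandEdge_spec (L := L) (K := K) (n := n) (B := B.drop (k + 1)) ?_ r B[k]
        (by simp [e80]) (by simp) hrn hbn hgr hfr hgb hfb (hdrop _) (by simp) (by simp; rfl)
        (by simpa using hE) ?_
      · exact ((hL2.setI (by simp [Layout.arrays]) _ _ _).setI (by simp [Layout.arrays]) _ _ _).setI
          (by simp [Layout.arrays]) _ _ _
      intro s3 t3 F3 ht3 hE3
      have := hE.le.trans (hszle (k + 1))
      have hp : (List.drop k (B.map (L.edge K r))).prod =
          L.edge K r B[k] * ((B.drop (k + 1)).map (L.edge K r)).prod := by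
        rw [← List.map_drop, hd, List.map_cons, List.prod_cons]
      rw [← hd] at hE3
      simp only [Store.setI_idx_ne _ _ _ _ (by norm_num : (83 : ℕ) ≠ 81),
        Store.setI_idx_ne _ _ _ _ (by norm_num : (26 : ℕ) ≠ 81),
        Store.setI_idx_ne _ _ _ _ (by norm_num : (27 : ℕ) ≠ 81), hp]
      rw [List.map_drop]
      exact ⟨hE3, by omega⟩
    · rintro s2 t2 hE h81 hF ht2
      simp at ht2 hE
      refine ⟨?_, hE⟩
      have h1 : B.length * (600 * L.size (L.bag r) + 60 + 19) =
        600 * (B.length * L.size (L.bag r)) + 79 * B.length := by ring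
      have h2 : B.length * 1 ≤ B.length * L.size (L.bag r) := Nat.mul_le_mul_left _ hpos
      rw [add_mul]
      omega
  rw [WP_ifLt]
  by_cases hr0 : L.kind r = 0
  · rw [if_neg (by simp [hs0, hr, hkr, hr0])]
    have := key _ 60 (by omega) rfl
    rw [if_pos hr0] at this
    rw [WP_nop]
    refine this.mono fun s' t h _ => ⟨?_, h.2⟩
    simp
    omega
  · rw [if_pos (by simp [hs0, hr, hkr]; omega)]
    have := key _ 60 (by omega) rfl
    rw [if_neg hr0] at this
    rw [WP_set]
    refine this.mono fun s' t h _ => ⟨?_, h.2⟩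
    simp
    omega

open Program IExp in
/-- Writing the sum of the monomials in the arrays 26 and 27 to the table of the vertex in the
register 80. -/
def scatter : Program :=
  set 87 (.get 24 (V 80) 1) ;; .setIdx 28 0 0 0 ;;
  loop 85 (.get 16 0 (V 80)) (.setIdx 28 0 (V 85 + 1) (.get 28 0 (V 85) + V 87)) ;;
  loop 85 (.get 24 (V 80) 0) (.setNum 1 (V 80) (V 85) (.cast 0)) ;;
  loop 85 (V 83) (
    set 86 (.get 28 0 (.get 27 0 (V 85)) + .get 26 0 (V 85)) ;;
    .setNum 1 (V 80) (V 86) (.get 1 (V 80) (V 86) + .cast 1))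

/-- The multiples of the stride `S` are tabulated by repeated addition, which replaces the product
in the address `q * S + off`. Adding 1 at each address, rather than writing it, makes it unnecessary
to know that addresses are distinct. -/
theorem scatter_spec {s : Store} {Q : Store → ℕ → Prop} (r S low size cnt : ℕ)
    (hr : s.idx 80 0 0 = r) (hS : s.idx 24 r 1 = S) (hlow : s.idx 16 0 r = low)
    (hsize : s.idx 24 r 0 = size) (hcnt : s.idx 83 0 0 = cnt) (hq : ∀ i < cnt, s.idx 27 0 i < low)
    (hlt : ∀ i < cnt, s.idx 27 0 i * S + s.idx 26 0 i < size)
    (hQ : ∀ s' t, Frame scatter s s' → t ≤ 100 * (low + size + cnt + 1) →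
      (∀ i, i ≠ r → s'.num 1 i = s.num 1 i) →
      (∀ x < size, s'.num 1 r x =
        ∑ i ∈ range cnt, if s.idx 27 0 i * S + s.idx 26 0 i = x then (1 : ℂ) else 0) → Q s' t) :
    WP scatter s Q := by
  suffices H : WP scatter s (fun s' t => t ≤ 100 * (low + size + cnt + 1) ∧
      (∀ i, i ≠ r → s'.num 1 i = s.num 1 i) ∧
      (∀ x < size, s'.num 1 r x =
        ∑ i ∈ range cnt, if s.idx 27 0 i * S + s.idx 26 0 i = x then (1 : ℂ) else 0)) from
    H.mono fun s' t h hF => hQ s' t hF h.1 h.2.1 h.2.2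
  simp only [scatter, WP_seq, WP_set, WP_setIdx]
  refine WP_loop low 20 (fun m s' => ∀ d ≤ m, s'.idx 28 0 d = d * S) rfl ?_ ?_ ?_ ?_
  · intro s' hF
    have h1 := hF.idx 16 rfl
    have h2 := hF.idx 80 rfl
    simp at h1 h2
    simp [h1, h2, hr, hlow]
  · intro d hd
    obtain rfl : d = 0 := by omega
    simp
  · rintro m s1 hm h1 h85 hF
    have e87 := hF.idx 87 rfl
    simp [hr, hS] at e87
    simp [h85, h1 m le_rfl, e87]
    intro d hd
    by_cases h : d = m + 1
    · subst h
      rw [upd_same]; ring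
    · rw [upd_ne _ _ (by omega), h1 d (by omega)]
  rintro s1 t1 h28 - F1 ht1
  have f24 := F1.idx 24 rfl
  have f80 := F1.idx 80 rfl
  have f83 := F1.idx 83 rfl
  have f26 := F1.idx 26 rfl
  have f27 := F1.idx 27 rfl
  have f1 := F1.num 1 rfl
  simp at f24 f80 f83 f26 f27 f1 ht1
  refine WP_loop_setNum size r (fun _ => 0) (by simp [f80, hr]) (by simp)
    (by simp [f24, f80, hr, hsize]) ?_
  intro t2 ht2
  simp at ht2
  refine WP_loop cnt 40 (fun m s' => (∀ i, i ≠ r → s'.num 1 i = s.num 1 i) ∧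
      (∀ x < size, s'.num 1 r x =
        ∑ i ∈ range m, if s.idx 27 0 i * S + s.idx 26 0 i = x then (1 : ℂ) else 0)) rfl ?_ ?_ ?_ ?_
  · intro s' hF
    have := hF.idx 83 rfl
    simp at this
    simp [this, f83, hcnt]
  · simp [-sum_boole]
    refine ⟨fun i hi => ?_, fun x hx => ?_⟩
    · rw [fillRow_ne _ _ _ hi, f1]
    · rw [fillRow_lt _ _ _ hx]
  · rintro m s2 hm ⟨hrow, hx⟩ h85 hF
    have e28 := hF.idx 28 rfl
    have e27 := hF.idx 27 rfl
    have e26 := hF.idx 26 rfl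
    have e80 := hF.idx 80 rfl
    simp at e28 e27 e26 e80
    simp [h85, e28, e27, e26, e80, f27, f26, f80, hr, h28 _ (hq m hm).le, -sum_boole]
    refine ⟨fun i hi => ?_, fun x hxs => ?_⟩
    · rw [upd_row_ne _ _ _ hi, hrow i hi]
    · rw [sum_range_succ]
      by_cases h : s.idx 27 0 m * S + s.idx 26 0 m = x
      · rw [h, upd_same, hx x hxs, if_pos rfl]
      · rw [upd_ne _ _ (by omega), hx x hxs, if_neg h, add_zero]
  · rintro s2 t3 ⟨hrow, hx⟩ - F2 ht3
    simp [-sum_boole] at ht3 ⊢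
    exact ⟨by omega, hrow, hx⟩

open Program IExp in
/-- The table of the product of the edges at the vertex in the register 80. -/
def initTable : Program := expandEdges ;; scatter

theorem initTable_spec {L : Layout} {K : Counter} {n : ℕ} {s : Store} {Q : Store → ℕ → Prop}
    (hL : L.Holds n s) (r : ℕ) (B : List ℕ) (hr : s.idx 80 0 0 = r) (hrn : r < n)
    (hbag : L.bag r = r :: B) (hB : ∀ b ∈ L.bag r, b < n ∧ L.Good b ∧ L.Fits K b)
    (hQ : ∀ s' t, Frame initTable s s' →
      t ≤ 1100 * ((B.length + 1) * L.size (L.bag r)) → (∀ i, i ≠ r → s'.num 1 i = s.num 1 i) →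
      L.elem K (L.bag r) (s'.num 1 r) = (B.map (L.edge K r)).prod → Q s' t) :
    WP initTable s Q := by
  suffices H : WP initTable s (fun s' t => t ≤ 1100 * ((B.length + 1) * L.size (L.bag r)) ∧
      (∀ i, i ≠ r → s'.num 1 i = s.num 1 i) ∧
      L.elem K (L.bag r) (s'.num 1 r) = (B.map (L.edge K r)).prod) from
    H.mono fun s' t h hF => hQ s' t hF h.1 h.2.1 h.2.2
  obtain ⟨-, hgr, hfr⟩ := hB r (by simp [hbag])
  have hBn : ∀ b ∈ B, L.Good b := fun b hb => (hB b (by simp [hbag, hb])).2.1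
  have hpos : 0 < L.size (L.bag r) := L.size_pos fun b hb => (hB b hb).2.1
  have hposB : 0 < L.size B := L.size_pos hBn
  rw [initTable, WP_seq]
  refine expandEdges_spec hL r B hr hrn hbag hB ?_
  intro s1 t1 F1 ht1 hE
  have hL1 := hL.frame F1 rfl
  have hsz : L.size (L.bag r) = L.dim r * L.size B := by rw [hbag, L.size_cons]
  refine scatter_spec r (L.size B) (L.low r) (L.size (L.bag r)) _ (by rw [F1.idx 80 rfl, hr])
    (by rw [hL1.sz r hrn 1 (by simp [hbag]), hbag]; rfl) (hL1.low r hrn)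
    (by rw [hL1.sz r hrn 0 (by simp), List.drop_zero]) rfl hE.q_lt ?_ ?_
  · intro i hi
    rw [hsz]
    exact block_lt ((hE.q_lt i hi).trans_le hgr.low_le_dim) (hE.off_lt i hi)
  intro s2 t2 F2 ht2 hrow hx
  refine ⟨?_, fun i hi => by rw [hrow i hi, F1.num 1 rfl], ?_⟩
  · have h1 := hE.le
    have h2 : L.low r * L.size B ≤ L.size (L.bag r) := by
      rw [hsz]; exact Nat.mul_le_mul_right _ hgr.low_le_dim
    have h3 : L.low r * 1 ≤ L.low r * L.size B := Nat.mul_le_mul_left _ hposB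
    rw [add_mul] at ht1 ⊢
    omega
  · rw [hbag]
    exact hE.elem_eq hgr hBn (by rw [← hbag]; exact hx)

/-! ## Elimination of a vertex -/

open Program IExp in
/-- The table of the vertex in the register 80 after its elimination, to the array 4. -/
def message : Program :=
  loop 93 (.get 24 (V 80) 1) (.setNum 4 0 (V 93) (.cast 0)) ;; set 95 0 ;;
  loop 94 (.get 16 0 (V 80)) (
    loop 93 (.get 24 (V 80) 1) (.setNum 4 0 (V 93)
      (.get 4 0 (V 93) + .cast (.get 21 (V 80) (V 94)) * .get 1 (V 80) (V 95 + V 93))) ;;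
    set 95 (V 95 + .get 24 (V 80) 1))

theorem message_spec {s : Store} {Q : Store → ℕ → Prop} (r S low : ℕ) (wt : ℕ → ℕ)
    (hr : s.idx 80 0 0 = r) (hS : s.idx 24 r 1 = S) (hlow : s.idx 16 0 r = low) (hS0 : 0 < S)
    (hlow0 : 0 < low) (hwt : ∀ d < low, s.idx 21 r d = wt d)
    (hQ : ∀ s' t, Frame message s s' → t ≤ 300 * (low * S) →
      (∀ x < S, s'.num 4 0 x = ∑ d ∈ range low, (wt d : ℂ) * s.num 1 r (d * S + x)) → Q s' t) :
    WP message s Q := by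
  suffices H : WP message s (fun s' t => t ≤ 300 * (low * S) ∧
      (∀ x < S, s'.num 4 0 x = ∑ d ∈ range low, (wt d : ℂ) * s.num 1 r (d * S + x))) from
    H.mono fun s' t h hF => hQ s' t hF h.1 h.2
  rw [message, WP_seq]
  refine WP_loop_setNum S 0 (fun _ => 0) (by simp) (by simp) (by simp [hr, hS]) ?_
  intro t1 ht1
  simp only [WP_seq, WP_set]
  simp at ht1
  refine WP_loop low (80 * S) (fun m s' => s'.idx 95 0 0 = m * S ∧
    ∀ x < S, s'.num 4 0 x = ∑ d ∈ range m, (wt d : ℂ) * s.num 1 r (d * S + x)) rfl ?_ ?_ ?_ ?_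
  · intro s' hF
    have h1 := hF.idx 16 rfl
    have h2 := hF.idx 80 rfl
    simp at h1 h2
    simp [h1, h2, hr, hlow]
  · simp
    intro x hx
    rw [fillRow_lt _ _ _ hx]
  · rintro m s1 hm ⟨h95, h4⟩ h94 hF
    have e80 := hF.idx 80 rfl
    have e24 := hF.idx 24 rfl
    have e21 := hF.idx 21 rfl
    have e1 := hF.num 1 rfl
    simp at e80 e24 e21 e1
    rw [WP_seq]
    refine WP_loop_setNum S 0 (fun x => s1.num 4 0 x + (wt m : ℂ) * s.num 1 r (m * S + x))
      (by simp) ?_ (by simp [e80, e24, hr, hS]) ?_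
    · intro x hx
      simp [e80, e21, e1, hr, h95, h94, hwt m hm, fillRow_ge]
    · intro t2 ht2
      simp at ht2
      simp [e80, e24, hr, hS, h95]
      refine ⟨⟨by ring, fun x hx => ?_⟩, by omega⟩
      rw [fillRow_lt _ _ _ hx, sum_range_succ, h4 x hx]
  · rintro s1 t2 ⟨-, h4⟩ - - ht2
    simp at ht2 ⊢
    refine ⟨?_, h4⟩
    have h1 : low * (80 * S + 17) = 80 * (low * S) + 17 * low := by ring
    have h2 : low * 1 ≤ low * S := Nat.mul_le_mul_left _ hS0
    have h3 : 1 * S ≤ low * S := Nat.mul_le_mul_right _ hlow0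
    omega

/-! ### Embedding the table of a vertex into the table of its parent -/

namespace Layout

/-- The places `src` and `dst` embed the tables over `A` into the tables over `B`. -/
structure Embeds (L : Layout) (K : Counter) (A B : List ℕ) (cnt : ℕ) (src dst : ℕ → ℕ) : Prop where
  pos : 0 < cnt
  le : cnt ≤ L.size B
  src_lt : ∀ i < cnt, src i < L.size A
  dst_lt : ∀ i < cnt, dst i < L.size B
  sum : ∀ M : ℕ → ℂ, ∑ i ∈ range cnt, M (src i) • L.mono K B (dst i) = L.elem K A M

variable {L : Layout} {K : Counter}

theorem Embeds.nil {src dst : ℕ → ℕ} (h0 : src 0 = 0) (h1 : dst 0 = 0) :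
    L.Embeds K [] [] 1 src dst := by
  refine ⟨by omega, by simp, by simp [h0], by simp [h1], fun M => ?_⟩
  simp [h0, h1, mono_nil, elem, alg_smul_def]

theorem exists_block {c cnt x : ℕ} (hx : x < c * cnt) : ∃ d < c, ∃ i < cnt, x = d * cnt + i := by
  have h0 : 0 < cnt := Nat.pos_of_ne_zero (by rintro rfl; simp at hx)
  refine ⟨x / cnt, (Nat.div_lt_iff_lt_mul h0).2 hx, x % cnt, Nat.mod_lt _ h0,
    (Nat.div_add_mod' x cnt).symm⟩

theorem Embeds.mem {A B : List ℕ} {b cnt : ℕ} {src dst src' dst' : ℕ → ℕ}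
    (h : L.Embeds K A B cnt src dst) (hb : L.Good b) (hB : ∀ b ∈ B, L.Good b)
    (hsrc : ∀ d < L.low b, ∀ i < cnt, src' (d * cnt + i) = src i + d * L.size A)
    (hdst : ∀ d < L.low b, ∀ i < cnt, dst' (d * cnt + i) = dst i + d * L.size B) :
    L.Embeds K (b :: A) (b :: B) (L.low b * cnt) src' dst' := by
  refine ⟨Nat.mul_pos hb.low_pos h.pos, ?_, ?_, ?_, fun M => ?_⟩
  · rw [size_cons]
    exact Nat.mul_le_mul hb.low_le_dim h.le
  · intro x hx
    obtain ⟨d, hd, i, hi, rfl⟩ := exists_block hx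
    rw [hsrc d hd i hi, size_cons, add_comm]
    exact block_lt (hd.trans_le hb.low_le_dim) (h.src_lt i hi)
  · intro x hx
    obtain ⟨d, hd, i, hi, rfl⟩ := exists_block hx
    rw [hdst d hd i hi, size_cons, add_comm]
    exact block_lt (hd.trans_le hb.low_le_dim) (h.dst_lt i hi)
  · rw [sum_range_block, elem_cons]
    refine sum_congr rfl fun d hd => ?_
    rw [mem_range] at hd
    rw [← h.sum, mul_sum]
    refine sum_congr rfl fun i hi => ?_
    rw [mem_range] at hi
    rw [hsrc d hd i hi, hdst d hd i hi, add_comm (dst i), mono_cons hd hB (h.dst_lt i hi),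
      mul_smul_comm, add_comm (src i)]

/-- A coordinate that is missing in the smaller table enters through the factor 1: the sum of both
generators for a variable, the generator of the count 0 for a constraint. The source address
therefore ignores the new coordinate. -/
theorem Embeds.notMem {A B : List ℕ} {b cnt c : ℕ} {src dst src' dst' : ℕ → ℕ}
    (h : L.Embeds K A B cnt src dst) (hb : L.Good b) (hB : ∀ b ∈ B, L.Good b)
    (hc : c = if L.kind b = 0 then 2 else 1)
    (hsrc : ∀ d < c, ∀ i < cnt, src' (d * cnt + i) = src i)
    (hdst : ∀ d < c, ∀ i < cnt, dst' (d * cnt + i) = dst i + d * L.size B) :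
    L.Embeds K A (b :: B) (c * cnt) src' dst' := by
  have hcl : c ≤ L.low b := by
    split_ifs at hc with hk
    · have := (hb.var hk).1
      omega
    · have := hb.low_pos
      omega
  have hsum : ∑ d ∈ range c, L.gen K b d = 1 := by
    split_ifs at hc with hk
    · rw [hc, sum_gen hk]
    · rw [hc, sum_range_one, gen_zero hk]
  have hc0 : 0 < c := by split_ifs at hc <;> omega
  refine ⟨Nat.mul_pos hc0 h.pos, ?_, ?_, ?_, fun M => ?_⟩
  · rw [size_cons]
    exact Nat.mul_le_mul (hcl.trans hb.low_le_dim) h.le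
  · intro x hx
    obtain ⟨d, hd, i, hi, rfl⟩ := exists_block hx
    rw [hsrc d hd i hi]
    exact h.src_lt i hi
  · intro x hx
    obtain ⟨d, hd, i, hi, rfl⟩ := exists_block hx
    rw [hdst d hd i hi, size_cons, add_comm]
    exact block_lt ((hd.trans_le hcl).trans_le hb.low_le_dim) (h.dst_lt i hi)
  · rw [sum_range_block, ← h.sum, ← one_mul (∑ i ∈ range cnt, _), ← hsum, sum_mul]
    refine sum_congr rfl fun d hd => ?_
    rw [mem_range] at hd
    rw [mul_sum]
    refine sum_congr rfl fun i hi => ?_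
    rw [mem_range] at hi
    rw [hsrc d hd i hi, hdst d hd i hi, add_comm (dst i),
      mono_cons (hd.trans_le hcl) hB (h.dst_lt i hi), mul_smul_comm]

theorem Embeds.elem_eq {A B : List ℕ} {cnt : ℕ} {src dst : ℕ → ℕ} {M T : ℕ → ℂ}
    (h : L.Embeds K A B cnt src dst) (hB : ∀ b ∈ B, L.Good b)
    (hT : ∀ x < L.size B, T x = ∑ i ∈ range cnt, M (src i) * if dst i = x then (1 : ℂ) else 0) :
    L.elem K B T = L.elem K A M := by
  rw [elem_congr hB hT, elem_eq_sum_mono, h.sum]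

end Layout

open Program IExp in
/-- The places of the table of the vertex in the register 80, without its first coordinate, in the
table of the vertex in the register 70. -/
def embedding : Program :=
  .setIdx 26 0 0 0 ;; .setIdx 27 0 0 0 ;; set 83 1 ;; set 96 (.get 23 0 (V 80)) ;;
  loop 81 (.get 23 0 (V 70)) (
    set 82 (.get 23 0 (V 70) - 1 - V 81) ;;
    set 86 (.get 22 (V 70) (V 82)) ;; set 87 (.get 24 (V 70) (V 82 + 1)) ;;
    .ifLt 0 (.get 25 (V 80) (V 86))
      (set 89 (.get 24 (V 80) (V 96)) ;; set 88 (.get 16 0 (V 86)) ;; set 96 (V 96 - 1))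
      (set 89 0 ;; .ifLt 0 (.get 13 0 (V 86)) (set 88 1) (set 88 2)) ;;
    extend)

/-- The list of `p` is traversed from its end. The coordinates seen so far that also belong to `r`
form a suffix of the list of `r`, so the stride in the smaller table is already stored; the register
96 points to this suffix and moves down at every common coordinate. -/
theorem embedding_spec {L : Layout} {K : Counter} {n : ℕ} {s : Store} {Q : Store → ℕ → Prop}
    (hL : L.Holds n s) (r p : ℕ) {A : List ℕ} (hr : s.idx 80 0 0 = r) (hp : s.idx 70 0 0 = p)
    (hrn : r < n) (hpn : p < n) (hbag : L.bag r = r :: A)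
    (hA : (L.bag p).filter (fun b => decide (b ∈ L.bag r)) = A) (hB : ∀ b ∈ L.bag p, b < n ∧ L.Good b)
    (hQ : ∀ s' t, Frame embedding s s' →
      t ≤ 400 * (((L.bag p).length + 1) * L.size (L.bag p)) →
      L.Embeds K A (L.bag p) (s'.idx 83 0 0) (s'.idx 27 0) (s'.idx 26 0) → Q s' t) :
    WP embedding s Q := by
  suffices H : WP embedding s (fun s' t => t ≤ 400 * (((L.bag p).length + 1) * L.size (L.bag p)) ∧
      L.Embeds K A (L.bag p) (s'.idx 83 0 0) (s'.idx 27 0) (s'.idx 26 0)) from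
    H.mono fun s' t h hF => hQ s' t hF h.1 h.2
  set B := L.bag p with hBdef
  set φ : ℕ → Bool := fun b => decide (b ∈ L.bag r) with hφ
  have hpos : 0 < L.size B := L.size_pos fun b hb => (hB b hb).2
  have hdrop : ∀ k, ∀ b ∈ B.drop k, L.Good b := fun k b hb => (hB b (List.mem_of_mem_drop hb)).2
  have hszle : ∀ k, L.size (B.drop k) ≤ L.size B := by
    intro k
    conv_rhs => rw [← List.take_append_drop k B, L.size_append]
    exact Nat.le_mul_of_pos_left _ (L.size_pos fun b hb => (hB b (List.mem_of_mem_take hb)).2)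
  have hlenr := hL.len r hrn
  have hlenp := hL.len p hpn
  -- Filtering preserves suffixes, and by `hA` the filtered list of `p` is the tail of the list of
  -- `r`.
  have hsuf : ∀ k, (B.drop k).filter φ = (L.bag r).drop
      ((L.bag r).length - ((B.drop k).filter φ).length) := by
    intro k
    refine List.suffix_iff_eq_drop.1 ?_
    have h1 : (B.drop k).filter φ <:+ B.filter φ := (List.drop_suffix k B).filter _
    rw [hA] at h1
    exact h1.trans (by rw [hbag]; exact List.suffix_cons r A)
  have hle : ∀ k, ((B.drop k).filter φ).length ≤ (L.bag r).length := by
    intro k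
    have := congrArg List.length (hsuf k)
    rw [List.length_drop] at this
    omega
  simp only [embedding, WP_seq, WP_setIdx, WP_set]
  refine WP_loop B.length (100 * L.size B + 130) (fun m s' =>
    s'.idx 96 0 0 = (L.bag r).length - ((B.drop (B.length - m)).filter φ).length ∧
    L.Embeds K ((B.drop (B.length - m)).filter φ) (B.drop (B.length - m)) (s'.idx 83 0 0)
      (s'.idx 27 0) (s'.idx 26 0)) rfl ?_ ?_ ?_ ?_
  · intro s' hF
    have h1 := hF.idx 23 rfl
    have h2 := hF.idx 70 rfl
    simp at h1 h2
    simp [h1, h2, hp, hlenp, hBdef]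
  · have := Layout.Embeds.nil (L := L) (K := K) (src := fun _ => 0) (dst := fun _ => 0) rfl rfl
    simp [hr, hlenr]
    exact Layout.Embeds.nil (by simp) (by simp)
  · rintro m s1 hm ⟨h96, hE⟩ h81 hF
    have hL1 : L.Holds n s1 := by
      refine Layout.Holds.frame ?_ hF rfl
      exact (((hL.setI (by simp [Layout.arrays]) _ _ _).setI (by simp [Layout.arrays]) _ _ _).setI
        (by simp [Layout.arrays]) _ _ _).setI (by simp [Layout.arrays]) _ _ _
    obtain ⟨k, hk⟩ : ∃ k, k = B.length - (m + 1) := ⟨_, rfl⟩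
    have hk1 : B.length - m = k + 1 := by omega
    have hkl : k < B.length := by omega
    rw [hk1] at hE h96
    rw [← hk]
    have hd : B.drop k = B[k] :: B.drop (k + 1) := List.drop_eq_getElem_cons hkl
    have e80 := hF.idx 80 rfl
    have e70 := hF.idx 70 rfl
    simp at e80 e70
    have ev : B.length - 1 - m = k := by omega
    have hlen1 := hL1.len p hpn
    have hbg := hL1.bag p hpn k hkl
    have hsz := hL1.sz p hpn (k + 1) hkl
    obtain ⟨hbn, hgb⟩ := hB B[k] (List.getElem_mem hkl)
    set b := B[k] with hb
    have hmark := hL1.mark r hrn b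
    have hszr := hL1.sz r hrn _ (Nat.sub_le (L.bag r).length
      ((B.drop (k + 1)).filter φ).length)
    have hlow := hL1.low b hbn
    have hkind := hL1.kind b hbn
    have hpos' := hE.pos
    rw [← hsuf] at hszr
    simp only [WP_seq, WP_set, WP_ifLt]
    rw [← hBdef] at hlen1
    simp [e80, e70, hr, hp, hlen1, h81, ev, hbg, ← hBdef, ← hb, hmark]
    have hbound : L.low b * s1.idx 83 0 0 ≤ L.size B := by
      refine le_trans ?_ (hszle k)
      rw [hd, L.size_cons]
      exact Nat.mul_le_mul hgb.low_le_dim hE.le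
    by_cases hbm : b ∈ L.bag r
    · have hfil : (B.drop k).filter φ = b :: (B.drop (k + 1)).filter φ := by
        rw [hd, List.filter_cons_of_pos (by simpa [hφ] using hbm)]
      have hle' := hle k
      rw [hfil, List.length_cons] at hle'
      have hlp := hgb.low_pos
      rw [if_pos hbm]
      simp [e80, hr, h96, hszr, hlow]
      refine extend_spec (s1.idx 83 0 0) (L.size (B.drop (k + 1)))
        (L.size ((B.drop (k + 1)).filter φ)) (L.low b - 1) (by simp) hpos' (by simpa using hsz)
        (by simp) (by simp; omega) ?_
      intro s2 t2 F2 ht2 h83 h90 h26 h27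
      rw [Nat.sub_add_cancel hlp] at ht2 h83 h26 h27
      have e96 := F2.idx 96 rfl
      simp at e96 h26 h27 ⊢
      rw [hfil, e96, h83, hd]
      refine ⟨⟨by simp; omega, hE.mem hgb (hdrop _) h27 h26⟩, by omega⟩
    · have hfil : (B.drop k).filter φ = (B.drop (k + 1)).filter φ := by
        rw [hd, List.filter_cons_of_neg (by simpa [hφ] using hbm)]
      rw [if_neg hbm]
      simp [hkind]
      have fin : ∀ (s2 : Store) (t0 : ℕ), t0 ≤ 100 → s2.idx 83 0 0 = s1.idx 83 0 0 →
          s2.idx 87 0 0 = L.size (B.drop (k + 1)) → s2.idx 89 0 0 = 0 →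
          s2.idx 88 0 0 = (if L.kind b = 0 then 2 else 1) → s2.idx 96 0 0 = s1.idx 96 0 0 →
          s2.idx 26 = s1.idx 26 → s2.idx 27 = s1.idx 27 →
          WP extend s2 (fun s' t => (s'.idx 96 0 0 =
            (L.bag r).length - ((B.drop k).filter φ).length ∧
            L.Embeds K ((B.drop k).filter φ) (B.drop k) (s'.idx 83 0 0)
              (s'.idx 27 0) (s'.idx 26 0)) ∧ t0 + t ≤ 100 * L.size B + 130) := by
        intro s2 t0 ht0 g83 g87 g89 g88 g96 g26 g27
        have hc1 : (if L.kind b = 0 then 2 else 1) = (if L.kind b = 0 then 1 else 0) + 1 := by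
          split_ifs <;> rfl
        refine extend_spec (s1.idx 83 0 0) (L.size (B.drop (k + 1))) 0
          (if L.kind b = 0 then 1 else 0) g83 hpos' g87 g89 (by rw [g88, hc1]) ?_
        intro s3 t3 F3 ht3 h83 h90 h26 h27
        rw [← hc1] at ht3 h83 h26 h27
        have hcl : (if L.kind b = 0 then 2 else 1) ≤ L.low b := by
          split_ifs with hk0
          · exact (hgb.var hk0).1.ge
          · exact hgb.low_pos
        have := Nat.mul_le_mul_right (s1.idx 83 0 0) hcl
        rw [g26] at h26
        rw [g27] at h27
        rw [F3.idx 96 rfl, g96, h96, h83, hfil, hd]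
        refine ⟨⟨rfl, hE.notMem hgb (hdrop _) rfl (fun d hd i hi => ?_) h26⟩, by omega⟩
        simpa using h27 d hd i hi
      by_cases hk0 : L.kind b = 0
      · rw [if_neg (by omega)]
        refine (fin _ 100 (by omega) (by simp) (by simpa using hsz) (by simp) (by simp [hk0])
          (by simp) (by simp) (by simp)).mono ?_
        rintro s2 t2 ⟨h1, h2⟩ -
        exact ⟨h1, by omega⟩
      · rw [if_pos (by omega)]
        refine (fin _ 100 (by omega) (by simp) (by simpa using hsz) (by simp) (by simp [hk0])
          (by simp) (by simp) (by simp)).mono ?_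
        rintro s2 t2 ⟨h1, h2⟩ -
        exact ⟨h1, by omega⟩
  · rintro s1 t1 ⟨-, hE⟩ - - ht1
    simp [hA] at ht1 hE ⊢
    refine ⟨?_, hE⟩
    have h1 : B.length * (100 * L.size B + 130 + 17) =
      100 * (B.length * L.size B) + 147 * B.length := by ring
    have h2 : B.length * 1 ≤ B.length * L.size B := Nat.mul_le_mul_left _ hpos
    rw [add_mul]
    omega

open Program IExp in
/-- Adding the entries of the array 4 to the first row of the array 2, at the places of the
embedding. -/
def gather : Program :=
  loop 85 (V 83) (.setNum 2 0 (.get 26 0 (V 85))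
    (.get 2 0 (.get 26 0 (V 85)) + .get 4 0 (.get 27 0 (V 85))))

theorem gather_spec {s : Store} {Q : Store → ℕ → Prop} (cnt size : ℕ) (hcnt : s.idx 83 0 0 = cnt)
    (h0 : ∀ x < size, s.num 2 0 x = 0)
    (hQ : ∀ s' t, Frame gather s s' → t ≤ 60 * (cnt + 1) →
      (∀ x < size, s'.num 2 0 x = ∑ i ∈ range cnt, s.num 4 0 (s.idx 27 0 i) *
        if s.idx 26 0 i = x then (1 : ℂ) else 0) → Q s' t) :
    WP gather s Q := by
  suffices H : WP gather s (fun s' t => t ≤ 60 * (cnt + 1) ∧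
      (∀ x < size, s'.num 2 0 x = ∑ i ∈ range cnt, s.num 4 0 (s.idx 27 0 i) *
        if s.idx 26 0 i = x then (1 : ℂ) else 0)) from
    H.mono fun s' t h hF => hQ s' t hF h.1 h.2
  refine WP_loop cnt 40 (fun m s' => ∀ x < size, s'.num 2 0 x =
    ∑ i ∈ range m, s.num 4 0 (s.idx 27 0 i) * if s.idx 26 0 i = x then (1 : ℂ) else 0)
    rfl ?_ ?_ ?_ ?_
  · intro s' hF
    simp [hF.idx 83 rfl, hcnt]
  · simpa using h0
  · rintro m s1 hm h h85 hF
    have e26 := hF.idx 26 rfl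
    have e27 := hF.idx 27 rfl
    have e4 := hF.num 4 rfl
    rw [WP_setNum]
    simp only [IExp.eval_get, IExp.eval_zero, NExp.eval_add, NExp.eval_get, h85, e26, e27, e4]
    refine ⟨fun x hx => ?_, by simp⟩
    rw [sum_range_succ, Store.setI_num, Store.setN_num]
    by_cases hxx : s.idx 26 0 m = x
    · rw [hxx, upd_same, h x hx, if_pos rfl, mul_one]
    · rw [upd_ne _ _ (by omega), h x hx, if_neg hxx, mul_zero, add_zero]
  · rintro s1 t h - - ht
    simp only [IExp.cost_get, IExp.cost_zero] at ht
    exact ⟨by omega, h⟩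

open Program IExp in
/-- The multiplication of the table of the vertex in the register 70 by the table in the array 4 of
the vertex in the register 80. -/
def join : Program :=
  set 60 0 ;;
  loop 93 (.get 24 (V 70) 0) (.setNum 2 0 (V 93) (.get 1 (V 70) (V 93))) ;; axes ;;
  loop 93 (.get 24 (V 70) 0) (.setNum 3 0 (V 93) (.get 2 (.get 23 0 (V 70)) (V 93))) ;;
  embedding ;;
  loop 93 (.get 24 (V 70) 0) (.setNum 2 0 (V 93) (.cast 0)) ;; gather ;; axes ;;
  loop 93 (.get 24 (V 70) 0) (.setNum 2 0 (V 93)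
    (.get 3 0 (V 93) * .get 2 (.get 23 0 (V 70)) (V 93))) ;;
  set 60 1 ;; axes ;;
  loop 93 (.get 24 (V 70) 0) (.setNum 1 (V 70) (V 93) (.get 2 (.get 23 0 (V 70)) (V 93)))

/-- Two forward transforms, an entrywise product and one backward transform, justified by
`elem_mul`. Each transform of the table is bounded by 23000 units, and the embedding and the copying
fit into the remaining 2000. -/
theorem join_spec {L : Layout} {K : Counter} {n : ℕ} {s : Store} {Q : Store → ℕ → Prop}
    (hL : L.Holds n s) (r p lam : ℕ) {A : List ℕ} (hr : s.idx 80 0 0 = r) (hp : s.idx 70 0 0 = p)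
    (hrn : r < n) (hpn : p < n) (hbag : L.bag r = r :: A)
    (hA : (L.bag p).filter (fun b => decide (b ∈ L.bag r)) = A)
    (hB : ∀ b ∈ L.bag p, b < n ∧ L.Good b ∧ L.Fits K b ∧ Nat.log 2 (L.dim b) + 3 ≤ lam)
    (hlam : 0 < lam)
    (hQ : ∀ s' t, Frame join s s' →
      t ≤ 71000 * (((L.bag p).length + 1) * (L.size (L.bag p) * lam)) →
      (∀ i, i ≠ p → s'.num 1 i = s.num 1 i) →
      L.elem K (L.bag p) (s'.num 1 p) =
        L.elem K (L.bag p) (s.num 1 p) * L.elem K A (s.num 4 0) → Q s' t) :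
    WP join s Q := by
  suffices H : WP join s (fun s' t =>
      t ≤ 71000 * (((L.bag p).length + 1) * (L.size (L.bag p) * lam)) ∧
      (∀ i, i ≠ p → s'.num 1 i = s.num 1 i) ∧
      L.elem K (L.bag p) (s'.num 1 p) =
        L.elem K (L.bag p) (s.num 1 p) * L.elem K A (s.num 4 0)) from
    H.mono fun s' t h hF => hQ s' t hF h.1 h.2.1 h.2.2
  set B := L.bag p with hBdef
  set N := L.size B with hN
  have hlen : ∀ {s' : Store}, L.Holds n s' → s'.idx 23 0 p = B.length := fun h => h.len p hpn
  have hsz : ∀ {s' : Store}, L.Holds n s' → s'.idx 24 p 0 = N := fun h => by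
    rw [h.sz p hpn 0 (by simp), List.drop_zero]
  have hBg : ∀ b ∈ B, L.Good b := fun b hb => (hB b hb).2.1
  have hB1 : ∀ b ∈ B, b < n ∧ L.Good b ∧ Nat.log 2 (L.dim b) + 3 ≤ lam :=
    fun b hb => ⟨(hB b hb).1, (hB b hb).2.1, (hB b hb).2.2.2⟩
  have hpos : 0 < N := L.size_pos hBg
  simp only [join, WP_seq, WP_set]
  have hL0 := hL.setI (a := 60) (by simp [Layout.arrays]) 0 0 0
  refine WP_loop_setNum N 0 (fun x => s.num 1 p x) (by simp) (by simp [hp])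
    (by simp [hp, hsz hL]) ?_
  intro t1 ht1
  refine axes_spec (L := L) (n := n)
    ((hL0.setI (a := 93) (by simp [Layout.arrays]) _ _ _).fillN _ _ _ _) p lam (by simp [hp]) hpn
    hB1 hlam ?_
  intro s2 t2 F2 ht2 hax2
  have hL2 : L.Holds n s2 := ((hL0.setI (a := 93) (by simp [Layout.arrays]) _ _ _).fillN _ _ _ _).frame F2 rfl
  have e70 : s2.idx 70 0 0 = p := by rw [F2.idx 70 rfl]; simp [hp]
  have e80 : s2.idx 80 0 0 = r := by rw [F2.idx 80 rfl]; simp [hr]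
  have e60 : s2.idx 60 0 0 = 0 := by rw [F2.idx 60 rfl]; simp
  have e1 : s2.num 1 = s.num 1 := by rw [F2.num 1 rfl]; simp
  have e4 : s2.num 4 = s.num 4 := by rw [F2.num 4 rfl]; simp
  simp [Layout.dir] at hax2
  rw [← hBdef, ← hN] at hax2
  refine WP_loop_setNum N 0 (fun x => L.trans L.fwd B (s.num 1 p) x) (by simp) ?_
    (by simp [e70, hsz hL2]) ?_
  · intro x hx
    simp [e70, hlen hL2, hax2 x hx]
    refine Layout.trans_congr _ (fun y hy => ?_) x hx
    rw [fillRow_lt _ _ _ hy]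
  intro t3 ht3
  have hL3 := (hL2.setI (a := 93) (by simp [Layout.arrays]) 0 0 N).fillN 3 0 N
    (fun x => L.trans L.fwd B (s.num 1 p) x)
  refine embedding_spec (K := K) hL3 r p (by simp [e80]) (by simp [e70]) hrn hpn hbag hA
    (fun b hb => ⟨(hB b hb).1, (hB b hb).2.1⟩) ?_
  intro s4 t4 F4 ht4 hE
  have hL4 := hL3.frame F4 rfl
  have f70 : s4.idx 70 0 0 = p := by rw [F4.idx 70 rfl]; simp [e70]
  have f60 : s4.idx 60 0 0 = 0 := by rw [F4.idx 60 rfl]; simp [e60]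
  have f1 : s4.num 1 = s.num 1 := by rw [F4.num 1 rfl]; simp [e1]
  have f3 : s4.num 3 = fillRow (s2.num 3) 0 N (fun x => L.trans L.fwd B (s.num 1 p) x) := by
    rw [F4.num 3 rfl]; simp
  have f4 : s4.num 4 = s.num 4 := by rw [F4.num 4 rfl]; simp [e4]
  refine WP_loop_setNum N 0 (fun _ => 0) (by simp) (by simp) (by simp [f70, hsz hL4]) ?_
  intro t5 ht5
  have hL5 := (hL4.setI (a := 93) (by simp [Layout.arrays]) 0 0 N).fillN 2 0 N (fun _ => 0)
  refine gather_spec _ N (by simp; rfl) (fun x hx => by simp [fillRow_lt _ _ _ hx]) ?_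
  intro s6 t6 F6 ht6 hg
  have hL6 := hL5.frame F6 rfl
  have g70 : s6.idx 70 0 0 = p := by rw [F6.idx 70 rfl]; simp [f70]
  have g60 : s6.idx 60 0 0 = 0 := by rw [F6.idx 60 rfl]; simp [f60]
  have g1 : s6.num 1 = s.num 1 := by rw [F6.num 1 rfl]; simp [f1]
  have g3 : s6.num 3 = fillRow (s2.num 3) 0 N (fun x => L.trans L.fwd B (s.num 1 p) x) := by
    rw [F6.num 3 rfl]; simp [f3]
  -- The message is not changed as an element of the algebra when it is rewritten with the
  -- coordinates of the parent.
  have hT : L.elem K B (s6.num 2 0) = L.elem K A (s.num 4 0) := by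
    refine hE.elem_eq hBg fun x hx => ?_
    rw [hg x hx]
    simp [f4]
  refine axes_spec hL6 p lam g70 hpn hB1 hlam ?_
  intro s7 t7 F7 ht7 hax7
  have hL7 := hL6.frame F7 rfl
  have i70 : s7.idx 70 0 0 = p := by rw [F7.idx 70 rfl, g70]
  have i1 : s7.num 1 = s.num 1 := by rw [F7.num 1 rfl, g1]
  have i3 : s7.num 3 = fillRow (s2.num 3) 0 N (fun x => L.trans L.fwd B (s.num 1 p) x) := by
    rw [F7.num 3 rfl, g3]
  simp [Layout.dir, g60] at hax7
  rw [← hBdef, ← hN] at hax7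
  refine WP_loop_setNum N 0 (fun x => L.trans L.fwd B (s.num 1 p) x *
    L.trans L.fwd B (s6.num 2 0) x) (by simp) ?_ (by simp [i70, hsz hL7]) ?_
  · intro x hx
    simp [i70, hlen hL7, i3, fillRow_lt _ _ _ hx, fillRow_ge, hax7 x hx]
  intro t8 ht8
  have hL8 := ((hL7.setI (a := 93) (by simp [Layout.arrays]) 0 0 N).fillN 2 0 N
    (fun x => L.trans L.fwd B (s.num 1 p) x * L.trans L.fwd B (s6.num 2 0) x)).setI (a := 60)
    (by simp [Layout.arrays]) 0 0 1
  refine axes_spec (L := L) (n := n) hL8 p lam (by simp [i70]) hpn hB1 hlam ?_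
  intro s9 t9 F9 ht9 hax9
  have hL9 := hL8.frame F9 rfl
  have j70 : s9.idx 70 0 0 = p := by rw [F9.idx 70 rfl]; simp [i70]
  have j1 : s9.num 1 = s.num 1 := by rw [F9.num 1 rfl]; simp [i1]
  simp [Layout.dir] at hax9
  rw [← hBdef, ← hN] at hax9
  refine WP_loop_setNum N p (fun x => L.trans L.bwd B (fun x => L.trans L.fwd B (s.num 1 p) x *
    L.trans L.fwd B (s6.num 2 0) x) x) (by simp [j70]) ?_ (by simp [j70, hsz hL9]) ?_
  · intro x hx
    simp [j70, hlen hL9, hax9 x hx]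
    refine Layout.trans_congr _ (fun y hy => ?_) x hx
    rw [fillRow_lt _ _ _ hy]
  intro t10 ht10
  refine ⟨?_, fun i hi => ?_, ?_⟩
  · have h1 := hE.le
    have h2 : N * 1 ≤ N * lam := Nat.mul_le_mul_left _ hlam
    have h3 : (B.length + 1) * N ≤ (B.length + 1) * (N * lam) := Nat.mul_le_mul_left _ (by omega)
    have h4 : 1 * N ≤ (B.length + 1) * N := Nat.mul_le_mul_right _ (by omega)
    simp at ht1 ht3 ht5 ht8 ht10 ⊢
    rw [← hBdef] at ht2 ht4 ht7 ht9
    rw [← hN] at ht2 ht4 ht7 ht9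
    rw [← hN] at h1
    omega
  · simp [fillRow_ne _ _ _ hi, j1]
  · rw [← hT, ← Layout.elem_mul (fun b hb => ⟨(hB b hb).2.1, (hB b hb).2.2.1⟩)]
    refine Layout.elem_congr hBg fun x hx => ?_
    simp [fillRow_lt _ _ _ (show x < N from hx)]

/-- The conditions on a layout with `n` vertices under which the elimination works; the tables have
at most `k` coordinates and at most `M` entries. -/
structure Layout.Elim (L : Layout) (K : Counter) (n k M lam : ℕ) : Prop where
  vertex : ∀ r < n, L.Good r ∧ L.Fits K r ∧ Nat.log 2 (L.dim r) + 3 ≤ lam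
  head : ∀ r < n, ∃ B, L.bag r = r :: B ∧ ∀ b ∈ B, b < r
  parent : ∀ r < n, ∀ p B, L.bag r = r :: p :: B →
    (L.bag p).filter (fun b => decide (b ∈ L.bag r)) = p :: B
  length : ∀ r < n, (L.bag r).length ≤ k
  size : ∀ r < n, L.size (L.bag r) ≤ M
  lam_pos : 0 < lam

theorem Layout.Elim.mem {L : Layout} {K : Counter} {n k M lam : ℕ} (h : L.Elim K n k M lam) {r b : ℕ}
    (hr : r < n) (hb : b ∈ L.bag r) :
    b < n ∧ L.Good b ∧ L.Fits K b ∧ Nat.log 2 (L.dim b) + 3 ≤ lam := by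
  obtain ⟨B, hB, hlt⟩ := h.head r hr
  have hbn : b < n := by
    rw [hB] at hb
    rcases List.mem_cons.1 hb with rfl | hb
    · exact hr
    · exact (hlt b hb).trans hr
  exact ⟨hbn, h.vertex b hbn⟩

open Program IExp in
/-- The elimination of the vertex in the register 80. -/
def eliminate : Program :=
  message ;;
  .ifLt (.get 23 0 (V 80)) 2 (setn 0 (VN 0 * .get 4 0 0)) (set 70 (.get 22 (V 80) 1) ;; join)

/-- The quantity that is preserved is the total elimination of the scalar in the register 0 times
the elements of all remaining tables. If `r` is alone in its table, its message is a number and goes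
into the scalar; otherwise it is absorbed by the second vertex of the list. -/
theorem eliminate_spec {L : Layout} {K : Counter} {n k M lam : ℕ} {s : Store}
    {Q : Store → ℕ → Prop} (hL : L.Holds n s) (hE : L.Elim K n k M lam) (r : ℕ)
    (hr : s.idx 80 0 0 = r) (hrn : r < n)
    (hQ : ∀ s' t, Frame eliminate s s' → t ≤ 72000 * ((k + 1) * (M * lam)) →
      L.elimAll K r (algebraMap ℂ (Layout.Alg K) (s'.num 0 0 0) *
          ∏ u ∈ range r, L.elem K (L.bag u) (s'.num 1 u)) =
        L.elimAll K (r + 1) (algebraMap ℂ (Layout.Alg K) (s.num 0 0 0) *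
          ∏ u ∈ range (r + 1), L.elem K (L.bag u) (s.num 1 u)) → Q s' t) :
    WP eliminate s Q := by
  suffices H : WP eliminate s (fun s' t => t ≤ 72000 * ((k + 1) * (M * lam)) ∧
      L.elimAll K r (algebraMap ℂ (Layout.Alg K) (s'.num 0 0 0) *
          ∏ u ∈ range r, L.elem K (L.bag u) (s'.num 1 u)) =
        L.elimAll K (r + 1) (algebraMap ℂ (Layout.Alg K) (s.num 0 0 0) *
          ∏ u ∈ range (r + 1), L.elem K (L.bag u) (s.num 1 u))) from
    H.mono fun s' t h hF => hQ s' t hF h.1 h.2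
  obtain ⟨A, hA, hlt⟩ := hE.head r hrn
  obtain ⟨hg, hf, -⟩ := hE.vertex r hrn
  have hAg : ∀ b ∈ A, L.Good b := fun b hb => (hE.mem hrn (by simp [hA, hb])).2.1
  have hApos : 0 < L.size A := L.size_pos hAg
  have hrA : r ∉ A := fun h => lt_irrefl _ (hlt r h)
  -- The table of `u` has only coordinates up to `u`, hence none that belongs to `r`.
  have hfree : ∀ u < r, L.Free K r (L.elem K (L.bag u) (s.num 1 u)) := by
    intro u hu
    refine Layout.free_elem (fun h => ?_) _
    obtain ⟨B, hB, hltu⟩ := hE.head u (hu.trans hrn)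
    rw [hB] at h
    rcases List.mem_cons.1 h with h | h
    · omega
    · have := hltu r h
      omega
  have hM : L.low r * L.size A ≤ M := by
    refine le_trans ?_ (hE.size r hrn)
    rw [hA, L.size_cons]
    exact Nat.mul_le_mul_right _ hg.low_le_dim
  have hM0 : 0 < M := (Nat.mul_pos hg.low_pos hApos).trans_le hM
  have hMl : M * 1 ≤ M * lam := Nat.mul_le_mul_left _ hE.lam_pos
  have hkM : 1 * (M * lam) ≤ (k + 1) * (M * lam) := Nat.mul_le_mul_right _ (by omega)
  rw [eliminate, WP_seq]
  refine message_spec r (L.size A) (L.low r) (L.wt r) hr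
    (by rw [hL.sz r hrn 1 (by simp [hA]), hA]; rfl) (hL.low r hrn) hApos hg.low_pos
    (hL.wt r hrn) ?_
  intro s1 t1 F1 ht1 h4
  have hL1 := hL.frame F1 rfl
  have e80 : s1.idx 80 0 0 = r := by rw [F1.idx 80 rfl, hr]
  have e1 := F1.num 1 rfl
  have e0 := F1.num 0 rfl
  have heps : L.eps K r (L.elem K (L.bag r) (s.num 1 r)) = L.elem K A (s1.num 4 0) := by
    rw [hA, Layout.eps_elem hg hf hrA]
    exact (Layout.elem_congr hAg h4).symm
  have hlen := hL1.len r hrn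
  rw [WP_ifLt]
  simp only [IExp.eval_get, IExp.eval_zero, IExp.eval_ofNat, e80, hlen]
  rcases A with _ | ⟨p, B⟩
  · rw [if_pos (by simp [hA])]
    have hstep := Layout.elimAll_step_root (z := s.num 0 0 0) (y := s1.num 4 0 0)
      (a := fun u => L.elem K (L.bag u) (s.num 1 u)) hfree (by simp only [heps]; rw [Layout.elem])
    simp only [WP_setn, NExp.eval_mul, NExp.eval_get, IExp.eval_zero, Store.setN_num, upd_same,
      Store.setN_num_ne _ _ _ _ (by norm_num : (1 : ℕ) ≠ 0), e0, e1]
    refine ⟨by simp; omega, hstep.symm⟩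
  · have hpr : p < r := hlt p (by simp)
    have hpn := hpr.trans hrn
    have hbag := hL1.bag r hrn 1 (by simp [hA])
    have hp1 : (L.bag r)[1]'(by simp [hA]) = p := by simp [hA]
    rw [if_neg (by simp [hA]), WP_seq]
    simp only [WP_set, IExp.eval_get, IExp.eval_one, IExp.eval_zero, e80, hbag, hp1]
    refine join_spec (hL1.setI (by simp [Layout.arrays]) _ _ _) r p lam (by simp [e80]) (by simp)
      hrn hpn hA (hE.parent r hrn p B hA) (fun b hb => hE.mem hpn hb) hE.lam_pos ?_
    intro s2 t2 F2 ht2 hrow hel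
    have g0 := F2.num 0 rfl
    simp at hrow hel g0
    have hle : ((L.bag p).length + 1) * (L.size (L.bag p) * lam) ≤ (k + 1) * (M * lam) :=
      Nat.mul_le_mul (by have := hE.length p hpn; omega)
        (Nat.mul_le_mul_right _ (hE.size p hpn))
    refine ⟨by simp; omega, ?_⟩
    rw [g0, e0]
    refine (Layout.elimAll_step_parent (a := fun u => L.elem K (L.bag u) (s.num 1 u))
      (a' := fun u => L.elem K (L.bag u) (s2.num 1 u)) hfree hpr ?_ ?_).symm
    · simp only [hel, heps, e1]
    · intro u _ hu
      simp only [hrow u hu, e1]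

open Program IExp in
/-- The elimination of all vertices. -/
def eliminateAll : Program :=
  loop 79 (V 30) (set 80 (V 79) ;; initTable) ;; setn 0 (.cast 1) ;;
  loop 79 (V 30) (set 80 (V 30 - 1 - V 79) ;; eliminate)

theorem eliminateAll_spec {L : Layout} {K : Counter} {n k M lam : ℕ} {s : Store}
    {Q : Store → ℕ → Prop} (hL : L.Holds n s) (hE : L.Elim K n k M lam) (hn : s.idx 30 0 0 = n)
    (hQ : ∀ s' t, Frame eliminateAll s s' → t ≤ 74000 * (n * ((k + 1) * (M * lam)) + 1) →
      algebraMap ℂ (Layout.Alg K) (s'.num 0 0 0) =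
        L.elimAll K n (∏ r ∈ range n, ((L.bag r).tail.map (L.edge K r)).prod) → Q s' t) :
    WP eliminateAll s Q := by
  suffices H : WP eliminateAll s (fun s' t => t ≤ 74000 * (n * ((k + 1) * (M * lam)) + 1) ∧
      algebraMap ℂ (Layout.Alg K) (s'.num 0 0 0) =
        L.elimAll K n (∏ r ∈ range n, ((L.bag r).tail.map (L.edge K r)).prod)) from
    H.mono fun s' t h hF => hQ s' t hF h.1 h.2
  set T := (k + 1) * (M * lam) with hT
  have hT0 : ∀ r < n, (L.bag r).length * L.size (L.bag r) ≤ T ∧ 1 ≤ T := by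
    intro r hr
    have h1 := hE.length r hr
    have h2 := hE.size r hr
    have h3 : 0 < L.size (L.bag r) := L.size_pos fun b hb => (hE.mem hr hb).2.1
    have h4 := hE.lam_pos
    constructor
    · refine Nat.mul_le_mul (by omega) (h2.trans (Nat.le_mul_of_pos_right _ h4))
    · exact Nat.mul_pos (by omega) (Nat.mul_pos (by omega) h4)
  rw [eliminateAll, WP_seq]
  refine WP_loop n (1100 * T + 20) (fun m s' => ∀ r < m, L.elem K (L.bag r) (s'.num 1 r) =
    ((L.bag r).tail.map (L.edge K r)).prod) rfl ?_ ?_ ?_ ?_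
  · intro s' hF
    simp [hF.idx 30 rfl, hn]
  · simp
  · rintro r s1 hr h1 h79 hF
    obtain ⟨B, hB, -⟩ := hE.head r hr
    simp only [WP_seq, WP_set]
    simp only [IExp.eval_get, IExp.eval_zero, h79]
    refine initTable_spec (L := L) (K := K) ((hL.frame hF rfl).setI (by simp [Layout.arrays]) _ _ _)
      r B (by simp) hr hB (fun b hb => ?_) ?_
    · have := hE.mem hr hb
      exact ⟨this.1, this.2.1, this.2.2.1⟩
    intro s2 t2 F2 ht2 hrow hel
    simp at hrow
    have h2 := hT0 r hr
    have h3 : (L.bag r).length = B.length + 1 := by simp [hB]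
    rw [h3] at h2
    refine ⟨fun u hu => ?_, by simp; omega⟩
    rw [Store.setI_num]
    rcases Nat.lt_succ_iff_lt_or_eq.1 hu with hu | rfl
    · rw [hrow u (by omega), h1 u hu]
    · rw [hel, hB, List.tail_cons]
  rintro s1 t1 h1 - F1 ht1
  simp only [WP_seq, WP_setn]
  refine WP_loop n (72000 * T + 50) (fun m s' =>
    L.elimAll K (n - m) (algebraMap ℂ (Layout.Alg K) (s'.num 0 0 0) *
      ∏ u ∈ range (n - m), L.elem K (L.bag u) (s'.num 1 u)) =
    L.elimAll K n (∏ r ∈ range n, ((L.bag r).tail.map (L.edge K r)).prod)) rfl ?_ ?_ ?_ ?_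
  · intro s' hF
    have := hF.idx 30 rfl
    simp at this
    simp [this, F1.idx 30 rfl, hn]
  · simp
    congr 1
    refine prod_congr rfl fun r hr => ?_
    rw [h1 r (mem_range.1 hr), List.map_tail]
  · rintro m s2 hm h2 h79 hF
    obtain ⟨r, hr⟩ : ∃ r, r = n - (m + 1) := ⟨_, rfl⟩
    have hr1 : n - m = r + 1 := by omega
    have hr2 : n - 1 - m = r := by omega
    rw [hr1] at h2
    rw [← hr]
    have e30 := hF.idx 30 rfl
    simp [F1.idx 30 rfl] at e30
    simp only [WP_seq, WP_set]
    simp only [IExp.eval_get, IExp.eval_zero, IExp.eval_sub, IExp.eval_one, h79, e30, hn, hr2]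
    refine eliminate_spec (L := L) (K := K) (n := n) (lam := lam) (k := k) (M := M) ?_ hE r (by simp)
      (by omega) ?_
    · exact Layout.Holds.setI (Layout.Holds.frame (Layout.Holds.setN (hL.frame F1 rfl) _ _ _ _) hF
        rfl) (by simp [Layout.arrays]) _ _ _
    intro s3 t3 F3 ht3 hel
    rw [← hT] at ht3
    refine ⟨?_, by simp; omega⟩
    simp only [Store.setI_num] at hel ⊢
    rw [hel, h2]
  · rintro s2 t2 h2 - F2 ht2
    simp [Layout.elimAll] at h2 ht1 ht2 ⊢
    refine ⟨?_, h2⟩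
    have hnT : n * 1 ≤ n * T := by
      rcases Nat.eq_zero_or_pos n with h | h
      · simp [h]
      · exact Nat.mul_le_mul_left _ (hT0 0 h).2
    have h5 : n * (1100 * T + 20 + 15) = 1100 * (n * T) + 35 * n := by ring
    have h6 : n * (72000 * T + 50 + 15) = 72000 * (n * T) + 65 * n := by ring
    omega

/-! ## The counters of the constraints -/

/-- The side of the automaton of the constraint `c` in the memory: `1` if the letter `0` acts
trivially. -/
def Store.side (s : Store) (c : ℕ) : ℕ := if ∀ x < s.idx 2 c 0, s.idx 3 c x = x then 1 else 0

/-- The transition function of the automaton of the constraint `c` for the active letter. -/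
def Store.step (s : Store) (c : ℕ) : ℕ → ℕ := if s.side c = 0 then s.idx 3 c else s.idx 4 c

/-- The reduction of counts that continues after `w - 1` with `a`. -/
def wrap (w a d : ℕ) : ℕ := (fun x => if x + 1 < w then x + 1 else a)^[d] 0

theorem wrap_succ (w a d : ℕ) :
    wrap w a (d + 1) = if wrap w a d + 1 < w then wrap w a d + 1 else a := by
  rw [wrap, Function.iterate_succ_apply']
  rfl

theorem wrap_of_lt {w a d : ℕ} (h : d < w) : wrap w a d = d := by
  induction d with
  | zero => rfl
  | succ d ih => rw [wrap_succ, ih (by omega), if_pos h]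

theorem wrap_lt {w a : ℕ} (ha : a < w) (d : ℕ) : wrap w a d < w := by
  induction d with
  | zero => exact (Nat.zero_le a).trans_lt ha
  | succ d ih =>
    rw [wrap_succ]
    split_ifs with h
    exacts [h, ha]

/-- Running from `w - 1` back to `a` instead of on to `w` does not affect the state. The repetition
need not be the first one, so any `a` found by a search will do. -/
theorem iterate_wrap {f : ℕ → ℕ} {w a q : ℕ} (ha : a < w) (h : f^[a] q = f^[w] q) (d : ℕ) :
    f^[wrap w a d] q = f^[d] q := by
  induction d with
  | zero => rfl
  | succ d ih =>
    rw [wrap_succ, Function.iterate_succ_apply', ← ih]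
    split_ifs with hlt
    · rw [Function.iterate_succ_apply']
    · have := wrap_lt ha d
      rw [h, ← Function.iterate_succ_apply' f, show (wrap w a d).succ = w by omega]

theorem iterate_lt {f : ℕ → ℕ} {w q : ℕ} (hf : ∀ x < w, f x < w) (hq : q < w) (d : ℕ) :
    f^[d] q < w := by
  induction d with
  | zero => exact hq
  | succ d ih => rw [Function.iterate_succ_apply']; exact hf _ ih

theorem exists_iterate_eq {f : ℕ → ℕ} {w q : ℕ} (hf : ∀ x < w, f x < w) (hq : q < w) :
    ∃ a < w, f^[a] q = f^[w] q := by
  obtain ⟨i, hi, j, hj, hij, he⟩ := exists_ne_map_eq_of_card_lt_of_maps_to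
    (s := range (w + 1)) (t := range w) (by simp) (f := fun d => f^[d] q)
    (fun d _ => by simpa using iterate_lt hf hq d)
  have key : ∀ i j, i < j → j ≤ w → f^[i] q = f^[j] q → ∃ a < w, f^[a] q = f^[w] q := by
    intro i j hlt hjw h
    -- A repetition at `i < j` given by the pigeonhole principle is moved forward by `w - j`, so
    -- that its later member is exactly `w`.
    refine ⟨(w - j) + i, by omega, ?_⟩
    rw [Function.iterate_add_apply, h, ← Function.iterate_add_apply, Nat.sub_add_cancel hjw]
  simp only [mem_range] at hi hj
  rcases lt_or_gt_of_ne hij with h | h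
  · exact key i j h (by omega) he
  · exact key j i h (by omega) he.symm

/-- The memory holds the counter of the vertex `r`. -/
structure CountAt (s : Store) (r : ℕ) : Prop where
  var : s.idx 13 0 r = 0 → s.idx 16 0 r = 2 ∧ s.idx 17 0 r = 2 ∧ ∀ d < 2, s.idx 21 r d = 1
  con : s.idx 13 0 r ≠ 0 → ∀ c, s.idx 14 0 r = c → ∀ w, s.idx 2 c 0 = w →
    s.idx 16 0 r = w ∧ s.idx 17 0 r = w + w ∧ s.idx 18 0 r = s.side c ∧ s.idx 29 0 r < w ∧
    (s.step c)^[s.idx 29 0 r] (s.idx 2 c 1) = (s.step c)^[w] (s.idx 2 c 1) ∧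
    (∀ d < w + w, s.idx 20 r d = wrap w (s.idx 29 0 r) d) ∧
    ∀ d < w, s.idx 21 r d = s.idx 5 c ((s.step c)^[d] (s.idx 2 c 1))

/-- The counter of the vertex `r` is the same in both memories. -/
structure SameCount (s s' : Store) (r : ℕ) : Prop where
  inp : ∀ a, a ≤ 15 → s'.idx a = s.idx a
  row0 : ∀ a ∈ [16, 17, 18, 29], s'.idx a 0 r = s.idx a 0 r
  row : ∀ a ∈ [20, 21], s'.idx a r = s.idx a r

theorem CountAt.congr {s s' : Store} {r : ℕ} (h : CountAt s r) (hs : SameCount s s' r) :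
    CountAt s' r := by
  have h16 := hs.row0 16 (by simp)
  have h17 := hs.row0 17 (by simp)
  have h18 := hs.row0 18 (by simp)
  have h29 := hs.row0 29 (by simp)
  have h20 := hs.row 20 (by simp)
  have h21 := hs.row 21 (by simp)
  have hside : ∀ c, s'.side c = s.side c := fun c => by
    rw [Store.side, Store.side, hs.inp 2 (by omega), hs.inp 3 (by omega)]
  have hstep : ∀ c, s'.step c = s.step c := fun c => by
    rw [Store.step, Store.step, hside, hs.inp 3 (by omega), hs.inp 4 (by omega)]
  constructor
  · rw [hs.inp 13 (by omega), h16, h17, h21]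
    exact h.var
  · rw [hs.inp 13 (by omega), hs.inp 14 (by omega), hs.inp 2 (by omega), h16, h17, h18, h29, h20,
      h21, hs.inp 5 (by omega)]
    simpa only [hside, hstep] using h.con

open Program IExp in
/-- The side of the automaton of the constraint in the register 103, to the register 106. -/
def findSide : Program :=
  set 106 1 ;;
  loop 105 (V 104) (
    .ifLt (.get 3 (V 103) (V 105)) (V 105) (set 106 0)
      (.ifLt (V 105) (.get 3 (V 103) (V 105)) (set 106 0) .nop))

theorem findSide_spec {s : Store} {Q : Store → ℕ → Prop} (c w : ℕ) (hc : s.idx 103 0 0 = c)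
    (hw : s.idx 104 0 0 = w) (hw' : s.idx 2 c 0 = w)
    (hQ : ∀ s' t, Frame findSide s s' → t ≤ 60 * (w + 1) → s'.idx 106 0 0 = s.side c → Q s' t) :
    WP findSide s Q := by
  suffices H : WP findSide s (fun s' t => t ≤ 60 * (w + 1) ∧ s'.idx 106 0 0 = s.side c) from
    H.mono fun s' t h hF => hQ s' t hF h.1 h.2
  simp only [findSide, WP_seq, WP_set]
  refine WP_loop w 40 (fun m s' => s'.idx 106 0 0 = if ∀ x < m, s.idx 3 c x = x then 1 else 0)
    rfl ?_ ?_ ?_ ?_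
  · intro s' hF
    have := hF.idx 104 rfl
    simp at this
    simp [this, hw]
  · simp
  · rintro m s1 hm h1 h105 hF
    have e103 := hF.idx 103 rfl
    have e3 := hF.idx 3 rfl
    simp at e103 e3
    have key : (∀ x < m + 1, s.idx 3 c x = x) ↔ (∀ x < m, s.idx 3 c x = x) ∧ s.idx 3 c m = m := by
      constructor
      · exact fun h => ⟨fun x hx => h x (by omega), h m (by omega)⟩
      · rintro ⟨h, h'⟩ x hx
        rcases Nat.lt_succ_iff_lt_or_eq.1 hx with hx | rfl
        exacts [h x hx, h']
    simp only [key]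
    simp only [WP_ifLt, IExp.eval_get, IExp.eval_zero, e103, e3, hc, h105, WP_set, WP_nop]
    by_cases g : s.idx 3 c m = m
    · simp [g, h1]
    · rcases lt_or_gt_of_ne g with g' | g'
      · simp [g, g']
      · simp [g, g', g'.le]
  · rintro s1 t h1 - - ht
    simp at ht ⊢
    refine ⟨by omega, ?_⟩
    rw [h1, Store.side, hw']

open Program IExp in
/-- The states of the automaton of the constraint in the register 103, to the array 19. -/
def orbit : Program :=
  .setIdx 19 0 0 (.get 2 (V 103) 1) ;;
  loop 105 (V 104) (.ifLt (V 106) 1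
    (.setIdx 19 0 (V 105 + 1) (.get 3 (V 103) (.get 19 0 (V 105))))
    (.setIdx 19 0 (V 105 + 1) (.get 4 (V 103) (.get 19 0 (V 105)))))

theorem orbit_spec {s : Store} {Q : Store → ℕ → Prop} (c w : ℕ) (hc : s.idx 103 0 0 = c)
    (hw : s.idx 104 0 0 = w) (hside : s.idx 106 0 0 = s.side c)
    (hQ : ∀ s' t, Frame orbit s s' → t ≤ 60 * (w + 1) →
      (∀ d ≤ w, s'.idx 19 0 d = (s.step c)^[d] (s.idx 2 c 1)) → Q s' t) :
    WP orbit s Q := by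
  suffices H : WP orbit s (fun s' t => t ≤ 60 * (w + 1) ∧
      (∀ d ≤ w, s'.idx 19 0 d = (s.step c)^[d] (s.idx 2 c 1))) from
    H.mono fun s' t h hF => hQ s' t hF h.1 h.2
  simp only [orbit, WP_seq, WP_setIdx]
  refine WP_loop w 40 (fun m s' => ∀ d ≤ m, s'.idx 19 0 d = (s.step c)^[d] (s.idx 2 c 1))
    rfl ?_ ?_ ?_ ?_
  · intro s' hF
    have := hF.idx 104 rfl
    simp at this
    simp [this, hw]
  · intro d hd
    obtain rfl : d = 0 := by omega
    simp [hc]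
  · rintro m s1 hm h1 h105 hF
    have e103 := hF.idx 103 rfl
    have e106 := hF.idx 106 rfl
    have e3 := hF.idx 3 rfl
    have e4 := hF.idx 4 rfl
    simp at e103 e106 e3 e4
    have hlast := h1 m le_rfl
    simp only [WP_ifLt, IExp.eval_get, IExp.eval_zero, IExp.eval_one, e103, e106, e3, e4, hc, hside,
      h105, hlast, WP_setIdx, IExp.eval_add]
    have fin : ∀ v, v = (s.step c)^[m + 1] (s.idx 2 c 1) → ∀ d ≤ m + 1,
        upd (s1.idx 19) 0 (m + 1) v 0 d = (s.step c)^[d] (s.idx 2 c 1) := by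
      intro v hv d hd
      by_cases h : d = m + 1
      · subst h; rw [upd_same, hv]
      · rw [upd_ne _ _ (by omega), h1 d (by omega)]
    split_ifs with g
    · simp
      refine fin _ ?_
      rw [Function.iterate_succ_apply']
      simp only [Store.step, if_pos (show s.side c = 0 by omega)]
    · simp
      refine fin _ ?_
      rw [Function.iterate_succ_apply']
      simp only [Store.step, if_neg (show s.side c ≠ 0 by omega)]
  · rintro s1 t h1 - - ht
    simp at ht ⊢
    exact ⟨by omega, h1⟩

open Program IExp in
/-- A repetition among the states in the array 19, to the register 107. -/
def findWrap : Program :=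
  set 107 0 ;;
  loop 105 (V 104) (
    .ifLt (.get 19 0 (V 105)) (.get 19 0 (V 104)) .nop
      (.ifLt (.get 19 0 (V 104)) (.get 19 0 (V 105)) .nop (set 107 (V 105))))

theorem findWrap_spec {s : Store} {Q : Store → ℕ → Prop} (w : ℕ) (hw : s.idx 104 0 0 = w)
    (hex : ∃ a < w, s.idx 19 0 a = s.idx 19 0 w)
    (hQ : ∀ s' t, Frame findWrap s s' → t ≤ 60 * (w + 1) → s'.idx 107 0 0 < w →
      s.idx 19 0 (s'.idx 107 0 0) = s.idx 19 0 w → Q s' t) :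
    WP findWrap s Q := by
  suffices H : WP findWrap s (fun s' t => t ≤ 60 * (w + 1) ∧ s'.idx 107 0 0 < w ∧
      s.idx 19 0 (s'.idx 107 0 0) = s.idx 19 0 w) from
    H.mono fun s' t h hF => hQ s' t hF h.1 h.2.1 h.2.2
  simp only [findWrap, WP_seq, WP_set]
  refine WP_loop w 40 (fun m s' => (∃ a < m, s.idx 19 0 a = s.idx 19 0 w) →
    s'.idx 107 0 0 < w ∧ s.idx 19 0 (s'.idx 107 0 0) = s.idx 19 0 w) rfl ?_ ?_ ?_ ?_
  · intro s' hF
    have := hF.idx 104 rfl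
    simp at this
    simp [this, hw]
  · simp
  · rintro m s1 hm h1 h105 hF
    have e104 := hF.idx 104 rfl
    have e19 := hF.idx 19 rfl
    simp at e104 e19
    simp only [WP_ifLt, IExp.eval_get, IExp.eval_zero, e104, e19, hw, h105, WP_set, WP_nop]
    have old : s.idx 19 0 m ≠ s.idx 19 0 w → (∃ a < m + 1, s.idx 19 0 a = s.idx 19 0 w) →
        s1.idx 107 0 0 < w ∧ s.idx 19 0 (s1.idx 107 0 0) = s.idx 19 0 w := by
      rintro hne ⟨a, ha, h⟩
      refine h1 ⟨a, ?_, h⟩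
      rcases Nat.lt_succ_iff_lt_or_eq.1 ha with ha | rfl
      exacts [ha, absurd h hne]
    split_ifs with g1 g2
    · exact ⟨by simpa using old (by omega), by simp⟩
    · exact ⟨by simpa using old (by omega), by simp⟩
    · refine ⟨fun _ => ?_, by simp⟩
      simp
      exact ⟨hm, by omega⟩
  · rintro s1 t h1 - - ht
    simp at ht ⊢
    exact ⟨by omega, h1 hex⟩

open Program IExp in
/-- The wrapped counts of the vertex in the register 80, to the array 20. -/
def wrapTable : Program :=
  .setIdx 20 (V 80) 0 0 ;;
  loop 105 (V 104 + V 104) (.ifLt (.get 20 (V 80) (V 105) + 1) (V 104)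
    (.setIdx 20 (V 80) (V 105 + 1) (.get 20 (V 80) (V 105) + 1))
    (.setIdx 20 (V 80) (V 105 + 1) (V 107)))

theorem wrapTable_spec {s : Store} {Q : Store → ℕ → Prop} (r w a : ℕ) (hr : s.idx 80 0 0 = r)
    (hw : s.idx 104 0 0 = w) (ha : s.idx 107 0 0 = a)
    (hQ : ∀ s' t, Frame wrapTable s s' → t ≤ 140 * (w + 1) →
      (∀ i, i ≠ r → s'.idx 20 i = s.idx 20 i) → (∀ d ≤ w + w, s'.idx 20 r d = wrap w a d) →
      Q s' t) :
    WP wrapTable s Q := by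
  suffices H : WP wrapTable s (fun s' t => t ≤ 140 * (w + 1) ∧
      (∀ i, i ≠ r → s'.idx 20 i = s.idx 20 i) ∧ (∀ d ≤ w + w, s'.idx 20 r d = wrap w a d)) from
    H.mono fun s' t h hF => hQ s' t hF h.1 h.2.1 h.2.2
  simp only [wrapTable, WP_seq, WP_setIdx]
  refine WP_loop (w + w) 40 (fun m s' => (∀ i, i ≠ r → s'.idx 20 i = s.idx 20 i) ∧
    ∀ d ≤ m, s'.idx 20 r d = wrap w a d) rfl ?_ ?_ ?_ ?_
  · intro s' hF
    have := hF.idx 104 rfl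
    simp at this
    simp [this, hw]
  · refine ⟨fun i hi => ?_, fun d hd => ?_⟩
    · simp [hr, upd_row_ne _ _ _ hi]
    · obtain rfl : d = 0 := by omega
      simp [hr, wrap]
  · rintro m s1 hm ⟨hrow, h1⟩ h105 hF
    have e80 := hF.idx 80 rfl
    have e104 := hF.idx 104 rfl
    have e107 := hF.idx 107 rfl
    simp at e80 e104 e107
    have hlast := h1 m le_rfl
    simp only [WP_ifLt, IExp.eval_get, IExp.eval_zero, IExp.eval_one, e80, e104, e107, hr, hw, ha,
      h105, hlast, WP_setIdx, IExp.eval_add]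
    have fin : ∀ v, v = wrap w a (m + 1) → (∀ i, i ≠ r → upd (s1.idx 20) r (m + 1) v i = s.idx 20 i) ∧
        ∀ d ≤ m + 1, upd (s1.idx 20) r (m + 1) v r d = wrap w a d := by
      intro v hv
      refine ⟨fun i hi => by rw [upd_row_ne _ _ _ hi, hrow i hi], fun d hd => ?_⟩
      by_cases h : d = m + 1
      · subst h; rw [upd_same, hv]
      · rw [upd_ne _ _ (by omega), h1 d (by omega)]
    split_ifs with g
    · simp
      exact fin _ (by rw [wrap_succ, if_pos g])
    · simp
      exact fin _ (by rw [wrap_succ, if_neg g])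
  · rintro s1 t ⟨hrow, h1⟩ - - ht
    simp at ht ⊢
    exact ⟨by omega, hrow, h1⟩

open Program IExp in
/-- The counter of the vertex in the register 80. -/
def countVertex : Program :=
  .ifLt 0 (.get 13 0 (V 80)) (
    set 103 (.get 14 0 (V 80)) ;; set 104 (.get 2 (V 103) 0) ;;
    .setIdx 16 0 (V 80) (V 104) ;; .setIdx 17 0 (V 80) (V 104 + V 104) ;;
    findSide ;; .setIdx 18 0 (V 80) (V 106) ;; orbit ;;
    loop 105 (V 104) (.setIdx 21 (V 80) (V 105) (.get 5 (V 103) (.get 19 0 (V 105)))) ;;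
    findWrap ;; .setIdx 29 0 (V 80) (V 107) ;; wrapTable)
  (.setIdx 16 0 (V 80) 2 ;; .setIdx 17 0 (V 80) 2 ;;
    .setIdx 21 (V 80) 0 1 ;; .setIdx 21 (V 80) 1 1)

/-- The automaton of the constraint `c` in the memory is well-formed. -/
structure StepsIn (s : Store) (c : ℕ) : Prop where
  start : s.idx 2 c 1 < s.idx 2 c 0
  step : ∀ x < s.idx 2 c 0, s.step c x < s.idx 2 c 0

/-- The first `w' + 1` states visited under the active letter determine the whole counter: they give
the weights of the counts, and a repetition of the last of them gives the target of the reduction. A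
linear number of operations suffices. -/
theorem countVertex_spec {s : Store} {Q : Store → ℕ → Prop} (r w : ℕ) (hr : s.idx 80 0 0 = r)
    (hc : s.idx 13 0 r ≠ 0 → StepsIn s (s.idx 14 0 r) ∧ s.idx 2 (s.idx 14 0 r) 0 ≤ w)
    (hQ : ∀ s' t, Frame countVertex s s' → t ≤ 500 * (w + 1) → CountAt s' r →
      (∀ r', r' ≠ r → SameCount s s' r') → Q s' t) :
    WP countVertex s Q := by
  suffices H : WP countVertex s (fun s' t => t ≤ 500 * (w + 1) ∧ CountAt s' r ∧
      (∀ r', r' ≠ r → SameCount s s' r')) from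
    H.mono fun s' t h hF => hQ s' t hF h.1 h.2.1 h.2.2
  rw [countVertex, WP_ifLt]
  by_cases hk : s.idx 13 0 r = 0
  · rw [if_neg (by simp [hr, hk])]
    simp only [WP_seq, WP_setIdx]
    simp [hr]
    refine ⟨by omega, ⟨?_, ?_⟩, ?_⟩
    · intro _
      simp
      intro d hd
      interval_cases d <;> simp [upd]
    · simp [hk]
    · intro r' hr'
      refine ⟨fun a ha => ?_, fun a ha => ?_, fun a ha => ?_⟩
      · have h1 : a ≠ 16 := by omega
        have h2 : a ≠ 17 := by omega
        have h3 : a ≠ 21 := by omega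
        simp [h1, h2, h3]
      · simp at ha
        rcases ha with rfl | rfl | rfl | rfl <;> simp [upd_ne _ _ (Or.inr hr')]
      · simp at ha
        rcases ha with rfl | rfl <;> simp [upd_row_ne _ _ _ hr']
  · rw [if_pos (by simp [hr]; omega)]
    obtain ⟨hst, hww⟩ := hc hk
    set c := s.idx 14 0 r with hcd
    set w' := s.idx 2 c 0 with hw'
    simp only [WP_seq, WP_set, WP_setIdx]
    simp [hr, ← hcd, ← hw']
    refine findSide_spec c w' (by simp) (by simp) (by simp [← hw']) ?_
    intro s1 t1 F1 ht1 h106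
    have hin1 : ∀ a, a ≤ 15 → s1.idx a = s.idx a := by
      intro a ha
      rw [F1.idx a (by interval_cases a <;> rfl)]
      have h1 : a ≠ 16 := by omega
      have h2 : a ≠ 17 := by omega
      have h3 : a ≠ 103 := by omega
      have h4 : a ≠ 104 := by omega
      simp [h1, h2, h3, h4]
    have sideC : ∀ {s1 s2 : Store}, (∀ a, a ≤ 15 → s1.idx a = s2.idx a) → s1.side c = s2.side c := by
      intro s1 s2 h
      rw [Store.side, Store.side, h 2 (by omega), h 3 (by omega)]
    have stepC : ∀ {s1 s2 : Store}, (∀ a, a ≤ 15 → s1.idx a = s2.idx a) → s1.step c = s2.step c := by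
      intro s1 s2 h
      rw [Store.step, Store.step, sideC h, h 3 (by omega), h 4 (by omega)]
    have hs0 : s1.idx 106 0 0 = s.side c := by
      rw [h106]
      refine sideC fun a ha => ?_
      have h1 : a ≠ 16 := by omega
      have h2 : a ≠ 17 := by omega
      have h3 : a ≠ 103 := by omega
      have h4 : a ≠ 104 := by omega
      simp [h1, h2, h3, h4]
    have a80 : s1.idx 80 0 0 = r := by rw [F1.idx 80 rfl]; simp [hr]
    have a103 : s1.idx 103 0 0 = c := by rw [F1.idx 103 rfl]; simp
    have a104 : s1.idx 104 0 0 = w' := by rw [F1.idx 104 rfl]; simp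
    have a16 : s1.idx 16 = upd (s.idx 16) 0 r w' := by rw [F1.idx 16 rfl]; simp
    have a17 : s1.idx 17 = upd (s.idx 17) 0 r (w' + w') := by rw [F1.idx 17 rfl]; simp
    have a18 : s1.idx 18 = s.idx 18 := by rw [F1.idx 18 rfl]; simp
    have a20 : s1.idx 20 = s.idx 20 := by rw [F1.idx 20 rfl]; simp
    have a21 : s1.idx 21 = s.idx 21 := by rw [F1.idx 21 rfl]; simp
    have a29 : s1.idx 29 = s.idx 29 := by rw [F1.idx 29 rfl]; simp
    simp only [a80, hs0, a18]
    refine orbit_spec c w' (by simp [a103]) (by simp [a104]) ?_ ?_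
    · simp only [Store.setI_idx_ne _ _ _ _ (by norm_num : (106 : ℕ) ≠ 18), hs0]
      refine sideC fun a ha => ?_
      rw [Store.setI_idx_ne _ _ _ _ (by omega), hin1 a ha]
    intro s2 t2 F2 ht2 h19
    have hin2 : ∀ a, a ≤ 15 → s2.idx a = s.idx a := by
      intro a ha
      rw [F2.idx a (by interval_cases a <;> rfl), Store.setI_idx_ne _ _ _ _ (by omega), hin1 a ha]
    have h19' : ∀ d ≤ w', s2.idx 19 0 d = (s.step c)^[d] (s.idx 2 c 1) := by
      intro d hd
      rw [h19 d hd]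
      have h1 : (s1.setI 18 0 r (s.side c)).step c = s.step c := by
        refine stepC fun a ha => ?_
        rw [Store.setI_idx_ne _ _ _ _ (by omega), hin1 a ha]
      rw [h1]
      simp [hin1 2 (by omega)]
    have b80 : s2.idx 80 0 0 = r := by rw [F2.idx 80 rfl]; simp [a80]
    have b103 : s2.idx 103 0 0 = c := by rw [F2.idx 103 rfl]; simp [a103]
    have b104 : s2.idx 104 0 0 = w' := by rw [F2.idx 104 rfl]; simp [a104]
    have b16 : s2.idx 16 = upd (s.idx 16) 0 r w' := by rw [F2.idx 16 rfl]; simp [a16]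
    have b17 : s2.idx 17 = upd (s.idx 17) 0 r (w' + w') := by rw [F2.idx 17 rfl]; simp [a17]
    have b18 : s2.idx 18 = upd (s.idx 18) 0 r (s.side c) := by rw [F2.idx 18 rfl]; simp [a18]
    have b20 : s2.idx 20 = s.idx 20 := by rw [F2.idx 20 rfl]; simp [a20]
    have b21 : s2.idx 21 = s.idx 21 := by rw [F2.idx 21 rfl]; simp [a21]
    have b29 : s2.idx 29 = s.idx 29 := by rw [F2.idx 29 rfl]; simp [a29]
    have b5 : s2.idx 5 = s.idx 5 := hin2 5 (by omega)
    refine WP_loop_setIdx w' r (fun d => s.idx 5 c ((s.step c)^[d] (s.idx 2 c 1))) (by norm_num)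
      (by simp [b80]) ?_ (by simp [b104]) ?_
    · intro d hd
      simp [b103, b5, h19' d hd.le]
    intro t3 ht3
    refine findWrap_spec w' (by simp [b104]) ?_ ?_
    · obtain ⟨a, ha, he⟩ : ∃ a < w', (s.step c)^[a] (s.idx 2 c 1) = (s.step c)^[w'] (s.idx 2 c 1) :=
        exists_iterate_eq hst.step hst.start
      refine ⟨a, ha, ?_⟩
      simpa using (h19' a ha.le).trans (he.trans (h19' w' le_rfl).symm)
    intro s4 t4 F4 ht4 h107 h107'
    have c80 : s4.idx 80 0 0 = r := by rw [F4.idx 80 rfl]; simp [b80]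
    have c104 : s4.idx 104 0 0 = w' := by rw [F4.idx 104 rfl]; simp [b104]
    set a := s4.idx 107 0 0 with had
    simp [h19' a h107.le, h19' w' le_rfl] at h107'
    refine wrapTable_spec r w' a (by simp [c80]) (by simp [c104]) (by simp [had]) ?_
    intro s5 t5 F5 ht5 hrow h20
    have hin : ∀ a, a ≤ 15 → s5.idx a = s.idx a := by
      intro a ha
      rw [F5.idx a (by interval_cases a <;> rfl), Store.setI_idx_ne _ _ _ _ (by omega),
        F4.idx a (by interval_cases a <;> rfl), Store.fillI_idx_ne _ _ _ _ (by omega),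
        Store.setI_idx_ne _ _ _ _ (by omega), hin2 a ha]
    have d16 : s5.idx 16 = upd (s.idx 16) 0 r w' := by
      rw [F5.idx 16 rfl, Store.setI_idx_ne _ _ _ _ (by norm_num), F4.idx 16 rfl]; simp [b16]
    have d17 : s5.idx 17 = upd (s.idx 17) 0 r (w' + w') := by
      rw [F5.idx 17 rfl, Store.setI_idx_ne _ _ _ _ (by norm_num), F4.idx 17 rfl]; simp [b17]
    have d18 : s5.idx 18 = upd (s.idx 18) 0 r (s.side c) := by
      rw [F5.idx 18 rfl, Store.setI_idx_ne _ _ _ _ (by norm_num), F4.idx 18 rfl]; simp [b18]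
    have d21 : s5.idx 21 =
        fillRow (s.idx 21) r w' (fun d => s.idx 5 c ((s.step c)^[d] (s.idx 2 c 1))) := by
      rw [F5.idx 21 rfl, Store.setI_idx_ne _ _ _ _ (by norm_num), F4.idx 21 rfl]; simp [b21]
    have d29 : s5.idx 29 = upd (s.idx 29) 0 r a := by
      rw [F5.idx 29 rfl, Store.setI_idx]
      simp only [IExp.eval_get, IExp.eval_zero, c80, F4.idx 29 rfl]
      simp [b29, had]
    have d20 : ∀ i, i ≠ r → s5.idx 20 i = s.idx 20 i := by
      intro i hi
      rw [hrow i hi, Store.setI_idx_ne _ _ _ _ (by norm_num), F4.idx 20 rfl]; simp [b20]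
    refine ⟨?_, ⟨?_, ?_⟩, ?_⟩
    · simp at ht3 ⊢
      omega
    · rw [hin 13 (by omega)]
      exact fun h => absurd h hk
    · rw [hin 13 (by omega), hin 14 (by omega), hin 2 (by omega)]
      intro _ c' hc' w'' hw''
      rw [← hcd] at hc'
      subst hc'
      rw [← hw'] at hw''
      subst hw''
      rw [sideC hin, stepC hin, hin 5 (by omega), d16, d17, d18, d29, d21]
      refine ⟨upd_same _ _ _ _, upd_same _ _ _ _, upd_same _ _ _ _, ?_⟩
      simp only [upd_same]
      refine ⟨ h107, h107', fun d hd => h20 d hd.le, fun d hd => ?_⟩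
      rw [fillRow_lt _ _ _ hd]
    · intro r' hr'
      refine ⟨hin, fun a ha => ?_, fun a ha => ?_⟩
      · simp at ha
        rcases ha with rfl | rfl | rfl | rfl
        · rw [d16, upd_ne _ _ (Or.inr hr')]
        · rw [d17, upd_ne _ _ (Or.inr hr')]
        · rw [d18, upd_ne _ _ (Or.inr hr')]
        · rw [d29, upd_ne _ _ (Or.inr hr')]
      · simp at ha
        rcases ha with rfl | rfl
        · exact d20 _ hr'
        · rw [d21, fillRow_ne _ _ _ hr']

/-! ## The lists of the vertices of the tables -/

/-- The decreasing list of the numbers below `x` with the property `φ`. -/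
def below (φ : ℕ → Prop) [DecidablePred φ] : ℕ → List ℕ
  | 0 => []
  | x + 1 => if φ x then x :: below φ x else below φ x

theorem mem_below {φ : ℕ → Prop} [DecidablePred φ] {x b : ℕ} : b ∈ below φ x ↔ b < x ∧ φ b := by
  induction x with
  | zero => simp [below]
  | succ x ih =>
    rw [below]
    by_cases h : φ x
    · rw [if_pos h, List.mem_cons, ih]
      constructor
      · rintro (rfl | h')
        · exact ⟨by omega, h⟩
        · exact ⟨by omega, h'.2⟩
      · rintro ⟨h1, h2⟩
        by_cases hb : b = x
        · exact Or.inl hb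
        · exact Or.inr ⟨by omega, h2⟩
    · rw [if_neg h, ih]
      constructor
      · exact fun h' => ⟨by omega, h'.2⟩
      · rintro ⟨h1, h2⟩
        have hb : b ≠ x := by rintro rfl; exact h h2
        exact ⟨by omega, h2⟩

theorem nodup_below {φ : ℕ → Prop} [DecidablePred φ] (x : ℕ) : (below φ x).Nodup := by
  induction x with
  | zero => simp [below]
  | succ x ih =>
    rw [below]
    split_ifs
    · exact List.nodup_cons.2 ⟨fun h => lt_irrefl _ (mem_below.1 h).1, ih⟩
    · exact ih

theorem below_eq_of_not {φ : ℕ → Prop} [DecidablePred φ] {x y : ℕ} (hyx : y ≤ x)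
    (h : ∀ u, y ≤ u → u < x → ¬ φ u) : below φ x = below φ y := by
  induction x with
  | zero => rw [Nat.le_zero.1 hyx]
  | succ x ih =>
    rcases Nat.lt_or_eq_of_le hyx with hlt | rfl
    · rw [below, if_neg (h x (by omega) (by omega)), ih (by omega) fun u h1 h2 => h u h1 (by omega)]
    · rfl

theorem below_filter {φ ψ : ℕ → Prop} [DecidablePred φ] [DecidablePred ψ] (x : ℕ) :
    (below φ x).filter (fun b => decide (ψ b)) = below (fun b => φ b ∧ ψ b) x := by
  induction x with
  | zero => rfl
  | succ x ih =>
    rw [below, below]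
    by_cases h1 : φ x <;> by_cases h2 : ψ x <;> simp [h1, h2, ih]

theorem below_congr {φ ψ : ℕ → Prop} [DecidablePred φ] [DecidablePred ψ] {x : ℕ}
    (h : ∀ b < x, φ b ↔ ψ b) : below φ x = below ψ x := by
  induction x with
  | zero => rfl
  | succ x ih => simp only [below, h x (by omega), ih fun b hb => h b (by omega)]

/-- A rank with the property can be recovered from an entry of one of two lists, so there are no
more such ranks than entries. -/
theorem length_below_le {φ : ℕ → Prop} [DecidablePred φ] {m m' : ℕ} {z z' : ℕ → ℕ}
    (hφ : ∀ u, φ u → (∃ j < m, z j = u + 1) ∨ ∃ j < m', z' j = u + 1) (x : ℕ) :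
    (below φ x).length ≤ m + m' := by
  rw [← List.toFinset_card_of_nodup (nodup_below x)]
  refine (card_le_card (t := (range m).image (fun j => z j - 1) ∪
    (range m').image (fun j => z' j - 1)) fun u hu => ?_).trans ((card_union_le _ _).trans ?_)
  · rw [List.mem_toFinset, mem_below] at hu
    rw [mem_union, mem_image, mem_image]
    rcases hφ u hu.2 with ⟨j, hj, h⟩ | ⟨j, hj, h⟩
    · exact Or.inl ⟨j, mem_range.2 hj, by omega⟩
    · exact Or.inr ⟨j, mem_range.2 hj, by omega⟩
  · refine Nat.add_le_add ?_ ?_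
    · simpa using card_image_le (s := range m) (f := fun j => z j - 1)
    · simpa using card_image_le (s := range m') (f := fun j => z' j - 1)

open Program IExp in
/-- Searching the list `lst` of the node in the register 109 for the largest entry of the row `κ` of
the array 12 that is smaller than the register 110. -/
def scan (κ lst : ℕ) (m : IExp) : Program :=
  loop 107 m (
    set 108 (.get 12 (.lit κ) (.get lst (V 109) (V 107))) ;;
    .ifLt (V 108) (V 110) (.ifLt (V 111) (V 108) (set 111 (V 108)) .nop) .nop)

theorem scan_spec {s : Store} {Q : Store → ℕ → Prop} {κ lst : ℕ} {m : IExp} (N : ℕ) (z : ℕ → ℕ)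
    (hlst : lst ≤ 20) (hm : ∀ s', Frame (scan κ lst m) s s' → m.eval s' = N) (hmc : m.cost ≤ 20)
    (hz : ∀ j < N, s.idx 12 κ (s.idx lst (s.idx 109 0 0) j) = z j)
    (hQ : ∀ s' t, Frame (scan κ lst m) s s' → t ≤ 80 * (N + 1) →
      s.idx 111 0 0 ≤ s'.idx 111 0 0 →
      (s'.idx 111 0 0 = s.idx 111 0 0 ∨
        s'.idx 111 0 0 < s.idx 110 0 0 ∧ ∃ j < N, z j = s'.idx 111 0 0) →
      (∀ j < N, z j < s.idx 110 0 0 → z j ≤ s'.idx 111 0 0) → Q s' t) :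
    WP (scan κ lst m) s Q := by
  suffices H : WP (scan κ lst m) s (fun s' t => t ≤ 80 * (N + 1) ∧
      s.idx 111 0 0 ≤ s'.idx 111 0 0 ∧
      (s'.idx 111 0 0 = s.idx 111 0 0 ∨
        s'.idx 111 0 0 < s.idx 110 0 0 ∧ ∃ j < N, z j = s'.idx 111 0 0) ∧
      (∀ j < N, z j < s.idx 110 0 0 → z j ≤ s'.idx 111 0 0)) from
    H.mono fun s' t h hF => hQ s' t hF h.1 h.2.1 h.2.2.1 h.2.2.2
  refine WP_loop N 40 (fun i s' => s.idx 111 0 0 ≤ s'.idx 111 0 0 ∧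
      (s'.idx 111 0 0 = s.idx 111 0 0 ∨
        s'.idx 111 0 0 < s.idx 110 0 0 ∧ ∃ j < N, z j = s'.idx 111 0 0) ∧
      (∀ j < i, z j < s.idx 110 0 0 → z j ≤ s'.idx 111 0 0)) rfl hm ?_ ?_ ?_
  · simp
  · rintro i s1 hi ⟨h1, h2, h3⟩ h107 hF
    have e109 := hF.idx 109 rfl
    have e110 := hF.idx 110 rfl
    have e12 := hF.idx 12 rfl
    have el : s1.idx lst = s.idx lst := by
      refine hF.idx lst ?_
      interval_cases lst <;> rfl
    simp only [WP_seq, WP_set, WP_ifLt, IExp.eval_get, IExp.eval_zero, IExp.eval_lit, e12, e109, el,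
      h107, hz i hi]
    have hne : ∀ v, (s1.setI 108 0 0 v).idx 110 = s1.idx 110 := fun v =>
      Store.setI_idx_ne _ _ _ _ (by norm_num)
    have hne' : ∀ v, (s1.setI 108 0 0 v).idx 111 = s1.idx 111 := fun v =>
      Store.setI_idx_ne _ _ _ _ (by norm_num)
    simp only [Store.setI_idx, upd_same, hne, hne', e110]
    split_ifs with g1 g2
    · simp
      refine ⟨by omega, Or.inr ⟨g1, i, hi, rfl⟩, fun j hj hlt => ?_⟩
      rcases Nat.lt_or_eq_of_le hj with hj | rfl
      · exact (h3 j hj hlt).trans g2.le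
      · exact le_rfl
    · simp
      refine ⟨h1, h2, fun j hj hlt => ?_⟩
      rcases Nat.lt_or_eq_of_le hj with hj | rfl
      · exact h3 j hj hlt
      · omega
    · simp
      refine ⟨h1, h2, fun j hj hlt => ?_⟩
      rcases Nat.lt_or_eq_of_le hj with hj | rfl
      · exact h3 j hj hlt
      · omega
  · rintro s1 t ⟨h1, h2, h3⟩ - - ht
    refine ⟨?_, h1, h2, h3⟩
    have : N * (40 + (m.cost + 12)) ≤ N * 72 := Nat.mul_le_mul_left _ (by omega)
    omega

open Program IExp in
/-- The largest entry for the bag of the node in the register 109 below the register 110. -/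
def nextBelow : Program :=
  set 111 0 ;; scan 1 8 (.get 6 (V 109) 1) ;; scan 0 9 (.get 6 (V 109) 2)

/-- The rank `u` occurs in the bag of the node `t`. -/
def InBag (s : Store) (t u : ℕ) : Prop :=
  (∃ j < s.idx 6 t 1, s.idx 12 1 (s.idx 8 t j) = u + 1) ∨
    ∃ j < s.idx 6 t 2, s.idx 12 0 (s.idx 9 t j) = u + 1

/-- Ranks are stored increased by one. Hence 0 can stand for the absence of a smaller rank, and the
two scans can share a running maximum that starts at 0. -/
theorem nextBelow_spec {s : Store} {Q : Store → ℕ → Prop} (t x : ℕ) (ht : s.idx 109 0 0 = t)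
    (hx : s.idx 110 0 0 = x)
    (hQ : ∀ s' t', Frame nextBelow s s' → t' ≤ 100 * (s.idx 6 t 1 + s.idx 6 t 2 + 2) →
      (s'.idx 111 0 0 = 0 ∨ s'.idx 111 0 0 < x ∧ InBag s t (s'.idx 111 0 0 - 1)) →
      (∀ u, InBag s t u → u + 1 < x → u + 1 ≤ s'.idx 111 0 0) → Q s' t') :
    WP nextBelow s Q := by
  suffices H : WP nextBelow s (fun s' t' => t' ≤ 100 * (s.idx 6 t 1 + s.idx 6 t 2 + 2) ∧
      (s'.idx 111 0 0 = 0 ∨ s'.idx 111 0 0 < x ∧ InBag s t (s'.idx 111 0 0 - 1)) ∧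
      (∀ u, InBag s t u → u + 1 < x → u + 1 ≤ s'.idx 111 0 0)) from
    H.mono fun s' t h hF => hQ s' t hF h.1 h.2.1 h.2.2
  simp only [nextBelow, WP_seq, WP_set]
  refine scan_spec (s.idx 6 t 1) (fun j => s.idx 12 1 (s.idx 8 t j)) (by norm_num) ?_ (by simp) ?_ ?_
  · intro s' hF
    have h6 := hF.idx 6 rfl
    have h109 := hF.idx 109 rfl
    simp at h6 h109
    simp [h6, h109, ht]
  · intro j _
    simp [ht]
  intro s1 t1 F1 ht1 h1 h2 h3
  have e6 := F1.idx 6 rfl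
  have e109 := F1.idx 109 rfl
  have e110 := F1.idx 110 rfl
  have e12 := F1.idx 12 rfl
  have e9 := F1.idx 9 rfl
  simp at e6 e109 e110 e12 e9 h1 h2 h3
  rw [hx] at h2 h3
  refine scan_spec (s.idx 6 t 2) (fun j => s.idx 12 0 (s.idx 9 t j)) (by norm_num) ?_ (by simp) ?_ ?_
  · intro s' hF
    simp [hF.idx 6 rfl, hF.idx 109 rfl, e6, e109, ht]
  · intro j _
    simp [e12, e9, e109, ht]
  intro s2 t2 F2 ht2 g1 g2 g3
  rw [e110, hx] at g2 g3
  refine ⟨by simp; omega, ?_, ?_⟩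
  · by_cases h0 : s2.idx 111 0 0 = 0
    · exact Or.inl h0
    · right
      rcases g2 with g2 | ⟨g2, j, hj, g⟩
      · rw [g2] at h0 ⊢
        rcases h2 with h2 | ⟨h2, j, hj, h⟩
        · exact absurd h2 h0
        · exact ⟨h2, Or.inl ⟨j, hj, by omega⟩⟩
      · exact ⟨g2, Or.inr ⟨j, hj, by omega⟩⟩
  · rintro u (⟨j, hj, h⟩ | ⟨j, hj, h⟩) hu
    · have := h3 j hj (by omega)
      omega
    · have := g3 j hj (by omega)
      omega

open Program IExp in
/-- The list of the table of the vertex in the register 80. -/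
def listBag : Program :=
  set 109 (.get 11 0 (.get 15 0 (V 80))) ;; set 110 (V 80 + 1) ;; set 112 0 ;;
  loop 113 (.get 6 (V 109) 1 + .get 6 (V 109) 2) (.ifLt 0 (V 110) (
    .setIdx 22 (V 80) (V 112) (V 110 - 1) ;; .setIdx 25 (V 80) (V 110 - 1) 1 ;;
    set 112 (V 112 + 1) ;; nextBelow ;; set 110 (V 111)) .nop) ;;
  .setIdx 23 0 (V 80) (V 112)

/-- The decreasing list is found by repeatedly searching for the largest smaller member. This is
quadratic in the size of the bag, which is affordable because `k` is at most the admitted table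
size. -/
theorem listBag_spec {s : Store} {Q : Store → ℕ → Prop} (r t m : ℕ) (φ : ℕ → Prop)
    [DecidablePred φ] (hr : s.idx 80 0 0 = r) (ht : s.idx 11 0 (s.idx 15 0 r) = t)
    (hm : s.idx 6 t 1 + s.idx 6 t 2 = m) (hφ : ∀ u, φ u ↔ InBag s t u) (hrφ : φ r)
    (h25 : ∀ b, s.idx 25 r b = 0)
    (hQ : ∀ s' t', Frame listBag s s' → t' ≤ 400 * ((m + 1) * (m + 1)) →
      s'.idx 112 0 0 = (below φ (r + 1)).length →
      s'.idx 23 = upd (s.idx 23) 0 r (below φ (r + 1)).length →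
      (∀ i, i ≠ r → s'.idx 22 i = s.idx 22 i ∧ s'.idx 25 i = s.idx 25 i) →
      (∀ j (h : j < (below φ (r + 1)).length), s'.idx 22 r j = (below φ (r + 1))[j]) →
      (∀ b, s'.idx 25 r b = if b ∈ below φ (r + 1) then 1 else 0) → Q s' t') :
    WP listBag s Q := by
  set T := below φ (r + 1) with hT
  suffices H : WP listBag s (fun s' t' => t' ≤ 400 * ((m + 1) * (m + 1)) ∧
      s'.idx 112 0 0 = T.length ∧ s'.idx 23 = upd (s.idx 23) 0 r T.length ∧
      (∀ i, i ≠ r → s'.idx 22 i = s.idx 22 i ∧ s'.idx 25 i = s.idx 25 i) ∧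
      (∀ j (h : j < T.length), s'.idx 22 r j = T[j]) ∧
      (∀ b, s'.idx 25 r b = if b ∈ T then 1 else 0)) from
    H.mono fun s' t h hF => hQ s' t hF h.1 h.2.1 h.2.2.1 h.2.2.2.1 h.2.2.2.2.1 h.2.2.2.2.2
  have hTm : T.length ≤ m := by
    rw [← hm]
    exact length_below_le (fun u hu => (hφ u).1 hu) (r + 1)
  simp only [listBag, WP_seq, WP_set]
  simp [hr, ht]
  -- `E` is the part already listed, and the register 110 is one more than the next member, or 0
  -- when none is left. As long as members remain, every round has listed exactly one.
  refine WP_loop m (100 * (m + 2) + 70) (fun i s' => ∃ E, T = E ++ below φ (s'.idx 110 0 0) ∧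
    s'.idx 112 0 0 = E.length ∧ (s'.idx 110 0 0 = 0 ∨ φ (s'.idx 110 0 0 - 1) ∧ E.length = i) ∧
    (∀ i, i ≠ r → s'.idx 22 i = s.idx 22 i ∧ s'.idx 25 i = s.idx 25 i) ∧
    (∀ j (h : j < E.length), s'.idx 22 r j = E[j]) ∧
    (∀ b, s'.idx 25 r b = if b ∈ E then 1 else 0)) rfl ?_ ?_ ?_ ?_
  · intro s' hF
    have h6 := hF.idx 6 rfl
    have h109 := hF.idx 109 rfl
    simp at h6 h109
    simp [h6, h109, hm]
  · refine ⟨[], by simp [hT], by simp, Or.inr ⟨by simpa using hrφ, rfl⟩, by simp, by simp, ?_⟩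
    simpa using h25
  · rintro i s1 hi ⟨E, hE, h112, hx, hrow, h22, h25⟩ h113 hF
    have e80 : s1.idx 80 0 0 = r := by rw [hF.idx 80 rfl]; simp [hr]
    have e109 : s1.idx 109 0 0 = t := by rw [hF.idx 109 rfl]; simp
    have e6 : s1.idx 6 = s.idx 6 := by rw [hF.idx 6 rfl]; simp
    have e8 : s1.idx 8 = s.idx 8 := by rw [hF.idx 8 rfl]; simp
    have e9 : s1.idx 9 = s.idx 9 := by rw [hF.idx 9 rfl]; simp
    have e12 : s1.idx 12 = s.idx 12 := by rw [hF.idx 12 rfl]; simp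
    obtain ⟨x, hxd⟩ : ∃ x, s1.idx 110 0 0 = x := ⟨_, rfl⟩
    rw [hxd] at hE hx
    rw [WP_ifLt]
    by_cases hx0 : x = 0
    · rw [if_neg (by simp [hxd, hx0])]
      simp
      exact ⟨E, by rw [hxd, hE], h112, Or.inl (by rw [hxd]; exact hx0), hrow, h22, h25⟩
    · rw [if_pos (by simp [hxd]; omega)]
      obtain ⟨hφx, hEi⟩ := hx.resolve_left hx0
      obtain ⟨y, rfl⟩ : ∃ y, x = y + 1 := ⟨x - 1, by omega⟩
      rw [Nat.add_sub_cancel] at hφx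
      simp only [WP_seq, WP_set, WP_setIdx]
      simp [e80, hxd, h112]
      refine nextBelow_spec t (y + 1) (by simp [e109]) (by simp [hxd]) ?_
      intro s2 t2 F2 ht2 g1 g2
      have hIn : ∀ u, InBag ((((s1.setI 22 r E.length y).setI 25 r y 1).setI 112 0 0 (E.length + 1))) t u
          ↔ φ u := by
        intro u
        rw [hφ]
        simp [InBag, e6, e8, e9, e12]
      have f112 : s2.idx 112 0 0 = E.length + 1 := by rw [F2.idx 112 rfl]; simp
      have f22 : s2.idx 22 = upd (s1.idx 22) r E.length y := by rw [F2.idx 22 rfl]; simp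
      have f25 : s2.idx 25 = upd (s1.idx 25) r y 1 := by rw [F2.idx 25 rfl]; simp
      obtain ⟨y', hy'⟩ : ∃ y', s2.idx 111 0 0 = y' := ⟨_, rfl⟩
      rw [hy'] at g1 g2
      have hy'y : y' ≤ y := by omega
      simp [f112, f22, f25, hy', e6, hm] at ht2 ⊢
      refine ⟨⟨E ++ [y], ?_, by simp, ?_, ?_, ?_, ?_⟩, by omega⟩
      · rw [hE, below, if_pos hφx, List.append_assoc, List.singleton_append,
          below_eq_of_not hy'y fun u hu1 hu2 hu => ?_]
        have := g2 u ((hIn u).2 hu) (by omega)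
        omega
      · rcases g1 with g1 | ⟨g1, g⟩
        · exact Or.inl g1
        · exact Or.inr ⟨(hIn _).1 g, by simp [hEi]⟩
      · intro i hi
        rw [upd_row_ne _ _ _ hi, upd_row_ne _ _ _ hi]
        exact hrow i hi
      · intro j hj
        rw [List.length_append, List.length_singleton] at hj
        by_cases h : j = E.length
        · subst h
          simp
        · have : j < E.length := by omega
          rw [upd_ne _ _ (Or.inr h), h22 j this, List.getElem_append_left this]
      · intro b
        by_cases h : b = y
        · subst h
          simp
        · rw [upd_ne _ _ (Or.inr h), h25 b]
          simp [h]
  · rintro s1 t1 ⟨E, hE, h112, hx, hrow, h22, h25⟩ - F1 ht1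
    have e80 : s1.idx 80 0 0 = r := by rw [F1.idx 80 rfl]; simp [hr]
    have e23 : s1.idx 23 = s.idx 23 := by rw [F1.idx 23 rfl]; simp
    have hET : T = E := by
      rcases hx with hx | ⟨hx, hl⟩
      · rw [hE, hx]; simp [below]
      · by_cases h0 : s1.idx 110 0 0 = 0
        · rw [hE, h0]; simp [below]
        -- A further member after `m` rounds would give the list more than `m` elements, contrary to
        -- `hTm`.
        · exfalso
          obtain ⟨y, hy⟩ : ∃ y, s1.idx 110 0 0 = y + 1 := ⟨s1.idx 110 0 0 - 1, by omega⟩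
          rw [hy, Nat.add_sub_cancel] at hx
          have := congrArg List.length hE
          rw [hy, below, if_pos hx, List.length_append, List.length_cons] at this
          omega
    subst hET
    simp [e80, h112, e23] at ht1 ⊢
    refine ⟨?_, hrow, h22, h25⟩
    have h1 : m * (100 * (m + 2) + 70 + 23) = 100 * (m * m) + 293 * m := by ring
    have h2 : (m + 1) * (m + 1) = m * m + 2 * m + 1 := by ring
    omega

open Program IExp in
/-- The sizes of the suffixes of the list of the vertex in the register 80. -/
def suffixSizes : Program :=
  .setIdx 24 (V 80) (V 112) 1 ;;
  loop 113 (V 112) (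
    set 114 (V 112 - 1 - V 113) ;; set 115 (.get 24 (V 80) (V 114 + 1)) ;; set 116 0 ;;
    loop 107 (.get 17 0 (.get 22 (V 80) (V 114))) (set 116 (V 116 + V 115)) ;;
    .setIdx 24 (V 80) (V 114) (V 116))

/-- Each product is formed by adding the previous size once for every value of the coordinate; its
cost is the dimension of the coordinate and not the size of the table. -/
theorem suffixSizes_spec {s : Store} {Q : Store → ℕ → Prop} (r D : ℕ) (T : List ℕ)
    (hr : s.idx 80 0 0 = r) (hl : s.idx 112 0 0 = T.length)
    (hT : ∀ j (h : j < T.length), s.idx 22 r j = T[j]) (hD : ∀ b ∈ T, s.idx 17 0 b ≤ D)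
    (hQ : ∀ s' t, Frame suffixSizes s s' → t ≤ 100 * (T.length * (D + 1) + 1) →
      (∀ i, i ≠ r → s'.idx 24 i = s.idx 24 i) →
      (∀ j ≤ T.length, s'.idx 24 r j = ((T.drop j).map (s.idx 17 0)).prod) → Q s' t) :
    WP suffixSizes s Q := by
  suffices H : WP suffixSizes s (fun s' t => t ≤ 100 * (T.length * (D + 1) + 1) ∧
      (∀ i, i ≠ r → s'.idx 24 i = s.idx 24 i) ∧
      (∀ j ≤ T.length, s'.idx 24 r j = ((T.drop j).map (s.idx 17 0)).prod)) from
    H.mono fun s' t h hF => hQ s' t hF h.1 h.2.1 h.2.2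
  rw [suffixSizes, WP_seq, WP_setIdx]
  refine WP_loop T.length (60 * D + 65) (fun i s' => (∀ i, i ≠ r → s'.idx 24 i = s.idx 24 i) ∧
    (∀ j, j ≤ T.length → T.length ≤ j + i →
      s'.idx 24 r j = ((T.drop j).map (s.idx 17 0)).prod)) rfl ?_ ?_ ?_ ?_
  · intro s' hF
    simp [hF.idx 112 rfl, hl]
  · refine ⟨fun i hi => ?_, fun j h1 h2 => ?_⟩
    · simp [hr, upd_row_ne _ _ _ hi]
    · obtain rfl : j = T.length := by omega
      simp [hr, hl]
  · rintro i s1 hi ⟨hrow, h24⟩ h113 hF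
    have e80 : s1.idx 80 0 0 = r := by rw [hF.idx 80 rfl]; simp [hr]
    have e112 : s1.idx 112 0 0 = T.length := by rw [hF.idx 112 rfl]; simp [hl]
    have e17 : s1.idx 17 = s.idx 17 := by rw [hF.idx 17 rfl]; simp
    have e22 : s1.idx 22 = s.idx 22 := by rw [hF.idx 22 rfl]; simp
    obtain ⟨j, hj⟩ : ∃ j, T.length - 1 - i = j := ⟨_, rfl⟩
    have hjl : j < T.length := by omega
    simp only [WP_seq, WP_set]
    simp [e80, e112, h113, hj]
    refine WP_loop (s.idx 17 0 T[j]) 12 (fun x s' =>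
      s'.idx 116 0 0 = x * s1.idx 24 r (j + 1)) rfl ?_ (by simp) ?_ ?_
    · intro s' hF'
      have g17 := hF'.idx 17 rfl
      have g22 := hF'.idx 22 rfl
      have g80 := hF'.idx 80 rfl
      have g114 := hF'.idx 114 rfl
      simp at g17 g22 g80 g114
      simp [g17, g22, g80, g114, e17, e22, e80, hT j hjl]
    · intro x s2 hx h116 h107 hF'
      have g115 := hF'.idx 115 rfl
      simp at g115
      simp [h116, g115]
      ring
    · intro s2 t2 h116 h107 hF' ht2
      have g80 : s2.idx 80 0 0 = r := by rw [hF'.idx 80 rfl]; simp [e80]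
      have g114 : s2.idx 114 0 0 = j := by rw [hF'.idx 114 rfl]; simp
      have g24 : s2.idx 24 = s1.idx 24 := by rw [hF'.idx 24 rfl]; simp
      have hDj := hD T[j] (List.getElem_mem _)
      simp at ht2
      simp [g80, g114, g24, h116]
      refine ⟨⟨fun i hi => ?_, fun j' h1 h2 => ?_⟩, ?_⟩
      · rw [upd_row_ne _ _ _ hi, hrow i hi]
      · by_cases h : j' = j
        · subst h
          rw [upd_same, h24 (j' + 1) (by omega) (by omega), ← List.map_drop,
            List.drop_eq_getElem_cons hjl, List.map_cons, List.prod_cons]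
        · rw [upd_ne _ _ (Or.inr h), h24 j' h1 (by omega), List.map_drop]
      · have : s.idx 17 0 T[j] * 33 ≤ D * 33 := Nat.mul_le_mul_right _ hDj
        omega
  · rintro s1 t1 ⟨hrow, h24⟩ - - ht
    refine ⟨?_, hrow, fun j hj => ?_⟩
    · simp at ht ⊢
      have : T.length * (60 * D + 65 + 15) ≤ T.length * (100 * (D + 1)) :=
        Nat.mul_le_mul_left _ (by omega)
      rw [Nat.mul_left_comm] at this
      omega
    · rw [h24 j hj (by omega), List.map_drop]

/-! ## All vertices -/

open Program IExp in
/-- The counters of all vertices. -/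
def countAll : Program := loop 80 (V 30) countVertex

theorem countAll_spec {s : Store} {Q : Store → ℕ → Prop} (n w : ℕ) (hn : s.idx 30 0 0 = n)
    (hc : ∀ r < n, s.idx 13 0 r ≠ 0 → StepsIn s (s.idx 14 0 r) ∧ s.idx 2 (s.idx 14 0 r) 0 ≤ w)
    (hQ : ∀ s' t, Frame countAll s s' → t ≤ 600 * (n * (w + 1) + 1) →
      (∀ r < n, CountAt s' r) → Q s' t) :
    WP countAll s Q := by
  suffices H : WP countAll s (fun s' t => t ≤ 600 * (n * (w + 1) + 1) ∧ ∀ r < n, CountAt s' r) from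
    H.mono fun s' t h hF => hQ s' t hF h.1 h.2
  have hset : ∀ (s' : Store) i r, SameCount s' (s'.setI 80 0 0 i) r := fun s' i r =>
    ⟨fun a ha => Store.setI_idx_ne _ _ _ _ (by omega),
      fun a ha => by rw [Store.setI_idx_ne _ _ _ _ (by simp at ha; omega)],
      fun a ha => by rw [Store.setI_idx_ne _ _ _ _ (by simp at ha; omega)]⟩
  refine WP_loop n (500 * (w + 1)) (fun i s' => ∀ r < i, CountAt s' r) rfl ?_ ?_ ?_ ?_
  · intro s' hF
    simp [hF.idx 30 rfl, hn]
  · simp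
  · intro i s1 hi hI h80 hF
    have e2 := hF.idx 2 rfl
    have e3 := hF.idx 3 rfl
    have e4 := hF.idx 4 rfl
    refine countVertex_spec i w h80 ?_ ?_
    · rw [hF.idx 13 rfl, hF.idx 14 rfl, e2]
      intro h
      obtain ⟨⟨h1, h2⟩, h3⟩ := hc i hi h
      refine ⟨⟨by rw [e2]; exact h1, ?_⟩, h3⟩
      have : s1.step (s.idx 14 0 i) = s.step (s.idx 14 0 i) := by
        rw [Store.step, Store.step, Store.side, Store.side, e2, e3, e4]
      rw [this, e2]
      exact h2
    · intro s2 t2 _ ht2 hi2 hother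
      refine ⟨fun r hr => ?_, ht2⟩
      refine CountAt.congr ?_ (hset s2 _ r)
      by_cases h : r = i
      · rw [h]; exact hi2
      · exact (hI r (by omega)).congr (hother r h)
  · intro s1 t1 hI _ _ ht
    refine ⟨?_, hI⟩
    simp at ht
    have : n * (500 * (w + 1) + 15) ≤ n * (600 * (w + 1)) := Nat.mul_le_mul_left _ (by omega)
    rw [Nat.mul_left_comm] at this
    omega

open Program IExp in
/-- The lists of all vertices. -/
def listAll : Program := loop 80 (V 30) (listBag ;; suffixSizes)

open Classical in
theorem listAll_spec {s : Store} {Q : Store → ℕ → Prop} (n k D : ℕ) (φ : ℕ → ℕ → Prop)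
    (hn : s.idx 30 0 0 = n)
    (hφ : ∀ r < n, ∀ u, φ r u ↔ InBag s (s.idx 11 0 (s.idx 15 0 r)) u) (hr : ∀ r < n, φ r r)
    (h25 : ∀ r b, s.idx 25 r b = 0)
    (hk : ∀ r < n, s.idx 6 (s.idx 11 0 (s.idx 15 0 r)) 1 +
      s.idx 6 (s.idx 11 0 (s.idx 15 0 r)) 2 ≤ k)
    (hD : ∀ r < n, s.idx 17 0 r ≤ D)
    (hQ : ∀ s' t, Frame listAll s s' →
      t ≤ 1000 * (n * ((k + 1) * (k + 1) + k * (D + 1)) + 1) →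
      (∀ r < n, s'.idx 23 0 r = (below (φ r) (r + 1)).length ∧
        (∀ j (h : j < (below (φ r) (r + 1)).length), s'.idx 22 r j = (below (φ r) (r + 1))[j]) ∧
        (∀ b, s'.idx 25 r b = if b ∈ below (φ r) (r + 1) then 1 else 0) ∧
        ∀ j ≤ (below (φ r) (r + 1)).length, s'.idx 24 r j =
          (((below (φ r) (r + 1)).drop j).map (s.idx 17 0)).prod) → Q s' t) :
    WP listAll s Q := by
  set T := fun r => below (φ r) (r + 1) with hT
  have hTk : ∀ r < n, (T r).length ≤ k := fun r hr =>
    (length_below_le (fun u hu => (hφ r hr u).1 hu) (r + 1)).trans (hk r hr)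
  suffices H : WP listAll s (fun s' t => t ≤ 1000 * (n * ((k + 1) * (k + 1) + k * (D + 1)) + 1) ∧
      (∀ r < n, s'.idx 23 0 r = (T r).length ∧
        (∀ j (h : j < (T r).length), s'.idx 22 r j = (T r)[j]) ∧
        (∀ b, s'.idx 25 r b = if b ∈ T r then 1 else 0) ∧
        ∀ j ≤ (T r).length, s'.idx 24 r j = (((T r).drop j).map (s.idx 17 0)).prod)) from
    H.mono fun s' t h hF => hQ s' t hF h.1 h.2
  refine WP_loop n (400 * ((k + 1) * (k + 1)) + 100 * (k * (D + 1) + 1)) (fun i s' =>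
    (∀ r < i, s'.idx 23 0 r = (T r).length ∧
        (∀ j (h : j < (T r).length), s'.idx 22 r j = (T r)[j]) ∧
        (∀ b, s'.idx 25 r b = if b ∈ T r then 1 else 0) ∧
        ∀ j ≤ (T r).length, s'.idx 24 r j = (((T r).drop j).map (s.idx 17 0)).prod) ∧
    ∀ r, i ≤ r → ∀ b, s'.idx 25 r b = 0) rfl ?_ ?_ ?_ ?_
  · intro s' hF
    simp [hF.idx 30 rfl, hn]
  · simpa using h25
  · rintro i s1 hi ⟨hI, hz⟩ h80 hF
    have e6 := hF.idx 6 rfl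
    have e8 := hF.idx 8 rfl
    have e9 := hF.idx 9 rfl
    have e11 := hF.idx 11 rfl
    have e12 := hF.idx 12 rfl
    have e15 := hF.idx 15 rfl
    have e17 := hF.idx 17 rfl
    rw [WP_seq]
    refine listBag_spec i (s.idx 11 0 (s.idx 15 0 i))
      (s.idx 6 (s.idx 11 0 (s.idx 15 0 i)) 1 + s.idx 6 (s.idx 11 0 (s.idx 15 0 i)) 2) (φ i) h80
      (by rw [e11, e15]) (by rw [e6]) ?_ (hr i hi) (hz i le_rfl) ?_
    · intro u
      rw [hφ i hi, InBag, InBag, e6, e8, e9, e12]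
    intro s2 t2 F2 ht2 h112 h23 hrow h22 h25'
    refine suffixSizes_spec i D (T i) (by rw [F2.idx 80 rfl, h80]) h112 h22 ?_ ?_
    · intro b hb
      rw [F2.idx 17 rfl, e17]
      exact hD b (lt_of_lt_of_le (mem_below.1 hb).1 hi)
    intro s3 t3 F3 ht3 hrow3 h24
    have e22 : s3.idx 22 = s2.idx 22 := F3.idx 22 rfl
    have e23 : s3.idx 23 = s2.idx 23 := F3.idx 23 rfl
    have e25 : s3.idx 25 = s2.idx 25 := F3.idx 25 rfl
    have e24 : s2.idx 24 = s1.idx 24 := F2.idx 24 rfl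
    have e17' : s2.idx 17 = s.idx 17 := by rw [F2.idx 17 rfl, e17]
    refine ⟨⟨fun r hr => ?_, fun r hr b => ?_⟩, ?_⟩
    · simp only [Store.setI_idx_ne _ _ _ _ (by norm_num : (22 : ℕ) ≠ 80),
        Store.setI_idx_ne _ _ _ _ (by norm_num : (23 : ℕ) ≠ 80),
        Store.setI_idx_ne _ _ _ _ (by norm_num : (24 : ℕ) ≠ 80),
        Store.setI_idx_ne _ _ _ _ (by norm_num : (25 : ℕ) ≠ 80), e22, e23, e25, h23]
      by_cases h : r = i
      · subst h
        refine ⟨by simp [hT], h22, h25', fun j hj => ?_⟩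
        rw [h24 j hj, e17']
      · rw [upd_ne _ _ (Or.inr h), (hrow r h).1, (hrow r h).2, hrow3 r h, e24]
        exact hI r (by omega)
    · rw [Store.setI_idx_ne _ _ _ _ (by norm_num : (25 : ℕ) ≠ 80), e25, (hrow r (by omega)).2]
      exact hz r (by omega) b
    · have h1 : (s.idx 6 (s.idx 11 0 (s.idx 15 0 i)) 1 +
          s.idx 6 (s.idx 11 0 (s.idx 15 0 i)) 2 + 1) * (s.idx 6 (s.idx 11 0 (s.idx 15 0 i)) 1 +
          s.idx 6 (s.idx 11 0 (s.idx 15 0 i)) 2 + 1) ≤ (k + 1) * (k + 1) :=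
        Nat.mul_le_mul (by have := hk i hi; omega) (by have := hk i hi; omega)
      have h2 : (T i).length * (D + 1) ≤ k * (D + 1) := Nat.mul_le_mul_right _ (hTk i hi)
      omega
  · rintro s1 t1 ⟨hI, -⟩ - - ht
    refine ⟨?_, hI⟩
    simp at ht
    have h0 : 1 ≤ (k + 1) * (k + 1) := Nat.mul_pos (by omega) (by omega)
    have : n * (400 * ((k + 1) * (k + 1)) + 100 * (k * (D + 1) + 1) + 15) ≤
        n * (1000 * ((k + 1) * (k + 1) + k * (D + 1))) := Nat.mul_le_mul_left _ (by omega)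
    rw [Nat.mul_left_comm n 1000] at this
    omega

/-- The rule for counting loops whose invariant refers to the time spent in the rounds. -/
theorem WP_loop_time {v : ℕ} {b : IExp} {p : Program} {s : Store} {Q : Store → ℕ → Prop} (n : ℕ)
    (I : ℕ → Store → ℕ → Prop) (hv : p.writesI v = false)
    (hb : ∀ s', Frame (.loop v b p) s s' → b.eval s' = n)
    (h0 : I 0 (s.setI v 0 0 0) 0)
    (hs : ∀ i s' T, i < n → I i s' T → s'.idx v 0 0 = i → Frame (.loop v b p) s s' →
      WP p s' (fun s'' t => I (i + 1) (s''.setI v 0 0 (i + 1)) (T + t)))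
    (hQ : ∀ s' T t, I n s' T → Frame (.loop v b p) s s' →
      t ≤ T + n * (b.cost + 12) + (b.cost + 8) → Q s' t) :
    WP (.loop v b p) s Q := by
  have hF0 : Frame (.loop v b p) s (s.setI v 0 0 0) := by
    refine ⟨fun a ha => Store.setI_idx_ne _ _ _ _ fun h => ?_, fun a _ => rfl⟩
    simp [Program.loop, Program.writesI, h] at ha
  have hle : ∀ s', Frame (p ;; .setIdx v 0 0 (V v + 1)) (s.setI v 0 0 0) s' →
      Frame (.loop v b p) s s' := fun s' h => hF0.trans (h.of_le
        (by intro a; simp +contextual [Program.loop, Program.writesI])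
        (by intro a; simp +contextual [Program.loop, Program.writesN]))
  have hcost : (V v).cost + b.cost + 1 = b.cost + 4 := by simp; omega
  suffices H : ∀ m i s' T, i + m = n → I i s' T → s'.idx v 0 0 = i →
      Frame (p ;; .setIdx v 0 0 (V v + 1)) (s.setI v 0 0 0) s' → ∃ s'' t T',
      Exec (.whileLt (V v) b (p ;; .setIdx v 0 0 (V v + 1))) s' s'' t ∧ I n s'' T' ∧
      Frame (p ;; .setIdx v 0 0 (V v + 1)) (s.setI v 0 0 0) s'' ∧
      t + T ≤ T' + m * (b.cost + 12) + (b.cost + 4) by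
    obtain ⟨s'', t, T', he, hI, hF, ht⟩ := H n 0 _ 0 (by omega) h0 (by simp) (Frame.refl _ _)
    rw [Program.loop, WP_seq, WP_setIdx]
    refine ⟨s'', t, he, hQ s'' T' _ hI (hle _ hF) ?_⟩
    simp only [IExp.cost_zero]
    omega
  intro m
  induction m with
  | zero =>
    intro i s' T hi hI hvi hF
    obtain rfl : i = n := by omega
    refine ⟨s', _, T, .whileFalse ?_, hI, hF, ?_⟩
    · simp [hvi, hb s' (hle s' hF)]
    · omega
  | succ m ih =>
    intro i s' T hi hI hvi hF
    have hstep : WP (p ;; .setIdx v 0 0 (V v + 1)) s' (fun s'' t => s''.idx v 0 0 = i + 1 ∧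
        ∃ t', t = t' + 8 ∧ I (i + 1) s'' (T + t')) := by
      rw [WP_seq]
      refine (hs i s' T (by omega) hI hvi (hle s' hF)).mono ?_
      intro s'' t hI' hF'
      have : s''.idx v 0 0 = i := by rw [hF'.idx v hv, hvi]
      simp only [WP_setIdx, IExp.eval_zero, IExp.eval_add, IExp.eval_get, IExp.eval_one, this,
        IExp.cost_zero, IExp.cost_one, IExp.cost_add, IExp.cost_get]
      exact ⟨by simp, t, by omega, hI'⟩
    obtain ⟨s1, t1, he1, hv1, t', rfl, hI1⟩ := hstep
    obtain ⟨s2, t2, T2, he2, hI2, hF2, ht2⟩ :=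
      ih (i + 1) s1 _ (by omega) hI1 hv1 (hF.trans he1.frame)
    refine ⟨s2, _, T2, .whileTrue ?_ he1 he2, hI2, hF2, ?_⟩
    · simp [hvi, hb s' (hle s' hF)]
      omega
    · rw [Nat.add_mul]
      omega

/-! ## Breadth first search in the decomposition tree -/

/-- The node `u` is in the list of neighbours of the node `t`. -/
def Neighbor (s : Store) (t u : ℕ) : Prop := ∃ j < s.idx 6 t 0, s.idx 7 t j = u

/-- The first `m` entries of the queue in the array 11. -/
structure Queue (A : ℕ → ℕ → Prop) (N : ℕ) (s : Store) (m : ℕ) : Prop where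
  tail : s.idx 118 0 0 = m
  pos : 0 < m
  zero : s.idx 11 0 0 = 0
  lt : ∀ i < m, s.idx 11 0 i < N
  inj : ∀ i < m, ∀ j < m, s.idx 11 0 i = s.idx 11 0 j → i = j
  mark : ∀ u, s.idx 10 0 u = 0 ↔ ∀ i < m, s.idx 11 0 i ≠ u
  parent : ∀ i < m, 0 < i → ∃ j < i, A (s.idx 11 0 j) (s.idx 11 0 i)

theorem Queue.congr {A : ℕ → ℕ → Prop} {N : ℕ} {s s' : Store} {m : ℕ} (h : Queue A N s m)
    (h10 : s'.idx 10 = s.idx 10) (h11 : s'.idx 11 = s.idx 11) (h118 : s'.idx 118 = s.idx 118) :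
    Queue A N s' m := by
  obtain ⟨h1, h2, h3, h4, h5, h6, h7⟩ := h
  constructor
  · rw [h118]; exact h1
  · exact h2
  · rw [h11]; exact h3
  · rw [h11]; exact h4
  · rw [h11]; exact h5
  · rw [h10, h11]; exact h6
  · rw [h11]; exact h7

theorem Queue.push {A : ℕ → ℕ → Prop} {N : ℕ} {s s' : Store} {m u p : ℕ} (h : Queue A N s m)
    (hu : s.idx 10 0 u = 0) (huN : u < N) (hp : p < m) (hA : A (s.idx 11 0 p) u)
    (h10 : s'.idx 10 = upd (s.idx 10) 0 u 1) (h11 : s'.idx 11 = upd (s.idx 11) 0 m u)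
    (h118 : s'.idx 118 0 0 = m + 1) : Queue A N s' (m + 1) := by
  have hnew := (h.mark u).1 hu
  have hold : ∀ i, i < m → s'.idx 11 0 i = s.idx 11 0 i := fun i hi => by
    rw [h11, upd_ne _ _ (Or.inr (by omega))]
  have hm : s'.idx 11 0 m = u := by rw [h11, upd_same]
  constructor
  · exact h118
  · omega
  · rw [hold 0 h.pos, h.zero]
  · intro i hi
    rcases Nat.lt_or_eq_of_le (Nat.le_of_lt_succ hi) with hi | rfl
    · rw [hold i hi]; exact h.lt i hi
    · rw [hm]; exact huN
  · intro i hi j hj he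
    rcases Nat.lt_or_eq_of_le (Nat.le_of_lt_succ hi) with hi | rfl <;>
      rcases Nat.lt_or_eq_of_le (Nat.le_of_lt_succ hj) with hj | rfl
    · rw [hold i hi, hold j hj] at he
      exact h.inj i hi j hj he
    · rw [hold i hi, hm] at he
      exact absurd he (hnew i hi)
    · rw [hold j hj, hm] at he
      exact absurd he.symm (hnew j hj)
    · rfl
  · intro v
    rw [h10]
    by_cases hv : v = u
    · subst hv
      rw [upd_same]
      refine ⟨fun h => by omega, fun h => absurd hm (h m (by omega))⟩
    · rw [upd_ne _ _ (Or.inr hv), h.mark v]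
      constructor
      · intro h' i hi
        rcases Nat.lt_or_eq_of_le (Nat.le_of_lt_succ hi) with hi | rfl
        · rw [hold i hi]; exact h' i hi
        · rw [hm]; exact fun e => hv e.symm
      · intro h' i hi
        rw [← hold i hi]
        exact h' i (by omega)
  · intro i hi h0
    rcases Nat.lt_or_eq_of_le (Nat.le_of_lt_succ hi) with hi | rfl
    · obtain ⟨j, hj, hA⟩ := h.parent i hi h0
      exact ⟨j, hj, by rw [hold i hi, hold j (by omega)]; exact hA⟩
    · exact ⟨p, hp, by rw [hm, hold p hp]; exact hA⟩

open Program IExp in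
/-- Adding the new neighbours of the node in the register 119 to the queue. -/
def visit : Program :=
  loop 120 (.get 6 (V 119) 0) (
    set 121 (.get 7 (V 119) (V 120)) ;;
    .ifLt (.get 10 0 (V 121)) 1 (
      .setIdx 10 0 (V 121) 1 ;; .setIdx 11 0 (V 118) (V 121) ;; set 118 (V 118 + 1)) .nop)

theorem visit_spec {s : Store} {Q : Store → ℕ → Prop} (N m h t : ℕ) (A : ℕ → ℕ → Prop)
    (ht : s.idx 119 0 0 = t) (hq : Queue A N s m) (hh : h < m) (hht : s.idx 11 0 h = t)
    (hA : ∀ u, Neighbor s t u → A t u ∧ u < N)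
    (hQ : ∀ s' t' m', Frame visit s s' → t' ≤ 80 * (s.idx 6 t 0 + 1) → Queue A N s' m' → m ≤ m' →
      (∀ i < m, s'.idx 11 0 i = s.idx 11 0 i) →
      (∀ u, Neighbor s t u → ∃ i < m', s'.idx 11 0 i = u) → Q s' t') :
    WP visit s Q := by
  suffices H : WP visit s (fun s' t' => t' ≤ 80 * (s.idx 6 t 0 + 1) ∧ ∃ m', Queue A N s' m' ∧
      m ≤ m' ∧ (∀ i < m, s'.idx 11 0 i = s.idx 11 0 i) ∧
      (∀ u, Neighbor s t u → ∃ i < m', s'.idx 11 0 i = u)) from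
    H.mono fun s' t ⟨h1, m', h2, h3, h4, h5⟩ hF => hQ s' t m' hF h1 h2 h3 h4 h5
  refine WP_loop (s.idx 6 t 0) 50 (fun x s' => ∃ m', Queue A N s' m' ∧
      m ≤ m' ∧ (∀ i < m, s'.idx 11 0 i = s.idx 11 0 i) ∧
      (∀ j < x, ∃ i < m', s'.idx 11 0 i = s.idx 7 t j)) rfl ?_ ?_ ?_ ?_
  · intro s' hF
    simp [hF.idx 6 rfl, hF.idx 119 rfl, ht]
  · exact ⟨m, hq.congr (by simp) (by simp) (by simp), le_rfl, by simp, by simp⟩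
  · rintro x s1 hx ⟨m', hq', hm, hold, hv⟩ h120 hF
    have e7 := hF.idx 7 rfl
    have e119 : s1.idx 119 0 0 = t := by rw [hF.idx 119 rfl, ht]
    obtain ⟨u, hu⟩ : ∃ u, s.idx 7 t x = u := ⟨_, rfl⟩
    simp only [WP_seq, WP_set, WP_ifLt]
    simp [e119, h120, e7, hu]
    split_ifs with hc
    · obtain ⟨hAu, huN⟩ := hA u ⟨x, hx, hu⟩
      refine ⟨m' + 1, hq'.push (u := u) (p := h) hc huN (by omega) ?_ (by simp)
        (by simp [hq'.tail]) (by simp [hq'.tail]), by omega, ?_, ?_⟩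
      · rw [hold h hh, hht]; exact hAu
      · intro i hi
        simp [hq'.tail]
        rw [upd_ne _ _ (Or.inr (by omega)), hold i hi]
      · intro j hj
        simp [hq'.tail]
        rcases Nat.lt_or_eq_of_le (by omega : j ≤ x) with hj | rfl
        · obtain ⟨i, hi, he⟩ := hv j hj
          exact ⟨i, by omega, by rw [upd_ne _ _ (Or.inr (by omega)), he]⟩
        · exact ⟨m', by omega, by rw [upd_same, hu]⟩
    · refine ⟨m', hq'.congr (by simp) (by simp) (by simp), hm, by simpa using hold, ?_⟩
      intro j hj
      rcases Nat.lt_or_eq_of_le (by omega : j ≤ x) with hj | rfl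
      · exact hv j hj
      · by_contra hcon
        push Not at hcon
        rw [hu] at hcon
        exact hc ((hq'.mark u).2 hcon)
  · rintro s1 t1 ⟨m', hq', hm, hold, hv⟩ - - ht1
    simp at ht1
    refine ⟨by omega, m', hq', hm, hold, ?_⟩
    rintro u ⟨j, hj, rfl⟩
    exact hv j hj

open Program IExp in
/-- Breadth first search from the node `0`; the queue is in the array 11. -/
def search : Program :=
  .setIdx 11 0 0 0 ;; .setIdx 10 0 0 1 ;; set 118 1 ;;
  loop 117 (.get 0 0 2) (set 119 (.get 11 0 (V 117)) ;; visit)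

/-- The loop visits all `N` positions without testing whether the queue is empty; connectedness
guarantees that there is always an entry to visit. A visit costs its degree, so the time is added up
along the queue, and the total is governed by the sum of the degrees. -/
theorem search_spec {s : Store} {Q : Store → ℕ → Prop} (N M : ℕ) (hN : s.idx 0 0 2 = N)
    (hpos : 0 < N) (h10 : ∀ u, s.idx 10 0 u = 0) (hnb : ∀ t < N, ∀ u, Neighbor s t u → u < N)
    (hconn : ∀ S : ℕ → Prop, S 0 → (∀ t < N, S t → ∀ u, Neighbor s t u → S u) → ∀ t < N, S t)
    (hM : ∑ t ∈ range N, s.idx 6 t 0 ≤ M)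
    (hQ : ∀ s' t', Frame search s s' → t' ≤ 200 * (N + M + 1) →
      (∀ i < N, s'.idx 11 0 i < N) →
      (∀ i < N, ∀ j < N, s'.idx 11 0 i = s'.idx 11 0 j → i = j) →
      (∀ i < N, 0 < i → ∃ j < i, Neighbor s (s'.idx 11 0 j) (s'.idx 11 0 i)) → Q s' t') :
    WP search s Q := by
  set A := Neighbor s with hA
  suffices H : WP search s (fun s' t' => t' ≤ 200 * (N + M + 1) ∧ Queue A N s' N) from
    H.mono fun s' t ⟨h1, h2⟩ hF => hQ s' t hF h1 h2.lt h2.inj h2.parent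
  have hle : ∀ {s' m}, Queue A N s' m → m ≤ N := fun {s' m} h => by
    have := card_le_card_of_injOn (s := range m) (t := range N) (s'.idx 11 0)
      (fun i hi => by simpa using h.lt i (by simpa using hi))
      (fun i hi j hj he => h.inj i (by simpa using hi) j (by simpa using hj) he)
    simpa using this
  -- If all queued nodes have been visited, they form a set that contains the node 0 and is closed
  -- under neighbours. It is then the set of all nodes, which contradicts `h < N`.
  have hfull : ∀ {s' m h}, Queue A N s' m → h < N → h ≤ m →
      (∀ i < h, ∀ u, A (s'.idx 11 0 i) u → ∃ j < m, s'.idx 11 0 j = u) → h < m := by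
    intro s' m h hq hhN hhm hcl
    by_contra hcon
    obtain rfl : m = h := by omega
    have hall := hconn (fun t => ∃ i < m, s'.idx 11 0 i = t) ⟨0, hq.pos, hq.zero⟩ (by
      rintro t ht ⟨i, hi, rfl⟩ u hu
      exact hcl i hi u hu)
    have := card_le_card (s := range N) (t := (range m).image (s'.idx 11 0)) (fun t ht => by
      obtain ⟨i, hi, he⟩ := hall t (by simpa using ht)
      exact mem_image.2 ⟨i, by simpa using hi, he⟩)
    have h2 := card_image_le (s := range m) (f := s'.idx 11 0)
    simp at this h2
    omega
  simp only [search, WP_seq, WP_setIdx, WP_set]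
  refine WP_loop_time N (fun h s' T => ∃ m, Queue A N s' m ∧ h ≤ m ∧
    (∀ i < h, ∀ u, A (s'.idx 11 0 i) u → ∃ j < m, s'.idx 11 0 j = u) ∧
    T ≤ ∑ i ∈ range h, (80 * s.idx 6 (s'.idx 11 0 i) 0 + 100)) rfl ?_ ?_ ?_ ?_
  · intro s' hF
    have h0 := hF.idx 0 rfl
    simp at h0
    simp [h0, hN]
  · refine ⟨1, ⟨by simp, by omega, by simp, ?_, ?_, ?_, ?_⟩, by omega, by simp, by simp⟩
    · intro i hi
      obtain rfl : i = 0 := by omega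
      simpa using hpos
    · intro i hi j hj _
      omega
    · intro u
      by_cases hu : u = 0
      · subst hu
        simp
      · simp [upd_ne _ _ (Or.inr hu : (0 : ℕ) ≠ 0 ∨ u ≠ 0), h10]
        exact fun e => hu e.symm
    · intro i hi h0
      omega
  · rintro h s1 T hh ⟨m, hq, hhm, hcl, hT⟩ h117 hF
    have e6 : s1.idx 6 = s.idx 6 := by rw [hF.idx 6 rfl]; simp
    have e7 : s1.idx 7 = s.idx 7 := by rw [hF.idx 7 rfl]; simp
    have hlt := hfull hq hh hhm hcl
    obtain ⟨t, ht⟩ : ∃ t, s1.idx 11 0 h = t := ⟨_, rfl⟩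
    have htN : t < N := by rw [← ht]; exact hq.lt h hlt
    rw [WP_seq, WP_set]
    simp [h117, ht]
    have hAn : ∀ u, Neighbor (s1.setI 119 0 0 t) t u ↔ A t u := by
      intro u
      simp [hA, Neighbor, e6, e7]
    refine visit_spec N m h t A (by simp) (hq.congr (by simp) (by simp) (by simp)) hlt
      (by simpa using ht) (fun u hu => ⟨(hAn u).1 hu, hnb t htN u ((hAn u).1 hu)⟩) ?_
    intro s2 t2 m' F2 ht2 hq2 hm' hold hnew
    simp [e6] at ht2 hold
    refine ⟨m', hq2.congr (by simp) (by simp) (by simp), by omega, ?_, ?_⟩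
    · intro i hi u hu
      rw [hold i (by omega)] at hu
      by_cases hih : i = h
      · subst hih
        rw [ht] at hu
        exact hnew u ((hAn u).2 hu)
      · obtain ⟨j, hj, he⟩ := hcl i (by omega) u hu
        exact ⟨j, by omega, by rw [hold j hj, he]⟩
    · have : ∑ i ∈ range h, (80 * s.idx 6 (s2.idx 11 0 i) 0 + 100) =
          ∑ i ∈ range h, (80 * s.idx 6 (s1.idx 11 0 i) 0 + 100) :=
        sum_congr rfl fun i hi => by
          rw [hold i (by have := mem_range.1 hi; omega)]
      simp only [Store.setI_idx_ne _ _ _ _ (by norm_num : (11 : ℕ) ≠ 117), sum_range_succ]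
      rw [this, hold h hlt, ht]
      simp
      omega
  · rintro s1 T t1 ⟨m, hq, hm, -, hT⟩ - ht1
    obtain rfl : m = N := le_antisymm (hle hq) hm
    refine ⟨?_, hq⟩
    -- No node is queued twice, so the degrees along the queue are among the degrees of all nodes.
    have hsum : ∑ i ∈ range m, s.idx 6 (s1.idx 11 0 i) 0 ≤ M := by
      refine le_trans ?_ hM
      rw [← sum_image (s := range m) (g := s1.idx 11 0) (f := fun t => s.idx 6 t 0)
        (fun i hi j hj he => hq.inj i (by simpa using hi) j (by simpa using hj) he)]
      refine sum_le_sum_of_subset fun t ht => ?_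
      obtain ⟨i, hi, rfl⟩ := mem_image.1 ht
      exact mem_range.2 (hq.lt i (mem_range.1 hi))
    rw [sum_add_distrib, ← mul_sum] at hT
    simp at hT ht1 ⊢
    omega

/-! ## Numbering the vertices of the incidence graph -/

/-- The first `n` vertices, numbered in the order of their occurrences; `P i κ c` tells that the
vertex `c` of the kind `κ` occurs at the position `i`. -/
structure Ranks (P : ℕ → ℕ → ℕ → Prop) (s : Store) (n : ℕ) : Prop where
  num : s.idx 30 0 0 = n
  rank : ∀ r < n, s.idx 12 (s.idx 13 0 r) (s.idx 14 0 r) = r + 1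
  exists_rank : ∀ κ c, s.idx 12 κ c ≠ 0 → ∃ r < n, s.idx 13 0 r = κ ∧ s.idx 14 0 r = c
  top : ∀ r < n, P (s.idx 15 0 r) (s.idx 13 0 r) (s.idx 14 0 r)
  first : ∀ r < n, ∀ i, P i (s.idx 13 0 r) (s.idx 14 0 r) → s.idx 15 0 r ≤ i
  mono : ∀ r < n, ∀ r' < r, s.idx 15 0 r' ≤ s.idx 15 0 r
  all : ∀ i κ c, P i κ c → s.idx 12 κ c ≠ 0

theorem Ranks.congr {P P' : ℕ → ℕ → ℕ → Prop} {s s' : Store} {n : ℕ} (h : Ranks P s n)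
    (hP : ∀ i κ c, P' i κ c ↔ P i κ c)
    (hs : ∀ a ∈ [12, 13, 14, 15, 30], s'.idx a = s.idx a) : Ranks P' s' n := by
  have h12 := hs 12 (by simp)
  have h13 := hs 13 (by simp)
  have h14 := hs 14 (by simp)
  have h15 := hs 15 (by simp)
  have h30 := hs 30 (by simp)
  obtain rfl : P' = P := by funext i κ c; exact propext (hP i κ c)
  obtain ⟨h1, h2, h3, h4, h5, h6, h7⟩ := h
  constructor
  · rw [h30]; exact h1
  · rw [h12, h13, h14]; exact h2
  · rw [h12, h13, h14]; exact h3
  · rw [h13, h14, h15]; exact h4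
  · rw [h13, h14, h15]; exact h5
  · rw [h15]; exact h6
  · rw [h12]; exact h7

/-- Positions are processed in increasing order, as `hle` expresses. An occurrence at the current
position therefore never precedes the recorded first occurrence of a vertex. -/
theorem Ranks.old {P P' : ℕ → ℕ → ℕ → Prop} {s : Store} {n h κ c : ℕ} (hR : Ranks P s n)
    (hle : ∀ i κ c, P i κ c → i ≤ h) (hc : s.idx 12 κ c ≠ 0)
    (hP : ∀ i κ' c', P' i κ' c' ↔ P i κ' c' ∨ i = h ∧ κ' = κ ∧ c' = c) : Ranks P' s n := by
  refine ⟨hR.num, hR.rank, hR.exists_rank, fun r hr => (hP _ _ _).2 (Or.inl (hR.top r hr)),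
    fun r hr i hi => ?_, hR.mono, fun i κ' c' hi => ?_⟩
  · rcases (hP _ _ _).1 hi with hi | ⟨rfl, -, -⟩
    · exact hR.first r hr i hi
    · exact hle _ _ _ (hR.top r hr)
  · rcases (hP _ _ _).1 hi with hi | ⟨-, rfl, rfl⟩
    · exact hR.all i κ' c' hi
    · exact hc

theorem Ranks.new {P P' : ℕ → ℕ → ℕ → Prop} {s s' : Store} {n h κ c : ℕ} (hR : Ranks P s n)
    (hle : ∀ i κ c, P i κ c → i ≤ h) (hc : s.idx 12 κ c = 0)
    (hP : ∀ i κ' c', P' i κ' c' ↔ P i κ' c' ∨ i = h ∧ κ' = κ ∧ c' = c)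
    (h12 : s'.idx 12 = upd (s.idx 12) κ c (n + 1)) (h13 : s'.idx 13 = upd (s.idx 13) 0 n κ)
    (h14 : s'.idx 14 = upd (s.idx 14) 0 n c) (h15 : s'.idx 15 = upd (s.idx 15) 0 n h)
    (h30 : s'.idx 30 0 0 = n + 1) : Ranks P' s' (n + 1) := by
  have o13 : ∀ r < n, s'.idx 13 0 r = s.idx 13 0 r := fun r hr => by
    rw [h13, upd_ne _ _ (Or.inr (by omega))]
  have o14 : ∀ r < n, s'.idx 14 0 r = s.idx 14 0 r := fun r hr => by
    rw [h14, upd_ne _ _ (Or.inr (by omega))]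
  have o15 : ∀ r < n, s'.idx 15 0 r = s.idx 15 0 r := fun r hr => by
    rw [h15, upd_ne _ _ (Or.inr (by omega))]
  have n13 : s'.idx 13 0 n = κ := by rw [h13, upd_same]
  have n14 : s'.idx 14 0 n = c := by rw [h14, upd_same]
  have n15 : s'.idx 15 0 n = h := by rw [h15, upd_same]
  have hne : ∀ r < n, s.idx 13 0 r ≠ κ ∨ s.idx 14 0 r ≠ c := fun r hr => by
    by_contra hcon
    push Not at hcon
    have := hR.rank r hr
    rw [hcon.1, hcon.2, hc] at this
    omega
  refine ⟨h30, fun r hr => ?_, fun κ' c' h' => ?_, fun r hr => ?_, fun r hr i hi => ?_,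
    fun r hr r' hr' => ?_, fun i κ' c' hi => ?_⟩
  · rcases Nat.lt_or_eq_of_le (Nat.le_of_lt_succ hr) with hr | rfl
    · rw [o13 r hr, o14 r hr, h12, upd_ne _ _ (hne r hr), hR.rank r hr]
    · rw [n13, n14, h12, upd_same]
  · by_cases he : κ' = κ ∧ c' = c
    · exact ⟨n, by omega, by rw [n13, he.1], by rw [n14, he.2]⟩
    · rw [h12, upd_ne _ _ (by tauto)] at h'
      obtain ⟨r, hr, e1, e2⟩ := hR.exists_rank κ' c' h'
      exact ⟨r, by omega, by rw [o13 r hr, e1], by rw [o14 r hr, e2]⟩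
  · rcases Nat.lt_or_eq_of_le (Nat.le_of_lt_succ hr) with hr | rfl
    · rw [o13 r hr, o14 r hr, o15 r hr, hP]
      exact Or.inl (hR.top r hr)
    · rw [n13, n14, n15, hP]
      exact Or.inr ⟨rfl, rfl, rfl⟩
  · rcases Nat.lt_or_eq_of_le (Nat.le_of_lt_succ hr) with hr | rfl
    · rw [o13 r hr, o14 r hr, hP] at hi
      rw [o15 r hr]
      rcases hi with hi | ⟨rfl, -, -⟩
      · exact hR.first r hr i hi
      · exact hle _ _ _ (hR.top r hr)
    · rw [n13, n14, hP] at hi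
      rw [n15]
      rcases hi with hi | ⟨rfl, -, -⟩
      · exact absurd hc (hR.all _ _ _ hi)
      · exact le_rfl
  · rcases Nat.lt_or_eq_of_le (Nat.le_of_lt_succ hr) with hr | rfl
    · rw [o15 r hr, o15 r' (by omega)]
      exact hR.mono r hr r' hr'
    · rw [n15, o15 r' hr']
      exact hle _ _ _ (hR.top r' hr')
  · rw [h12]
    by_cases he : κ' = κ ∧ c' = c
    · rw [he.1, he.2, upd_same]
      omega
    · rw [upd_ne _ _ (by tauto)]
      refine hR.all i κ' c' (((hP _ _ _).1 hi).resolve_right ?_)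
      tauto

open Program IExp in
/-- Numbering the new vertices of the kind `κ` in the list `lst` of the node in the register 119, at
the position in the register 117. -/
def number (κ lst : ℕ) (m : IExp) : Program :=
  loop 120 m (
    set 121 (.get lst (V 119) (V 120)) ;;
    .ifLt (.get 12 (.lit κ) (V 121)) 1 (
      .setIdx 12 (.lit κ) (V 121) (V 30 + 1) ;; .setIdx 13 0 (V 30) (.lit κ) ;;
      .setIdx 14 0 (V 30) (V 121) ;; .setIdx 15 0 (V 30) (V 117) ;; set 30 (V 30 + 1)) .nop)

theorem number_spec {s : Store} {Q : Store → ℕ → Prop} {κ lst : ℕ} {m : IExp} (N n h : ℕ)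
    (z : ℕ → ℕ) (P : ℕ → ℕ → ℕ → Prop) (hlst : lst ≤ 11)
    (hm : ∀ s', Frame (number κ lst m) s s' → m.eval s' = N) (hmc : m.cost ≤ 20)
    (hz : ∀ j < N, s.idx lst (s.idx 119 0 0) j = z j) (h117 : s.idx 117 0 0 = h)
    (hR : Ranks P s n) (hle : ∀ i κ c, P i κ c → i ≤ h)
    (hQ : ∀ s' t n', Frame (number κ lst m) s s' → t ≤ 100 * (N + 1) →
      Ranks (fun i κ' c' => P i κ' c' ∨ i = h ∧ κ' = κ ∧ ∃ j < N, z j = c') s' n' → Q s' t) :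
    WP (number κ lst m) s Q := by
  suffices H : WP (number κ lst m) s (fun s' t => t ≤ 100 * (N + 1) ∧ ∃ n',
      Ranks (fun i κ' c' => P i κ' c' ∨ i = h ∧ κ' = κ ∧ ∃ j < N, z j = c') s' n') from
    H.mono fun s' t ⟨h1, n', h2⟩ hF => hQ s' t n' hF h1 h2
  refine WP_loop N 60 (fun x s' => ∃ n',
      Ranks (fun i κ' c' => P i κ' c' ∨ i = h ∧ κ' = κ ∧ ∃ j < x, z j = c') s' n') rfl hm ?_ ?_ ?_
  · refine ⟨n, hR.congr (by simp) fun a ha => ?_⟩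
    rw [Store.setI_idx_ne _ _ _ _ (by simp at ha; omega)]
  · rintro x s1 hx ⟨n', hR'⟩ h120 hF
    have e119 := hF.idx 119 rfl
    have e117 : s1.idx 117 0 0 = h := by rw [hF.idx 117 rfl, h117]
    have el : s1.idx lst = s.idx lst := by
      refine hF.idx lst ?_
      interval_cases lst <;> rfl
    have hle' : ∀ i κ' c', (P i κ' c' ∨ i = h ∧ κ' = κ ∧ ∃ j < x, z j = c') → i ≤ h := by
      rintro i κ' c' (h' | h')
      · exact hle _ _ _ h'
      · omega
    have hP' : ∀ i κ' c', (P i κ' c' ∨ i = h ∧ κ' = κ ∧ ∃ j < x + 1, z j = c') ↔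
        (P i κ' c' ∨ i = h ∧ κ' = κ ∧ ∃ j < x, z j = c') ∨ i = h ∧ κ' = κ ∧ c' = z x := by
      intro i κ' c'
      have : (∃ j < x + 1, z j = c') ↔ (∃ j < x, z j = c') ∨ c' = z x := by
        constructor
        · rintro ⟨j, hj, e⟩
          rcases Nat.lt_or_eq_of_le (Nat.le_of_lt_succ hj) with hj | rfl
          · exact Or.inl ⟨j, hj, e⟩
          · exact Or.inr e.symm
        · rintro (⟨j, hj, e⟩ | e)
          · exact ⟨j, by omega, e⟩
          · exact ⟨x, by omega, e.symm⟩
      rw [this, or_assoc, ← and_or_left, ← and_or_left]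
    simp only [WP_seq, WP_set, WP_ifLt, IExp.eval_get, IExp.eval_zero, IExp.eval_lit, e119, el,
      h120, hz x hx]
    simp
    split_ifs with hc
    · refine ⟨n' + 1, (Ranks.new hR' hle' hc hP' (s' := ((((s1.setI 12 κ (z x) (n' + 1)).setI 13 0 n'
        κ).setI 14 0 n' (z x)).setI 15 0 n' h).setI 30 0 0 (n' + 1)) (by simp) (by simp) (by simp)
        (by simp) (by simp)).congr (fun _ _ _ => by simp only [Nat.lt_succ_iff]) fun a ha => ?_⟩
      simp at ha
      rcases ha with rfl | rfl | rfl | rfl | rfl <;> simp [hR'.num, e117]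
    · refine ⟨n', (Ranks.old hR' hle' hc hP').congr (fun _ _ _ => by simp only [Nat.lt_succ_iff]) fun a ha => ?_⟩
      rw [Store.setI_idx_ne _ _ _ _ (by simp at ha; omega),
        Store.setI_idx_ne _ _ _ _ (by simp at ha; omega)]
  · rintro s1 t ⟨n', hR'⟩ - - ht
    refine ⟨?_, n', hR'⟩
    have : N * (60 + (m.cost + 12)) ≤ N * 92 := Nat.mul_le_mul_left _ (by omega)
    omega

/-- The vertex `c` of the kind `κ` is in the bag of the node `t`. -/
def Occurs (s : Store) (t κ c : ℕ) : Prop :=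
  (κ = 1 ∧ ∃ j < s.idx 6 t 1, s.idx 8 t j = c) ∨ (κ = 0 ∧ ∃ j < s.idx 6 t 2, s.idx 9 t j = c)

open Program IExp in
/-- Numbering all vertices, in the order of the queue. -/
def numberAll : Program :=
  set 30 0 ;;
  loop 117 (.get 0 0 2) (
    set 119 (.get 11 0 (V 117)) ;;
    number 1 8 (.get 6 (V 119) 1) ;; number 0 9 (.get 6 (V 119) 2))

theorem numberAll_spec {s : Store} {Q : Store → ℕ → Prop} (N k : ℕ) (hN : s.idx 0 0 2 = N)
    (h12 : ∀ κ c, s.idx 12 κ c = 0)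
    (hk : ∀ i < N, s.idx 6 (s.idx 11 0 i) 1 + s.idx 6 (s.idx 11 0 i) 2 ≤ k)
    (hQ : ∀ s' t n, Frame numberAll s s' → t ≤ 300 * (N * (k + 1) + 1) →
      Ranks (fun i κ c => i < N ∧ Occurs s (s.idx 11 0 i) κ c) s' n → Q s' t) :
    WP numberAll s Q := by
  suffices H : WP numberAll s (fun s' t => t ≤ 300 * (N * (k + 1) + 1) ∧ ∃ n,
      Ranks (fun i κ c => i < N ∧ Occurs s (s.idx 11 0 i) κ c) s' n) from
    H.mono fun s' t ⟨h1, n', h2⟩ hF => hQ s' t n' hF h1 h2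
  simp only [numberAll, WP_seq, WP_set]
  refine WP_loop N (100 * k + 220) (fun x s' => ∃ n,
      Ranks (fun i κ c => i < x ∧ Occurs s (s.idx 11 0 i) κ c) s' n) rfl ?_ ?_ ?_ ?_
  · intro s' hF
    have h0 := hF.idx 0 rfl
    simp at h0
    simp [h0, hN]
  · refine ⟨0, by simp, by simp, fun κ c h => ?_, by simp, by simp, by simp, by simp⟩
    simp [h12] at h
  · rintro x s1 hx ⟨n, hR⟩ h117 hF
    have e6 : s1.idx 6 = s.idx 6 := by rw [hF.idx 6 rfl]; simp
    have e8 : s1.idx 8 = s.idx 8 := by rw [hF.idx 8 rfl]; simp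
    have e9 : s1.idx 9 = s.idx 9 := by rw [hF.idx 9 rfl]; simp
    have e11 : s1.idx 11 = s.idx 11 := by rw [hF.idx 11 rfl]; simp
    obtain ⟨t, ht⟩ : ∃ t, s.idx 11 0 x = t := ⟨_, rfl⟩
    have hkt := hk x hx
    rw [ht] at hkt
    simp only [WP_seq, WP_set]
    simp [h117, e11, ht]
    refine number_spec (s.idx 6 t 1) n x (fun j => s.idx 8 t j) _ (by norm_num) ?_ (by simp) ?_
      (by simp [h117]) (hR.congr (fun _ _ _ => Iff.rfl) fun a ha => ?_) (fun i κ c h => h.1.le) ?_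
    · intro s' hF'
      have g6 := hF'.idx 6 rfl
      have g119 := hF'.idx 119 rfl
      simp at g6 g119
      simp [g6, g119, e6]
    · intro j _
      simp [e8]
    · rw [Store.setI_idx_ne _ _ _ _ (by simp at ha; omega)]
    intro s2 t2 n2 F2 ht2 hR2
    have f119 : s2.idx 119 0 0 = t := by rw [F2.idx 119 rfl]; simp
    have f117 : s2.idx 117 0 0 = x := by rw [F2.idx 117 rfl]; simp [h117]
    have f6 : s2.idx 6 = s.idx 6 := by rw [F2.idx 6 rfl]; simp [e6]
    have f9 : s2.idx 9 = s.idx 9 := by rw [F2.idx 9 rfl]; simp [e9]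
    refine number_spec (s.idx 6 t 2) n2 x (fun j => s.idx 9 t j) _ (by norm_num) ?_ (by simp) ?_
      f117 hR2 ?_ ?_
    · intro s' hF'
      simp [hF'.idx 6 rfl, hF'.idx 119 rfl, f6, f119]
    · intro j _
      simp [f9, f119]
    · rintro i κ c (h | h)
      · exact h.1.le
      · exact h.1.le
    intro s3 t3 n3 F3 ht3 hR3
    refine ⟨⟨n3, hR3.congr (fun i κ c => ?_) fun a ha => ?_⟩, by omega⟩
    · constructor
      · rintro ⟨hi, ho⟩
        rcases Nat.lt_or_eq_of_le (by omega : i ≤ x) with hi | rfl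
        · exact Or.inl (Or.inl ⟨hi, ho⟩)
        · rw [ht] at ho
          rcases ho with ho | ho
          · exact Or.inl (Or.inr ⟨rfl, ho⟩)
          · exact Or.inr ⟨rfl, ho⟩
      · rintro ((⟨hi, ho⟩ | ⟨rfl, ho⟩) | ⟨rfl, ho⟩)
        · exact ⟨by omega, ho⟩
        · exact ⟨by omega, by rw [ht]; exact Or.inl ho⟩
        · exact ⟨by omega, by rw [ht]; exact Or.inr ho⟩
    · rw [Store.setI_idx_ne _ _ _ _ (by simp at ha; omega)]
  · rintro s1 t ⟨n, hR⟩ - - ht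
    refine ⟨?_, n, hR⟩
    simp at ht ⊢
    have : N * (100 * k + 220 + 15) ≤ N * (300 * (k + 1)) := Nat.mul_le_mul_left _ (by omega)
    rw [Nat.mul_left_comm] at this
    omega

/-! ## Bags in a search order of a tree -/

/-- In a connected set of nodes of a tree, a node that is not the first one has its parent in
the set. -/
theorem parent_mem {V : Type*} {G : SimpleGraph V} (hG : G.IsAcyclic) {q : ℕ → V} {N : ℕ}
    (hinj : ∀ i < N, ∀ j < N, q i = q j → i = j)
    (hpar : ∀ i < N, 0 < i → ∃ j < i, G.Adj (q j) (q i)) {S : Set V}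
    (hS : (G.induce S).Preconnected) {i i0 j : ℕ} (hi : i < N) (h0 : i0 < i) (hiS : q i ∈ S)
    (h0S : q i0 ∈ S) (hj : j < i) (hadj : G.Adj (q j) (q i)) : q j ∈ S := by
  by_contra hjS
  -- Every edge of an acyclic graph is a bridge. It is shown that without this edge its ends would
  -- still be connected, through `q 0` and the set `S`.
  have hb : G.IsBridge s(q j, q i) := SimpleGraph.isAcyclic_iff_forall_adj_isBridge.1 hG hadj
  rw [SimpleGraph.isBridge_iff] at hb
  refine hb ?_
  -- Descending along earlier neighbours leads from `q m` to `q 0` through nodes before `q i`; the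
  -- deleted edge, one end of which is `q i`, is not used.
  have hroot : ∀ m, m < i → (G.deleteEdges {s(q j, q i)}).Reachable (q m) (q 0) := by
    intro m
    induction m using Nat.strong_induction_on with
    | _ m ih =>
      intro hm
      rcases Nat.eq_zero_or_pos m with rfl | hm0
      · rfl
      · obtain ⟨l, hl, hA⟩ := hpar m (by omega) hm0
        refine SimpleGraph.Reachable.trans (SimpleGraph.Adj.reachable ?_) (ih l hl (by omega))
        rw [SimpleGraph.deleteEdges_adj]
        refine ⟨hA.symm, fun h => ?_⟩
        have hmem : q i ∈ s(q m, q l) := by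
          rw [Set.mem_singleton_iff.1 h]
          exact Sym2.mem_mk_right _ _
        rcases Sym2.mem_iff.1 hmem with h | h
        · have := hinj i hi m (by omega) h
          omega
        · have := hinj i hi l (by omega) h
          omega
  -- A path inside `S` avoids the deleted edge because `q j` is outside `S`.
  have hin : (G.deleteEdges {s(q j, q i)}).Reachable (q i0) (q i) := by
    have h := hS ⟨q i0, h0S⟩ ⟨q i, hiS⟩
    refine h.map (⟨fun x => x.1, ?_⟩ : G.induce S →g G.deleteEdges {s(q j, q i)})
    intro a b hab
    rw [SimpleGraph.deleteEdges_adj]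
    refine ⟨hab, fun h => hjS ?_⟩
    have hmem : q j ∈ s(a.1, b.1) := by
      rw [Set.mem_singleton_iff.1 h]
      exact Sym2.mem_mk_left _ _
    rcases Sym2.mem_iff.1 hmem with h | h
    · rw [h]; exact a.2
    · rw [h]; exact b.2
  exact ((hroot j hj).trans (hroot i0 h0).symm).trans hin

/-- If two connected sets of nodes of a tree meet, then one of them contains the first node of the
other. -/
theorem first_mem {V : Type*} {G : SimpleGraph V} (hG : G.IsAcyclic) {q : ℕ → V} {N : ℕ}
    (hinj : ∀ i < N, ∀ j < N, q i = q j → i = j)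
    (hpar : ∀ i < N, 0 < i → ∃ j < i, G.Adj (q j) (q i)) {S S' : Set V}
    (hS : (G.induce S).Preconnected) (hS' : (G.induce S').Preconnected) {i0 i1 : ℕ}
    (h01 : i0 ≤ i1) (h0 : q i0 ∈ S) (h1 : q i1 ∈ S') (hfirst : ∀ i < N, q i ∈ S' → i1 ≤ i) {i : ℕ}
    (hi : i < N) (hiS : q i ∈ S) (hiS' : q i ∈ S') : q i1 ∈ S := by
  induction i using Nat.strong_induction_on with
  | _ i ih =>
    -- From a common node after `i1`, the step to the earlier neighbour stays in both sets by
    -- `parent_mem`; the descent ends at `i1`.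
    rcases Nat.lt_or_eq_of_le (hfirst i hi hiS') with hlt | rfl
    · obtain ⟨j, hj, hA⟩ := hpar i hi (by omega)
      exact ih j hj (by omega) (parent_mem hG hinj hpar hS hi (by omega) hiS h0 hj hA)
        (parent_mem hG hinj hpar hS' hi hlt hiS' h1 hj hA)
    · exact hiS

theorem below_eq_cons {φ : ℕ → Prop} [DecidablePred φ] {x p : ℕ} {B : List ℕ}
    (h : below φ x = p :: B) : φ p ∧ p < x ∧ B = below φ p := by
  induction x with
  | zero => simp [below] at h
  | succ x ih =>
    rw [below] at h
    split_ifs at h with hx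
    · obtain ⟨rfl, rfl⟩ := List.cons_eq_cons.1 h
      exact ⟨hx, by omega, rfl⟩
    · obtain ⟨h1, h2, h3⟩ := ih h
      exact ⟨h1, by omega, h3⟩

/-- Vertices outside the list contribute trivial factors, so the short product computed from a table
equals the product over all smaller vertices. -/
theorem prod_below {M : Type*} [CommMonoid M] {φ : ℕ → Prop} [DecidablePred φ] {x : ℕ} {f : ℕ → M}
    (h : ∀ b < x, ¬ φ b → f b = 1) : ((below φ x).map f).prod = ∏ b ∈ range x, f b := by
  induction x with
  | zero => simp [below]
  | succ x ih =>
    rw [below, prod_range_succ, ← ih fun b hb => h b (by omega), mul_comm]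
    split_ifs with hx
    · simp
    · rw [h x (by omega) hx, one_mul]

/-! ## The layout in the memory -/

open Classical in
/-- The layout that is described by the memory. -/
noncomputable def Store.layout (s : Store) : Layout where
  kind := s.idx 13 0
  low := s.idx 16 0
  dim := s.idx 17 0
  rd r := wrap (s.idx 16 0 r) (s.idx 29 0 r)
  wt := s.idx 21
  act c x := if s.idx 1 (s.idx 14 0 c) (s.idx 14 0 x) < 1 then 2 else
      if s.idx 1 (s.idx 14 0 c) (s.idx 14 0 x) < 2 then s.idx 18 0 c else 1 - s.idx 18 0 c
  bag r := below (InBag s (s.idx 11 0 (s.idx 15 0 r))) (r + 1)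

/-- The automata that are described by the memory. -/
noncomputable def Store.counter (s : Store) : Counter where
  cls r d := (s.step (s.idx 14 0 r))^[d] (s.idx 2 (s.idx 14 0 r) 1)
  cls_add r d d' e h := by
    rw [add_comm d, add_comm d', Function.iterate_add_apply, Function.iterate_add_apply, h]
  val r q := s.idx 5 (s.idx 14 0 r) q

/-- The occurrences of the vertices at the positions of the queue. -/
def Store.occ (s : Store) (N i κ c : ℕ) : Prop := i < N ∧ Occurs s (s.idx 11 0 i) κ c

open Classical in
/-- The memory before the elimination. -/
structure Prepared (s : Store) (n N k w : ℕ) : Prop where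
  ranks : Ranks (s.occ N) s n
  count : ∀ r < n, CountAt s r
  steps : ∀ r < n, s.idx 13 0 r ≠ 0 → StepsIn s (s.idx 14 0 r) ∧ s.idx 2 (s.idx 14 0 r) 0 ≤ w
  list : ∀ r < n, s.idx 23 0 r = (s.layout.bag r).length ∧
    (∀ j (h : j < (s.layout.bag r).length), s.idx 22 r j = (s.layout.bag r)[j]) ∧
    (∀ b, s.idx 25 r b = if b ∈ s.layout.bag r then 1 else 0) ∧
    ∀ j ≤ (s.layout.bag r).length, s.idx 24 r j = s.layout.size ((s.layout.bag r).drop j)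
  bag : ∀ i < N, s.idx 6 (s.idx 11 0 i) 1 + s.idx 6 (s.idx 11 0 i) 2 ≤ k
  meet : ∀ i κ c κ' c' i0 i1, s.occ N i κ c → s.occ N i κ' c' → s.occ N i0 κ c → s.occ N i1 κ' c' →
    i0 ≤ i1 → (∀ j, s.occ N j κ' c' → i1 ≤ j) → s.occ N i1 κ c
  edge : ∀ c x, s.idx 1 c x ≠ 0 → ∃ i, s.occ N i 1 c ∧ s.occ N i 0 x

theorem Ranks.inBag_iff {s : Store} {n N i u : ℕ} (hR : Ranks (s.occ N) s n) (hi : i < N) :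
    InBag s (s.idx 11 0 i) u ↔ u < n ∧ s.occ N i (s.idx 13 0 u) (s.idx 14 0 u) := by
  have key : ∀ κ c, s.idx 12 κ c = u + 1 → u < n ∧ s.idx 13 0 u = κ ∧ s.idx 14 0 u = c := by
    intro κ c h
    obtain ⟨r, hr, h1, h2⟩ := hR.exists_rank κ c (by omega)
    have := hR.rank r hr
    rw [h1, h2, h] at this
    obtain rfl : u = r := by omega
    exact ⟨hr, h1, h2⟩
  constructor
  · rintro (⟨j, hj, h⟩ | ⟨j, hj, h⟩)
    · obtain ⟨h1, h2, h3⟩ := key _ _ h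
      exact ⟨h1, hi, Or.inl ⟨h2, j, hj, h3.symm⟩⟩
    · obtain ⟨h1, h2, h3⟩ := key _ _ h
      exact ⟨h1, hi, Or.inr ⟨h2, j, hj, h3.symm⟩⟩
  · rintro ⟨hu, -, ⟨h1, j, hj, h2⟩ | ⟨h1, j, hj, h2⟩⟩
    · refine Or.inl ⟨j, hj, ?_⟩
      rw [h2, ← hR.rank u hu, h1]
    · refine Or.inr ⟨j, hj, ?_⟩
      rw [h2, ← hR.rank u hu, h1]

namespace Prepared

variable {s : Store} {n N k w : ℕ}

theorem top (h : Prepared s n N k w) {r : ℕ} (hr : r < n) : s.occ N (s.idx 15 0 r) (s.idx 13 0 r) (s.idx 14 0 r) :=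
  h.ranks.top r hr

theorem inBag_iff (h : Prepared s n N k w) {r u : ℕ} (hr : r < n) : InBag s (s.idx 11 0 (s.idx 15 0 r)) u ↔
    u < n ∧ s.occ N (s.idx 15 0 r) (s.idx 13 0 u) (s.idx 14 0 u) :=
  h.ranks.inBag_iff (h.top hr).1

/-- Ranks follow the order of first occurrences, so the subtree of `v` starts no earlier than that
of `u`. As the two subtrees meet at the position `i`, the first bag of `v` contains `u`. Both the
completeness of the tables and the choice of the parent rest on this. -/
theorem inBag_of_meet (h : Prepared s n N k w) {i u v : ℕ} (huv : u ≤ v) (hv : v < n)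
    (hu : s.occ N i (s.idx 13 0 u) (s.idx 14 0 u)) (hv' : s.occ N i (s.idx 13 0 v) (s.idx 14 0 v)) :
    InBag s (s.idx 11 0 (s.idx 15 0 v)) u := by
  rw [h.inBag_iff hv]
  refine ⟨by omega, h.meet i _ _ _ _ (s.idx 15 0 u) (s.idx 15 0 v) hu hv' (h.top (by omega))
    (h.top hv) ?_ (fun j hj => h.ranks.first v hv j hj)⟩
  rcases Nat.lt_or_eq_of_le huv with huv | rfl
  · exact h.ranks.mono v hv u huv
  · exact le_rfl

theorem kind_eq_one (h : Prepared s n N k w) {r : ℕ} (hr : r < n) (h0 : s.idx 13 0 r ≠ 0) : s.idx 13 0 r = 1 := by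
  rcases (h.top hr).2 with h' | h'
  · exact h'.1
  · exact absurd h'.1 h0

theorem good (h : Prepared s n N k w) {r : ℕ} (hr : r < n) : s.layout.Good r := by
  refine ⟨fun h0 => ?_, fun h0 => ?_⟩
  · obtain ⟨h1, h2, -⟩ := (h.count r hr).var h0
    exact ⟨h1, h2⟩
  · obtain ⟨h1, h2, h3, h4, h5, h6, h7⟩ := (h.count r hr).con h0 _ rfl _ rfl
    obtain ⟨⟨h8, -⟩, -⟩ := h.steps r hr h0
    refine ⟨h.kind_eq_one hr h0, ?_, ?_, fun d => ?_, fun d hd => wrap_of_lt hd⟩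
    · change 0 < s.idx 16 0 r
      omega
    · change s.idx 17 0 r = s.idx 16 0 r + s.idx 16 0 r
      omega
    · exact wrap_lt (h1 ▸ h4) d

theorem fits (h : Prepared s n N k w) {r : ℕ} (hr : r < n) : s.layout.Fits s.counter r := by
  refine ⟨fun h0 => ((h.count r hr).var h0).2.2, fun h0 d => ?_, fun h0 d hd => ?_⟩
  · obtain ⟨h1, h2, h3, h4, h5, h6, h7⟩ := (h.count r hr).con h0 _ rfl _ rfl
    simp only [Store.counter, Store.layout, h1]
    exact iterate_wrap h4 h5 d
  · obtain ⟨h1, h2, h3, h4, h5, h6, h7⟩ := (h.count r hr).con h0 _ rfl _ rfl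
    simp only [Store.layout, h1] at hd
    simp only [Store.counter, Store.layout]
    rw [h7 d hd]

theorem holds (h : Prepared s n N k w) : s.layout.Holds n s := by
  refine ⟨fun _ _ => rfl, fun _ _ => rfl, fun _ _ => rfl, fun r hr h0 d hd => ?_, fun _ _ _ _ => rfl,
    fun r hr => (h.list r hr).1, fun r hr => (h.list r hr).2.1, fun r hr => (h.list r hr).2.2.2,
    fun r hr b => ?_, fun _ _ _ _ _ _ => rfl⟩
  · obtain ⟨h1, h2, h3, h4, h5, h6, h7⟩ := (h.count r hr).con h0 _ rfl _ rfl
    simp only [Store.layout, h2] at hd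
    simp only [Store.layout, h1]
    exact h6 d hd
  · rw [(h.list r hr).2.2.1 b]

theorem bag_eq_cons (h : Prepared s n N k w) {r : ℕ} (hr : r < n) : s.layout.bag r = r ::
    (open Classical in below (InBag s (s.idx 11 0 (s.idx 15 0 r))) r) := by
  simp only [Store.layout]
  rw [below, if_pos ((h.inBag_iff hr).2 ⟨hr, h.top hr⟩)]

theorem dim_le (h : Prepared s n N k w) {r : ℕ} (hr : r < n) (hw : 1 ≤ w) : s.layout.dim r ≤ 2 * w := by
  by_cases h0 : s.idx 13 0 r = 0
  · have := ((h.count r hr).var h0).2.1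
    simp only [Store.layout]
    omega
  · have h1 := ((h.count r hr).con h0 _ rfl _ rfl).2.1
    have h2 := (h.steps r hr h0).2
    simp only [Store.layout]
    omega

open Classical in
theorem length_le (h : Prepared s n N k w) {r : ℕ} (hr : r < n) : (s.layout.bag r).length ≤ k :=
  (length_below_le (φ := InBag s (s.idx 11 0 (s.idx 15 0 r))) (fun _ hu => hu) (r + 1)).trans (h.bag _ (h.top hr).1)

theorem elim (h : Prepared s n N k w) (hw : 1 ≤ w) :
    s.layout.Elim s.counter n k ((2 * w) ^ k) (Nat.log 2 (2 * w) + 3) := by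
  classical
  refine ⟨fun r hr => ⟨h.good hr, h.fits hr, ?_⟩, fun r hr => ⟨_, h.bag_eq_cons hr,
    fun b hb => (mem_below.1 hb).1⟩, fun r hr p B hB => ?_, fun r hr => h.length_le hr,
    fun r hr => ?_, by omega⟩
  · have := Nat.log_mono_right (b := 2) (h.dim_le hr hw)
    omega
  · have hB' := hB
    rw [h.bag_eq_cons hr] at hB'
    obtain ⟨-, hB'⟩ := List.cons_eq_cons.1 hB'
    obtain ⟨h1, h2, h3⟩ := below_eq_cons hB'
    have hpn : p < n := by omega
    have e1 : (s.layout.bag p).filter (fun b => decide (b ∈ s.layout.bag r)) =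
        below (fun b => InBag s (s.idx 11 0 (s.idx 15 0 p)) b ∧ b ∈ s.layout.bag r) (p + 1) :=
      @below_filter _ _ (_) (_) (p + 1)
    have e2 : p :: B = below (InBag s (s.idx 11 0 (s.idx 15 0 r))) (p + 1) := by
      rw [below, if_pos h1, h3]
    have h1' := (h.inBag_iff hr).1 h1
    refine Eq.trans ?_ ((e1.trans (below_congr fun b hb => ?_)).trans e2.symm)
    · congr
    · constructor
      · rintro ⟨-, hb⟩
        exact (mem_below.1 hb).2
      -- Both `b` and `p` occur at the first node of `r`. Hence they meet, and the smaller one is in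
      -- the first bag of `p`.
      · intro hbr
        refine ⟨h.inBag_of_meet (by omega) hpn ((h.inBag_iff hr).1 hbr).2 h1'.2, ?_⟩
        exact mem_below.2 ⟨by omega, hbr⟩
  · have hdim : ∀ b ∈ s.layout.bag r, s.layout.dim b ≤ 2 * w := fun b hb =>
      h.dim_le (by have := (mem_below.1 hb).1; omega) hw
    have hlen := h.length_le hr
    have hprod := List.prod_le_pow_card ((s.layout.bag r).map s.layout.dim) (2 * w) (by
      intro x hx
      obtain ⟨b, hb, rfl⟩ := List.mem_map.1 hx
      exact hdim b hb)
    rw [List.length_map] at hprod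
    exact hprod.trans (Nat.pow_le_pow_right (by omega) hlen)

/-- A constraint and a variable that occurs in it share some node, so by `inBag_of_meet` the smaller
is in the table of the larger. A pair that is missing in the tables has no occurrence and counts
nothing. -/
theorem cross_eq_one (h : Prepared s n N k w) {c x : ℕ} {i j : ℕ}
    (hij : i = c ∧ j = x ∨ i = x ∧ j = c) (hc : c < n)
    (hx : x < n) (hc0 : s.idx 13 0 c ≠ 0) (hx0 : s.idx 13 0 x = 0) (hji : j < i)
    (hn : ¬ InBag s (s.idx 11 0 (s.idx 15 0 i)) j) :
    s.layout.cross s.counter c x = 1 := by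
  have hocc : s.idx 1 (s.idx 14 0 c) (s.idx 14 0 x) = 0 := by
    by_contra hne
    obtain ⟨m, h1, h2⟩ := h.edge _ _ hne
    rw [← h.kind_eq_one hc hc0] at h1
    replace h2 : s.occ N m (s.idx 13 0 x) (s.idx 14 0 x) := by rw [hx0]; exact h2
    refine hn ?_
    rcases hij with ⟨rfl, rfl⟩ | ⟨rfl, rfl⟩
    · exact h.inBag_of_meet hji.le hc h2 h1
    · exact h.inBag_of_meet hji.le hx h1 h2
  funext τ
  have hact : s.layout.act c x = 2 := by simp [Store.layout, hocc]
  rw [Layout.cross, hact, if_neg]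
  · rfl
  · cases τ x <;> simp

theorem prod_edge_tail (h : Prepared s n N k w) {r : ℕ} (hr : r < n) :
    ((s.layout.bag r).tail.map (s.layout.edge s.counter r)).prod =
      ∏ b ∈ range r, s.layout.edge s.counter r b := by
  classical
  rw [h.bag_eq_cons hr, List.tail_cons]
  refine prod_below fun b hb hn => ?_
  have hbn : b < n := by omega
  rw [Layout.edge]
  split_ifs with h1 h2 h2
  · rfl
  · exact h.cross_eq_one (Or.inr ⟨rfl, rfl⟩) hbn hr h2 h1 hb hn
  · exact h.cross_eq_one (Or.inl ⟨rfl, rfl⟩) hr hbn h1 h2 hb hn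
  · rfl

/-- The result of the elimination. -/
theorem eliminateAll_spec (h : Prepared s n N k w) (hw : 1 ≤ w) {Q : Store → ℕ → Prop}
    (hQ : ∀ s' t, t ≤ 74000 * (n * ((k + 1) * ((2 * w) ^ k * (Nat.log 2 (2 * w) + 3))) + 1) →
      s'.num 0 0 0 = ∑ τ ∈ s.layout.assignments n, ∏ c ∈ range n,
        (if s.idx 13 0 c = 0 then 1 else (s.idx 5 (s.idx 14 0 c) ((s.step (s.idx 14 0 c))^[
          s.layout.count n τ c] (s.idx 2 (s.idx 14 0 c) 1)) : ℂ)) → Q s' t) :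
    WP eliminateAll s Q := by
  refine OneSidedCounting.eliminateAll_spec h.holds (h.elim hw) h.ranks.num ?_
  intro s' t _ ht hs'
  refine hQ s' t ht ?_
  rw [prod_congr rfl fun r hr => h.prod_edge_tail (mem_range.1 hr)] at hs'
  exact Layout.elimAll_prod_edge (L := s.layout) (K := s.counter) n hs'

end Prepared

/-! ## The program -/

open Program in
/-- Counting models. -/
def countModels : Program := search ;; numberAll ;; countAll ;; listAll ;; eliminateAll

/-- The properties of the input that the program relies on. -/
structure Input (s : Store) (N k w : ℕ) : Prop where
  nodes : s.idx 0 0 2 = N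
  pos : 0 < N
  zero : ∀ a, 10 ≤ a → ∀ i j, s.idx a i j = 0
  neighbor : ∀ t < N, ∀ u, Neighbor s t u → u < N
  conn : ∀ S : ℕ → Prop, S 0 → (∀ t < N, S t → ∀ u, Neighbor s t u → S u) → ∀ t < N, S t
  degree : ∑ t ∈ range N, s.idx 6 t 0 ≤ 2 * N
  bag : ∀ t < N, s.idx 6 t 1 + s.idx 6 t 2 ≤ k
  steps : ∀ t < N, ∀ c, Occurs s t 1 c → StepsIn s c ∧ s.idx 2 c 0 ≤ w
  meet : ∀ q : ℕ → ℕ, (∀ i < N, q i < N) → (∀ i < N, ∀ j < N, q i = q j → i = j) →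
    (∀ i < N, 0 < i → ∃ j < i, Neighbor s (q j) (q i)) →
    ∀ i < N, ∀ κ c κ' c', ∀ i0 i1, i0 ≤ i1 → i1 < N → Occurs s (q i) κ c → Occurs s (q i) κ' c' →
      Occurs s (q i0) κ c → Occurs s (q i1) κ' c' → (∀ j < N, Occurs s (q j) κ' c' → i1 ≤ j) →
      Occurs s (q i1) κ c
  edge : ∀ c x, s.idx 1 c x ≠ 0 → ∃ t < N, Occurs s t 1 c ∧ Occurs s t 0 x

theorem StepsIn.congr {s s' : Store} {c : ℕ} (h : StepsIn s c)
    (hs : ∀ a ≤ 9, s'.idx a = s.idx a) : StepsIn s' c := by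
  have h2 := hs 2 (by norm_num)
  have hstep : s'.step c = s.step c := by
    rw [Store.step, Store.step, Store.side, Store.side, h2, hs 3 (by norm_num), hs 4 (by norm_num)]
  refine ⟨?_, ?_⟩
  · rw [h2]; exact h.start
  · rw [h2, hstep]; exact h.step

theorem occurs_congr {s s' : Store} {t κ c : ℕ} (hs : ∀ a ≤ 9, s'.idx a = s.idx a) :
    Occurs s' t κ c ↔ Occurs s t κ c := by
  rw [Occurs, Occurs, hs 6 (by norm_num), hs 8 (by norm_num), hs 9 (by norm_num)]

/-- The bound on the number of operations, for `n` vertices and `N` nodes. -/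
def timeBound (n N k w : ℕ) : ℕ :=
  200 * (N + 2 * N + 1) + (300 * (N * (k + 1) + 1) + (600 * (n * (w + 1) + 1) +
    (1000 * (n * ((k + 1) * (k + 1) + k * (2 * w + 1)) + 1) +
      74000 * (n * ((k + 1) * ((2 * w) ^ k * (Nat.log 2 (2 * w) + 3))) + 1))))

/-- The arrays 0 to 9 of the input are never written. Facts about the input thus remain valid
through all phases, and it only remains to transport them along the order of the nodes that the
search has produced. -/
theorem countModels_spec {s : Store} {N k w : ℕ} (hI : Input s N k w) (hw : 1 ≤ w)
    {Q : Store → ℕ → Prop}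
    (hQ : ∀ s' s1 t n, t ≤ timeBound n N k w → Prepared s1 n N k w →
      (∀ a ≤ 9, s1.idx a = s.idx a) → (∀ t < N, ∃ i < N, s1.idx 11 0 i = t) →
      s'.num 0 0 0 = ∑ τ ∈ s1.layout.assignments n, ∏ c ∈ range n,
        (if s1.idx 13 0 c = 0 then 1 else (s1.idx 5 (s1.idx 14 0 c) ((s1.step (s1.idx 14 0 c))^[
          s1.layout.count n τ c] (s1.idx 2 (s1.idx 14 0 c) 1)) : ℂ)) → Q s' t) :
    WP countModels s Q := by
  simp only [countModels, WP_seq]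
  refine search_spec N (2 * N) hI.nodes hI.pos (hI.zero 10 (by norm_num) 0) hI.neighbor hI.conn
    hI.degree ?_
  intro s1 t1 F1 ht1 hlt hinj hpar
  have e1 : ∀ a ≤ 9, s1.idx a = s.idx a := fun a ha => F1.idx a (by interval_cases a <;> rfl)
  have hsurj : ∀ t < N, ∃ i < N, s1.idx 11 0 i = t := by
    intro t ht
    have himg : (range N).image (s1.idx 11 0) = range N := by
      refine eq_of_subset_of_card_le (fun u hu => ?_) ?_
      · obtain ⟨i, hi, rfl⟩ := mem_image.1 hu
        exact mem_range.2 (hlt i (mem_range.1 hi))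
      · rw [card_image_of_injOn fun i hi j hj he =>
          hinj i (by simpa using hi) j (by simpa using hj) he]
    obtain ⟨i, hi, he⟩ := mem_image.1 (himg.symm ▸ mem_range.2 ht : t ∈ (range N).image _)
    exact ⟨i, mem_range.1 hi, he⟩
  refine numberAll_spec N k (by rw [e1 0 (by norm_num), hI.nodes])
    (by rw [F1.idx 12 rfl]; exact hI.zero 12 (by norm_num))
    (fun i hi => by rw [e1 6 (by norm_num)]; exact hI.bag _ (hlt i hi)) ?_
  intro s2 t2 n F2 ht2 hR
  have e2 : ∀ a ≤ 9, s2.idx a = s.idx a := fun a ha =>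
    (F2.idx a (by interval_cases a <;> rfl)).trans (e1 a ha)
  have e2' : s2.idx 11 = s1.idx 11 := F2.idx 11 rfl
  have hsteps : ∀ r < n, s2.idx 13 0 r ≠ 0 →
      StepsIn s (s2.idx 14 0 r) ∧ s.idx 2 (s2.idx 14 0 r) 0 ≤ w := by
    intro r hr h0
    obtain ⟨hi, ho⟩ := hR.top r hr
    rw [occurs_congr e1] at ho
    rcases ho with ho | ho
    · exact hI.steps _ (hlt _ hi) _ (Or.inl ⟨rfl, ho.2⟩)
    · exact absurd ho.1 h0
  refine countAll_spec n w hR.num (fun r hr h0 => ?_) ?_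
  · obtain ⟨h1, h2⟩ := hsteps r hr h0
    exact ⟨h1.congr e2, by rw [e2 2 (by norm_num)]; exact h2⟩
  intro s3 t3 F3 ht3 hC
  have e3 : ∀ a ≤ 15, s3.idx a = s2.idx a := fun a ha => F3.idx a (by interval_cases a <;> rfl)
  have e3' : ∀ a ≤ 9, s3.idx a = s.idx a := fun a ha => (e3 a (by omega)).trans (e2 a ha)
  have e30 : s3.idx 30 = s2.idx 30 := F3.idx 30 rfl
  have hP : ∀ {s' : Store}, (∀ a ≤ 9, s'.idx a = s.idx a) → s'.idx 11 = s1.idx 11 → ∀ i κ c,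
      s'.occ N i κ c ↔ i < N ∧ Occurs s1 (s1.idx 11 0 i) κ c := by
    intro s' h9 h11 i κ c
    rw [Store.occ, occurs_congr h9, occurs_congr e1, h11]
  have hR3 : Ranks (s3.occ N) s3 n := by
    refine hR.congr (hP e3' ((e3 11 (by norm_num)).trans e2')) fun a ha => ?_
    by_cases h : a = 30
    · rw [h, e30]
    · exact e3 a (by simp at ha; omega)
  have hbag3 : ∀ i < N, s3.idx 6 (s3.idx 11 0 i) 1 + s3.idx 6 (s3.idx 11 0 i) 2 ≤ k := by
    intro i hi
    rw [e3' 6 (by norm_num), e3 11 (by norm_num), e2']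
    exact hI.bag _ (hlt i hi)
  refine listAll_spec n k (2 * w) (fun r => InBag s3 (s3.idx 11 0 (s3.idx 15 0 r))) hR3.num
    (fun r _ u => Iff.rfl) (fun r hr => ?_) ?_ (fun r hr => hbag3 _ (hR3.top r hr).1)
    (fun r hr => ?_) ?_
  · rw [hR3.inBag_iff (hR3.top r hr).1]
    exact ⟨hr, hR3.top r hr⟩
  · rw [F3.idx 25 rfl, F2.idx 25 rfl, F1.idx 25 rfl]
    exact hI.zero 25 (by norm_num)
  · by_cases h0 : s3.idx 13 0 r = 0
    · have := ((hC r hr).var h0).2.1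
      omega
    · have h1 := ((hC r hr).con h0 _ rfl _ rfl).2.1
      have h2 := (hsteps r hr (by rw [← e3 13 (by norm_num)]; exact h0)).2
      rw [← e3 14 (by norm_num), ← e3' 2 (by norm_num)] at h2
      omega
  intro s4 t4 F4 ht4 hlist
  have e4 : ∀ a, a ≤ 20 → s4.idx a = s3.idx a := fun a ha =>
    F4.idx a (by interval_cases a <;> rfl)
  have e4' : ∀ a ≤ 9, s4.idx a = s.idx a := fun a ha => (e4 a (by omega)).trans (e3' a ha)
  have e411 : s4.idx 11 = s1.idx 11 := by rw [e4 11 (by norm_num), e3 11 (by norm_num), e2']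
  have hocc := hP e4' e411
  have hInBag : ∀ t u, InBag s4 t u ↔ InBag s3 t u := by
    intro t u
    rw [InBag, InBag, e4 6 (by norm_num), e4 8 (by norm_num), e4 9 (by norm_num),
      e4 12 (by norm_num)]
  have hlay : ∀ r, s4.layout.bag r =
      (open Classical in below (InBag s3 (s3.idx 11 0 (s3.idx 15 0 r))) (r + 1)) := by
    intro r
    simp only [Store.layout]
    rw [e4 11 (by norm_num), e4 15 (by norm_num)]
    exact @below_congr _ _ (_) (_) _ fun b _ => hInBag _ b
  have hprep : Prepared s4 n N k w := by
    refine ⟨?_, fun r hr => ?_, fun r hr h0 => ?_, fun r hr => ?_, ?_, ?_, ?_⟩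
    · refine hR.congr hocc fun a ha => ?_
      by_cases h : a = 30
      · rw [h, F4.idx 30 rfl, e30]
      · simp at ha
        rw [e4 a (by omega), e3 a (by omega)]
    · refine (hC r hr).congr ⟨fun a ha => e4 a (by omega), fun a ha => ?_, fun a ha => ?_⟩
      · simp at ha
        rcases ha with rfl | rfl | rfl | rfl <;> rw [F4.idx _ rfl]
      · simp at ha
        rcases ha with rfl | rfl <;> rw [F4.idx _ rfl]
    · rw [e4 13 (by norm_num), e3 13 (by norm_num)] at h0
      rw [e4' 2 (by norm_num), e4 14 (by norm_num), e3 14 (by norm_num)]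
      exact ⟨(hsteps r hr h0).1.congr e4', (hsteps r hr h0).2⟩
    · obtain ⟨h1, h2, h3, h4⟩ := hlist r hr
      simp only [hlay]
      refine ⟨h1, h2, fun b => by rw [h3 b], fun j hj => ?_⟩
      rw [h4 j hj, Layout.size]
      simp only [Store.layout]
      rw [e4 17 (by norm_num)]
    · rw [e4' 6 (by norm_num), e411]
      exact fun i hi => hI.bag _ (hlt i hi)
    · intro i κ c κ' c' i0 i1 h1 h2 h3 h4 h01 hfirst
      simp only [hocc, occurs_congr e1] at h1 h2 h3 h4 hfirst ⊢
      exact ⟨h4.1, hI.meet (s1.idx 11 0) hlt hinj hpar i h1.1 κ c κ' c' i0 i1 h01 h4.1 h1.2 h2.2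
        h3.2 h4.2 fun j hj ho => hfirst j ⟨hj, ho⟩⟩
    · intro c x hne
      rw [e4' 1 (by norm_num)] at hne
      obtain ⟨t, ht, h1, h2⟩ := hI.edge c x hne
      obtain ⟨i, hi, rfl⟩ := hsurj t ht
      exact ⟨i, (hocc _ _ _).2 ⟨hi, (occurs_congr e1).2 h1⟩,
        (hocc _ _ _).2 ⟨hi, (occurs_congr e1).2 h2⟩⟩
  refine hprep.eliminateAll_spec hw ?_
  intro s5 t5 ht5 hs5
  refine hQ s5 s4 _ n ?_ hprep e4' (by rw [e411]; exact hsurj) hs5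
  rw [timeBound]
  omega

/-! ## The input -/

theorem pad_of_lt {n i : ℕ} (f : Fin n → ℕ) (h : i < n) : pad f i = f ⟨i, h⟩ := dif_pos h

theorem pad_of_not_lt {n i : ℕ} (f : Fin n → ℕ) (h : ¬ i < n) : pad f i = 0 := dif_neg h

@[simp] theorem pad_val {n : ℕ} (f : Fin n → ℕ) (i : Fin n) : pad f i = f i := pad_of_lt f i.2

theorem exists_listing {n : ℕ} (S : Finset (Fin n)) (u : ℕ) :
    (∃ j < #S, listing S j = u) ↔ ∃ v ∈ S, (v : ℕ) = u := by
  have hlen : ((S.sort (· ≤ ·)).map Fin.val).length = #S := by simp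
  constructor
  · rintro ⟨j, hj, h⟩
    have hj' : j < ((S.sort (· ≤ ·)).map Fin.val).length := by omega
    rw [listing, List.getD_eq_getElem _ _ hj'] at h
    have hm := List.getElem_mem hj'
    rw [h] at hm
    obtain ⟨v, hv, hvu⟩ := List.mem_map.1 hm
    exact ⟨v, by simpa using hv, hvu⟩
  · rintro ⟨v, hv, rfl⟩
    obtain ⟨j, hj, h⟩ := List.getElem_of_mem
      (List.mem_map_of_mem (f := Fin.val) ((S.mem_sort (· ≤ ·)).2 hv))
    exact ⟨j, by omega, by rw [listing, List.getD_eq_getElem _ _ hj, h]⟩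

/-- The kind and the number of a vertex of the incidence graph. -/
def code {a b : ℕ} : Fin a ⊕ Fin b → ℕ × ℕ
  | Sum.inl c => (1, c)
  | Sum.inr v => (0, v)

theorem code_injective {a b : ℕ} : Function.Injective (code : Fin a ⊕ Fin b → ℕ × ℕ) := by
  rintro (c | v) (c' | v') h <;> simp only [code, Prod.mk.injEq] at h
  · rw [Fin.ext h.2]
  · omega
  · omega
  · rw [Fin.ext h.2]

section

variable {F : ConstraintSystem} (R : ∀ c, OneSidedDescription (F.con c))
  (D : TreeDecomposition F.incidenceGraph)

theorem neighbor_input_iff {t u : ℕ} (ht : t < D.numNodes) :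
    Neighbor (inputStore F R D) t u ↔ ∃ hu : u < D.numNodes, D.tree.Adj ⟨t, ht⟩ ⟨u, hu⟩ := by
  simp only [Neighbor, inputStore, inputIdx]
  simp only [pad_of_lt _ ht, exists_listing]
  simp only [nodeNeighbors, mem_filter, mem_univ, true_and]
  constructor
  · rintro ⟨v, hv, rfl⟩
    exact ⟨v.2, hv⟩
  · rintro ⟨hu, h⟩
    exact ⟨⟨u, hu⟩, h, rfl⟩

theorem occurs_input_iff {t κ c : ℕ} (ht : t < D.numNodes) :
    Occurs (inputStore F R D) t κ c ↔ ∃ x ∈ D.bag ⟨t, ht⟩, code x = (κ, c) := by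
  simp only [Occurs, inputStore, inputIdx]
  simp only [pad_of_lt _ ht, exists_listing]
  simp only [bagCons, bagVars, mem_filter, mem_univ, true_and]
  constructor
  · rintro (⟨rfl, v, hv, rfl⟩ | ⟨rfl, v, hv, rfl⟩)
    · exact ⟨_, hv, rfl⟩
    · exact ⟨_, hv, rfl⟩
  · rintro ⟨x | x, hx, h⟩
    · simp only [code, Prod.mk.injEq] at h
      exact Or.inl ⟨h.1.symm, x, hx, h.2⟩
    · simp only [code, Prod.mk.injEq] at h
      exact Or.inr ⟨h.1.symm, x, hx, h.2⟩

theorem card_bagCons_add_card_bagVars (t : Fin D.numNodes) :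
    #(bagCons F D t) + #(bagVars F D t) = #(D.bag t) := by
  have h1 : bagCons F D t = (D.bag t).toLeft := by ext; simp [bagCons]
  have h2 : bagVars F D t = (D.bag t).toRight := by ext; simp [bagVars]
  rw [h1, h2, card_toLeft_add_card_toRight]

theorem side_input (c : Fin F.numCons) :
    (inputStore F R D).side c = if ∀ x, (R c).sts.f0 x = x then 1 else 0 := by
  simp only [Store.side, inputStore, inputIdx, pad_val]
  congr 1
  rw [eq_iff_iff]
  constructor
  · intro h x
    have := h x x.2
    rw [pad_val] at this
    exact Fin.ext this
  · intro h x hx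
    rw [pad_of_lt _ hx, h]

/-- The letter that may change the state of the automaton of `c`. -/
def activeLetter (c : Fin F.numCons) : Bool := decide (∀ x, (R c).sts.f0 x = x)

/-- If the letter 0 acts trivially, the letter 1 is taken as active, even if it acts trivially as
well; otherwise one-sidedness forces the letter 1 to be trivial, and 0 is active. -/
theorem step_input (c : Fin F.numCons) (x : Fin (R c).numStates) :
    (inputStore F R D).step c x =
      if activeLetter R c = true then ((R c).sts.f1 x : ℕ) else ((R c).sts.f0 x : ℕ) := by
  rw [Store.step, side_input]
  by_cases h : ∀ x, (R c).sts.f0 x = x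
  · rw [if_pos h, if_neg (by norm_num), if_pos (by simpa [activeLetter] using h)]
    simp [inputStore, inputIdx]
  · rw [if_neg h, if_pos rfl, if_neg (by simpa [activeLetter] using h)]
    simp [inputStore, inputIdx]

/-- This is where one-sidedness is used: the inactive letter leaves the state alone, so a word acts
as the power of one map given by the number of its active letters, regardless of their order. -/
theorem run_input (c : Fin F.numCons) (l : List Bool) (x : Fin (R c).numStates) :
    ((l.foldl (fun s b => if b then (R c).sts.f1 s else (R c).sts.f0 s) x : Fin _) : ℕ) =
      ((inputStore F R D).step c)^[l.count (activeLetter R c)] x := by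
  induction l generalizing x with
  | nil => rfl
  | cons b l ih =>
    rw [List.foldl_cons, ih, List.count_cons]
    have hs := step_input R D c x
    cases hA : activeLetter R c <;> cases b
    · rw [hA] at hs
      simpa using congrArg _ hs.symm
    · have h0 : ¬ ∀ x, (R c).sts.f0 x = x := by simpa [activeLetter] using hA
      simp [(R c).oneSided.resolve_left h0]
    · have h0 : ∀ x, (R c).sts.f0 x = x := by simpa [activeLetter] using hA
      simp [h0]
    · rw [hA] at hs
      simpa using congrArg _ hs.symm

theorem stepsIn_input (c : Fin F.numCons) : StepsIn (inputStore F R D) c := by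
  refine ⟨?_, fun x hx => ?_⟩
  · simp [inputStore, inputIdx]
  · simp only [inputStore, inputIdx, pad_val] at hx ⊢
    have := step_input R D c ⟨x, hx⟩
    simp only [inputStore] at this
    rw [this]
    split_ifs
    · exact Fin.is_lt _
    · exact Fin.is_lt _

theorem degree_input (t : Fin D.numNodes) [DecidableRel D.tree.Adj] :
    (inputStore F R D).idx 6 t 0 = D.tree.degree t := by
  simp only [inputStore, inputIdx, pad_val]
  rw [← SimpleGraph.card_neighborFinset_eq_degree]
  congr 1
  ext u
  simp [nodeNeighbors]

/-- The input of the program. -/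
theorem input_inputStore {w k : ℕ} (hw : ∀ c, (R c).numStates ≤ w) (hk : D.width = k) :
    Input (inputStore F R D) D.numNodes k w := by
  classical
  have hpos : 0 < D.numNodes := by
    obtain ⟨t⟩ := D.isTree.connected.nonempty
    exact t.pos
  refine ⟨rfl, hpos, fun a ha i j => ?_, fun t ht u hu => ?_, fun S h0 hS t ht => ?_, ?_,
    fun t ht => ?_, fun t ht c hc => ?_, ?_, fun c x hne => ?_⟩
  · obtain ⟨b, rfl⟩ := Nat.exists_eq_add_of_le' ha
    rfl
  · exact ((neighbor_input_iff R D ht).1 hu).1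
  · obtain ⟨p⟩ := D.isTree.connected.preconnected ⟨0, hpos⟩ ⟨t, ht⟩
    have key : ∀ (a b : Fin D.numNodes), D.tree.Walk a b → S a → S b := by
      intro a b p
      induction p with
      | nil => exact id
      | cons hadj _ ih =>
        exact fun ha => ih (hS _ (Fin.is_lt _) ha _
          ((neighbor_input_iff R D (Fin.is_lt _)).2 ⟨Fin.is_lt _, hadj⟩))
    exact key _ _ p h0
  -- The degrees sum to twice the number of edges, and a tree has one edge less than nodes.
  · rw [sum_range, sum_congr rfl fun t _ => degree_input R D t,
      SimpleGraph.sum_degrees_eq_twice_card_edges]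
    have := D.isTree.card_edgeFinset
    rw [Fintype.card_fin] at this
    omega
  · rw [← hk, TreeDecomposition.width]
    refine le_trans (le_of_eq ?_) (le_sup (f := fun t => #(D.bag t)) (mem_univ ⟨t, ht⟩))
    rw [← card_bagCons_add_card_bagVars]
    simp only [inputStore, inputIdx, pad_of_lt _ ht]
  · obtain ⟨x, hx, h⟩ := (occurs_input_iff R D ht).1 hc
    rcases x with x | x
    · simp only [code, Prod.mk.injEq, true_and] at h
      rw [← h]
      refine ⟨stepsIn_input R D x, ?_⟩
      simpa [inputStore, inputIdx] using hw x
    · simp [code] at h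
  · intro q hlt hinj hpar i hi κ c κ' c' i0 i1 h01 hi1 h1 h2 h3 h4 hfirst
    -- The sequence is only constrained below the number of nodes; elsewhere the value is replaced
    -- by the node 0, and it is never used.
    set q' : ℕ → Fin D.numNodes := fun i => if h : q i < D.numNodes then ⟨q i, h⟩ else ⟨0, hpos⟩
      with hq'
    have hq'e : ∀ i (h : i < D.numNodes), q' i = ⟨q i, hlt i h⟩ := fun i h => by
      rw [hq']
      exact dif_pos (hlt i h)
    rw [occurs_input_iff R D (hlt _ hi)] at h1 h2
    rw [occurs_input_iff R D (hlt _ (by omega : i0 < D.numNodes))] at h3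
    rw [occurs_input_iff R D (hlt _ hi1)] at h4 ⊢
    obtain ⟨x, hx1, hx⟩ := h1
    obtain ⟨y, hy2, hy⟩ := h2
    obtain ⟨x', hx3, hx'⟩ := h3
    obtain rfl : x' = x := code_injective (hx'.trans hx.symm)
    obtain ⟨y', hy4, hy'⟩ := h4
    obtain rfl : y' = y := code_injective (hy'.trans hy.symm)
    refine ⟨x', ?_, hx⟩
    have := first_mem D.isTree.isAcyclic (q := q') (N := D.numNodes) ?_ ?_
      (D.conn x').preconnected (D.conn y').preconnected h01 ?_ ?_ ?_ hi ?_ ?_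
    · rw [hq'e _ hi1] at this
      exact this
    · intro i hi j hj h
      rw [hq'e _ hi, hq'e _ hj] at h
      exact hinj i hi j hj (Fin.mk.inj h)
    · intro i hi h0
      obtain ⟨j, hj, hA⟩ := hpar i hi h0
      obtain ⟨_, hA⟩ := (neighbor_input_iff R D (hlt _ (by omega))).1 hA
      exact ⟨j, hj, by rw [hq'e _ hi, hq'e _ (by omega)]; exact hA⟩
    · rw [hq'e _ (by omega)]
      exact hx3
    · rw [hq'e _ hi1]
      exact hy4
    · intro j hj h
      rw [hq'e _ hj] at h
      exact hfirst j hj ((occurs_input_iff R D (hlt _ hj)).2 ⟨y', h, hy⟩)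
    · rw [hq'e _ hi]
      exact hx1
    · rw [hq'e _ hi]
      exact hy2
  · simp only [inputStore, inputIdx] at hne
    by_cases hc : c < F.numCons
    · rw [pad_of_lt _ hc] at hne
      by_cases hx : x < F.numVars
      · rw [pad_of_lt _ hx, occurrence] at hne
        have hmem : (⟨x, hx⟩ : Fin F.numVars) ∈ (F.con ⟨c, hc⟩).scope := by
          by_contra hcon
          rw [dif_neg hcon] at hne
          exact hne rfl
        obtain ⟨t, h1, h2⟩ := D.edge (Sum.inl ⟨c, hc⟩) (Sum.inr ⟨x, hx⟩) (by
          rw [ConstraintSystem.incidenceGraph, SimpleGraph.fromRel_adj]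
          exact ⟨by simp, Or.inl ⟨_, _, rfl, rfl, hmem⟩⟩)
        exact ⟨t, t.2, (occurs_input_iff R D t.2).2 ⟨_, h1, rfl⟩,
          (occurs_input_iff R D t.2).2 ⟨_, h2, rfl⟩⟩
      · rw [pad_of_not_lt _ hx] at hne
        exact absurd rfl hne
    · rw [pad_of_not_lt _ hc] at hne
      exact absurd rfl hne

end

/-! ### From the numbered vertices back to assignments and models -/

section

variable {F : ConstraintSystem} (R : ∀ c, OneSidedDescription (F.con c))
  (D : TreeDecomposition F.incidenceGraph)

theorem occurs_input {t κ c : ℕ} (h : Occurs (inputStore F R D) t κ c) :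
    ∃ x : Fin F.numCons ⊕ Fin F.numVars, code x = (κ, c) := by
  by_cases ht : t < D.numNodes
  · obtain ⟨x, -, hx⟩ := (occurs_input_iff R D ht).1 h
    exact ⟨x, hx⟩
  · simp [Occurs, inputStore, inputIdx, pad_of_not_lt _ ht] at h

/-- The vertices of the incidence graph are numbered bijectively. -/
theorem exists_equiv {s : Store} {n k w : ℕ} (h : Prepared s n D.numNodes k w)
    (h9 : ∀ a ≤ 9, s.idx a = (inputStore F R D).idx a)
    (hsurj : ∀ t < D.numNodes, ∃ i < D.numNodes, s.idx 11 0 i = t) :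
    ∃ e : Fin F.numCons ⊕ Fin F.numVars ≃ Fin n,
      ∀ x, (s.idx 13 0 (e x), s.idx 14 0 (e x)) = code x := by
  have hex : ∀ r : Fin n, ∃ x : Fin F.numCons ⊕ Fin F.numVars,
      code x = (s.idx 13 0 r, s.idx 14 0 r) := fun r =>
    occurs_input R D ((occurs_congr h9).1 (h.top r.2).2)
  choose f hf using hex
  have hinj : Function.Injective f := by
    intro r r' he
    have h1 := hf r
    rw [he, hf r', Prod.mk.injEq] at h1
    have h2 := h.ranks.rank r r.2
    rw [← h1.1, ← h1.2, h.ranks.rank r' r'.2] at h2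
    exact Fin.ext (by omega)
  have hsur : Function.Surjective f := by
    intro x
    obtain ⟨t, ht⟩ := D.cover x
    obtain ⟨i, hi, hit⟩ := hsurj t t.2
    have hocc : s.occ D.numNodes i (code x).1 (code x).2 := by
      refine ⟨hi, (occurs_congr h9).2 ?_⟩
      rw [hit]
      exact (occurs_input_iff R D t.2).2 ⟨x, ht, rfl⟩
    obtain ⟨r, hr, h1, h2⟩ := h.ranks.exists_rank _ _ (h.ranks.all _ _ _ hocc)
    exact ⟨⟨r, hr⟩, code_injective ((hf _).trans (Prod.ext h1 h2))⟩
  refine ⟨(Equiv.ofBijective f ⟨hinj, hsur⟩).symm, fun x => ?_⟩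
  rw [← hf]
  congr 1
  exact Equiv.ofBijective_apply_symm_apply f ⟨hinj, hsur⟩ x

section

variable {R D} {s : Store} {n k w : ℕ} {e : Fin F.numCons ⊕ Fin F.numVars ≃ Fin n}

theorem kind_inl (he : ∀ x, (s.idx 13 0 (e x), s.idx 14 0 (e x)) = code x) (c : Fin F.numCons) :
    s.idx 13 0 (e (Sum.inl c)) = 1 ∧ s.idx 14 0 (e (Sum.inl c)) = c := by
  simpa [code] using he (Sum.inl c)

theorem kind_inr (he : ∀ x, (s.idx 13 0 (e x), s.idx 14 0 (e x)) = code x) (v : Fin F.numVars) :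
    s.idx 13 0 (e (Sum.inr v)) = 0 ∧ s.idx 14 0 (e (Sum.inr v)) = v := by
  simpa [code] using he (Sum.inr v)

/-- The counted value is the one for which the literal, after flipping, reads as the active letter.
The stored codes for unflipped and flipped occurrences select the active letter and its complement,
respectively. -/
theorem act_eq_iff (h : Prepared s n D.numNodes k w)
    (h9 : ∀ a ≤ 9, s.idx a = (inputStore F R D).idx a)
    (he : ∀ x, (s.idx 13 0 (e x), s.idx 14 0 (e x)) = code x) (c : Fin F.numCons)
    (v : Fin F.numVars) (b : Bool) :
    s.layout.act (e (Sum.inl c)) (e (Sum.inr v)) = b.toNat ↔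
      ∃ hv : v ∈ (F.con c).scope, activeLetter R c = xor ((R c).flip ⟨v, hv⟩) b := by
  obtain ⟨hk, hid⟩ := kind_inl he c
  have hside : s.idx 18 0 (e (Sum.inl c)) = (activeLetter R c).toNat := by
    rw [((h.count _ (e (Sum.inl c)).2).con (by rw [hk]; norm_num) _ rfl _ rfl).2.2.1, hid]
    have : s.side c = (inputStore F R D).side c := by
      rw [Store.side, Store.side, h9 2 (by norm_num), h9 3 (by norm_num)]
    rw [this, side_input, activeLetter]
    split_ifs with h0 <;> simp [h0]
  have hocc : s.idx 1 (s.idx 14 0 (e (Sum.inl c))) (s.idx 14 0 (e (Sum.inr v))) =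
      occurrence F R c v := by
    rw [hid, (kind_inr he v).2, h9 1 (by norm_num)]
    simp [inputStore, inputIdx]
  simp only [Store.layout]
  rw [hocc, hside, occurrence]
  by_cases hv : v ∈ (F.con c).scope
  · rw [dif_pos hv, exists_prop_of_true hv]
    generalize activeLetter R c = a
    generalize (R c).flip ⟨v, hv⟩ = f
    -- Only three Booleans are left, so all cases are checked.
    revert a f b
    decide
  · rw [dif_neg hv]
    simp only [hv, IsEmpty.exists_iff, iff_false]
    cases b <;> simp

/-- The number of active letters in the word does not depend on the order of the variables, so it
can be counted over the scope as a set and compared through the numbering of the vertices. -/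
theorem count_eq (h : Prepared s n D.numNodes k w)
    (h9 : ∀ a ≤ 9, s.idx a = (inputStore F R D).idx a)
    (he : ∀ x, (s.idx 13 0 (e x), s.idx 14 0 (e x)) = code x) {τ : ℕ → Bool}
    {σ : Fin F.numVars → Bool} (hτ : ∀ v, τ (e (Sum.inr v)) = σ v) (c : Fin F.numCons) :
    s.layout.count n τ (e (Sum.inl c)) =
      (((univ : Finset (F.con c).scope).sort (· ≤ ·)).map
        fun v => xor ((R c).flip v) (σ v)).count (activeLetter R c) := by
  have hkind : ∀ x, s.layout.kind x = s.idx 13 0 x := fun _ => rfl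
  have hr : (((univ : Finset (F.con c).scope).sort (· ≤ ·)).map
      fun v => xor ((R c).flip v) (σ v)).count (activeLetter R c) =
      #{v : (F.con c).scope | activeLetter R c = xor ((R c).flip v) (σ v)} := by
    rw [← Multiset.coe_count, ← Multiset.map_coe, sort_eq, Multiset.count_map]
    rfl
  rw [hr, Layout.count, if_pos ⟨(e (Sum.inl c)).2, by rw [hkind, (kind_inl he c).1]; norm_num⟩]
  symm
  refine card_bij (fun v _ => (e (Sum.inr v.1) : ℕ)) ?_ ?_ ?_
  · intro v hv
    simp only [mem_filter, mem_univ, true_and] at hv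
    rw [mem_filter, mem_range]
    refine ⟨Fin.is_lt _, (kind_inr he v).1, ?_⟩
    rw [hτ, act_eq_iff h h9 he]
    exact ⟨v.2, hv⟩
  · intro v _ v' _ hvv
    have := e.injective (Fin.ext hvv)
    exact Subtype.ext (Sum.inr_injective this)
  · intro x hx
    rw [mem_filter, mem_range] at hx
    obtain ⟨hxn, hx0, hxa⟩ := hx
    obtain ⟨y, hy⟩ := e.surjective ⟨x, hxn⟩
    have hyx : (e y : ℕ) = x := by rw [hy]
    rcases y with y | y
    · have := (kind_inl he y).1
      rw [hyx, ← hkind, hx0] at this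
      omega
    · rw [← hyx, hτ, act_eq_iff h h9 he] at hxa
      obtain ⟨hv, hxa⟩ := hxa
      exact ⟨⟨y, hv⟩, by simpa using hxa, hyx⟩

theorem weight_eq (h : Prepared s n D.numNodes k w)
    (h9 : ∀ a ≤ 9, s.idx a = (inputStore F R D).idx a)
    (he : ∀ x, (s.idx 13 0 (e x), s.idx 14 0 (e x)) = code x) {τ : ℕ → Bool}
    {σ : Fin F.numVars → Bool} (hτ : ∀ v, τ (e (Sum.inr v)) = σ v) (c : Fin F.numCons) :
    s.idx 5 (s.idx 14 0 (e (Sum.inl c))) ((s.step (s.idx 14 0 (e (Sum.inl c))))^[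
      s.layout.count n τ (e (Sum.inl c))] (s.idx 2 (s.idx 14 0 (e (Sum.inl c))) 1)) =
      if (F.con c).holds (fun v => σ v) = true then 1 else 0 := by
  have hstep : s.step c = (inputStore F R D).step c := by
    rw [Store.step, Store.step, Store.side, Store.side, h9 2 (by norm_num), h9 3 (by norm_num),
      h9 4 (by norm_num)]
  have hstart : s.idx 2 c 1 = ((R c).sts.start : ℕ) := by
    rw [h9 2 (by norm_num)]
    simp [inputStore, inputIdx]
  rw [count_eq h h9 he hτ c, (kind_inl he c).2, hstep, hstart, ← run_input,
    ← (R c).describes fun v => σ v, h9 5 (by norm_num)]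
  simp only [inputStore, inputIdx, pad_val, STS.run]
  congr

open Classical in
/-- The result of the program is the number of models. -/
theorem sum_eq_modelCount (h : Prepared s n D.numNodes k w)
    (h9 : ∀ a ≤ 9, s.idx a = (inputStore F R D).idx a)
    (he : ∀ x, (s.idx 13 0 (e x), s.idx 14 0 (e x)) = code x) :
    ∑ τ ∈ s.layout.assignments n, ∏ c ∈ range n,
        (if s.idx 13 0 c = 0 then 1 else (s.idx 5 (s.idx 14 0 c) ((s.step (s.idx 14 0 c))^[
          s.layout.count n τ c] (s.idx 2 (s.idx 14 0 c) 1)) : ℂ)) = (F.modelCount : ℂ) := by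
  have hkind : ∀ x, s.layout.kind x = s.idx 13 0 x := fun _ => rfl
  have hprod : ∀ τ : ℕ → Bool, ∏ c ∈ range n,
        (if s.idx 13 0 c = 0 then 1 else (s.idx 5 (s.idx 14 0 c) ((s.step (s.idx 14 0 c))^[
          s.layout.count n τ c] (s.idx 2 (s.idx 14 0 c) 1)) : ℂ)) =
      if F.IsModel (fun v => τ (e (Sum.inr v))) then 1 else 0 := by
    intro τ
    rw [prod_range, ← e.prod_comp, Fintype.prod_sum_type]
    simp only [kind_inr he, if_true, prod_const_one, mul_one]
    rw [prod_congr rfl fun c _ => by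
      rw [if_neg (by rw [(kind_inl he c).1]; norm_num),
        weight_eq (σ := fun v => τ (e (Sum.inr v))) h h9 he (fun _ => rfl) c]]
    simp only [Nat.cast_ite, Nat.cast_one, Nat.cast_zero]
    rw [prod_ite_zero, prod_const_one]
    simp only [ConstraintSystem.IsModel, mem_univ, true_imp_iff]
    congr
  rw [sum_congr rfl fun τ _ => hprod τ, ConstraintSystem.modelCount, Nat.card_eq_fintype_card,
    Fintype.card_subtype, card_filter, Nat.cast_sum]
  -- Assignments of numbered vertices correspond to assignments of the variables: restrict to the
  -- ranks of variables, and conversely extend by false to all other places.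
  refine sum_bij' (fun τ _ v => τ (e (Sum.inr v)))
    (fun σ _ x => if hx : x < n then
      (match e.symm ⟨x, hx⟩ with
        | Sum.inl _ => false
        | Sum.inr v => σ v) else false) ?_ ?_ ?_ ?_ ?_
  · simp
  · intro σ _
    rw [Layout.mem_assignments]
    intro x hx
    split_ifs at hx with hxn
    refine ⟨hxn, ?_⟩
    obtain ⟨y, hy⟩ := e.surjective ⟨x, hxn⟩
    rw [← hy, Equiv.symm_apply_apply] at hx
    have hyx : (e y : ℕ) = x := by rw [hy]
    rcases y with y | y
    · simp at hx
    · rw [hkind, ← hyx]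
      exact (kind_inr he y).1
  · intro τ hτ
    rw [Layout.mem_assignments] at hτ
    funext x
    by_cases hxn : x < n
    · simp only [dif_pos hxn]
      obtain ⟨y, hy⟩ := e.surjective ⟨x, hxn⟩
      have hyx : (e y : ℕ) = x := by rw [hy]
      rw [← hy, Equiv.symm_apply_apply]
      rcases y with y | y
      · have := (kind_inl he y).1
        rw [hyx, ← hkind] at this
        by_contra hcon
        have h1 : τ x = true := by
          cases h' : τ x
          · exact absurd h'.symm hcon
          · rfl
        have := (hτ x h1).2
        omega
      · simp only [hyx]
    · simp only [dif_neg hxn]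
      by_contra hcon
      have h1 : τ x = true := by
        cases h' : τ x
        · exact absurd h'.symm hcon
        · rfl
      exact hxn (hτ x h1).1
  · intro σ _
    funext v
    simp
  · intro τ _
    simp

end

end

/-! ### The time bound and the conclusion -/

theorem timeBound_le {n N k w : ℕ} (hw : 2 ≤ w) (hN : 0 < N) (hk : k = 0 → n = 0) :
    timeBound n N k w ≤
      750000 * ((2 * w) ^ k * k * Nat.log 2 w * n) + 80000 * ((k + 1) * N) := by
  have hlog : Nat.log 2 (2 * w) = Nat.log 2 w + 1 := by
    rw [mul_comm]
    exact Nat.log_mul_base (by norm_num) (by omega)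
  have hl : 1 ≤ Nat.log 2 w := Nat.log_pos (by norm_num) hw
  have hB : 1 ≤ (k + 1) * N := Nat.mul_pos (by omega) hN
  have hNB : N ≤ (k + 1) * N := Nat.le_mul_of_pos_left _ (by omega)
  rw [timeBound, hlog, mul_comm N (k + 1)]
  generalize hℓ : Nat.log 2 w = l at *
  generalize (k + 1) * N = B at *
  -- For `k = 0` there are no vertices, so only terms in the number of nodes and additive constants
  -- survive; the constants are covered because there is at least one node.
  rcases Nat.eq_zero_or_pos k with h0 | hkpos
  · rw [hk h0]
    omega
  · have hP1 : 2 * w ≤ (2 * w) ^ k := Nat.le_self_pow (by omega) _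
    -- This estimate absorbs the quadratic cost of listing a bag into `k * (2 * w) ^ k`; the
    -- products with `w` are absorbed by `2 * w ≤ (2 * w) ^ k`, which needs `k ≥ 1`.
    have hP2 : k ≤ (2 * w) ^ k :=
      (Nat.lt_two_pow_self).le.trans (Nat.pow_le_pow_left (by omega) k)
    generalize (2 * w) ^ k = P at *
    have hPk : P * k ≤ P * k * l := Nat.le_mul_of_pos_right _ hl
    have hPP : P ≤ P * k := Nat.le_mul_of_pos_right _ hkpos
    have h1 : w + 1 ≤ P * k * l := by omega
    have h2 : (k + 1) * (k + 1) + k * (2 * w + 1) ≤ 6 * (P * k * l) := by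
      have a1 : (k + 1) * (k + 1) ≤ (2 * k) * (2 * k) := Nat.mul_le_mul (by omega) (by omega)
      have a2 : k * k ≤ P * k := Nat.mul_le_mul_right _ hP2
      have a3 : k * (2 * w + 1) ≤ k * (2 * P) := Nat.mul_le_mul_left _ (by omega)
      have e1 : (2 * k) * (2 * k) = 4 * (k * k) := by ring
      have e2 : k * (2 * P) = 2 * (P * k) := by ring
      omega
    have h3 : (k + 1) * (P * (l + 1 + 3)) ≤ 10 * (P * k * l) := by
      calc (k + 1) * (P * (l + 1 + 3)) ≤ (2 * k) * (P * (5 * l)) :=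
            Nat.mul_le_mul (by omega) (Nat.mul_le_mul_left _ (by omega))
        _ = 10 * (P * k * l) := by ring
    have g1 := Nat.mul_le_mul_left n h1
    have g2 := Nat.mul_le_mul_left n h2
    have g3 := Nat.mul_le_mul_left n h3
    rw [Nat.mul_left_comm n 6] at g2
    rw [Nat.mul_left_comm n 10] at g3
    rw [mul_comm (P * k * l) n]
    omega

theorem log_two_le_two_mul_log {w : ℕ} (hw : 0 < w) : (Nat.log 2 w : ℝ) ≤ 2 * Real.log w := by
  have h1 : ((2 : ℝ) ^ Nat.log 2 w) ≤ w := by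
    exact_mod_cast Nat.pow_log_le_self 2 (by omega)
  have h2 := Real.log_le_log (by positivity) h1
  rw [Real.log_pow] at h2
  have h3 := Real.log_two_gt_d9
  have h4 : (0 : ℝ) ≤ Nat.log 2 w := Nat.cast_nonneg _
  nlinarith

/-- Without elements in the bags there are no vertices. -/
theorem graphSize_eq_zero {F : ConstraintSystem} (D : TreeDecomposition F.incidenceGraph)
    (h : D.width = 0) : F.graphSize = 0 := by
  rw [ConstraintSystem.graphSize, Fintype.card_eq_zero_iff]
  refine ⟨fun x => ?_⟩
  obtain ⟨t, ht⟩ := D.cover x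
  have h1 : #(D.bag t) ≤ D.width := le_sup (f := fun t => #(D.bag t)) (mem_univ t)
  rw [h, Nat.le_zero, card_eq_zero] at h1
  rw [h1] at ht
  simp at ht

end OneSidedCounting

theorem mainTheorem4 :
    ∃ (P : OneSidedCounting.Program) (K : ℝ),
      ∀ (F : OneSidedCounting.ConstraintSystem)
        (R : ∀ c, OneSidedCounting.OneSidedDescription (F.con c))
        (D : OneSidedCounting.TreeDecomposition F.incidenceGraph) (w k : ℕ),
        2 ≤ w → (∀ c, (R c).numStates ≤ w) → D.width = k →
          ∃ (s : OneSidedCounting.Store) (t : ℕ),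
            OneSidedCounting.Exec P (OneSidedCounting.inputStore F R D) s t ∧
            s.num 0 0 0 = (F.modelCount : ℂ) ∧
            (t : ℝ) ≤ K * ((2 * (w : ℝ)) ^ k * k * Real.log w * F.graphSize +
              (k + 1) * D.numNodes) := by
  -- The constant is twice 750000: passing from the logarithm to the base 2 to the natural one costs
  -- a factor of at most 2, as `log 2 > 1 / 2`.
  refine ⟨OneSidedCounting.countModels, 1500000, fun F R D w k hw hR hk => ?_⟩
  have hI := OneSidedCounting.input_inputStore R D hR hk
  refine OneSidedCounting.countModels_spec hI (by omega) ?_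
  intro s' s t n ht hprep h9 hsurj hs'
  obtain ⟨e, he⟩ := OneSidedCounting.exists_equiv R D hprep h9 hsurj
  have hn : F.graphSize = n := by
    rw [OneSidedCounting.ConstraintSystem.graphSize, Fintype.card_congr e, Fintype.card_fin]
  refine ⟨hs'.trans (OneSidedCounting.sum_eq_modelCount hprep h9 he), ?_⟩
  have hb := ht.trans (OneSidedCounting.timeBound_le hw hI.pos fun h0 => by
    rw [← hn]
    exact OneSidedCounting.graphSize_eq_zero D (hk.trans h0))
  have hb' : (t : ℝ) ≤ 750000 * ((2 * (w : ℝ)) ^ k * k * Nat.log 2 w * n) +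
      80000 * ((k + 1) * D.numNodes) := by
    exact_mod_cast hb
  have hlog := OneSidedCounting.log_two_le_two_mul_log (w := w) (by omega)
  have h1 : (2 * (w : ℝ)) ^ k * k * Nat.log 2 w * n ≤
      2 * ((2 * (w : ℝ)) ^ k * k * Real.log w * n) := by
    calc (2 * (w : ℝ)) ^ k * k * Nat.log 2 w * n
        ≤ (2 * (w : ℝ)) ^ k * k * (2 * Real.log w) * n := by gcongr
      _ = 2 * ((2 * (w : ℝ)) ^ k * k * Real.log w * n) := by ring
  have h2 : (0 : ℝ) ≤ (k + 1) * D.numNodes := by positivity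
  rw [hn]
  linarith
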